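/- **Geometry.** Let $N\ge 1$, $L>0$, and let $(x_i^-,x_i^+)$, $i\in\mathbb Z$, be intervals with $x_i^-<x_i^+<x_{i+1}^-$ and $x_{i+N}^\pm=x_i^\pm+L$. Put $\ell_i=x_i^+-x_i^-$, $\ell_{i(i+1)}=x_{i+1}^--x_i^+$, and fix $\alpha\in\mathbb R$. Write $D_i=(x_i^-,x_i^+)$, $1\le i\le N$, and $\|\cdot\|_2$ for the norm of $L^2(0,L)$. **Media.** A medium has constants $\rho_0,\kappa_0,\rho_{\mathrm r},\kappa_{\mathrm r},\Omega>0$ and positive functions $\rho_i,\kappa_i$ of $t$ with $1/\rho_i(t)=\sum_{|m|\le M}r_{i,m}e^{\mathrm im\Omega t}$ and $1/\kappa_i(t)=\sum_{|m|\le M}k_{i,m}e^{\mathrm im\Omega t}$. The density and bulk modulus are $\rho_{\mathrm r}\rho_i(t),\ \kappa_{\mathrm r}\kappa_i(t)$ in $D_i$, and $\rho_0,\kappa_0$ outside the resonators. Put $\delta=\rho_{\mathrm r}/\rho_0$ and $T=2\pi/\Omega$. Consider a sequence of media with $\delta\to0$ in which $\rho_0,\kappa_0$ and $v_{\mathrm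 r}=\sqrt{\kappa_{\mathrm r}/\rho_{\mathrm r}}$ are fixed, $\Omega$ is of the exact order $\delta^{1/2}$, $M=O(\delta^{-\gamma/2})$ for some $\gamma\in(0,1)$, and $0<c\le\rho_i(t),\kappa_i(t)\le C$ with $c,C$ independent of $\delta,i,t$. **Spectral problem with sources.** For $\omega\in\mathbb C$ and functions $f_n$, $n\in\mathbb Z$, look for continuous $v_n:\mathbb R\to\mathbb C$, $n\in\mathbb Z$, with $v_n(x+L)=e^{\mathrm i\alpha L}v_n(x)$ and $$v_n''+\frac{\rho_0(\omega+n\Omega)^2}{\kappa_0}v_n=f_n\ \text{ in the gaps }(x_i^+,x_{i+1}^-),\qquad (v_{i,n}^*)''+\frac{\rho_{\mathrm r}(\omega+n\Omega)^2}{\kappa_{\mathrm r}}v_{i,n}^{**}=\delta f_n\ \text{ in }D_i,$$ $$(v_{i,n}^*)'|_+(x_i^-)=\delta\,v_n'|_-(x_i^-),\qquad (v_{i,n}^*)'|_-(x_i^+)=\delta\,v_n'|_+(x_i^+),$$ where $1\le i\le N$, $v_{i,n}^*=\sum_m r_{i,m}v_{n-m}$ and $v_{i,n}^{**}=\frac1{\omega+n\Omega}\sum_m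 k_{i,m}(\omega+(n-m)\Omega)v_{n-m}$. With $f=0$ this is the wave equation for $u(x,t)=e^{\mathrm i\omega t}\sum_n v_n(x)e^{\mathrm in\Omega t}$. A family of solutions is *low-frequency* if $\sum_{n}\|v_n\|_2=1$ and, for some $K=K(\delta)\in\mathbb N$ with $K\Omega\to0$, $\sum_{|n|\le K}\|v_n\|_2=1+o(1)$ as $\delta\to0$. A family $\omega(\delta)\in\mathbb C$ with $\operatorname{Re}\omega\in[-\Omega/2,\Omega/2)$ and $\omega=O(\delta^{1/2})$ is a family of *subwavelength quasifrequencies* if, for all small $\delta$, the problem with $f=0$ has solutions forming a low-frequency family. A family $\omega(\delta)$ satisfies the problem *at leading order* if there is a low-frequency family of solutions, for small $\delta$, with sources such that $\sum_n\sup_x|f_n(x)|^2\to0$. **Capacitance ODE.** Let $C^\alpha\in\mathbb C^{N\times N}$ be the matrix with diagonal entries $\frac1{\ell_{(i-1)i}}+\frac1{\ell_{i(i+1)}}$, entries $(i,i+1)$ and $(i+1,i)$ equal to $-\frac1{\ell_{i(i+1)}}$, and additional corner contributions $-\frac{e^{-\mathrm i\alpha L}}{\ell_{N(N+1)}}$ at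 $(1,N)$ and $-\frac{e^{\mathrm i\alpha L}}{\ell_{N(N+1)}}$ at $(N,1)$ (contributions at the same place add up if $N\le2$). Call $\omega\in\mathbb C$ a *quasifrequency of the ODE system* $$\sum_{j=1}^N C^\alpha_{ij}w_j(t)=-\frac{\ell_i\rho_{\mathrm r}}{\delta\kappa_{\mathrm r}}\frac{\mathrm d}{\mathrm dt}\Big(\frac1{\kappa_i(t)}\frac{\mathrm dw_i(t)}{\mathrm dt}\Big),\qquad 1\le i\le N,$$ if it has a nontrivial solution $w_i=\rho_ic_i$ for which every $c_i(t)e^{-\mathrm i\omega t}$ is $T$-periodic. **Theorem.** As $\delta\to0$, the subwavelength quasifrequencies are, at leading order, given by the quasifrequencies of the ODE system: 1. for every family $\omega(\delta)$ of subwavelength quasifrequencies there are quasifrequencies $\omega_{\mathrm{cap}}(\delta)$ of the ODE system with $\omega(\delta)=\omega_{\mathrm{cap}}(\delta)+o(\delta^{1/2})$; 2. conversely, every family $\omega_{\mathrm{cap}}(\delta)=O(\delta^{1/2})$ of quasifrequencies of the ODE system satisfies the spectral problem at leading order. -/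

import Mathlib

open Filter Topology Asymptotics

/-- A periodic chain of resonators on the real line, `N` per period of length `L`:
the `i`-th resonator is the interval `(left i, right i)`, `i ∈ ℤ`, and the resonators with
indices `0, …, N - 1` form one period. -/
structure Resonators (N : ℕ) where
  L : ℝ
  left : ℤ → ℝ
  right : ℤ → ℝ
  L_pos : 0 < L
  left_lt_right : ∀ i, left i < right i
  right_lt_left : ∀ i, right i < left (i + 1)
  left_periodic : ∀ i, left (i + N) = left i + L
  right_periodic : ∀ i, right (i + N) = right i + L

/-- The length `ℓ_i` of the `i`-th resonator. -/
def Resonators.len {N : ℕ} (G : Resonators N) (i : ℤ) : ℝ := G.right i - G.left i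

/-- The length `ℓ_{i(i+1)}` of the gap between the resonators `i` and `i + 1`. -/
def Resonators.gap {N : ℕ} (G : Resonators N) (i : ℤ) : ℝ := G.left (i + 1) - G.right i

/-- The material parameters: bulk modulus `κ₀` and density `ρ₀` outside the resonators,
`κr κ_i(t)` and `ρr ρ_i(t)` inside the `i`-th resonator.  The functions `1 / ρ_i` and `1 / κ_i`
are trigonometric polynomials of degree at most `M` in `Ω t`, with Fourier coefficients
`r_{i,m}` and `k_{i,m}`. -/
structure Medium (N : ℕ) where
  ρ₀ : ℝ
  κ₀ : ℝ
  ρr : ℝ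
  κr : ℝ
  Ω : ℝ
  ρ : Fin N → ℝ → ℝ
  κ : Fin N → ℝ → ℝ
  M : ℕ
  r : Fin N → ℤ → ℂ
  k : Fin N → ℤ → ℂ
  ρ₀_pos : 0 < ρ₀
  κ₀_pos : 0 < κ₀
  ρr_pos : 0 < ρr
  κr_pos : 0 < κr
  Ω_pos : 0 < Ω
  ρ_pos : ∀ i t, 0 < ρ i t
  κ_pos : ∀ i t, 0 < κ i t
  ρ_series : ∀ i t, (((ρ i t)⁻¹ : ℝ) : ℂ) =
    ∑ m ∈ Finset.Icc (-(M : ℤ)) M, r i m * Complex.exp (Complex.I * m * Ω * t)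
  κ_series : ∀ i t, (((κ i t)⁻¹ : ℝ) : ℂ) =
    ∑ m ∈ Finset.Icc (-(M : ℤ)) M, k i m * Complex.exp (Complex.I * m * Ω * t)

namespace Medium

variable {N : ℕ}

/-- The contrast `δ = ρr / ρ₀`. -/
noncomputable def δ (S : Medium N) : ℝ := S.ρr / S.ρ₀

/-- The wave speed `√(κr / ρr)` in the resonators. -/
noncomputable def vr (S : Medium N) : ℝ := √(S.κr / S.ρr)

/-- The period `T = 2π / Ω` of the modulation. -/
noncomputable def T (S : Medium N) : ℝ := 2 * Real.pi / S.Ω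

/-- The convolution `v*_{i,n} = ∑_m r_{i,m} v_{n-m}`. -/
noncomputable def vStar (S : Medium N) (v : ℤ → ℝ → ℂ) (i : Fin N) (n : ℤ) (x : ℝ) : ℂ :=
  ∑ m ∈ Finset.Icc (-(S.M : ℤ)) S.M, S.r i m * v (n - m) x

/-- The convolution `v**_{i,n} = (ω + nΩ)⁻¹ ∑_m k_{i,m} (ω + (n-m)Ω) v_{n-m}`.  It only enters
multiplied by `(ω + nΩ)²`, so that its value for `ω + nΩ = 0` does not matter. -/
noncomputable def vStarStar (S : Medium N) (ω : ℂ) (v : ℤ → ℝ → ℂ) (i : Fin N) (n : ℤ)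
    (x : ℝ) : ℂ :=
  1 / (ω + n * S.Ω) *
    ∑ m ∈ Finset.Icc (-(S.M : ℤ)) S.M, S.k i m * (ω + (n - m) * S.Ω) * v (n - m) x

end Medium

/-- `g` is twice differentiable at `x` with second derivative `y`. -/
def HasSecondDerivAt (g : ℝ → ℂ) (y : ℂ) (x : ℝ) : Prop :=
  DifferentiableAt ℝ g x ∧ HasDerivAt (deriv g) y x

/-- The coupled `α`-quasiperiodic spectral problem for the harmonics `v_n`, `n ∈ ℤ`, of
`u(x,t) = e^{iωt} ∑_n v_n(x) e^{inΩt}`, with source term `f_n` outside and `δ f_n` inside the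
resonators.  The problem proper is the case `f = 0`. -/
structure IsBlochMode {N : ℕ} (G : Resonators N) (S : Medium N) (α : ℝ) (ω : ℂ)
    (v f : ℤ → ℝ → ℂ) : Prop where
  continuous : ∀ n, Continuous (v n)
  quasiperiodic : ∀ n x, v n (x + G.L) = Complex.exp (Complex.I * α * G.L) * v n x
  exterior : ∀ n (i : Fin N), ∀ x ∈ Set.Ioo (G.right i) (G.left (i + 1)),
    HasSecondDerivAt (v n) (f n x - S.ρ₀ * (ω + n * S.Ω) ^ 2 / S.κ₀ * v n x) x
  interior : ∀ n (i : Fin N), ∀ x ∈ Set.Ioo (G.left i) (G.right i),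
    HasSecondDerivAt (S.vStar v i n)
      (S.δ * f n x - S.ρr * (ω + n * S.Ω) ^ 2 / S.κr * S.vStarStar ω v i n x) x
  transmission_left : ∀ n (i : Fin N), ∃ d : ℂ,
    Tendsto (deriv (v n)) (𝓝[<] (G.left i)) (𝓝 d) ∧
    Tendsto (deriv (S.vStar v i n)) (𝓝[>] (G.left i)) (𝓝 (S.δ * d))
  transmission_right : ∀ n (i : Fin N), ∃ d : ℂ,
    Tendsto (deriv (v n)) (𝓝[>] (G.right i)) (𝓝 d) ∧
    Tendsto (deriv (S.vStar v i n)) (𝓝[<] (G.right i)) (𝓝 (S.δ * d))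

/-- The `L²` norm on the unit cell `(0, L)`. -/
noncomputable def cellNorm (L : ℝ) (g : ℝ → ℂ) : ℝ := √(∫ x in (0 : ℝ)..L, ‖g x‖ ^ 2)

/-- The modes `(v_n)`, normalized by `∑_n ‖v_n‖₂ = 1`, are essentially supported in the
low-frequency regime along the sequence `S` of media: there is `K` with `K Ω → 0` and
`∑_n ‖v_n‖₂ = ∑_{|n| ≤ K} ‖v_n‖₂ + o(1)`. -/
def IsLowFrequency {N : ℕ} (G : Resonators N) (S : ℕ → Medium N) (v : ℕ → ℤ → ℝ → ℂ) : Prop :=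
  (∀ᶠ p in atTop, HasSum (fun n : ℤ => cellNorm G.L (v p n)) 1) ∧
  ∃ K : ℕ → ℕ, Tendsto (fun p => (K p : ℝ) * (S p).Ω) atTop (𝓝 0) ∧
    Tendsto (fun p => ∑ n ∈ Finset.Icc (-(K p : ℤ)) (K p), cellNorm G.L (v p n)) atTop (𝓝 1)

/-- `ω p` is a subwavelength quasifrequency of the medium `S p`, as `p → ∞`. -/
def IsSubwavelengthQuasifrequency {N : ℕ} (G : Resonators N) (S : ℕ → Medium N) (α : ℝ)
    (ω : ℕ → ℂ) : Prop :=
  (∀ᶠ p in atTop, (ω p).re ∈ Set.Ico (-(S p).Ω / 2) ((S p).Ω / 2)) ∧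
  ω =O[atTop] (fun p => √(S p).δ) ∧
  ∃ v : ℕ → ℤ → ℝ → ℂ,
    (∀ᶠ p in atTop, IsBlochMode G (S p) α (ω p) (v p) 0) ∧ IsLowFrequency G S v

/-- `ω p` is a quasifrequency at leading order: the spectral problem has low-frequency modes up
to source terms (relative to the contrast in the resonators) which tend to zero in the `ℓ²` sum
over the harmonics of the suprema over `x`. -/
def IsLeadingOrderQuasifrequency {N : ℕ} (G : Resonators N) (S : ℕ → Medium N) (α : ℝ)
    (ω : ℕ → ℂ) : Prop :=
  ∃ v f : ℕ → ℤ → ℝ → ℂ,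
    (∀ᶠ p in atTop, IsBlochMode G (S p) α (ω p) (v p) (f p)) ∧ IsLowFrequency G S v ∧
    ∃ a : ℕ → ℤ → ℝ,
      (∀ᶠ p in atTop, (∀ n x, ‖f p n x‖ ≤ a p n) ∧ Summable (fun n => a p n ^ 2)) ∧
      Tendsto (fun p => ∑' n, a p n ^ 2) atTop (𝓝 0)

/-- The quasiperiodic capacitance matrix: tridiagonal plus the two corners `(0, N-1)` and
`(N-1, 0)`; for `N ≤ 2` the overlapping contributions add up. -/
noncomputable def capacitanceMatrix {N : ℕ} (G : Resonators N) (α : ℝ) :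
    Matrix (Fin N) (Fin N) ℂ :=
  fun i j =>
    (if i = j then 1 / (G.gap (i - 1) : ℂ) + 1 / (G.gap i : ℂ) else 0)
    - (if (i : ℕ) = j + 1 then 1 / (G.gap j : ℂ) else 0)
    - (if (j : ℕ) = i + 1 then 1 / (G.gap i : ℂ) else 0)
    - (if (i : ℕ) = 0 ∧ (j : ℕ) + 1 = N then
        Complex.exp (-(Complex.I * α * G.L)) / (G.gap j : ℂ) else 0)
    - (if (j : ℕ) = 0 ∧ (i : ℕ) + 1 = N then
        Complex.exp (Complex.I * α * G.L) / (G.gap i : ℂ) else 0)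

/-- `w` solves `∑_j C_{ij} w_j = -(ℓ_i ρr / (δ κr)) d/dt ((1 / κ_i) dw_i/dt)` for all `i`. -/
def SolvesCapacitanceODE {N : ℕ} (G : Resonators N) (S : Medium N) (α : ℝ)
    (w : Fin N → ℝ → ℂ) : Prop :=
  ∀ i t, DifferentiableAt ℝ (w i) t ∧
    DifferentiableAt ℝ (fun s => 1 / (S.κ i s : ℂ) * deriv (w i) s) t ∧
    ∑ j, capacitanceMatrix G α i j * w j t =
      -(G.len i * S.ρr / (S.δ * S.κr) : ℂ) *
        deriv (fun s => 1 / (S.κ i s : ℂ) * deriv (w i) s) t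

/-- `ω` is a (Floquet) quasifrequency of the capacitance ODE: it has a nontrivial solution
`w_i = ρ_i c_i` such that `c_i(t) e^{-iωt}` is `T`-periodic. -/
def IsCapacitanceQuasifrequency {N : ℕ} (G : Resonators N) (S : Medium N) (α : ℝ)
    (ω : ℂ) : Prop :=
  ∃ c : Fin N → ℝ → ℂ, c ≠ 0 ∧
    (∀ i, Function.Periodic (fun t : ℝ => c i t * Complex.exp (-(Complex.I * ω * t))) S.T) ∧
    SolvesCapacitanceODE G S α (fun i t => S.ρ i t * c i t)

/-!
In the rescaled time `τ = Ω t` the capacitance ODE is the `2π`-periodic first order system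
`y' = i (κ / m) q`, `q' = i C y` with `m = odeMass` (`odeField`). Its coefficients are bounded
uniformly along the sequence of media, since `Ω` is of the exact order `√δ`; its quasifrequencies are
`Ω` times the logarithms, divided by `2πi`, of the eigenvalues of the monodromy matrix. On the
Fourier side, multiplication by `1 / ρ_i` and `1 / κ_i` is the convolution `trigConv` with a
trigonometric polynomial of degree `M`, and Bernstein's inequality together with `Ω (M + 1) → 0` shows
that this almost commutes with multiplication by `ω + n Ω`.

*From the spectral problem to the ODE.* Integrating the equations over a resonator, and solving them
in the gaps, shows that the averages of `v_n` over the resonators satisfy the capacitance equation up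
to terms which are small where `ω + n Ω` is small (`exists_modeBounds`). Nothing is known about the
size of these terms for the remaining frequencies, where `v` only has a small, but not quantified, part
of its mass. Therefore the sequences are multiplied by the weights `1 / cosh (θ n)`. With
`θ = Ω ^ β / (M + 1)` and a small power `β` the weights still almost commute with the convolutions, by
the addition theorem for `cosh` and estimates of trigonometric polynomials in a strip
(`l2norm_weighted_trigConv_sub_le`), but they decay fast enough to make the high frequencies
negligible, even after multiplication with powers of `ω + n Ω` (`eventually_wnorm_pow_mul_le`). The
weighted averages are thus the Fourier coefficients of an approximate Floquet solution of the ODE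
(`LowFrequencyBounds.exists_isApproxFloquet`). By Gronwall's inequality, `e^{2πiω/Ω}` is almost an
eigenvalue of the monodromy matrix, and by the Cayley-Hamilton theorem it is close to an eigenvalue
(`exists_hasEigenvalue_near`, `exists_near_isCapacitanceQuasifrequency`).

*From the ODE to the spectral problem.* For a Floquet solution `w` of the ODE, normalized to have
maximum one, the second component `q` and two derivatives of `w` are bounded, with a factor `M + 1` for
each derivative of a coefficient (`norm_snd_le_of_norm_fst_le`, `exists_isFloquetData`). The mode built
from it is equal to the Fourier coefficients of `w_i` in the resonators up to a correction of order
`δ`, a quadratic function of `x` whose convolution with `1 / ρ_i` has the slopes required by the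
transmission conditions; in the gaps it is linear up to a Hermite correction of order `δ` without
slopes at the ends (`exists_profile`). In the resonators the leading terms cancel because of the ODE,
and what remains are sources whose `ℓ²` norm is of order `(Ω (M + 1)) ^ 2`
(`exists_isBlochMode_source`, `sourceBound_sqSummable_and_le`). The modes are low-frequency since the
`ℓ²` bound for `(ω / Ω + n) y_n` gives a uniform bound for the tails of the sum of the norms
(`exists_normalized_mode`).
-/

/-! ### Square-summable sequences -/

/-- `∑ ‖c n‖² < ∞`. -/
def SqSummable {E : Type*} [NormedAddCommGroup E] (c : ℤ → E) : Prop :=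
  Summable fun n => ‖c n‖ ^ 2

/-- The `ℓ²` norm of a sequence indexed by `ℤ`; it is `0` if the sequence is not
square-summable. -/
noncomputable def l2norm {E : Type*} [NormedAddCommGroup E] (c : ℤ → E) : ℝ :=
  √(∑' n, ‖c n‖ ^ 2)

section L2

variable {E F : Type*} [NormedAddCommGroup E] [NormedAddCommGroup F]

lemma l2norm_nonneg (c : ℤ → E) : 0 ≤ l2norm c := Real.sqrt_nonneg _

lemma sq_l2norm (c : ℤ → E) : l2norm c ^ 2 = ∑' n, ‖c n‖ ^ 2 :=
  Real.sq_sqrt (tsum_nonneg fun _ => by positivity)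

lemma SqSummable.of_norm_le {c : ℤ → E} {d : ℤ → F} (hd : SqSummable d) {K : ℝ}
    (h : ∀ n, ‖c n‖ ≤ K * ‖d n‖) : SqSummable c := by
  refine Summable.of_nonneg_of_le (fun _ => by positivity) (fun n => ?_) (hd.mul_left (K ^ 2))
  rw [← mul_pow]
  exact pow_le_pow_left₀ (norm_nonneg _) (h n) 2

lemma l2norm_le_of_norm_le {c : ℤ → E} {d : ℤ → F} (hd : SqSummable d) {K : ℝ} (hK : 0 ≤ K)
    (h : ∀ n, ‖c n‖ ≤ K * ‖d n‖) : l2norm c ≤ K * l2norm d := by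
  refine Real.sqrt_le_iff.2 ⟨mul_nonneg hK (l2norm_nonneg _), ?_⟩
  rw [mul_pow, sq_l2norm, ← tsum_mul_left]
  refine Summable.tsum_le_tsum (fun n => ?_) (hd.of_norm_le h) (hd.mul_left (K ^ 2))
  rw [← mul_pow]
  exact pow_le_pow_left₀ (norm_nonneg _) (h n) 2

lemma l2norm_congr_norm {c : ℤ → E} {d : ℤ → F} (h : ∀ n, ‖c n‖ = ‖d n‖) :
    l2norm c = l2norm d := by
  simp only [l2norm, h]

lemma SqSummable.memℓp {c : ℤ → E} (hc : SqSummable c) : Memℓp c 2 := by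
  refine memℓp_gen ?_
  simpa [SqSummable] using hc

lemma SqSummable.add {c d : ℤ → E} (hc : SqSummable c) (hd : SqSummable d) :
    SqSummable (fun n => c n + d n) := by
  have h := (hc.memℓp.add hd.memℓp).summable (by norm_num)
  simpa [SqSummable] using h

lemma l2norm_add_le {c d : ℤ → E} (hc : SqSummable c) (hd : SqSummable d) :
    l2norm (fun n => c n + d n) ≤ l2norm c + l2norm d := by
  have h := Real.Lp_add_le_tsum_of_nonneg (p := 2) (by norm_num) (fun n => norm_nonneg (c n))
    (fun n => norm_nonneg (d n)) (by simpa [SqSummable] using hc) (by simpa [SqSummable] using hd)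
  have h2 := h.2
  simp only [Real.rpow_ofNat, ← Real.sqrt_eq_rpow] at h2
  refine le_trans (Real.sqrt_le_sqrt ?_) h2
  refine Summable.tsum_le_tsum (fun n => ?_) (hc.add hd) (by simpa using h.1)
  exact pow_le_pow_left₀ (norm_nonneg _) (norm_add_le _ _) 2

lemma SqSummable.neg {c : ℤ → E} (hc : SqSummable c) : SqSummable (fun n => -c n) := by
  simpa [SqSummable] using hc

lemma SqSummable.sub {c d : ℤ → E} (hc : SqSummable c) (hd : SqSummable d) :
    SqSummable (fun n => c n - d n) := by
  simpa [sub_eq_add_neg] using hc.add hd.neg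

lemma l2norm_sub_le {c d : ℤ → E} (hc : SqSummable c) (hd : SqSummable d) :
    l2norm (fun n => c n - d n) ≤ l2norm c + l2norm d := by
  have := l2norm_add_le hc hd.neg
  simp only [← sub_eq_add_neg] at this
  rwa [l2norm_congr_norm (c := fun n => -d n) (d := d) (fun _ => norm_neg _)] at this

lemma l2norm_le_add_sub {c d : ℤ → E} (hc : SqSummable c) (hd : SqSummable d) :
    l2norm c ≤ l2norm d + l2norm (fun n => c n - d n) := by
  have := l2norm_add_le hd (hc.sub hd)
  simpa using this

lemma SqSummable.const_smul {𝕜 : Type*} [NormedField 𝕜] [NormedSpace 𝕜 E] {c : ℤ → E}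
    (hc : SqSummable c) (a : 𝕜) : SqSummable (fun n => a • c n) :=
  hc.of_norm_le (K := ‖a‖) fun _ => (norm_smul _ _).le

lemma l2norm_const_smul {𝕜 : Type*} [NormedField 𝕜] [NormedSpace 𝕜 E] (a : 𝕜) (c : ℤ → E) :
    l2norm (fun n => a • c n) = ‖a‖ * l2norm c := by
  simp only [l2norm, norm_smul, mul_pow, tsum_mul_left]
  rw [Real.sqrt_mul (by positivity), Real.sqrt_sq (norm_nonneg _)]

lemma SqSummable.zero : SqSummable (fun _ : ℤ => (0 : E)) := by
  simp [SqSummable, summable_zero]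

lemma l2norm_zero : l2norm (fun _ : ℤ => (0 : E)) = 0 := by simp [l2norm]

lemma SqSummable.sum {ι : Type*} (s : Finset ι) {c : ι → ℤ → E} (hc : ∀ i ∈ s, SqSummable (c i)) :
    SqSummable (fun n => ∑ i ∈ s, c i n) := by
  classical
  induction s using Finset.induction_on with
  | empty => simpa using SqSummable.zero
  | insert i s hi ih =>
    simp only [Finset.sum_insert hi]
    exact (hc i (by simp)).add (ih fun j hj => hc j (by simp [hj]))

lemma l2norm_sum_le {ι : Type*} (s : Finset ι) {c : ι → ℤ → E} (hc : ∀ i ∈ s, SqSummable (c i)) :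
    l2norm (fun n => ∑ i ∈ s, c i n) ≤ ∑ i ∈ s, l2norm (c i) := by
  classical
  induction s using Finset.induction_on with
  | empty => simp [l2norm_zero]
  | insert i s hi ih =>
    simp only [Finset.sum_insert hi]
    refine (l2norm_add_le (hc i (by simp)) (.sum s fun j hj => hc j (by simp [hj]))).trans ?_
    gcongr
    exact ih fun j hj => hc j (by simp [hj])

lemma norm_le_l2norm {c : ℤ → E} (hc : SqSummable c) (n : ℤ) : ‖c n‖ ≤ l2norm c := by
  refine Real.le_sqrt_of_sq_le ?_
  exact hc.le_tsum n (fun _ _ => by positivity)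

lemma sum_sq_le_sq_l2norm {c : ℤ → E} (hc : SqSummable c) (s : Finset ℤ) :
    ∑ n ∈ s, ‖c n‖ ^ 2 ≤ l2norm c ^ 2 := by
  rw [sq_l2norm]
  exact hc.sum_le_tsum s (fun _ _ => by positivity)

lemma sqSummable_and_l2norm_le_of_sum_le {c : ℤ → E} {K : ℝ} (hK : 0 ≤ K)
    (h : ∀ s : Finset ℤ, ∑ n ∈ s, ‖c n‖ ^ 2 ≤ K ^ 2) : SqSummable c ∧ l2norm c ≤ K := by
  have hs : SqSummable c := summable_of_sum_le (fun _ => by positivity) h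
  refine ⟨hs, Real.sqrt_le_iff.2 ⟨hK, ?_⟩⟩
  exact hs.tsum_le_of_sum_le h

lemma SqSummable.of_summable_norm {c : ℤ → E} (hc : Summable fun n => ‖c n‖) : SqSummable c := by
  have h0 := hc.tendsto_cofinite_zero
  refine Summable.of_norm_bounded_eventually hc ?_
  filter_upwards [h0.eventually (gt_mem_nhds one_pos)] with n hn
  rw [Real.norm_of_nonneg (by positivity)]
  nlinarith [norm_nonneg (c n)]

lemma l2norm_le_tsum_norm {c : ℤ → E} (hc : Summable fun n => ‖c n‖) :
    l2norm c ≤ ∑' n, ‖c n‖ := by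
  refine (sqSummable_and_l2norm_le_of_sum_le (tsum_nonneg fun _ => norm_nonneg _) fun s => ?_).2
  calc ∑ n ∈ s, ‖c n‖ ^ 2 ≤ (∑ n ∈ s, ‖c n‖) ^ 2 :=
        Finset.sum_sq_le_sq_sum_of_nonneg fun _ _ => norm_nonneg _
    _ ≤ _ := by
        gcongr
        exact hc.sum_le_tsum s fun _ _ => norm_nonneg _

end L2

/-! ### Trigonometric polynomials and convolutions -/

/-- The trigonometric polynomial `∑_{|m| ≤ M} f_m e^{imz}`. -/
noncomputable def trigPoly (M : ℕ) (f : ℤ → ℂ) (z : ℂ) : ℂ :=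
  ∑ m ∈ Finset.Icc (-(M : ℤ)) M, f m * Complex.exp (Complex.I * m * z)

/-- The action of the trigonometric polynomial with coefficients `f` on Fourier coefficients:
`(f * c)_n = ∑_{|m| ≤ M} f_m c_{n-m}`. -/
noncomputable def trigConv {H : Type*} [AddCommGroup H] [Module ℂ H] (M : ℕ) (f : ℤ → ℂ)
    (c : ℤ → H) (n : ℤ) : H :=
  ∑ m ∈ Finset.Icc (-(M : ℤ)) M, f m • c (n - m)

lemma integral_exp_int (k : ℤ) :
    ∫ t in (0 : ℝ)..2 * Real.pi, Complex.exp (Complex.I * k * t) =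
      if k = 0 then (2 * Real.pi : ℂ) else 0 := by
  split_ifs with hk
  · simp [hk]
  · rw [integral_exp_mul_complex (by simp [hk])]
    have : Complex.exp (Complex.I * k * ((2 * Real.pi : ℝ) : ℂ)) = 1 := by
      rw [Complex.exp_eq_one_iff]
      exact ⟨k, by push_cast; ring⟩
    rw [this]
    simp

section Conv

variable {H : Type*} [NormedAddCommGroup H] [InnerProductSpace ℂ H]

/-- Parseval's identity for finite sums. -/
lemma integral_norm_sq_sum_exp (s : Finset ℤ) (c : ℤ → H) :
    ∫ t in (0 : ℝ)..2 * Real.pi, ‖∑ n ∈ s, Complex.exp (Complex.I * n * t) • c n‖ ^ 2 =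
      2 * Real.pi * ∑ n ∈ s, ‖c n‖ ^ 2 := by
  have key : ∀ t : ℝ, ((‖∑ n ∈ s, Complex.exp (Complex.I * n * t) • c n‖ ^ 2 : ℝ) : ℂ) =
      ∑ n ∈ s, ∑ m ∈ s, Complex.exp (Complex.I * ((m - n : ℤ) : ℂ) * t) * inner ℂ (c n) (c m) := by
    intro t
    have h := inner_self_eq_norm_sq_to_K (𝕜 := ℂ)
      (∑ n ∈ s, Complex.exp (Complex.I * n * t) • c n)
    have h' : ((‖∑ n ∈ s, Complex.exp (Complex.I * n * t) • c n‖ ^ 2 : ℝ) : ℂ) =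
      inner ℂ (∑ n ∈ s, Complex.exp (Complex.I * n * t) • c n)
        (∑ n ∈ s, Complex.exp (Complex.I * n * t) • c n) := by
      rw [h]; simp
    rw [h', sum_inner]
    refine Finset.sum_congr rfl fun n _ => ?_
    rw [inner_sum]
    refine Finset.sum_congr rfl fun m _ => ?_
    rw [inner_smul_left, inner_smul_right, ← Complex.exp_conj, ← mul_assoc, ← Complex.exp_add]
    congr 2
    simp
    ring
  have h1 : ((∫ t in (0 : ℝ)..2 * Real.pi,
      ‖∑ n ∈ s, Complex.exp (Complex.I * n * t) • c n‖ ^ 2 : ℝ) : ℂ) =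
      ((2 * Real.pi * ∑ n ∈ s, ‖c n‖ ^ 2 : ℝ) : ℂ) := by
    rw [← intervalIntegral.integral_ofReal]
    simp_rw [key]
    rw [intervalIntegral.integral_finsetSum
      fun n _ => Continuous.intervalIntegrable (by fun_prop) _ _]
    rw [Complex.ofReal_mul, Complex.ofReal_sum, Finset.mul_sum]
    refine Finset.sum_congr rfl fun n hn => ?_
    rw [intervalIntegral.integral_finsetSum
      fun n _ => Continuous.intervalIntegrable (by fun_prop) _ _]
    rw [Finset.sum_eq_single n]
    · rw [intervalIntegral.integral_mul_const, integral_exp_int]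
      simp
    · intro m _ hm
      rw [intervalIntegral.integral_mul_const, integral_exp_int]
      simp [sub_eq_zero, hm]
    · exact fun h => absurd hn h
  exact_mod_cast h1

lemma sum_exp_smul_trigConv {M : ℕ} (f : ℤ → ℂ) (c : ℤ → H) {Q : ℕ}
    (hc : ∀ n : ℤ, n ∉ Finset.Icc (-(Q : ℤ)) Q → c n = 0) (t : ℝ) :
    ∑ n ∈ Finset.Icc (-((Q + M : ℕ) : ℤ)) (Q + M : ℕ),
        Complex.exp (Complex.I * n * t) • trigConv M f c n =
      trigPoly M f t • ∑ n ∈ Finset.Icc (-(Q : ℤ)) Q, Complex.exp (Complex.I * n * t) • c n := by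
  simp only [trigConv, trigPoly, Finset.smul_sum, Finset.sum_smul]
  rw [Finset.sum_comm]
  rw [Finset.sum_comm (s := Finset.Icc (-(Q : ℤ)) Q)]
  refine Finset.sum_congr rfl fun m hm => ?_
  rw [Finset.mem_Icc] at hm
  have hsub : (Finset.Icc (-(Q : ℤ)) Q).map (addRightEmbedding m) ⊆
      Finset.Icc (-((Q + M : ℕ) : ℤ)) (Q + M : ℕ) := by
    intro n hn
    simp only [Finset.mem_map, Finset.mem_Icc, addRightEmbedding_apply] at hn ⊢
    push_cast
    omega
  rw [← Finset.sum_subset hsub, Finset.sum_map]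
  · refine Finset.sum_congr rfl fun n _ => ?_
    simp only [addRightEmbedding_apply, add_sub_cancel_right, smul_smul]
    have h : Complex.exp (Complex.I * ((n + m : ℤ) : ℂ) * t) =
        Complex.exp (Complex.I * m * t) * Complex.exp (Complex.I * n * t) := by
      rw [← Complex.exp_add]
      congr 1
      push_cast
      ring
    rw [h]
    congr 1
    ring
  · intro n _ hn
    rw [hc (n - m), smul_zero, smul_zero]
    intro h
    apply hn
    simp only [Finset.mem_map, addRightEmbedding_apply]
    exact ⟨n - m, h, by ring⟩

lemma trigConv_support {M : ℕ} (f : ℤ → ℂ) (c : ℤ → H) {Q : ℕ}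
    (hc : ∀ n : ℤ, n ∉ Finset.Icc (-(Q : ℤ)) Q → c n = 0) (n : ℤ)
    (hn : n ∉ Finset.Icc (-((Q + M : ℕ) : ℤ)) (Q + M : ℕ)) : trigConv M f c n = 0 := by
  refine Finset.sum_eq_zero fun m hm => ?_
  rw [hc, smul_zero]
  rw [Finset.mem_Icc] at hm hn ⊢
  push_cast at hn
  omega

lemma continuous_trigPoly (M : ℕ) (f : ℤ → ℂ) : Continuous (trigPoly M f) := by
  unfold trigPoly; fun_prop

lemma l2norm_of_support {E : Type*} [NormedAddCommGroup E] {c : ℤ → E} {s : Finset ℤ}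
    (hc : ∀ n ∉ s, c n = 0) : SqSummable c ∧ l2norm c ^ 2 = ∑ n ∈ s, ‖c n‖ ^ 2 := by
  have h : ∀ n ∉ s, ‖c n‖ ^ 2 = 0 := fun n hn => by simp [hc n hn]
  exact ⟨summable_of_ne_finset_zero h, by rw [sq_l2norm, tsum_eq_sum h]⟩

lemma l2norm_trigConv_le_of_support {M : ℕ} {f : ℤ → ℂ} {B : ℝ}
    (hf : ∀ t : ℝ, ‖trigPoly M f t‖ ≤ B) {c : ℤ → H} {Q : ℕ}
    (hc : ∀ n : ℤ, n ∉ Finset.Icc (-(Q : ℤ)) Q → c n = 0) :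
    l2norm (trigConv M f c) ≤ B * l2norm c := by
  have hB : 0 ≤ B := (norm_nonneg _).trans (hf 0)
  refine le_of_sq_le_sq ?_ (mul_nonneg hB (l2norm_nonneg _))
  rw [mul_pow, (l2norm_of_support hc).2, (l2norm_of_support (trigConv_support f c hc)).2]
  have h1 := integral_norm_sq_sum_exp (Finset.Icc (-((Q + M : ℕ) : ℤ)) (Q + M : ℕ))
    (trigConv M f c)
  have h2 := integral_norm_sq_sum_exp (Finset.Icc (-(Q : ℤ)) Q) c
  simp_rw [sum_exp_smul_trigConv f c hc] at h1
  have h3 : ∫ t in (0 : ℝ)..2 * Real.pi, ‖trigPoly M f t •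
      ∑ n ∈ Finset.Icc (-(Q : ℤ)) Q, Complex.exp (Complex.I * n * t) • c n‖ ^ 2 ≤
      ∫ t in (0 : ℝ)..2 * Real.pi, B ^ 2 *
      ‖∑ n ∈ Finset.Icc (-(Q : ℤ)) Q, Complex.exp (Complex.I * n * t) • c n‖ ^ 2 := by
    have := (continuous_trigPoly M f).comp Complex.continuous_ofReal
    refine intervalIntegral.integral_mono_on (by positivity)
      (Continuous.intervalIntegrable (by fun_prop) _ _)
      (Continuous.intervalIntegrable (by fun_prop) _ _) fun t _ => ?_
    rw [norm_smul, mul_pow]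
    gcongr
    exact hf t
  rw [h1, intervalIntegral.integral_const_mul, h2] at h3
  have := Real.pi_pos
  refine le_of_mul_le_mul_left (a := 2 * Real.pi) ?_ (by positivity)
  linarith

lemma le_l2norm_trigConv_of_support {M : ℕ} {f : ℤ → ℂ} {b : ℝ} (hb : 0 ≤ b)
    (hf : ∀ t : ℝ, b ≤ ‖trigPoly M f t‖) {c : ℤ → H} {Q : ℕ}
    (hc : ∀ n : ℤ, n ∉ Finset.Icc (-(Q : ℤ)) Q → c n = 0) :
    b * l2norm c ≤ l2norm (trigConv M f c) := by
  refine le_of_sq_le_sq ?_ (l2norm_nonneg _)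
  rw [mul_pow, (l2norm_of_support hc).2, (l2norm_of_support (trigConv_support f c hc)).2]
  have h1 := integral_norm_sq_sum_exp (Finset.Icc (-((Q + M : ℕ) : ℤ)) (Q + M : ℕ))
    (trigConv M f c)
  have h2 := integral_norm_sq_sum_exp (Finset.Icc (-(Q : ℤ)) Q) c
  simp_rw [sum_exp_smul_trigConv f c hc] at h1
  have h3 : ∫ t in (0 : ℝ)..2 * Real.pi, b ^ 2 *
      ‖∑ n ∈ Finset.Icc (-(Q : ℤ)) Q, Complex.exp (Complex.I * n * t) • c n‖ ^ 2 ≤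
      ∫ t in (0 : ℝ)..2 * Real.pi, ‖trigPoly M f t •
      ∑ n ∈ Finset.Icc (-(Q : ℤ)) Q, Complex.exp (Complex.I * n * t) • c n‖ ^ 2 := by
    have := (continuous_trigPoly M f).comp Complex.continuous_ofReal
    refine intervalIntegral.integral_mono_on (by positivity)
      (Continuous.intervalIntegrable (by fun_prop) _ _)
      (Continuous.intervalIntegrable (by fun_prop) _ _) fun t _ => ?_
    rw [norm_smul, mul_pow]
    gcongr
    exact hf t
  rw [h1, intervalIntegral.integral_const_mul, h2] at h3
  have := Real.pi_pos
  refine le_of_mul_le_mul_left (a := 2 * Real.pi) ?_ (by positivity)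
  linarith

/-- The restriction of a sequence to `|n| ≤ Q`. -/
noncomputable def trunc {E : Type*} [Zero E] (Q : ℕ) (c : ℤ → E) (n : ℤ) : E :=
  if n ∈ Finset.Icc (-(Q : ℤ)) Q then c n else 0

lemma trunc_support {E : Type*} [Zero E] (Q : ℕ) (c : ℤ → E) (n : ℤ)
    (hn : n ∉ Finset.Icc (-(Q : ℤ)) Q) : trunc Q c n = 0 := if_neg hn

lemma norm_trunc_le {E : Type*} [NormedAddCommGroup E] (Q : ℕ) (c : ℤ → E) (n : ℤ) :
    ‖trunc Q c n‖ ≤ 1 * ‖c n‖ := by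
  unfold trunc
  split_ifs <;> simp

lemma trigConv_sqSummable_and_le {M : ℕ} {f : ℤ → ℂ} {B : ℝ}
    (hf : ∀ t : ℝ, ‖trigPoly M f t‖ ≤ B) {c : ℤ → H} (hc : SqSummable c) :
    SqSummable (trigConv M f c) ∧ l2norm (trigConv M f c) ≤ B * l2norm c := by
  have hB : 0 ≤ B := (norm_nonneg _).trans (hf 0)
  refine sqSummable_and_l2norm_le_of_sum_le (mul_nonneg hB (l2norm_nonneg _)) fun s => ?_
  obtain ⟨Q, hQ⟩ : ∃ Q : ℕ, ∀ n ∈ s, |n| + M ≤ (Q : ℤ) := by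
    refine ⟨∑ n ∈ s, (n.natAbs + M), fun n hn => ?_⟩
    have := Finset.single_le_sum (f := fun n : ℤ => n.natAbs + M) (fun _ _ => Nat.zero_le _) hn
    zify at this
    push_cast
    exact this
  have heq : ∀ n ∈ s, trigConv M f c n = trigConv M f (trunc Q c) n := fun n hn => by
    refine Finset.sum_congr rfl fun m hm => ?_
    rw [trunc, if_pos]
    have := hQ n hn
    rw [Finset.mem_Icc] at hm ⊢
    have := abs_le.1 (show |n| ≤ Q - M by omega)
    omega
  have h1 := l2norm_trigConv_le_of_support hf (trunc_support Q c)
  have h2 := l2norm_le_of_norm_le hc zero_le_one (norm_trunc_le Q c)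
  calc ∑ n ∈ s, ‖trigConv M f c n‖ ^ 2 = ∑ n ∈ s, ‖trigConv M f (trunc Q c) n‖ ^ 2 :=
        Finset.sum_congr rfl fun n hn => by rw [heq n hn]
    _ ≤ l2norm (trigConv M f (trunc Q c)) ^ 2 := sum_sq_le_sq_l2norm
        (l2norm_of_support (trigConv_support f _ (trunc_support Q c))).1 s
    _ ≤ (B * l2norm c) ^ 2 := by
        refine pow_le_pow_left₀ (l2norm_nonneg _) (h1.trans ?_) 2
        gcongr
        linarith

lemma SqSummable.trigConv {M : ℕ} {f : ℤ → ℂ} {c : ℤ → H} (hc : SqSummable c) :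
    SqSummable (trigConv M f c) := by
  refine (trigConv_sqSummable_and_le (B := ∑ m ∈ Finset.Icc (-(M : ℤ)) M, ‖f m‖)
    (fun t => (norm_sum_le _ _).trans (Finset.sum_le_sum fun m _ => ?_)) hc).1
  rw [norm_mul, Complex.norm_exp]
  simp

lemma l2norm_trigConv_le {M : ℕ} {f : ℤ → ℂ} {B : ℝ}
    (hf : ∀ t : ℝ, ‖trigPoly M f t‖ ≤ B) {c : ℤ → H} (hc : SqSummable c) :
    l2norm (trigConv M f c) ≤ B * l2norm c :=
  (trigConv_sqSummable_and_le hf hc).2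

lemma trigConv_add {M : ℕ} {f : ℤ → ℂ} (c d : ℤ → H) (n : ℤ) :
    trigConv M f (fun n => c n + d n) n = trigConv M f c n + trigConv M f d n := by
  simp [trigConv, Finset.sum_add_distrib]

lemma trigConv_sub {M : ℕ} {f : ℤ → ℂ} (c d : ℤ → H) (n : ℤ) :
    trigConv M f (fun n => c n - d n) n = trigConv M f c n - trigConv M f d n := by
  simp [trigConv, smul_sub]

lemma trigConv_const_smul {M : ℕ} {f : ℤ → ℂ} (a : ℂ) (c : ℤ → H) (n : ℤ) :
    trigConv M f (fun n => a • c n) n = a • trigConv M f c n := by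
  simp only [trigConv, Finset.smul_sum, smul_comm a]

lemma SqSummable.tendsto_l2norm_sub_trunc {E : Type*} [NormedAddCommGroup E] {c : ℤ → E}
    (hc : SqSummable c) :
    Tendsto (fun Q => l2norm (fun n => c n - trunc Q c n)) atTop (𝓝 0) := by
  have h1 : Tendsto (fun s : Finset ℤ => ∑' n, ‖c n‖ ^ 2 - ∑ n ∈ s, ‖c n‖ ^ 2) atTop (𝓝 0) := by
    have := (tendsto_const_nhds (x := ∑' n, ‖c n‖ ^ 2)).sub (Summable.hasSum hc)
    rwa [sub_self] at this
  have h2 : Tendsto (fun Q : ℕ => Finset.Icc (-(Q : ℤ)) Q) atTop atTop := by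
    refine tendsto_atTop_finset_of_monotone ?_ fun n => ⟨n.natAbs, by
      rw [Finset.mem_Icc]; omega⟩
    intro a b hab
    exact Finset.Icc_subset_Icc (by simpa using hab) (by simpa using hab)
  have h3 := (h1.comp h2).sqrt
  rw [Real.sqrt_zero] at h3
  refine h3.congr fun Q => ?_
  simp only [Function.comp, l2norm]
  congr 1
  have hs : ∀ n ∉ Finset.Icc (-(Q : ℤ)) Q, ‖trunc Q c n‖ ^ 2 = 0 := fun n hn => by
    simp [trunc_support Q c n hn]
  rw [show ∑ n ∈ Finset.Icc (-(Q : ℤ)) Q, ‖c n‖ ^ 2 = ∑ n ∈ Finset.Icc (-(Q : ℤ)) Q,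
    ‖trunc Q c n‖ ^ 2 from Finset.sum_congr rfl fun n hn => by rw [trunc, if_pos hn],
    ← tsum_eq_sum (L := .unconditional ℤ) hs, ← Summable.tsum_sub hc (summable_of_ne_finset_zero hs)]
  refine tsum_congr fun n => ?_
  unfold trunc
  split_ifs <;> simp

/-- Multiplication by a function which is bounded away from zero is bounded below on `ℓ²`. -/
lemma le_l2norm_trigConv {M : ℕ} {f : ℤ → ℂ} {b : ℝ} (hb : 0 ≤ b)
    (hf : ∀ t : ℝ, b ≤ ‖trigPoly M f t‖) {c : ℤ → H} (hc : SqSummable c) :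
    b * l2norm c ≤ l2norm (trigConv M f c) := by
  have hB : ∀ t : ℝ, ‖trigPoly M f t‖ ≤ ∑ m ∈ Finset.Icc (-(M : ℤ)) M, ‖f m‖ := fun t => by
    refine (norm_sum_le _ _).trans (Finset.sum_le_sum fun m _ => ?_)
    rw [norm_mul, Complex.norm_exp]
    simp
  set B := ∑ m ∈ Finset.Icc (-(M : ℤ)) M, ‖f m‖
  have hB0 : 0 ≤ B := (norm_nonneg _).trans (hB 0)
  have hlim : Tendsto (fun Q => l2norm (trigConv M f c) +
      (B + b) * l2norm (fun n => c n - trunc Q c n)) atTop (𝓝 (l2norm (trigConv M f c))) := by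
    simpa using tendsto_const_nhds.add (hc.tendsto_l2norm_sub_trunc.const_mul (B + b))
  refine ge_of_tendsto' hlim fun Q => ?_
  have ht : SqSummable (trunc Q c) := hc.of_norm_le (norm_trunc_le Q c)
  have h1 := le_l2norm_trigConv_of_support hb hf (trunc_support Q c)
  have h2 := l2norm_le_add_sub hc ht
  have h3 := l2norm_trigConv_le hB (hc.sub ht)
  have h4 := l2norm_sub_le (hc.trigConv (M := M) (f := f)) ((hc.sub ht).trigConv (M := M) (f := f))
  have h5 : (fun n => trigConv M f c n - trigConv M f (fun n => c n - trunc Q c n) n) =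
      trigConv M f (trunc Q c) := by
    ext n
    rw [trigConv_sub]
    abel
  rw [h5] at h4
  nlinarith

end Conv


/-! ### Bernstein inequalities -/

lemma trigPoly_neg (M : ℕ) (f : ℤ → ℂ) (z : ℂ) :
    trigPoly M (fun m => f (-m)) (-z) = trigPoly M f z := by
  unfold trigPoly
  refine Finset.sum_nbij' (fun m => -m) (fun m => -m) ?_ ?_ ?_ ?_ ?_
  · intro m hm; rw [Finset.mem_Icc] at hm ⊢; omega
  · intro m hm; rw [Finset.mem_Icc] at hm ⊢; omega
  · simp
  · simp
  · intro m _
    simp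

/-- The maximum principle on the unit disc for the polynomial `∑ f_m w^{m + M}` in `w = e^{iz}`. -/
lemma norm_trigPoly_le_of_im_nonneg {M : ℕ} {f : ℤ → ℂ} {B : ℝ}
    (hf : ∀ t : ℝ, ‖trigPoly M f t‖ ≤ B) {z : ℂ} (hz : 0 ≤ z.im) :
    ‖trigPoly M f z‖ ≤ B * Real.exp (M * z.im) := by
  set p : ℂ → ℂ := fun w => ∑ m ∈ Finset.Icc (-(M : ℤ)) M, f m * w ^ (m + M).toNat with hp
  have hpe : ∀ z : ℂ, p (Complex.exp (Complex.I * z)) =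
      Complex.exp (Complex.I * M * z) * trigPoly M f z := by
    intro z
    simp only [hp, trigPoly, Finset.mul_sum]
    refine Finset.sum_congr rfl fun m hm => ?_
    rw [Finset.mem_Icc] at hm
    rw [← Complex.exp_nat_mul, mul_left_comm (Complex.exp _), ← Complex.exp_add]
    congr 2
    have : (((m + M).toNat : ℕ) : ℂ) = (m : ℂ) + M := by
      have : (((m + M).toNat : ℕ) : ℤ) = m + M := Int.toNat_of_nonneg (by omega)
      exact_mod_cast congrArg (Int.cast : ℤ → ℂ) this
    rw [this]
    ring
  have hdiff : Differentiable ℂ p := by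
    simp only [hp]; fun_prop
  have hball : ‖Complex.exp (Complex.I * z)‖ ≤ 1 := by
    rw [Complex.norm_exp]
    simpa using hz
  have hmax : ‖p (Complex.exp (Complex.I * z))‖ ≤ B := by
    refine Complex.norm_le_of_forall_mem_frontier_norm_le (U := Metric.ball 0 1)
      Metric.isBounded_ball hdiff.diffContOnCl (fun w hw => ?_) ?_
    · rw [frontier_ball _ one_ne_zero, mem_sphere_zero_iff_norm] at hw
      have hw' : w = Complex.exp (Complex.I * (w.arg : ℝ)) := by
        conv_lhs => rw [← Complex.norm_mul_exp_arg_mul_I w, hw]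
        rw [mul_comm Complex.I]
        simp
      rw [hw', hpe, norm_mul, Complex.norm_exp]
      simpa using hf w.arg
    · rw [closure_ball _ one_ne_zero]
      simpa using hball
  rw [hpe, norm_mul, Complex.norm_exp] at hmax
  have h1 : (Complex.I * M * z).re = -(M * z.im) := by simp
  rw [h1, Real.exp_neg, inv_mul_le_iff₀ (Real.exp_pos _)] at hmax
  linarith

lemma norm_trigPoly_le {M : ℕ} {f : ℤ → ℂ} {B : ℝ}
    (hf : ∀ t : ℝ, ‖trigPoly M f t‖ ≤ B) (z : ℂ) :
    ‖trigPoly M f z‖ ≤ B * Real.exp (M * |z.im|) := by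
  rcases le_total 0 z.im with h | h
  · rw [abs_of_nonneg h]
    exact norm_trigPoly_le_of_im_nonneg hf h
  · rw [abs_of_nonpos h, ← trigPoly_neg]
    have : -z.im = (-z).im := by simp
    rw [this]
    refine norm_trigPoly_le_of_im_nonneg (fun t => ?_) (by simpa using h)
    have h1 := hf (-t)
    rw [← trigPoly_neg] at h1
    simpa using h1

lemma hasDerivAt_trigPoly (M : ℕ) (f : ℤ → ℂ) (z : ℂ) :
    HasDerivAt (trigPoly M f) (trigPoly M (fun m => Complex.I * m * f m) z) z := by
  unfold trigPoly
  refine HasDerivAt.fun_sum fun m _ => ?_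
  have h := (((hasDerivAt_id z).const_mul (Complex.I * m)).cexp).const_mul (f m)
  refine h.congr_deriv ?_
  simp
  ring

/-- Bernstein's inequality in a strip, with a constant from Cauchy's estimate on a disc of radius
`1 / (M + 1)`. -/
lemma norm_deriv_trigPoly_le {M : ℕ} {f : ℤ → ℂ} {B : ℝ}
    (hf : ∀ t : ℝ, ‖trigPoly M f t‖ ≤ B) (z : ℂ) :
    ‖trigPoly M (fun m => Complex.I * m * f m) z‖ ≤
      (M + 1) * Real.exp (1 + M * |z.im|) * B := by
  have hB : 0 ≤ B := (norm_nonneg _).trans (hf 0)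
  rw [← (hasDerivAt_trigPoly M f z).deriv]
  have hR : (0 : ℝ) < 1 / (M + 1) := by positivity
  have hd : Differentiable ℂ (trigPoly M f) := fun z => (hasDerivAt_trigPoly M f z).differentiableAt
  have h := Complex.norm_deriv_le_of_forall_mem_sphere_norm_le (c := z) hR
    (hd.diffContOnCl) (C := B * Real.exp (1 + M * |z.im|)) (fun w hw => ?_)
  · refine h.trans_eq ?_
    field_simp
  · refine (norm_trigPoly_le hf w).trans ?_
    gcongr
    have h1 : |w.im| ≤ |z.im| + 1 / (M + 1) := by
      have h2 := Complex.abs_im_le_norm (w - z)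
      rw [mem_sphere_iff_norm] at hw
      rw [hw, Complex.sub_im] at h2
      have := abs_sub_abs_le_abs_sub w.im z.im
      linarith
    have h3 : (M : ℝ) * (1 / (M + 1)) ≤ 1 := by
      rw [mul_one_div, div_le_one (by positivity)]
      linarith
    have h4 : (M : ℝ) * |w.im| ≤ M * (|z.im| + 1 / (M + 1)) := by gcongr
    linarith

lemma norm_trigPoly_mul_int_le {M : ℕ} {f : ℤ → ℂ} {B : ℝ}
    (hf : ∀ t : ℝ, ‖trigPoly M f t‖ ≤ B) (t : ℝ) :
    ‖trigPoly M (fun m => m * f m) t‖ ≤ Real.exp 1 * (M + 1) * B := by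
  have h := norm_deriv_trigPoly_le hf t
  have h2 : trigPoly M (fun m => Complex.I * m * f m) t =
      Complex.I * trigPoly M (fun m => m * f m) t := by
    simp only [trigPoly, Finset.mul_sum, mul_assoc]
  rw [h2, norm_mul, Complex.norm_I, one_mul] at h
  simp only [Complex.ofReal_im, abs_zero, mul_zero, add_zero] at h
  linarith

lemma norm_trigPoly_shift_sub_le {M : ℕ} {f : ℤ → ℂ} {B : ℝ}
    (hf : ∀ t : ℝ, ‖trigPoly M f t‖ ≤ B) {s : ℝ} (hs : M * |s| ≤ 1) (t : ℝ) :
    ‖trigPoly M f (t + s * Complex.I) - trigPoly M f t‖ ≤ Real.exp 2 * (M + 1) * |s| * B := by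
  have hB : 0 ≤ B := (norm_nonneg _).trans (hf 0)
  have hconv : Convex ℝ {z : ℂ | |z.im| ≤ |s|} := by
    have : {z : ℂ | |z.im| ≤ |s|} = Complex.imLm ⁻¹' (Set.Icc (-|s|) |s|) := by
      ext z; simp [abs_le]
    rw [this]
    exact (convex_Icc _ _).is_linear_preimage Complex.imLm.isLinear
  have h := Convex.norm_image_sub_le_of_norm_hasDerivWithin_le (f := trigPoly M f)
    (f' := trigPoly M (fun m => Complex.I * m * f m)) (s := {z : ℂ | |z.im| ≤ |s|})
    (C := (M + 1) * Real.exp 2 * B) (x := (t : ℂ)) (y := t + s * Complex.I)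
    (fun z _ => (hasDerivAt_trigPoly M f z).hasDerivWithinAt) (fun z hz => ?_) hconv
    (by simp) (by simp)
  · refine h.trans_eq ?_
    simp
    ring
  · refine (norm_deriv_trigPoly_le hf z).trans ?_
    gcongr
    have : (M : ℝ) * |z.im| ≤ M * |s| := mul_le_mul_of_nonneg_left hz (by positivity)
    linarith

lemma trigPoly_shift (M : ℕ) (f : ℤ → ℂ) (s t : ℝ) :
    trigPoly M f (t + s * Complex.I) =
      trigPoly M (fun m => f m * Real.exp (-(s * m))) t := by
  unfold trigPoly
  refine Finset.sum_congr rfl fun m _ => ?_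
  simp only
  rw [mul_assoc (f m), Complex.ofReal_exp, ← Complex.exp_add]
  congr 2
  push_cast
  linear_combination (m * s : ℂ) * Complex.I_mul_I

/-! ### Exponential weights -/

/-- The weights `1 / cosh (θ n)`, which decay like `e^{-θ|n|}`. -/
noncomputable def coshWeight (θ : ℝ) (n : ℤ) : ℝ := (Real.cosh (θ * n))⁻¹

lemma coshWeight_pos (θ : ℝ) (n : ℤ) : 0 < coshWeight θ n := inv_pos.2 (Real.cosh_pos _)

lemma coshWeight_le (θ : ℝ) (n : ℤ) : coshWeight θ n ≤ 2 * Real.exp (-|θ * n|) := by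
  rw [coshWeight, ← Real.cosh_abs, Real.cosh_eq]
  have h1 := Real.exp_pos (|θ * n|)
  have h2 := Real.exp_pos (-|θ * n|)
  rw [inv_le_comm₀ (by positivity) (by positivity), Real.exp_neg]
  field_simp
  nlinarith

lemma le_coshWeight (θ : ℝ) (n : ℤ) : Real.exp (-|θ * n|) ≤ coshWeight θ n := by
  rw [coshWeight, ← Real.cosh_abs, Real.cosh_eq]
  have h3 : Real.exp (-|θ * n|) ≤ Real.exp (|θ * n|) :=
    Real.exp_le_exp.2 (by linarith [abs_nonneg (θ * n)])
  have h1 := Real.exp_pos (|θ * n|)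
  rw [Real.exp_neg] at *
  rw [inv_le_inv₀ h1 (by positivity)]
  linarith

section Weighted

variable {H : Type*} [NormedAddCommGroup H] [InnerProductSpace ℂ H]

/-- The weighted sequence `c_n / cosh (θ n)`. -/
noncomputable def weighted (θ : ℝ) (c : ℤ → H) (n : ℤ) : H := (coshWeight θ n : ℂ) • c n

lemma norm_weighted (θ : ℝ) (c : ℤ → H) (n : ℤ) :
    ‖weighted θ c n‖ = coshWeight θ n * ‖c n‖ := by
  rw [weighted, norm_smul, Complex.norm_real, Real.norm_of_nonneg (coshWeight_pos θ n).le]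

/-- The addition theorem for `cosh` turns the conjugation of a convolution with the weights
`1 / cosh (θ n)` into convolutions with the shifts of the symbol by `± iθ`. -/
lemma weighted_trigConv (M : ℕ) (f : ℤ → ℂ) (θ : ℝ) (c : ℤ → H) (n : ℤ) :
    weighted θ (trigConv M f c) n =
      trigConv M (fun m => f m * Real.cosh (θ * m)) (weighted θ c) n
      - (Real.tanh (θ * n) : ℂ) •
        trigConv M (fun m => f m * Real.sinh (θ * m)) (weighted θ c) n := by
  simp only [weighted, trigConv, Finset.smul_sum, ← Finset.sum_sub_distrib, smul_smul, ← sub_smul]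
  refine Finset.sum_congr rfl fun m _ => ?_
  congr 1
  have h : coshWeight θ n = Real.cosh (θ * m) * coshWeight θ (n - m) -
      Real.tanh (θ * n) * (Real.sinh (θ * m) * coshWeight θ (n - m)) := by
    have h1 := (Real.cosh_pos (θ * n)).ne'
    have h2 := (Real.cosh_pos (θ * (n - m : ℤ))).ne'
    rw [coshWeight, coshWeight, Real.tanh_eq_sinh_div_cosh]
    have h3 : Real.cosh (θ * (n - m : ℤ)) =
        Real.cosh (θ * n) * Real.cosh (θ * m) - Real.sinh (θ * n) * Real.sinh (θ * m) := by
      rw [← Real.cosh_sub]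
      congr 1
      push_cast
      ring
    field_simp
    rw [h3]
  rw [h]
  push_cast
  ring

lemma norm_trigPoly_cosh_le {M : ℕ} {f : ℤ → ℂ} {B : ℝ}
    (hf : ∀ t : ℝ, ‖trigPoly M f t‖ ≤ B) {θ : ℝ} (hθ : 0 ≤ θ) (hθM : M * θ ≤ 1) (t : ℝ) :
    ‖trigPoly M (fun m => f m * (Real.cosh (θ * m) - 1)) t‖ ≤ Real.exp 2 * (M + 1) * θ * B ∧
    ‖trigPoly M (fun m => f m * Real.sinh (θ * m)) t‖ ≤ Real.exp 2 * (M + 1) * θ * B := by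
  have h1 := norm_trigPoly_shift_sub_le hf (s := θ) (by rwa [abs_of_nonneg hθ]) t
  have h2 := norm_trigPoly_shift_sub_le hf (s := -θ) (by rwa [abs_neg, abs_of_nonneg hθ]) t
  rw [abs_neg] at h2
  rw [abs_of_nonneg hθ] at h1 h2
  have e1 : trigPoly M (fun m => f m * (Real.cosh (θ * m) - 1)) t =
      ((trigPoly M f (t + θ * Complex.I) - trigPoly M f t) +
        (trigPoly M f (t + (-θ : ℝ) * Complex.I) - trigPoly M f t)) / 2 := by
    rw [trigPoly_shift, trigPoly_shift]
    simp only [trigPoly, ← Finset.sum_sub_distrib, ← Finset.sum_add_distrib, Finset.sum_div]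
    refine Finset.sum_congr rfl fun m _ => ?_
    rw [Real.cosh_eq]
    push_cast
    ring_nf
  have e2 : trigPoly M (fun m => f m * Real.sinh (θ * m)) t =
      ((trigPoly M f (t + (-θ : ℝ) * Complex.I) - trigPoly M f t) -
        (trigPoly M f (t + θ * Complex.I) - trigPoly M f t)) / 2 := by
    rw [trigPoly_shift, trigPoly_shift]
    simp only [trigPoly, ← Finset.sum_sub_distrib, Finset.sum_div]
    refine Finset.sum_congr rfl fun m _ => ?_
    rw [Real.sinh_eq]
    push_cast
    ring_nf
  constructor
  · rw [e1, norm_div, Complex.norm_ofNat]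
    have := norm_add_le (trigPoly M f (t + θ * Complex.I) - trigPoly M f t)
      (trigPoly M f (t + (-θ : ℝ) * Complex.I) - trigPoly M f t)
    linarith
  · rw [e2, norm_div, Complex.norm_ofNat]
    have := norm_sub_le (trigPoly M f (t + (-θ : ℝ) * Complex.I) - trigPoly M f t)
      (trigPoly M f (t + θ * Complex.I) - trigPoly M f t)
    linarith

/-- Multiplication by a trigonometric polynomial of degree `M` almost commutes with the weights
`1 / cosh (θ n)` if `θ M` is small. -/
lemma l2norm_weighted_trigConv_sub_le {M : ℕ} {f : ℤ → ℂ} {B : ℝ}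
    (hf : ∀ t : ℝ, ‖trigPoly M f t‖ ≤ B) {θ : ℝ} (hθ : 0 ≤ θ) (hθM : M * θ ≤ 1) {c : ℤ → H}
    (hc : SqSummable (weighted θ c)) :
    SqSummable (fun n => weighted θ (trigConv M f c) n - trigConv M f (weighted θ c) n) ∧
    l2norm (fun n => weighted θ (trigConv M f c) n - trigConv M f (weighted θ c) n) ≤
      2 * Real.exp 2 * (M + 1) * θ * B * l2norm (weighted θ c) := by
  have heq : (fun n => weighted θ (trigConv M f c) n - trigConv M f (weighted θ c) n) =
      fun n => trigConv M (fun m => f m * (Real.cosh (θ * m) - 1)) (weighted θ c) n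
      - (Real.tanh (θ * n) : ℂ) •
        trigConv M (fun m => f m * Real.sinh (θ * m)) (weighted θ c) n := by
    ext n
    rw [weighted_trigConv, sub_right_comm]
    congr 1
    simp only [trigConv, ← Finset.sum_sub_distrib, ← sub_smul]
    refine Finset.sum_congr rfl fun m _ => ?_
    congr 1
    ring
  rw [heq]
  have h1 := trigConv_sqSummable_and_le
    (fun t => (norm_trigPoly_cosh_le hf hθ hθM t).1) hc
  have h2 := trigConv_sqSummable_and_le
    (fun t => (norm_trigPoly_cosh_le hf hθ hθM t).2) hc
  have h3 : ∀ n : ℤ, ‖(Real.tanh (θ * n) : ℂ) •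
        trigConv M (fun m => f m * Real.sinh (θ * m)) (weighted θ c) n‖ ≤
        1 * ‖trigConv M (fun m => f m * Real.sinh (θ * m)) (weighted θ c) n‖ := fun n => by
    rw [norm_smul, Complex.norm_real]
    gcongr
    rw [Real.norm_eq_abs]
    exact (Real.abs_tanh_lt_one _).le
  refine ⟨h1.1.sub (h2.1.of_norm_le h3), (l2norm_sub_le h1.1 (h2.1.of_norm_le h3)).trans ?_⟩
  have h4 := l2norm_le_of_norm_le h2.1 zero_le_one h3
  linarith [h1.2, h2.2]

lemma l2norm_weighted_trigConv_le {M : ℕ} {f : ℤ → ℂ} {B : ℝ}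
    (hf : ∀ t : ℝ, ‖trigPoly M f t‖ ≤ B) {θ : ℝ} (hθ : 0 ≤ θ) (hθM : M * θ ≤ 1) {c : ℤ → H}
    (hc : SqSummable (weighted θ c)) :
    SqSummable (weighted θ (trigConv M f c)) ∧ l2norm (weighted θ (trigConv M f c)) ≤
      (1 + 2 * Real.exp 2 * (M + 1) * θ) * B * l2norm (weighted θ c) := by
  have h1 := l2norm_weighted_trigConv_sub_le hf hθ hθM hc
  have h2 := trigConv_sqSummable_and_le hf hc
  have h3 : SqSummable (weighted θ (trigConv M f c)) := by
    have := h1.1.add h2.1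
    simpa using this
  refine ⟨h3, (l2norm_le_add_sub h3 h2.1).trans ?_⟩
  linarith [h1.2, h2.2]

lemma le_l2norm_weighted_trigConv {M : ℕ} {f : ℤ → ℂ} {b B : ℝ} (hb : 0 ≤ b)
    (hf : ∀ t : ℝ, ‖trigPoly M f t‖ ≤ B) (hf' : ∀ t : ℝ, b ≤ ‖trigPoly M f t‖)
    {θ : ℝ} (hθ : 0 ≤ θ) (hθM : M * θ ≤ 1) {c : ℤ → H}
    (hc : SqSummable (weighted θ c)) :
    (b - 2 * Real.exp 2 * (M + 1) * θ * B) * l2norm (weighted θ c) ≤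
      l2norm (weighted θ (trigConv M f c)) := by
  have h1 := l2norm_weighted_trigConv_sub_le hf hθ hθM hc
  have h2 := le_l2norm_trigConv hb hf' hc
  have h3 := (l2norm_weighted_trigConv_le hf hθ hθM hc).1
  have h4 := l2norm_le_add_sub (hc.trigConv (M := M) (f := f)) h3
  rw [l2norm_congr_norm (c := fun n => trigConv M f (weighted θ c) n - weighted θ (trigConv M f c) n)
    (d := fun n => weighted θ (trigConv M f c) n - trigConv M f (weighted θ c) n)
    fun n => norm_sub_rev _ _] at h4
  linarith [h1.2]

/-- The Leibniz rule on the Fourier side. -/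
lemma smul_trigConv (M : ℕ) (f : ℤ → ℂ) (ω Ω : ℂ) (c : ℤ → H) (n : ℤ) :
    (ω + n * Ω) • trigConv M f c n = trigConv M f (fun n => (ω + n * Ω) • c n) n +
      Ω • trigConv M (fun m => m * f m) c n := by
  simp only [trigConv, Finset.smul_sum, ← Finset.sum_add_distrib, smul_smul, ← add_smul]
  refine Finset.sum_congr rfl fun m _ => ?_
  congr 1
  push_cast
  ring

end Weighted


/-! ### Linear differential equations with bounded coefficients -/

section ODE

variable {E : Type*} [NormedAddCommGroup E] [NormedSpace ℂ E]

/-- `X` solves the linear differential equation `X' = A(t) X`. -/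
def IsLinearSolution (A : ℝ → E →L[ℂ] E) (X : ℝ → E) : Prop :=
  ∀ t, HasDerivAt X (A t (X t)) t

/-- Global existence.  The equation is a fixed point equation for `X(t) / cosh (β t)` in the space
of bounded continuous functions, and it is contracting for large `β`. -/
lemma exists_isLinearSolution [CompleteSpace E] {A : ℝ → E →L[ℂ] E} (hA : Continuous A) {B : ℝ}
    (hB : ∀ t, ‖A t‖ ≤ B) (x₀ : E) : ∃ X : ℝ → E, X 0 = x₀ ∧ IsLinearSolution A X := by
  have hB0 : 0 ≤ B := (norm_nonneg _).trans (hB 0)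
  set β : ℝ := 2 * B + 1 with hβ
  have hβ0 : 0 < β := by positivity
  set I : (ℝ → E) → ℝ → E := fun Z t => ∫ s in (0 : ℝ)..t, Real.cosh (β * s) • A s (Z s) with hI
  have hcont : ∀ Z : BoundedContinuousFunction ℝ E,
      Continuous fun s => Real.cosh (β * s) • A s (Z s) := fun Z => by
    have h1 : Continuous fun s => A s (Z s) := hA.clm_apply Z.continuous
    have h2 : Continuous fun s : ℝ => Real.cosh (β * s) := by fun_prop
    exact h2.smul h1
  have hcosh : ∀ t, (0 : ℝ) < Real.cosh (β * t) := fun t => Real.cosh_pos _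
  -- the basic estimate `|∫₀ᵗ cosh (β s)| ≤ cosh (β t) / β`
  have hint : ∀ (t K : ℝ), 0 ≤ K → |∫ s in (0 : ℝ)..t, K * Real.cosh (β * s)| ≤
      K / β * Real.cosh (β * t) := fun t K hK => by
    have h1 : ∀ s ∈ Set.uIcc 0 t, HasDerivAt (fun s => K / β * Real.sinh (β * s))
        (K * Real.cosh (β * s)) s := fun s _ => by
      have := (((hasDerivAt_id s).const_mul β).sinh).const_mul (K / β)
      refine this.congr_deriv ?_
      simp only [id]
      field_simp
    rw [intervalIntegral.integral_eq_sub_of_hasDerivAt h1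
      (Continuous.intervalIntegrable (by fun_prop) _ _)]
    simp only [mul_zero, Real.sinh_zero, sub_zero]
    rw [abs_mul, abs_of_nonneg (by positivity : 0 ≤ K / β)]
    gcongr
    rw [Real.abs_sinh, ← Real.cosh_abs]
    exact (Real.sinh_lt_cosh _).le
  have hIle : ∀ (Z : ℝ → E) (K : ℝ), 0 ≤ K → (∀ s, ‖Z s‖ ≤ K) → ∀ t,
      ‖(Real.cosh (β * t))⁻¹ • I Z t‖ ≤ 2⁻¹ * K := fun Z K hK hZ t => by
    rw [norm_smul, norm_inv, Real.norm_of_nonneg (hcosh t).le, inv_mul_le_iff₀ (hcosh t)]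
    have h1 : ‖I Z t‖ ≤ |∫ s in (0 : ℝ)..t, (B * K) * Real.cosh (β * s)| := by
      refine intervalIntegral.norm_integral_le_abs_of_norm_le (Eventually.of_forall fun s => ?_)
        (Continuous.intervalIntegrable (by fun_prop) _ _)
      rw [norm_smul, Real.norm_of_nonneg (hcosh s).le, mul_comm]
      gcongr
      refine ((A s).le_opNorm _).trans ?_
      gcongr
      · exact hB s
      · exact hZ s
    refine h1.trans ((hint t _ (by positivity)).trans ?_)
    have h2 : B * K / β ≤ 2⁻¹ * K := by
      rw [div_le_iff₀ hβ0, hβ]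
      nlinarith
    calc B * K / β * Real.cosh (β * t) ≤ (2⁻¹ * K) * Real.cosh (β * t) := by gcongr
      _ = _ := by ring
  set T : BoundedContinuousFunction ℝ E → BoundedContinuousFunction ℝ E := fun Z =>
    BoundedContinuousFunction.ofNormedAddCommGroup
      (fun t => (Real.cosh (β * t))⁻¹ • (x₀ + I Z t))
      (by
        have h1 : Continuous (I Z) := intervalIntegral.continuous_primitive
          (fun a b => (hcont Z).intervalIntegrable a b) 0
        have h2 : Continuous fun t : ℝ => (Real.cosh (β * t))⁻¹ :=
          Continuous.inv₀ (by fun_prop) fun t => (hcosh t).ne'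
        exact h2.smul (continuous_const.add h1))
      (‖x₀‖ + 2⁻¹ * ‖Z‖)
      (fun t => by
        rw [smul_add]
        refine (norm_add_le _ _).trans (add_le_add ?_ ?_)
        · rw [norm_smul, norm_inv, Real.norm_of_nonneg (hcosh t).le]
          exact mul_le_of_le_one_left (norm_nonneg _)
            (inv_le_one_of_one_le₀ (Real.one_le_cosh _))
        · exact hIle Z _ (norm_nonneg _) Z.norm_coe_le_norm t) with hT
  have hTapp : ∀ Z t, T Z t = (Real.cosh (β * t))⁻¹ • (x₀ + I Z t) := fun Z t => rfl
  have hcontr : ContractingWith 2⁻¹ T := by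
    refine ⟨by norm_num, LipschitzWith.of_dist_le_mul fun Z Z' => ?_⟩
    rw [BoundedContinuousFunction.dist_le (by positivity)]
    intro t
    rw [dist_eq_norm, hTapp, hTapp, ← smul_sub, add_sub_add_left_eq_sub]
    have h1 : I Z t - I Z' t = I (fun s => Z s - Z' s) t := by
      simp only [hI]
      rw [← intervalIntegral.integral_sub ((hcont Z).intervalIntegrable _ _)
        ((hcont Z').intervalIntegrable _ _)]
      congr 1
      ext s
      simp [smul_sub]
    rw [h1]
    have h2 := hIle (fun s => Z s - Z' s) (dist Z Z') dist_nonneg (fun s => by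
      rw [← dist_eq_norm]
      exact BoundedContinuousFunction.dist_coe_le_dist s) t
    simpa using h2
  set Z := ContractingWith.fixedPoint T hcontr
  have hZ : T Z = Z := hcontr.fixedPoint_isFixedPt
  have hZ' : ∀ t, Real.cosh (β * t) • Z t = x₀ + I Z t := fun t => by
    conv_lhs => rw [← hZ]
    rw [hTapp, smul_inv_smul₀ (hcosh t).ne']
  refine ⟨fun t => Real.cosh (β * t) • Z t, ?_, fun t => ?_⟩
  · simp only [hZ']
    simp [hI]
  · have h1 : HasDerivAt (fun t => x₀ + I Z t) (Real.cosh (β * t) • A t (Z t)) t :=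
      ((hcont Z).integral_hasStrictDerivAt 0 t).hasDerivAt.const_add x₀
    simp only [← hZ'] at h1
    refine h1.congr_deriv ?_
    have : A t (Real.cosh (β * t) • Z t) = Real.cosh (β * t) • A t (Z t) := by
      rw [← Complex.coe_smul, map_smul, Complex.coe_smul]
    rw [this]

lemma IsLinearSolution.unique {A : ℝ → E →L[ℂ] E} {B : ℝ} (hB : ∀ t, ‖A t‖ ≤ B) {X Y : ℝ → E}
    (hX : IsLinearSolution A X) (hY : IsLinearSolution A Y) {t₀ : ℝ} (h : X t₀ = Y t₀) :
    X = Y := by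
  have hB0 : 0 ≤ B := (norm_nonneg _).trans (hB 0)
  refine ODE_solution_unique_univ (v := fun t x => A t x) (s := fun _ => Set.univ)
    (K := ⟨B, hB0⟩) (fun t => ?_) (fun t => ⟨hX t, trivial⟩) (fun t => ⟨hY t, trivial⟩) h
  refine LipschitzWith.lipschitzOnWith (LipschitzWith.of_dist_le_mul fun x y => ?_)
  rw [dist_eq_norm, dist_eq_norm, ← map_sub]
  exact (A t).le_of_opNorm_le (hB t) _

lemma IsLinearSolution.add {A : ℝ → E →L[ℂ] E} {X Y : ℝ → E}
    (hX : IsLinearSolution A X) (hY : IsLinearSolution A Y) :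
    IsLinearSolution A (fun t => X t + Y t) := fun t => by
  simpa using (hX t).fun_add (hY t)

lemma IsLinearSolution.smul {A : ℝ → E →L[ℂ] E} {X : ℝ → E}
    (hX : IsLinearSolution A X) (a : ℂ) :
    IsLinearSolution A (fun t => a • X t) := fun t => by
  simpa using (hX t).fun_const_smul a

lemma IsLinearSolution.comp_add {A : ℝ → E →L[ℂ] E} {T : ℝ} (hA : Function.Periodic A T)
    {X : ℝ → E} (hX : IsLinearSolution A X) : IsLinearSolution A (fun t => X (t + T)) := fun t => by
  have := (hX (t + T)).comp_add_const t T
  rwa [hA t] at this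

/-- The monodromy map `X 0 ↦ X T` of a linear differential equation. -/
lemma exists_monodromy [CompleteSpace E] {A : ℝ → E →L[ℂ] E} (hA : Continuous A) {B : ℝ}
    (hB : ∀ t, ‖A t‖ ≤ B) (T : ℝ) :
    ∃ P : E →ₗ[ℂ] E, ∀ X, IsLinearSolution A X → P (X 0) = X T := by
  choose S hS0 hS using exists_isLinearSolution hA hB
  refine ⟨⟨⟨fun x => S x T, fun x y => ?_⟩, fun a x => ?_⟩, fun X hX => ?_⟩
  · exact congrFun (IsLinearSolution.unique hB (hS (x + y)) ((hS x).add (hS y)) (t₀ := 0)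
      (by simp [hS0])) T
  · exact congrFun (IsLinearSolution.unique hB (hS (a • x)) ((hS x).smul a) (t₀ := 0)
      (by simp [hS0])) T
  · exact congrFun (IsLinearSolution.unique hB (hS (X 0)) hX (t₀ := 0) (by simp [hS0])) T

/-- A Gronwall estimate for solutions of `X' = A X + F` in terms of the integral of `F`. -/
lemma norm_sub_le_of_linear_perturbation [CompleteSpace E] {A : ℝ → E →L[ℂ] E} {B : ℝ}
    (hB1 : 1 ≤ B) (hB : ∀ t, ‖A t‖ ≤ B) {X Y F : ℝ → E} (hF : Continuous F)
    (hX : ∀ t, HasDerivAt X (A t (X t) + F t) t) (hY : IsLinearSolution A Y) (h0 : X 0 = Y 0)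
    {T : ℝ} {t : ℝ} (ht : t ∈ Set.Icc 0 T) :
    ‖X t - Y t‖ ≤ Real.exp (B * T) * ∫ s in (0 : ℝ)..T, ‖F s‖ := by
  set I := ∫ s in (0 : ℝ)..T, ‖F s‖ with hI
  set G : ℝ → E := fun t => ∫ s in (0 : ℝ)..t, F s with hG
  have hGd : ∀ t, HasDerivAt G (F t) t := fun t => (hF.integral_hasStrictDerivAt 0 t).hasDerivAt
  have hGle : ∀ t ∈ Set.Icc 0 T, ‖G t‖ ≤ I := fun t ht => by
    refine (intervalIntegral.norm_integral_le_integral_norm ht.1).trans ?_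
    exact intervalIntegral.integral_mono_interval le_rfl ht.1 ht.2
      (Eventually.of_forall fun _ => norm_nonneg _) (hF.norm.intervalIntegrable _ _)
  have hI0 : 0 ≤ I := (norm_nonneg _).trans (hGle t ht)
  have hd : ∀ t, HasDerivAt (fun t => X t - Y t - G t) (A t (X t - Y t)) t := fun t => by
    refine (((hX t).sub (hY t)).sub (hGd t)).congr_deriv ?_
    rw [map_sub]
    abel
  have hgr := norm_le_gronwallBound_of_norm_deriv_right_le (f := fun t => X t - Y t - G t)
    (f' := fun t => A t (X t - Y t)) (δ := 0) (K := B) (ε := B * I) (a := 0) (b := T)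
    (fun t _ => (hd t).continuousAt.continuousWithinAt)
    (fun t _ => (hd t).hasDerivWithinAt) (by simp [h0, hG])
    (fun t ht => by
      refine ((A t).le_of_opNorm_le (hB t) _).trans ?_
      rw [← mul_add]
      gcongr
      have h1 := norm_add_le (X t - Y t - G t) (G t)
      rw [sub_add_cancel] at h1
      linarith [hGle t ⟨ht.1, ht.2.le⟩]) t ht
  have hB0 : B ≠ 0 := by positivity
  simp only [gronwallBound_of_K_ne_0 hB0, sub_zero, zero_mul, zero_add] at hgr
  rw [mul_div_cancel_left₀ _ hB0] at hgr
  have h1 := norm_add_le (X t - Y t - G t) (G t)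
  rw [sub_add_cancel] at h1
  have h2 := hGle t ht
  have h3 : Real.exp (B * t) ≤ Real.exp (B * T) := by
    gcongr
    exact ht.2
  nlinarith

/-- The monodromy map almost has the eigenvalue `μ` if there is an approximate solution which is
multiplied by `μ` over one period. -/
lemma norm_monodromy_sub_le [CompleteSpace E] {A : ℝ → E →L[ℂ] E} (hA : Continuous A) {B : ℝ}
    (hB1 : 1 ≤ B) (hB : ∀ t, ‖A t‖ ≤ B) {T : ℝ} (hT : 0 ≤ T) {P : E →ₗ[ℂ] E}
    (hP : ∀ X, IsLinearSolution A X → P (X 0) = X T) {X F : ℝ → E} (hF : Continuous F)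
    (hX : ∀ t, HasDerivAt X (A t (X t) + F t) t) {μ : ℂ} (hμ : X T = μ • X 0) {ε : ℝ}
    (hε : Real.exp (B * T) * ε ≤ 1 / 2) {t₀ : ℝ} (ht₀ : t₀ ∈ Set.Icc 0 T) (hXt : X t₀ ≠ 0)
    (hI : ∫ s in (0 : ℝ)..T, ‖F s‖ ≤ ε * ‖X t₀‖) :
    X 0 ≠ 0 ∧ ‖P (X 0) - μ • X 0‖ ≤ 2 * Real.exp (B * T) ^ 2 * ε * ‖X 0‖ := by
  obtain ⟨Y, hY0, hY⟩ := exists_isLinearSolution hA hB (X 0)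
  have hZ : IsLinearSolution A (fun _ => (0 : E)) := fun t => by
    simpa using hasDerivAt_const t (0 : E)
  have h1 := norm_sub_le_of_linear_perturbation hB1 hB hF hX hY hY0.symm ht₀
  have h2 := norm_sub_le_of_linear_perturbation hB1 hB hF hX hY hY0.symm (t := T) ⟨hT, le_rfl⟩
  have h3 := norm_sub_le_of_linear_perturbation (F := fun _ => 0) hB1 hB continuous_const
    (fun t => by simpa using hY t) hZ (T := T) (t := t₀)
  have hYle : ‖Y t₀‖ ≤ Real.exp (B * T) * ‖X 0‖ := by
    have := norm_le_gronwallBound_of_norm_deriv_right_le (f := Y)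
      (f' := fun t => A t (Y t)) (δ := ‖X 0‖) (K := B) (ε := 0) (a := 0) (b := T)
      (fun t _ => (hY t).continuousAt.continuousWithinAt)
      (fun t _ => (hY t).hasDerivWithinAt) (by rw [hY0])
      (fun t _ => by
        simpa using (A t).le_of_opNorm_le (hB t) _) t₀ ht₀
    rw [gronwallBound_ε0, sub_zero] at this
    refine this.trans ?_
    rw [mul_comm]
    gcongr
    exact ht₀.2
  have hexp := Real.exp_pos (B * T)
  have hX0 : ‖X t₀‖ ≤ 2 * Real.exp (B * T) * ‖X 0‖ := by
    have h4 := norm_add_le (X t₀ - Y t₀) (Y t₀)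
    rw [sub_add_cancel] at h4
    have h5 : Real.exp (B * T) * ∫ s in (0 : ℝ)..T, ‖F s‖ ≤ 1 / 2 * ‖X t₀‖ :=
      calc _ ≤ Real.exp (B * T) * (ε * ‖X t₀‖) := by gcongr
        _ = (Real.exp (B * T) * ε) * ‖X t₀‖ := by ring
        _ ≤ _ := by gcongr
    linarith
  have hε0 : 0 ≤ ε := by
    have h6 : 0 ≤ ∫ s in (0 : ℝ)..T, ‖F s‖ :=
      intervalIntegral.integral_nonneg hT fun _ _ => norm_nonneg _
    exact nonneg_of_mul_nonneg_left (h6.trans hI) (norm_pos_iff.2 hXt)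
  refine ⟨fun h => ?_, ?_⟩
  · rw [h, norm_zero, mul_zero] at hX0
    exact hXt (norm_le_zero_iff.1 hX0)
  · have h7 : P (X 0) = Y T := by rw [← hY0, hP Y hY]
    rw [h7, ← hμ, norm_sub_rev]
    calc _ ≤ _ := h2
      _ ≤ Real.exp (B * T) * (ε * (2 * Real.exp (B * T) * ‖X 0‖)) := by
        gcongr
        exact hI.trans (by gcongr)
      _ = _ := by ring

lemma norm_monodromy_le [CompleteSpace E] {A : ℝ → E →L[ℂ] E} (hA : Continuous A) {B : ℝ}
    (hB : ∀ t, ‖A t‖ ≤ B) {T : ℝ} (hT : 0 ≤ T) {P : E →ₗ[ℂ] E}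
    (hP : ∀ X, IsLinearSolution A X → P (X 0) = X T) (x : E) :
    ‖P x‖ ≤ Real.exp (B * T) * ‖x‖ := by
  obtain ⟨Y, hY0, hY⟩ := exists_isLinearSolution hA hB x
  have := norm_le_gronwallBound_of_norm_deriv_right_le (f := Y)
      (f' := fun t => A t (Y t)) (δ := ‖x‖) (K := B) (ε := 0) (a := 0) (b := T)
      (fun t _ => (hY t).continuousAt.continuousWithinAt)
      (fun t _ => (hY t).hasDerivWithinAt) (by rw [hY0])
      (fun t _ => by
        simpa using (A t).le_of_opNorm_le (hB t) _) T ⟨hT, le_rfl⟩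
  rw [gronwallBound_ε0, sub_zero, ← hP Y hY, hY0] at this
  linarith

/-- An eigenvector of the monodromy map belongs to a Floquet solution. -/
lemma exists_floquet_solution [CompleteSpace E] {A : ℝ → E →L[ℂ] E} (hA : Continuous A) {B : ℝ}
    (hB : ∀ t, ‖A t‖ ≤ B) {T : ℝ} (hper : Function.Periodic A T) {P : E →ₗ[ℂ] E}
    (hP : ∀ X, IsLinearSolution A X → P (X 0) = X T) {ν : ℂ}
    (hν : Module.End.HasEigenvalue P ν) :
    ν ≠ 0 ∧ ∃ X, IsLinearSolution A X ∧ X 0 ≠ 0 ∧ ∀ t, X (t + T) = ν • X t := by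
  obtain ⟨x, hx⟩ := hν.exists_hasEigenvector
  obtain ⟨X, hX0, hX⟩ := exists_isLinearSolution hA hB x
  have h1 : X T = ν • x := by rw [← hP X hX, hX0, hx.apply_eq_smul]
  have h2 : (fun t => X (t + T)) = fun t => ν • X t :=
    IsLinearSolution.unique hB (hX.comp_add hper) (hX.smul ν) (t₀ := 0) (by simp [h1, hX0])
  refine ⟨fun h => ?_, X, hX, by rw [hX0]; exact hx.2, fun t => congrFun h2 t⟩
  have hZ : IsLinearSolution A (fun _ => (0 : E)) := fun t => by
    simpa using hasDerivAt_const t (0 : E)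
  have h3 : X = fun _ => 0 := IsLinearSolution.unique hB hX hZ (t₀ := T) (by rw [h1, h, zero_smul])
  apply hx.2
  rw [← hX0, h3]

end ODE

/-! ### Perturbation of eigenvalues -/

section Eigenvalue

variable {E : Type*} [NormedAddCommGroup E] [NormedSpace ℂ E]

/-- An approximate eigenvector of `P` is an approximate eigenvector of polynomials in `P`. -/
lemma norm_aeval_prod_sub_le {P : E →ₗ[ℂ] E} {R : ℝ} (hR : 0 ≤ R) (hP : ∀ x, ‖P x‖ ≤ R * ‖x‖)
    {μ : ℂ} (hμ : ‖μ‖ ≤ R) {x : E} {ε : ℝ} (hε : 0 ≤ ε) (hx : ‖P x - μ • x‖ ≤ ε * ‖x‖)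
    (s : Multiset ℂ) (hs : ∀ ν ∈ s, ‖ν‖ ≤ R) :
    ‖Polynomial.aeval P (s.map fun ν => Polynomial.X - Polynomial.C ν).prod x -
      (s.map fun ν => μ - ν).prod • x‖ ≤ s.card * (2 * R + 1) ^ s.card * ε * ‖x‖ ∧
    ‖(s.map fun ν => μ - ν).prod‖ ≤ (2 * R + 1) ^ s.card := by
  induction s using Multiset.induction_on with
  | empty => simp
  | cons ν s ih =>
    obtain ⟨h1, h2⟩ := ih fun ν' h => hs ν' (by simp [h])
    have hν : ‖ν‖ ≤ R := hs ν (by simp)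
    have hμν : ‖μ - ν‖ ≤ 2 * R + 1 := (norm_sub_le _ _).trans (by linarith)
    simp only [Multiset.map_cons, Multiset.prod_cons, Multiset.card_cons]
    constructor
    · set y := Polynomial.aeval P (s.map fun ν => Polynomial.X - Polynomial.C ν).prod x
      set π := (s.map fun ν => μ - ν).prod
      have e : Polynomial.aeval P ((Polynomial.X - Polynomial.C ν) *
          (s.map fun ν => Polynomial.X - Polynomial.C ν).prod) x - ((μ - ν) * π) • x =
          (P (y - π • x) - ν • (y - π • x)) + π • (P x - μ • x) := by
        rw [map_mul, Module.End.mul_apply]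
        simp only [map_sub, Polynomial.aeval_X, Polynomial.aeval_C, LinearMap.sub_apply,
          Module.algebraMap_end_apply, map_smul]
        change P y - ν • y - _ = _
        module
      rw [e]
      have h3 : ‖P (y - π • x) - ν • (y - π • x)‖ ≤ 2 * R * ‖y - π • x‖ := by
        refine (norm_sub_le _ _).trans ?_
        rw [norm_smul]
        nlinarith [hP (y - π • x), norm_nonneg (y - π • x)]
      have h4 : ‖π • (P x - μ • x)‖ ≤ (2 * R + 1) ^ s.card * (ε * ‖x‖) := by
        rw [norm_smul]
        gcongr
      have h5 : 2 * R * ‖y - π • x‖ ≤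
          (2 * R + 1) * (s.card * (2 * R + 1) ^ s.card * ε * ‖x‖) := by
        gcongr
        linarith
      have h6 : (2 * R + 1) ^ s.card * (ε * ‖x‖) ≤
          (2 * R + 1) * ((2 * R + 1) ^ s.card * (ε * ‖x‖)) :=
        le_mul_of_one_le_left (by positivity) (by linarith)
      refine (norm_add_le _ _).trans ?_
      push_cast
      calc _ ≤ (2 * R + 1) * (s.card * (2 * R + 1) ^ s.card * ε * ‖x‖) +
            (2 * R + 1) * ((2 * R + 1) ^ s.card * (ε * ‖x‖)) := by linarith
        _ = _ := by ring
    · rw [norm_mul, pow_succ, mul_comm]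
      gcongr

/-- If `μ` is almost an eigenvalue of `P`, then it is close to an eigenvalue: by the
Cayley-Hamilton theorem, `∏ (μ - ν)` over the eigenvalues `ν` is small. -/
lemma exists_hasEigenvalue_near [FiniteDimensional ℂ E] {P : E →ₗ[ℂ] E} {R : ℝ} (hR : 0 ≤ R)
    (hP : ∀ x, ‖P x‖ ≤ R * ‖x‖) {μ : ℂ} (hμ : ‖μ‖ ≤ R) {x : E} (hx0 : x ≠ 0) {ε : ℝ}
    (hε : 0 ≤ ε) (hx : ‖P x - μ • x‖ ≤ ε * ‖x‖) :
    ∃ ν, Module.End.HasEigenvalue P ν ∧ ‖μ - ν‖ ^ Module.finrank ℂ E ≤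
      Module.finrank ℂ E * (2 * R + 1) ^ Module.finrank ℂ E * ε := by
  set s := P.charpoly.roots
  have hsplit : P.charpoly.Splits := IsAlgClosed.splits _
  have hcard : s.card = Module.finrank ℂ E := by
    rw [← P.charpoly_natDegree, hsplit.natDegree_eq_card_roots]
  have hprod : P.charpoly = (s.map fun ν => Polynomial.X - Polynomial.C ν).prod :=
    hsplit.eq_prod_roots_of_monic P.charpoly_monic
  have heig : ∀ ν ∈ s, Module.End.HasEigenvalue P ν := fun ν hν => by
    rw [Module.End.hasEigenvalue_iff_isRoot_charpoly]
    exact (Polynomial.mem_roots'.1 hν).2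
  have hs : ∀ ν ∈ s, ‖ν‖ ≤ R := fun ν hν => by
    obtain ⟨y, hy⟩ := (heig ν hν).exists_hasEigenvector
    have h1 := hP y
    rw [hy.apply_eq_smul, norm_smul] at h1
    exact le_of_mul_le_mul_right h1 (norm_pos_iff.2 hy.2)
  obtain ⟨h1, -⟩ := norm_aeval_prod_sub_le hR hP hμ hε hx s hs
  rw [← hprod, LinearMap.aeval_self_charpoly, LinearMap.zero_apply, zero_sub, norm_neg, norm_smul,
    hcard] at h1
  have h2 : ‖(s.map fun ν => μ - ν).prod‖ ≤
      Module.finrank ℂ E * (2 * R + 1) ^ Module.finrank ℂ E * ε :=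
    le_of_mul_le_mul_right h1 (norm_pos_iff.2 hx0)
  by_contra hcon
  push Not at hcon
  have hpos : 0 < Module.finrank ℂ E := by
    have : Nontrivial E := ⟨⟨x, 0, hx0⟩⟩
    exact Module.finrank_pos
  have hK : 0 ≤ Module.finrank ℂ E * (2 * R + 1) ^ Module.finrank ℂ E * ε := by positivity
  generalize (Module.finrank ℂ E * (2 * R + 1) ^ Module.finrank ℂ E * ε : ℝ) = K at *
  generalize Module.finrank ℂ E = d at *
  have key : ∀ t : Multiset ℂ, (∀ ν ∈ t, K < ‖μ - ν‖ ^ d) → t ≠ 0 →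
      K ^ t.card < ‖(t.map fun ν => μ - ν).prod‖ ^ d := by
    intro t
    induction t using Multiset.induction_on with
    | empty => simp
    | cons ν t ih =>
      intro ht _
      have hν := ht ν (by simp)
      rw [Multiset.card_cons, pow_succ, Multiset.map_cons, Multiset.prod_cons, norm_mul, mul_pow,
        mul_comm]
      rcases eq_or_ne t 0 with rfl | h0
      · simpa using hν
      · exact mul_lt_mul'' hν (ih (fun ν' h => ht ν' (by simp [h])) h0) hK (by positivity)
  have h3 := key s (fun ν hν => hcon ν (heig ν hν)) (by
    rw [← Multiset.card_pos, hcard]; exact hpos)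
  rw [hcard] at h3
  exact absurd (lt_of_pow_lt_pow_left₀ d (norm_nonneg _) h3) (not_lt.2 h2)

end Eigenvalue


/-! ### Second order equations on an interval -/

/-- A function with continuous second derivative `h` in the open interval is the integral of its
Taylor expansion at the left end point. -/
lemma exists_deriv_eq_add_integral {g h : ℝ → ℂ} {a b : ℝ} (hab : a < b)
    (hg : ContinuousOn g (Set.Icc a b))
    (hh : Continuous h) (H : ∀ x ∈ Set.Ioo a b, HasSecondDerivAt g (h x) x) :
    ∃ d : ℂ, (∀ x ∈ Set.Ioo a b, deriv g x = d + ∫ t in a..x, h t) ∧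
      ∀ x ∈ Set.Icc a b, g x = g a + d * (x - a) + ∫ t in a..x, ∫ s in a..t, h s := by
  have hH1 : ∀ x, HasDerivAt (fun x => ∫ t in a..x, h t) (h x) x := fun x =>
    (hh.integral_hasStrictDerivAt a x).hasDerivAt
  have hc1 : Continuous fun x => ∫ t in a..x, h t :=
    continuous_iff_continuousAt.2 fun x => (hH1 x).continuousAt
  have hH2 : ∀ x, HasDerivAt (fun x => ∫ t in a..x, ∫ s in a..t, h s) (∫ t in a..x, h t) x :=
    fun x => (hc1.integral_hasStrictDerivAt a x).hasDerivAt
  obtain ⟨d, hd⟩ := isOpen_Ioo.exists_is_const_of_deriv_eq_zero (s := Set.Ioo a b)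
    (f := fun x => deriv g x - ∫ t in a..x, h t) isPreconnected_Ioo
    (fun x hx => ((H x hx).2.sub (hH1 x)).differentiableAt.differentiableWithinAt)
    (fun x hx => by
      have := ((H x hx).2.sub (hH1 x)).deriv
      rw [sub_self] at this
      exact this)
  have hd' : ∀ x ∈ Set.Ioo a b, deriv g x = d + ∫ t in a..x, h t := fun x hx => by
    rw [← hd x hx]; ring
  have hder : ∀ x ∈ Set.Ioo a b, HasDerivAt
      (fun x : ℝ => g x - d * (x - a) - ∫ t in a..x, ∫ s in a..t, h s) 0 x := fun x hx => by
    have h1 := (H x hx).1.hasDerivAt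
    have h2 : HasDerivAt (fun x : ℝ => d * ((x : ℂ) - a)) d x := by
      simpa using (((hasDerivAt_id x).ofReal_comp.sub_const (a : ℂ)).const_mul d)
    refine ((h1.sub h2).sub (hH2 x)).congr_deriv ?_
    rw [hd' x hx]
    ring
  obtain ⟨e, he⟩ := isOpen_Ioo.exists_is_const_of_deriv_eq_zero (s := Set.Ioo a b)
    (f := fun x : ℝ => g x - d * (x - a) - ∫ t in a..x, ∫ s in a..t, h s) isPreconnected_Ioo
    (fun x hx => (hder x hx).differentiableAt.differentiableWithinAt)
    (fun x hx => (hder x hx).deriv)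
  have hc2 : Continuous fun x => ∫ t in a..x, ∫ s in a..t, h s :=
    continuous_iff_continuousAt.2 fun x => (hH2 x).continuousAt
  have he' : Set.EqOn (fun x : ℝ => g x - d * (x - a) - ∫ t in a..x, ∫ s in a..t, h s)
      (fun _ => e) (Set.Icc a b) := by
    refine Set.EqOn.of_subset_closure (s := Set.Ioo a b) he ?_ continuousOn_const
      Set.Ioo_subset_Icc_self (by rw [closure_Ioo hab.ne])
    exact (hg.sub (by fun_prop)).sub hc2.continuousOn
  refine ⟨d, hd', fun x hx => ?_⟩
  have h1 := he' hx
  have h2 := he' (Set.left_mem_Icc.2 hab.le)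
  simp only [sub_self, mul_zero, sub_zero, intervalIntegral.integral_same] at h1 h2
  rw [h2, ← h1]
  ring

lemma norm_integral_le_integral_norm_of_mem {h : ℝ → ℂ} (hh : Continuous h) {a b x : ℝ}
    (hx : x ∈ Set.Icc a b) : ‖∫ t in a..x, h t‖ ≤ ∫ t in a..b, ‖h t‖ := by
  refine (intervalIntegral.norm_integral_le_integral_norm hx.1).trans ?_
  exact intervalIntegral.integral_mono_interval le_rfl hx.1 hx.2
      (Eventually.of_forall fun _ => norm_nonneg _) (hh.norm.intervalIntegrable _ _)

lemma norm_integral_integral_le {h : ℝ → ℂ} (hh : Continuous h) {a b x : ℝ}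
    (hx : x ∈ Set.Icc a b) :
    ‖∫ t in a..x, ∫ s in a..t, h s‖ ≤ (b - a) * ∫ t in a..b, ‖h t‖ := by
  have h1 := intervalIntegral.norm_integral_le_of_norm_le_const (a := a) (b := x)
    (f := fun t => ∫ s in a..t, h s) (C := ∫ t in a..b, ‖h t‖) fun t ht => by
      rw [Set.uIoc_of_le hx.1] at ht
      exact norm_integral_le_integral_norm_of_mem hh ⟨ht.1.le, ht.2.trans hx.2⟩
  refine h1.trans ?_
  rw [abs_of_nonneg (by linarith [hx.1]), mul_comm]
  gcongr
  · exact intervalIntegral.integral_nonneg (hx.1.trans hx.2) fun _ _ => norm_nonneg _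
  · exact hx.2

/-- The coefficients of a linear function are controlled by its `L¹` norm. -/
lemma norm_linear_le_integral (A d : ℂ) {a b : ℝ} (hab : a < b) :
    ‖A‖ ≤ 4 / (b - a) * ∫ x in a..b, ‖A + d * (x - a)‖ ∧
    ‖d‖ ≤ 6 / (b - a) ^ 2 * ∫ x in a..b, ‖A + d * (x - a)‖ := by
  have hl : 0 < b - a := sub_pos.2 hab
  have hlc : ((b : ℂ) - a) ≠ 0 := by exact_mod_cast hl.ne'
  have hlin : ∀ x : ℝ, HasDerivAt (fun x : ℝ => ((x : ℂ) - a)) 1 x := fun x => by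
    simpa using ((hasDerivAt_id x).ofReal_comp.sub_const (a : ℂ))
  have key : ∀ (w0 w1 K : ℝ) (R : ℂ), (∀ x ∈ Set.Icc a b, |w0 + w1 * (x - a)| ≤ K) →
      A * w0 * (b - a) + (A * w1 + d * w0) / 2 * (b - a) ^ 2 + d * w1 / 3 * (b - a) ^ 3 = R →
      ‖R‖ ≤ K * ∫ x in a..b, ‖A + d * (x - a)‖ := by
    intro w0 w1 K R hK hR
    have h1 : ∫ x in a..b, (A + d * (x - a)) * ((w0 : ℂ) + w1 * (x - a)) = R := by
      rw [intervalIntegral.integral_eq_sub_of_hasDerivAt (f := fun x : ℝ =>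
        A * w0 * ((x : ℂ) - a) + (A * w1 + d * w0) / 2 * ((x : ℂ) - a) ^ 2 +
          d * w1 / 3 * ((x : ℂ) - a) ^ 3)]
      · rw [← hR]
        simp
      · intro x _
        refine ((((hlin x).const_mul _).add (((hlin x).pow 2).const_mul _)).add
          (((hlin x).pow 3).const_mul _)).congr_deriv ?_
        push_cast
        ring
      · exact Continuous.intervalIntegrable (by fun_prop) _ _
    rw [← h1, ← intervalIntegral.integral_const_mul]
    refine intervalIntegral.norm_integral_le_of_norm_le hab.le
      (Eventually.of_forall fun x hx => ?_) (Continuous.intervalIntegrable (by fun_prop) _ _)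
    rw [norm_mul, mul_comm]
    gcongr
    have := hK x ⟨hx.1.le, hx.2⟩
    rw [← Real.norm_eq_abs, ← Complex.norm_real] at this
    simpa using this
  constructor
  · refine key (4 / (b - a)) (-6 / (b - a) ^ 2) _ A (fun x hx => ?_) ?_
    · have e : 4 / (b - a) + -6 / (b - a) ^ 2 * (x - a) =
        (4 * (b - a) - 6 * (x - a)) / (b - a) ^ 2 := by field_simp; ring
      rw [e, abs_div, abs_of_pos (by positivity : 0 < (b - a) ^ 2), div_le_div_iff₀ (by positivity)
        hl]
      have : |4 * (b - a) - 6 * (x - a)| ≤ 4 * (b - a) := by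
        rw [abs_le]; constructor <;> linarith [hx.1, hx.2]
      nlinarith
    · push_cast
      field_simp
      ring
  · refine key (-6 / (b - a) ^ 2) (12 / (b - a) ^ 3) _ d (fun x hx => ?_) ?_
    · have e : -6 / (b - a) ^ 2 + 12 / (b - a) ^ 3 * (x - a) =
        (-6 * (b - a) + 12 * (x - a)) / (b - a) ^ 3 := by field_simp
      rw [e, abs_div, abs_of_pos (by positivity : 0 < (b - a) ^ 3), div_le_div_iff₀ (by positivity)
        (by positivity)]
      have : |-6 * (b - a) + 12 * (x - a)| ≤ 6 * (b - a) := by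
        rw [abs_le]; constructor <;> linarith [hx.1, hx.2]
      calc _ ≤ 6 * (b - a) * (b - a) ^ 2 := by gcongr
        _ = _ := by ring
    · push_cast
      field_simp
      ring

lemma sq_integral_le_mul_integral_sq {f : ℝ → ℝ} (hf : Continuous f) {a b : ℝ} (hab : a < b) :
    (∫ x in a..b, f x) ^ 2 ≤ (b - a) * ∫ x in a..b, f x ^ 2 := by
  have hl : 0 < b - a := sub_pos.2 hab
  set m := (∫ x in a..b, f x) / (b - a) with hm
  have h0 : 0 ≤ ∫ x in a..b, (f x - m) ^ 2 :=
    intervalIntegral.integral_nonneg hab.le fun _ _ => sq_nonneg _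
  have h1 : ∫ x in a..b, (f x - m) ^ 2 =
      (∫ x in a..b, f x ^ 2) - 2 * m * (∫ x in a..b, f x) + m ^ 2 * (b - a) := by
    have : ∀ x, (f x - m) ^ 2 = f x ^ 2 - 2 * m * f x + m ^ 2 := fun x => by ring
    simp_rw [this]
    rw [intervalIntegral.integral_add (Continuous.intervalIntegrable (by fun_prop) _ _)
      (Continuous.intervalIntegrable (by fun_prop) _ _),
      intervalIntegral.integral_sub (Continuous.intervalIntegrable (by fun_prop) _ _)
      (Continuous.intervalIntegrable (by fun_prop) _ _), intervalIntegral.integral_const_mul,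
      intervalIntegral.integral_const]
    simp
    ring
  have h2 : ∫ x in a..b, f x = m * (b - a) := by rw [hm]; field_simp
  rw [h1, h2] at h0
  rw [h2]
  nlinarith

/-! ### The `L²` norm of continuous functions on an interval -/

section IntervalL2

open MeasureTheory

/-- The Hilbert space `L²(a, b)`. -/
def IntervalL2 (a b : ℝ) : Type := Lp ℂ 2 (volume.restrict (Set.Ioc a b))

noncomputable instance (a b : ℝ) : NormedAddCommGroup (IntervalL2 a b) :=
  inferInstanceAs (NormedAddCommGroup (Lp ℂ 2 (volume.restrict (Set.Ioc a b))))

noncomputable instance (a b : ℝ) : InnerProductSpace ℂ (IntervalL2 a b) :=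
  inferInstanceAs (InnerProductSpace ℂ (Lp ℂ 2 (volume.restrict (Set.Ioc a b))))

lemma memLp_of_continuous (a b : ℝ) (f : C(ℝ, ℂ)) :
    MemLp f 2 (volume.restrict (Set.Ioc a b)) := by
  obtain ⟨K, hK⟩ := (isCompact_Icc (a := a) (b := b)).exists_bound_of_continuousOn
    f.continuous.continuousOn
  refine MemLp.of_bound f.continuous.aestronglyMeasurable K ?_
  refine (ae_restrict_iff' measurableSet_Ioc).2 (Eventually.of_forall fun x hx => ?_)
  exact hK x (Set.Ioc_subset_Icc_self hx)

/-- The class in `L²(a, b)` of a continuous function. -/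
noncomputable def toIntervalL2 (a b : ℝ) : C(ℝ, ℂ) →ₗ[ℂ] IntervalL2 a b where
  toFun f := (memLp_of_continuous a b f).toLp f
  map_add' f g := MemLp.toLp_add (memLp_of_continuous a b f) (memLp_of_continuous a b g)
  map_smul' c f := MemLp.toLp_const_smul c (memLp_of_continuous a b f)

lemma norm_toIntervalL2_sq {a b : ℝ} (hab : a ≤ b) (f : C(ℝ, ℂ)) :
    ‖toIntervalL2 a b f‖ ^ 2 = ∫ x in a..b, ‖f x‖ ^ 2 := by
  set F : Lp ℂ 2 (volume.restrict (Set.Ioc a b)) := (memLp_of_continuous a b f).toLp f with hF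
  change ‖F‖ ^ 2 = _
  have h1 := inner_self_eq_norm_sq_to_K (𝕜 := ℂ) F
  rw [L2.inner_def] at h1
  have h2 : ∫ x in Set.Ioc a b, inner ℂ (F x) (F x) =
      ∫ x in Set.Ioc a b, ((‖f x‖ ^ 2 : ℝ) : ℂ) := by
    refine integral_congr_ae ?_
    filter_upwards [(memLp_of_continuous a b f).coeFn_toLp] with x hx
    have : F x = f x := hx
    rw [this, inner_self_eq_norm_sq_to_K]
    push_cast
    rfl
  rw [h2, integral_complex_ofReal] at h1
  rw [intervalIntegral.integral_of_le hab]
  exact (Complex.ofReal_injective (h1.trans (by simp))).symm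

lemma integral_norm_le_norm_toIntervalL2 {a b : ℝ} (hab : a < b) (f : C(ℝ, ℂ)) :
    ∫ x in a..b, ‖f x‖ ≤ √(b - a) * ‖toIntervalL2 a b f‖ := by
  have hl : 0 < b - a := sub_pos.2 hab
  refine le_of_sq_le_sq ?_ (by positivity)
  rw [mul_pow, norm_toIntervalL2_sq hab.le, Real.sq_sqrt hl.le]
  exact sq_integral_le_mul_integral_sq (by fun_prop) hab

lemma norm_toIntervalL2_le {a b : ℝ} (hab : a ≤ b) (f : C(ℝ, ℂ)) {K : ℝ} (hK : 0 ≤ K)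
    (hf : ∀ x ∈ Set.Icc a b, ‖f x‖ ≤ K) : ‖toIntervalL2 a b f‖ ≤ √(b - a) * K := by
  refine le_of_sq_le_sq ?_ (by positivity)
  rw [mul_pow, norm_toIntervalL2_sq hab, Real.sq_sqrt (by linarith)]
  have : ∫ x in a..b, ‖f x‖ ^ 2 ≤ ∫ x in a..b, K ^ 2 :=
    intervalIntegral.integral_mono_on hab (Continuous.intervalIntegrable (by fun_prop) _ _)
      (by simp) fun x hx => pow_le_pow_left₀ (norm_nonneg _) (hf x hx) 2
  simpa using this

end IntervalL2


/-! ### The geometry of the chain and the capacitance matrix -/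

namespace Resonators

variable {N : ℕ} (G : Resonators N)

lemma len_pos (i : ℤ) : 0 < G.len i := sub_pos.2 (G.left_lt_right i)

lemma gap_pos (i : ℤ) : 0 < G.gap i := sub_pos.2 (G.right_lt_left i)

lemma left_strictMono : StrictMono G.left :=
  strictMono_int_of_lt_succ fun i => (G.left_lt_right i).trans (G.right_lt_left i)

lemma right_strictMono : StrictMono G.right :=
  strictMono_int_of_lt_succ fun i => (G.right_lt_left i).trans (G.left_lt_right (i + 1))

lemma gap_periodic (i : ℤ) : G.gap (i + N) = G.gap i := by
  unfold gap
  rw [G.right_periodic, show i + (N : ℤ) + 1 = i + 1 + N by ring, G.left_periodic]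
  ring

lemma right_le_left_add (hN : 0 < N) (i : ℤ) : G.right i ≤ G.left i + G.L := by
  rw [← G.left_periodic]
  exact (G.right_lt_left i).le.trans (G.left_strictMono.monotone (by omega))

lemma left_succ_le_right_add (hN : 0 < N) (i : ℤ) : G.left (i + 1) ≤ G.right i + G.L := by
  rw [← G.right_periodic]
  exact (G.left_lt_right (i + 1)).le.trans (G.right_strictMono.monotone (by omega))

end Resonators

/-- The value at the resonator `i + 1` of the `α`-quasiperiodic extension of `y`. -/
noncomputable def nextVal {N : ℕ} (G : Resonators N) (α : ℝ) (y : Fin N → ℂ) (i : Fin N) : ℂ :=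
  if h : (i : ℕ) + 1 < N then y ⟨i + 1, h⟩
  else Complex.exp (Complex.I * α * G.L) * y ⟨0, i.pos⟩

/-- The value at the resonator `i - 1` of the `α`-quasiperiodic extension of `y`. -/
noncomputable def prevVal {N : ℕ} (G : Resonators N) (α : ℝ) (y : Fin N → ℂ) (i : Fin N) : ℂ :=
  if (i : ℕ) = 0 then Complex.exp (-(Complex.I * α * G.L)) * y ⟨N - 1, by have := i.pos; omega⟩
  else y ⟨i - 1, by omega⟩

lemma capacitanceMatrix_mulVec {N : ℕ} (G : Resonators N) (α : ℝ) (y : Fin N → ℂ) (i : Fin N) :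
    ∑ j, capacitanceMatrix G α i j * y j =
      (y i - prevVal G α y i) / G.gap (i - 1) + (y i - nextVal G α y i) / G.gap i := by
  have hN := i.pos
  have e1 : ∑ j, (if i = j then 1 / (G.gap (i - 1) : ℂ) + 1 / (G.gap i : ℂ) else 0) * y j =
      (1 / (G.gap (i - 1) : ℂ) + 1 / (G.gap i : ℂ)) * y i := by
    simp [ite_mul]
  have e2 : ∑ j : Fin N, (if (i : ℕ) = j + 1 then 1 / (G.gap j : ℂ) else 0) * y j +
      ∑ j : Fin N, (if (i : ℕ) = 0 ∧ (j : ℕ) + 1 = N then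
        Complex.exp (-(Complex.I * α * G.L)) / (G.gap j : ℂ) else 0) * y j =
      prevVal G α y i / G.gap (i - 1) := by
    unfold prevVal
    split_ifs with h0
    · rw [Finset.sum_eq_zero fun j _ => by rw [if_neg (by omega), zero_mul], zero_add,
        Finset.sum_eq_single ⟨N - 1, by omega⟩]
      · rw [if_pos ⟨h0, by simp only; omega⟩]
        have : G.gap ((i : ℕ) - 1 : ℤ) = G.gap ((N - 1 : ℕ) : ℤ) := by
          rw [← G.gap_periodic]
          congr 1
          omega
        rw [this]
        ring
      · intro j _ hj
        rw [if_neg, zero_mul]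
        rintro ⟨-, h⟩
        exact hj (Fin.ext (by simp only; omega))
      · simp
    · rw [add_comm, Finset.sum_eq_zero fun j _ => by rw [if_neg (by tauto), zero_mul], zero_add,
        Finset.sum_eq_single ⟨i - 1, by omega⟩]
      · rw [if_pos (by simp only; omega)]
        have : ((i - 1 : ℕ) : ℤ) = (i : ℕ) - 1 := by omega
        simp only [this]
        ring
      · intro j _ hj
        rw [if_neg, zero_mul]
        intro h
        exact hj (Fin.ext (by simp only; omega))
      · simp
  have e3 : ∑ j : Fin N, (if (j : ℕ) = i + 1 then 1 / (G.gap i : ℂ) else 0) * y j +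
      ∑ j : Fin N, (if (j : ℕ) = 0 ∧ (i : ℕ) + 1 = N then
        Complex.exp (Complex.I * α * G.L) / (G.gap i : ℂ) else 0) * y j =
      nextVal G α y i / G.gap i := by
    unfold nextVal
    split_ifs with h0
    · rw [add_comm, Finset.sum_eq_zero fun j _ => by rw [if_neg (by omega), zero_mul], zero_add,
        Finset.sum_eq_single ⟨i + 1, h0⟩]
      · rw [if_pos rfl]
        ring
      · intro j _ hj
        rw [if_neg, zero_mul]
        intro h
        exact hj (Fin.ext h)
      · simp
    · rw [Finset.sum_eq_zero fun j _ => by rw [if_neg (by omega), zero_mul], zero_add,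
        Finset.sum_eq_single ⟨0, hN⟩]
      · rw [if_pos ⟨rfl, by omega⟩]
        ring
      · intro j _ hj
        rw [if_neg, zero_mul]
        rintro ⟨h, -⟩
        exact hj (Fin.ext h)
      · simp
  simp only [capacitanceMatrix, sub_mul, Finset.sum_sub_distrib]
  rw [sub_div, sub_div, ← e2, ← e3, e1]
  ring

/-! ### Estimates on gaps and resonators -/

/-- On a gap, a solution of `g'' = -θ g` with small `θ` is almost linear. -/
lemma exists_gap_estimates {a b : ℝ} (hab : a < b) : ∃ K : ℝ, 0 ≤ K ∧
    ∀ (g : C(ℝ, ℂ)) (θ : ℂ), (∀ x ∈ Set.Ioo a b, HasSecondDerivAt g (-θ * g x) x) →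
    ∃ da db : ℂ, Tendsto (deriv g) (𝓝[>] a) (𝓝 da) ∧ Tendsto (deriv g) (𝓝[<] b) (𝓝 db) ∧
      ‖da - (g b - g a) / ((b - a : ℝ) : ℂ)‖ ≤ K * (‖θ‖ * ‖toIntervalL2 a b g‖) ∧
      ‖db - (g b - g a) / ((b - a : ℝ) : ℂ)‖ ≤ K * (‖θ‖ * ‖toIntervalL2 a b g‖) ∧
      ‖g a‖ ≤ K * ((1 + ‖θ‖) * ‖toIntervalL2 a b g‖) ∧
      ‖g b‖ ≤ K * ((1 + ‖θ‖) * ‖toIntervalL2 a b g‖) ∧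
      ‖da‖ ≤ K * ((1 + ‖θ‖) * ‖toIntervalL2 a b g‖) ∧
      ‖db‖ ≤ K * ((1 + ‖θ‖) * ‖toIntervalL2 a b g‖) ∧
      ‖toIntervalL2 a b g‖ ≤ K * (‖g a‖ + ‖g b‖ + ‖θ‖ * ‖toIntervalL2 a b g‖) := by
  have hl : 0 < b - a := sub_pos.2 hab
  set l := b - a with hldef
  set q := √l with hq
  have hq0 : 0 < q := Real.sqrt_pos.2 hl
  set K : ℝ := 2 * q + 2 * q * l + (4 / l) * (q + l ^ 2 * q) + 6 / l ^ 2 * (q + l ^ 2 * q) * (1 + l)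
    + l * q + q + q * (2 * l * q) with hK
  refine ⟨K, by positivity, fun g θ H => ?_⟩
  set m := ‖toIntervalL2 a b g‖ with hm
  have hm0 : 0 ≤ m := norm_nonneg _
  have hθ := norm_nonneg θ
  set h : ℝ → ℂ := fun x => -θ * g x with hh
  have hhc : Continuous h := by fun_prop
  obtain ⟨d, hd1, hd2⟩ := exists_deriv_eq_add_integral hab g.continuous.continuousOn hhc H
  have hL1 : ∫ x in a..b, ‖g x‖ ≤ q * m := integral_norm_le_norm_toIntervalL2 hab g
  have hJ : ∫ x in a..b, ‖h x‖ ≤ q * (‖θ‖ * m) := by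
    simp only [hh, norm_mul, norm_neg]
    rw [intervalIntegral.integral_const_mul]
    nlinarith
  set J := ∫ x in a..b, ‖h x‖ with hJdef
  have hint : ∀ x ∈ Set.Icc a b, ‖∫ t in a..x, h t‖ ≤ J := fun x hx =>
    norm_integral_le_integral_norm_of_mem hhc hx
  have hint2 : ∀ x ∈ Set.Icc a b, ‖∫ t in a..x, ∫ s in a..t, h s‖ ≤ l * J := fun x hx =>
    norm_integral_integral_le hhc hx
  have hbm : b ∈ Set.Icc a b := ⟨hab.le, le_rfl⟩
  have hJ0 : 0 ≤ J := (norm_nonneg _).trans (hint b hbm)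
  have hcont : Continuous fun x => d + ∫ t in a..x, h t :=
    continuous_const.add (continuous_iff_continuousAt.2 fun x =>
      (hhc.integral_hasStrictDerivAt a x).hasDerivAt.continuousAt)
  have hlc : (l : ℂ) ≠ 0 := by exact_mod_cast hl.ne'
  have hda : ‖d - (g b - g a) / ((l : ℝ) : ℂ)‖ ≤ J := by
    have e : d - (g b - g a) / ((l : ℝ) : ℂ) = -(∫ t in a..b, ∫ s in a..t, h s) / l := by
      have e1 : g b - g a = d * l + ∫ t in a..b, ∫ s in a..t, h s := by
        rw [hd2 b hbm, hldef]
        push_cast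
        ring
      rw [e1]
      field_simp
      ring
    rw [e, norm_div, norm_neg, Complex.norm_real, Real.norm_of_nonneg hl.le, div_le_iff₀ hl]
    linarith [hint2 b hbm]
  have hdb : ‖d + (∫ t in a..b, h t) - (g b - g a) / ((l : ℝ) : ℂ)‖ ≤ 2 * J := by
    rw [add_sub_right_comm]
    exact (norm_add_le _ _).trans (by linarith [hint b hbm])
  have hlinL1 : ∫ x in a..b, ‖g a + d * (x - a)‖ ≤ q * m + l ^ 2 * J := by
    have h1 : ∫ x in a..b, ‖g a + d * (x - a)‖ ≤ ∫ x in a..b, (‖g x‖ + l * J) := by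
      refine intervalIntegral.integral_mono_on hab.le (Continuous.intervalIntegrable (by fun_prop) _ _)
        (Continuous.intervalIntegrable (by fun_prop) _ _) fun x hx => ?_
      have e : g a + d * (x - a) = g x - ∫ t in a..x, ∫ s in a..t, h s := by
        rw [hd2 x hx]; ring
      rw [e]
      exact (norm_sub_le _ _).trans (by linarith [hint2 x hx])
    rw [intervalIntegral.integral_add (Continuous.intervalIntegrable (by fun_prop) _ _)
      (by simp), intervalIntegral.integral_const, smul_eq_mul, ← hldef] at h1
    nlinarith
  obtain ⟨hA, hD⟩ := norm_linear_le_integral (g a) d hab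
  rw [← hldef] at hA hD
  have hX : q * m + l ^ 2 * J ≤ (q + l ^ 2 * q) * ((1 + ‖θ‖) * m) := by
    have : l ^ 2 * J ≤ l ^ 2 * (q * (‖θ‖ * m)) := by gcongr
    have : 0 ≤ q * ‖θ‖ * m := by positivity
    have : 0 ≤ l ^ 2 * q * m := by positivity
    nlinarith
  set P := (1 + ‖θ‖) * m with hP
  have hP0 : 0 ≤ P := by positivity
  have hA' : ‖g a‖ ≤ (4 / l) * (q + l ^ 2 * q) * P := by
    refine hA.trans ?_
    rw [mul_assoc]
    gcongr
    exact hlinL1.trans hX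
  have hD' : ‖d‖ ≤ 6 / l ^ 2 * (q + l ^ 2 * q) * P := by
    refine hD.trans ?_
    rw [mul_assoc]
    gcongr
    exact hlinL1.trans hX
  have hJP : J ≤ q * P := by
    refine hJ.trans ?_
    gcongr
    rw [hP]
    gcongr
    linarith
  set c1 := (4 / l) * (q + l ^ 2 * q) with hc1
  set c2 := 6 / l ^ 2 * (q + l ^ 2 * q) with hc2
  have hc1' : 0 ≤ c1 := by positivity
  have hc2' : 0 ≤ c2 := by positivity
  have hlq : 0 ≤ l * q := by positivity
  have hlq2 : 0 ≤ l * c2 := by positivity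
  have hlqq : 0 ≤ q * (2 * l * q) := by positivity
  refine ⟨d, d + ∫ t in a..b, h t, ?_, ?_, ?_, ?_, ?_, ?_, ?_, ?_, ?_⟩
  · have h1 : Tendsto (fun x => d + ∫ t in a..x, h t) (𝓝[>] a) (𝓝 d) := by
      have := (hcont.tendsto a).mono_left (nhdsWithin_le_nhds (s := Set.Ioi a))
      simpa using this
    refine h1.congr' ?_
    filter_upwards [Ioo_mem_nhdsGT hab] with x hx
    rw [hd1 x hx]
  · refine ((hcont.tendsto b).mono_left (nhdsWithin_le_nhds (s := Set.Iio b))).congr' ?_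
    filter_upwards [Ioo_mem_nhdsLT hab] with x hx
    rw [hd1 x hx]
  · refine hda.trans (hJ.trans ?_)
    gcongr
    rw [hK]
    linarith
  · refine hdb.trans ?_
    have h2 : 2 * q * (‖θ‖ * m) ≤ K * (‖θ‖ * m) := by
      gcongr
      rw [hK]
      linarith
    linarith
  · refine hA'.trans ?_
    gcongr
    rw [hK]
    linarith
  · have h1 : ‖g b‖ ≤ ‖g a‖ + ‖d‖ * l + l * J := by
      rw [hd2 b hbm]
      refine (norm_add₃_le).trans ?_
      have e2 : ‖d * ((b : ℂ) - a)‖ = ‖d‖ * l := by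
        rw [norm_mul, ← Complex.ofReal_sub, Complex.norm_real, Real.norm_of_nonneg hl.le]
      rw [e2]
      linarith [hint2 b hbm]
    have h2 : ‖d‖ * l ≤ c2 * P * l := by gcongr
    have h3 : l * J ≤ l * (q * P) := by gcongr
    have h4 : (c1 + c2 * l + l * q) * P ≤ K * P := by
      gcongr
      rw [hK]
      linarith
    linarith
  · refine hD'.trans ?_
    gcongr
    rw [hK]
    linarith
  · have h1 := norm_add_le d (∫ t in a..b, h t)
    have h2 : (c2 + q) * P ≤ K * P := by
      gcongr
      rw [hK]
      linarith
    linarith [hint b hbm]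
  · have hdl : ‖d‖ * l ≤ ‖g a‖ + ‖g b‖ + l * J := by
      have e1 : d * (((b : ℂ) - a)) = g b - g a - ∫ t in a..b, ∫ s in a..t, h s := by
        rw [hd2 b hbm]
        ring
      have e2 : ‖d * ((b : ℂ) - a)‖ = ‖d‖ * l := by
        rw [norm_mul, ← Complex.ofReal_sub, Complex.norm_real, Real.norm_of_nonneg hl.le]
      rw [← e2, e1]
      have := norm_sub_le (g b - g a) (∫ t in a..b, ∫ s in a..t, h s)
      have := norm_sub_le (g b) (g a)
      linarith [hint2 b hbm]
    have h1 : ∀ x ∈ Set.Icc a b, ‖g x‖ ≤ 2 * (‖g a‖ + ‖g b‖) + 2 * l * J := fun x hx => by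
      rw [hd2 x hx]
      refine (norm_add₃_le).trans ?_
      have e2 : ‖d * ((x : ℂ) - a)‖ ≤ ‖d‖ * l := by
        rw [norm_mul, ← Complex.ofReal_sub, Complex.norm_real,
          Real.norm_of_nonneg (by linarith [hx.1])]
        gcongr
        linarith [hx.2]
      linarith [hint2 x hx, norm_nonneg (g b)]
    have h2 := norm_toIntervalL2_le hab.le g (by positivity) h1
    rw [← hldef, ← hq, ← hm] at h2
    have h3 : 0 ≤ ‖g a‖ + ‖g b‖ := by positivity
    have h4 : 2 * q * (‖g a‖ + ‖g b‖) ≤ K * (‖g a‖ + ‖g b‖) := by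
      gcongr
      rw [hK]
      linarith
    have h5 : q * (2 * l * q) * (‖θ‖ * m) ≤ K * (‖θ‖ * m) := by
      gcongr
      rw [hK]
      linarith
    have h6 : q * (2 * l * J) ≤ q * (2 * l * (q * (‖θ‖ * m))) := by gcongr
    linarith

/-- On a resonator, a function with small second derivative and small slope at one end point is
almost constant. -/
lemma resonator_estimates {u h : ℝ → ℂ} {a b : ℝ} (hab : a < b) (hu : Continuous u)
    (hh : Continuous h) (H : ∀ x ∈ Set.Ioo a b, HasSecondDerivAt u (h x) x) {da db : ℂ}
    (hda : Tendsto (deriv u) (𝓝[>] a) (𝓝 da)) (hdb : Tendsto (deriv u) (𝓝[<] b) (𝓝 db)) :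
    db - da = ∫ x in a..b, h x ∧
    ∀ x ∈ Set.Icc a b, ‖u x - (1 / ((b - a : ℝ) : ℂ)) * ∫ t in a..b, u t‖ ≤
      2 * (b - a) * (‖da‖ + ∫ t in a..b, ‖h t‖) := by
  have hl : 0 < b - a := sub_pos.2 hab
  obtain ⟨d, hd1, hd2⟩ := exists_deriv_eq_add_integral hab hu.continuousOn hh H
  have hcont : Continuous fun x => d + ∫ t in a..x, h t :=
    continuous_const.add (continuous_iff_continuousAt.2 fun x =>
      (hh.integral_hasStrictDerivAt a x).hasDerivAt.continuousAt)
  have e1 : da = d := by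
    refine tendsto_nhds_unique hda ?_
    have h1 : Tendsto (fun x => d + ∫ t in a..x, h t) (𝓝[>] a) (𝓝 d) := by
      have := (hcont.tendsto a).mono_left (nhdsWithin_le_nhds (s := Set.Ioi a))
      simpa using this
    refine h1.congr' ?_
    filter_upwards [Ioo_mem_nhdsGT hab] with x hx
    rw [hd1 x hx]
  have e2 : db = d + ∫ t in a..b, h t := by
    refine tendsto_nhds_unique hdb ?_
    refine ((hcont.tendsto b).mono_left (nhdsWithin_le_nhds (s := Set.Iio b))).congr' ?_
    filter_upwards [Ioo_mem_nhdsLT hab] with x hx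
    rw [hd1 x hx]
  refine ⟨by rw [e1, e2]; ring, fun x hx => ?_⟩
  set J := ∫ t in a..b, ‖h t‖
  have hnear : ∀ x ∈ Set.Icc a b, ‖u x - u a‖ ≤ (b - a) * (‖da‖ + J) := fun x hx => by
    rw [hd2 x hx, add_assoc, add_sub_cancel_left, e1]
    refine (norm_add_le _ _).trans ?_
    have h2 : ‖d * ((x : ℂ) - a)‖ ≤ ‖d‖ * (b - a) := by
      rw [norm_mul, ← Complex.ofReal_sub, Complex.norm_real,
        Real.norm_of_nonneg (by linarith [hx.1])]
      gcongr
      exact hx.2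
    linarith [norm_integral_integral_le hh hx]
  have hlc : ((b - a : ℝ) : ℂ) ≠ 0 := by exact_mod_cast hl.ne'
  have e3 : u x - (1 / ((b - a : ℝ) : ℂ)) * ∫ t in a..b, u t =
      (u x - u a) - (1 / ((b - a : ℝ) : ℂ)) * ∫ t in a..b, (u t - u a) := by
    rw [intervalIntegral.integral_sub (hu.intervalIntegrable _ _) (by simp),
      intervalIntegral.integral_const, Complex.real_smul]
    field_simp
    ring
  have h4 := intervalIntegral.norm_integral_le_of_norm_le_const (a := a) (b := b)
    (f := fun t => u t - u a) (C := (b - a) * (‖da‖ + J)) fun t ht => by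
      rw [Set.uIoc_of_le hab.le] at ht
      exact hnear t ⟨ht.1.le, ht.2⟩
  rw [abs_of_pos hl] at h4
  rw [e3]
  refine (norm_sub_le _ _).trans ?_
  rw [norm_mul, norm_div, norm_one, Complex.norm_real, Real.norm_of_nonneg hl.le]
  have h5 : 1 / (b - a) * ‖∫ t in a..b, (u t - u a)‖ ≤ (b - a) * (‖da‖ + J) := by
    rw [one_div, inv_mul_le_iff₀ hl]
    linarith
  linarith [hnear x hx]


/-! ### The harmonics of a Bloch mode -/

lemma norm_phase {N : ℕ} (G : Resonators N) (α : ℝ) :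
    ‖Complex.exp (Complex.I * α * G.L)‖ = 1 ∧ ‖Complex.exp (-(Complex.I * α * G.L))‖ = 1 := by
  constructor <;> rw [Complex.norm_exp] <;> simp

lemma norm_nextVal_le {N : ℕ} (G : Resonators N) (α : ℝ) (y : Fin N → ℂ) (i : Fin N) :
    ‖nextVal G α y i‖ ≤ ∑ j, ‖y j‖ := by
  unfold nextVal
  split_ifs
  · exact Finset.single_le_sum (f := fun j => ‖y j‖) (fun _ _ => norm_nonneg _)
      (Finset.mem_univ _)
  · rw [norm_mul, (norm_phase G α).1, one_mul]
    exact Finset.single_le_sum (f := fun j => ‖y j‖) (fun _ _ => norm_nonneg _)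
      (Finset.mem_univ _)

lemma norm_prevVal_le {N : ℕ} (G : Resonators N) (α : ℝ) (y : Fin N → ℂ) (i : Fin N) :
    ‖prevVal G α y i‖ ≤ ∑ j, ‖y j‖ := by
  unfold prevVal
  split_ifs
  · rw [norm_mul, (norm_phase G α).2, one_mul]
    exact Finset.single_le_sum (f := fun j => ‖y j‖) (fun _ _ => norm_nonneg _)
      (Finset.mem_univ _)
  · exact Finset.single_le_sum (f := fun j => ‖y j‖) (fun _ _ => norm_nonneg _)
      (Finset.mem_univ _)

lemma nextVal_sub {N : ℕ} (G : Resonators N) (α : ℝ) (y z : Fin N → ℂ) (i : Fin N) :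
    nextVal G α (fun j => y j - z j) i = nextVal G α y i - nextVal G α z i := by
  unfold nextVal
  split_ifs <;> ring

lemma prevVal_sub {N : ℕ} (G : Resonators N) (α : ℝ) (y z : Fin N → ℂ) (i : Fin N) :
    prevVal G α (fun j => y j - z j) i = prevVal G α y i - prevVal G α z i := by
  unfold prevVal
  split_ifs <;> ring

section Quasiperiodic

variable {N : ℕ} {G : Resonators N} {α : ℝ} {g : ℝ → ℂ}

lemma quasiperiodic_left_succ (hg : ∀ x, g (x + G.L) = Complex.exp (Complex.I * α * G.L) * g x)
    (i : Fin N) : g (G.left ((i : ℕ) + 1 : ℤ)) = nextVal G α (fun j => g (G.left (j : ℕ))) i := by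
  unfold nextVal
  split_ifs with h
  · simp only [Nat.cast_add, Nat.cast_one]
  · have : ((i : ℕ) + 1 : ℤ) = ((0 : ℕ) : ℤ) + N := by have := i.isLt; omega
    rw [this, G.left_periodic, hg]

lemma quasiperiodic_right_pred (hg : ∀ x, g (x + G.L) = Complex.exp (Complex.I * α * G.L) * g x)
    (i : Fin N) : g (G.right ((i : ℕ) - 1 : ℤ)) = prevVal G α (fun j => g (G.right (j : ℕ))) i := by
  unfold prevVal
  split_ifs with h
  · have h1 := i.isLt
    have : ((N - 1 : ℕ) : ℤ) = ((i : ℕ) - 1 : ℤ) + N := by omega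
    simp only [this]
    rw [G.right_periodic, hg, ← mul_assoc, ← Complex.exp_add]
    simp
  · have : ((i - 1 : ℕ) : ℤ) = ((i : ℕ) - 1 : ℤ) := by omega
    simp only [this]

lemma norm_quasiperiodic (hg : ∀ x, g (x + G.L) = Complex.exp (Complex.I * α * G.L) * g x)
    (x : ℝ) : ‖g (x + G.L)‖ = ‖g x‖ := by
  rw [hg, norm_mul, (norm_phase G α).1, one_mul]

lemma sq_cellNorm_eq (hg : ∀ x, g (x + G.L) = Complex.exp (Complex.I * α * G.L) * g x) (a : ℝ) :
    cellNorm G.L g ^ 2 = ∫ x in a..a + G.L, ‖g x‖ ^ 2 := by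
  have hper : Function.Periodic (fun x => ‖g x‖ ^ 2) G.L := fun x => by
    simp only [norm_quasiperiodic hg]
  rw [cellNorm, Real.sq_sqrt (intervalIntegral.integral_nonneg G.L_pos.le fun _ _ => by positivity),
    hper.intervalIntegral_add_eq a 0, zero_add]

lemma norm_toIntervalL2_le_cellNorm {g : C(ℝ, ℂ)}
    (hg : ∀ x, g (x + G.L) = Complex.exp (Complex.I * α * G.L) * g x) {a b : ℝ} (hab : a ≤ b)
    (hb : b ≤ a + G.L) : ‖toIntervalL2 a b g‖ ≤ cellNorm G.L g := by
  refine le_of_sq_le_sq ?_ (Real.sqrt_nonneg _)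
  rw [sq_cellNorm_eq hg a, norm_toIntervalL2_sq hab]
  exact intervalIntegral.integral_mono_interval le_rfl hab hb
    (Eventually.of_forall fun _ => by positivity) (Continuous.intervalIntegrable (by fun_prop) _ _)

lemma cellNorm_le_sum {g : C(ℝ, ℂ)}
    (hg : ∀ x, g (x + G.L) = Complex.exp (Complex.I * α * G.L) * g x) :
    cellNorm G.L g ≤ ∑ i : Fin N, (‖toIntervalL2 (G.left (i : ℕ)) (G.right (i : ℕ)) g‖ +
      ‖toIntervalL2 (G.right (i : ℕ)) (G.left ((i : ℕ) + 1 : ℤ)) g‖) := by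
  have hint : ∀ a b : ℝ, IntervalIntegrable (fun x => ‖g x‖ ^ 2) MeasureTheory.volume a b :=
    fun a b => Continuous.intervalIntegrable (by fun_prop) _ _
  have h1 : cellNorm G.L g ^ 2 = ∑ i : Fin N,
      (‖toIntervalL2 (G.left (i : ℕ)) (G.right (i : ℕ)) g‖ ^ 2 +
      ‖toIntervalL2 (G.right (i : ℕ)) (G.left ((i : ℕ) + 1 : ℤ)) g‖ ^ 2) := by
    rw [sq_cellNorm_eq hg (G.left 0), ← G.left_periodic]
    have h2 := intervalIntegral.sum_integral_adjacent_intervals (μ := MeasureTheory.volume)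
      (f := fun x => ‖g x‖ ^ 2) (a := fun k : ℕ => G.left k) (n := N) (fun k _ => hint _ _)
    simp only [Nat.cast_zero] at h2
    rw [zero_add, ← h2, ← Fin.sum_univ_eq_sum_range
      (fun k : ℕ => ∫ x in G.left k..G.left (k + 1 : ℕ), ‖g x‖ ^ 2)]
    refine Finset.sum_congr rfl fun i _ => ?_
    rw [norm_toIntervalL2_sq (G.left_lt_right _).le, norm_toIntervalL2_sq (G.right_lt_left _).le,
      intervalIntegral.integral_add_adjacent_intervals (hint _ _) (hint _ _)]
    push_cast
    rfl
  refine le_of_sq_le_sq ?_ (Finset.sum_nonneg fun _ _ => by positivity)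
  rw [h1]
  calc _ ≤ ∑ i : Fin N, (‖toIntervalL2 (G.left (i : ℕ)) (G.right (i : ℕ)) g‖ +
      ‖toIntervalL2 (G.right (i : ℕ)) (G.left ((i : ℕ) + 1 : ℤ)) g‖) ^ 2 :=
        Finset.sum_le_sum fun i _ => by
          nlinarith [mul_nonneg (norm_nonneg (toIntervalL2 (G.left (i : ℕ)) (G.right (i : ℕ)) g))
            (norm_nonneg (toIntervalL2 (G.right (i : ℕ)) (G.left ((i : ℕ) + 1 : ℤ)) g))]
    _ ≤ _ := Finset.sum_sq_le_sq_sum_of_nonneg fun _ _ => by positivity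

end Quasiperiodic

lemma Medium.vr_pos {N : ℕ} (S : Medium N) : 0 < S.vr :=
  Real.sqrt_pos.2 (div_pos S.κr_pos S.ρr_pos)

lemma Medium.δ_pos {N : ℕ} (S : Medium N) : 0 < S.δ := div_pos S.ρr_pos S.ρ₀_pos

lemma Medium.sq_vr {N : ℕ} (S : Medium N) : S.vr ^ 2 = S.κr / S.ρr :=
  Real.sq_sqrt (div_pos S.κr_pos S.ρr_pos).le

lemma Medium.vStar_eq {N : ℕ} (S : Medium N) (v : ℤ → ℝ → ℂ) (i : Fin N) (n : ℤ) (x : ℝ) :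
    S.vStar v i n x = trigConv S.M (S.r i) (fun n => v n x) n := rfl

lemma Medium.mul_vStarStar_eq {N : ℕ} (S : Medium N) (ω : ℂ) (v : ℤ → ℝ → ℂ) (i : Fin N) (n : ℤ)
    (x : ℝ) : S.ρr * (ω + n * S.Ω) ^ 2 / S.κr * S.vStarStar ω v i n x =
      (1 / (S.vr ^ 2 : ℝ) : ℂ) * ((ω + n * S.Ω) *
        trigConv S.M (S.k i) (fun n => (ω + n * S.Ω) * v n x) n) := by
  have e : S.vStarStar ω v i n x = 1 / (ω + n * S.Ω) *
      trigConv S.M (S.k i) (fun n => (ω + n * S.Ω) * v n x) n := by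
    unfold Medium.vStarStar trigConv
    congr 1
    refine Finset.sum_congr rfl fun m _ => ?_
    rw [smul_eq_mul]
    push_cast
    ring
  rw [e, S.sq_vr]
  have h1 : (S.κr : ℂ) ≠ 0 := by exact_mod_cast S.κr_pos.ne'
  have h2 : (S.ρr : ℂ) ≠ 0 := by exact_mod_cast S.ρr_pos.ne'
  push_cast
  by_cases h : ω + n * S.Ω = 0
  · simp [h]
  · field_simp

/-- The average of `g` over the resonator `i`. -/
noncomputable def resonatorAvg {N : ℕ} (G : Resonators N) (i : Fin N) (g : ℝ → ℂ) : ℂ :=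
  (1 / (G.len (i : ℕ) : ℂ)) * ∫ x in G.left (i : ℕ)..G.right (i : ℕ), g x

/-- The class of `g` in the `L²` space of the resonator `i`. -/
noncomputable def resonatorL2 {N : ℕ} (G : Resonators N) (i : Fin N) :
    C(ℝ, ℂ) →ₗ[ℂ] IntervalL2 (G.left (i : ℕ)) (G.right (i : ℕ)) :=
  toIntervalL2 (G.left (i : ℕ)) (G.right (i : ℕ))

lemma norm_resonatorAvg_le {N : ℕ} (G : Resonators N) (i : Fin N) (g : C(ℝ, ℂ)) :
    ‖resonatorAvg G i g‖ ≤ 1 / √(G.len (i : ℕ)) * ‖resonatorL2 G i g‖ := by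
  have hl := G.len_pos (i : ℕ)
  have h1 := integral_norm_le_norm_toIntervalL2 (G.left_lt_right (i : ℕ)) g
  have h2 := intervalIntegral.norm_integral_le_integral_norm (μ := MeasureTheory.volume)
    (f := g) (G.left_lt_right (i : ℕ)).le
  rw [resonatorAvg, norm_mul, norm_div, norm_one, Complex.norm_real, Real.norm_of_nonneg hl.le]
  have h3 : G.len (i : ℕ) = √(G.len (i : ℕ)) * √(G.len (i : ℕ)) := (Real.mul_self_sqrt hl.le).symm
  have h4 : 0 < √(G.len (i : ℕ)) := Real.sqrt_pos.2 hl
  calc 1 / G.len (i : ℕ) * ‖∫ x in G.left (i : ℕ)..G.right (i : ℕ), g x‖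
      ≤ 1 / G.len (i : ℕ) * (√(G.len (i : ℕ)) * ‖resonatorL2 G i g‖) := by
        gcongr
        exact h2.trans h1
    _ = _ := by
        nth_rewrite 1 [h3]
        field_simp

lemma trigConv_resonatorAvg {N : ℕ} (G : Resonators N) (i : Fin N) (M : ℕ) (f : ℤ → ℂ)
    (v : ℤ → C(ℝ, ℂ)) (n : ℤ) :
    resonatorAvg G i (fun x => trigConv M f (fun n => v n x) n) =
      trigConv M f (fun n => resonatorAvg G i (v n)) n := by
  unfold resonatorAvg trigConv
  rw [intervalIntegral.integral_finsetSum
    fun m _ => Continuous.intervalIntegrable (by fun_prop) _ _, Finset.mul_sum]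
  refine Finset.sum_congr rfl fun m _ => ?_
  rw [intervalIntegral.integral_smul, smul_eq_mul, smul_eq_mul]
  ring

/-- The convolution of a sequence of continuous functions, as a continuous function. -/
lemma trigConv_apply (M : ℕ) (f : ℤ → ℂ) (v : ℤ → C(ℝ, ℂ)) (n : ℤ) (x : ℝ) :
    trigConv M f v n x = trigConv M f (fun n => v n x) n := by
  simp [trigConv]

lemma map_trigConv {E : Type*} [AddCommGroup E] [Module ℂ E] (J : C(ℝ, ℂ) →ₗ[ℂ] E) (M : ℕ)
    (f : ℤ → ℂ) (v : ℤ → C(ℝ, ℂ)) (n : ℤ) :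
    J (trigConv M f v n) = trigConv M f (fun n => J (v n)) n := by
  simp [trigConv]

lemma HasSecondDerivAt.congr_of_eventuallyEq {g g' : ℝ → ℂ} {y : ℂ} {x : ℝ}
    (h : HasSecondDerivAt g y x) (heq : g' =ᶠ[𝓝 x] g) : HasSecondDerivAt g' y x :=
  ⟨h.1.congr_of_eventuallyEq heq, h.2.congr_of_eventuallyEq heq.deriv⟩

lemma HasSecondDerivAt.congr_value {g : ℝ → ℂ} {y y' : ℂ} {x : ℝ}
    (h : HasSecondDerivAt g y x) (hy : y = y') : HasSecondDerivAt g y' x := hy ▸ h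

lemma hasSecondDerivAt_const_mul_comp_add {g : ℝ → ℂ} {y : ℂ} {x L : ℝ} (c : ℂ)
    (h : HasSecondDerivAt g y (x + L)) : HasSecondDerivAt (fun x => c * g (x + L)) (c * y) x := by
  have hd : deriv (fun x => c * g (x + L)) = fun x => c * deriv g (x + L) := by
    ext z
    rw [deriv_const_mul_field, deriv_comp_add_const]
  refine ⟨?_, ?_⟩
  · have h1 := h.1.hasDerivAt.comp_add_const x L
    exact (h1.const_mul c).differentiableAt
  · rw [hd]
    exact (h.2.comp_add_const x L).const_mul c

section Mode

variable {N : ℕ} {G : Resonators N} {S : Medium N} {α : ℝ} {ω : ℂ} {v : ℤ → ℝ → ℂ}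

lemma IsBlochMode.exterior_right (hv : IsBlochMode G S α ω v 0) (n : ℤ) (i : Fin N) :
    ∀ x ∈ Set.Ioo (G.right (i : ℕ)) (G.left ((i : ℕ) + 1 : ℤ)),
      HasSecondDerivAt (v n) (-(S.ρ₀ * (ω + n * S.Ω) ^ 2 / S.κ₀) * v n x) x := fun x hx =>
  (hv.exterior n i x hx).congr_value (by simp)

lemma IsBlochMode.exterior_left (hv : IsBlochMode G S α ω v 0) (n : ℤ) (i : Fin N) :
    ∀ x ∈ Set.Ioo (G.right ((i : ℕ) - 1 : ℤ)) (G.left (i : ℕ)),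
      HasSecondDerivAt (v n) (-(S.ρ₀ * (ω + n * S.Ω) ^ 2 / S.κ₀) * v n x) x := fun x hx => by
  have hi := i.isLt
  by_cases h : (i : ℕ) = 0
  · set j : Fin N := ⟨N - 1, by omega⟩
    have hj : ((j : ℕ) : ℤ) = (i : ℕ) - 1 + N := by simp only [j]; omega
    have h1 := hv.exterior_right n j (x + G.L) (by
      rw [hj, G.right_periodic, show (((i : ℕ) : ℤ) - 1 + N + 1) = (i : ℕ) + N by ring,
        G.left_periodic]
      exact ⟨by linarith [hx.1], by linarith [hx.2]⟩)
    have hq : v n = fun x => Complex.exp (-(Complex.I * α * G.L)) * v n (x + G.L) := by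
      ext z
      rw [hv.quasiperiodic, ← mul_assoc, ← Complex.exp_add]
      simp
    have h2 := hasSecondDerivAt_const_mul_comp_add (Complex.exp (-(Complex.I * α * G.L))) h1
    rw [← hq] at h2
    refine h2.congr_value ?_
    conv_rhs => rw [hq]
    ring
  · have h1 := hv.exterior_right n ⟨i - 1, by omega⟩ x
    have e : (((i : ℕ) - 1 : ℕ) : ℤ) = (i : ℕ) - 1 := by omega
    simp only [e, sub_add_cancel] at h1
    exact h1 hx

lemma IsBlochMode.interior_eq (hv : IsBlochMode G S α ω v 0) (n : ℤ) (i : Fin N) :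
    ∀ x ∈ Set.Ioo (G.left (i : ℕ)) (G.right (i : ℕ)),
      HasSecondDerivAt (S.vStar v i n) (-((1 / (S.vr ^ 2 : ℝ) : ℂ) * ((ω + n * S.Ω) *
        trigConv S.M (S.k i) (fun n => (ω + n * S.Ω) * v n x) n))) x := fun x hx =>
  (hv.interior n i x hx).congr_value (by rw [S.mul_vStarStar_eq]; simp)

end Mode


/-- Estimates for the harmonics `v_n` of a Bloch mode in terms of their averages `V_{i,n}` over the
resonators, with a constant `K` which does not depend on the modulation: the fluxes satisfy the
capacitance equation up to small errors (`balance`), the modes are almost constant in the resonators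
(`interior`), and they are determined by their values there (`cell`). -/
structure ModeBounds {N : ℕ} (G : Resonators N) (S : Medium N) (α : ℝ) (ω : ℂ)
    (v : ℤ → C(ℝ, ℂ)) (K : ℝ) : Prop where
  balance : ∀ n (i : Fin N), ∃ J : ℂ,
    S.δ * J = -((G.len (i : ℕ) / S.vr ^ 2 : ℝ) : ℂ) * ((ω + n * S.Ω) *
      trigConv S.M (S.k i) (fun n => (ω + n * S.Ω) * resonatorAvg G i (v n)) n) ∧
    ‖J + ∑ j, capacitanceMatrix G α i j * resonatorAvg G j (v n)‖ ≤
      K * (‖ω + n * S.Ω‖ ^ 2 * cellNorm G.L (v n) + ∑ j : Fin N,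
        (‖v n (G.left (j : ℕ)) - resonatorAvg G j (v n)‖ +
          ‖v n (G.right (j : ℕ)) - resonatorAvg G j (v n)‖))
  interior : ∀ n (i : Fin N), ∀ x ∈ Set.Icc (G.left (i : ℕ)) (G.right (i : ℕ)),
    ‖trigConv S.M (S.r i) (fun n => v n x - resonatorAvg G i (v n)) n‖ ≤
      K * (S.δ * ((1 + ‖ω + n * S.Ω‖ ^ 2) * cellNorm G.L (v n)) + ‖(ω + n * S.Ω) •
        trigConv S.M (S.k i) (fun n => (ω + n * S.Ω) • resonatorL2 G i (v n)) n‖)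
  cell : ∀ n, cellNorm G.L (v n) ≤ K * (‖ω + n * S.Ω‖ ^ 2 * cellNorm G.L (v n) + ∑ j : Fin N,
    (‖resonatorAvg G j (v n)‖ +
      ‖resonatorL2 G j (v n) - resonatorAvg G j (v n) • resonatorL2 G j 1‖ +
      (‖v n (G.left (j : ℕ)) - resonatorAvg G j (v n)‖ +
          ‖v n (G.right (j : ℕ)) - resonatorAvg G j (v n)‖)))
  left : ∀ n (i : Fin N), ‖v n (G.left (i : ℕ))‖ ≤
    K * ((1 + ‖ω + n * S.Ω‖ ^ 2) * cellNorm G.L (v n))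
  right : ∀ n (i : Fin N), ‖v n (G.right (i : ℕ))‖ ≤
    K * ((1 + ‖ω + n * S.Ω‖ ^ 2) * cellNorm G.L (v n))
  avg : ∀ n (i : Fin N), ‖resonatorAvg G i (v n)‖ ≤ K * cellNorm G.L (v n)
  interiorNorm : ∀ n (i : Fin N), ‖resonatorL2 G i (v n)‖ ≤ cellNorm G.L (v n)

set_option maxHeartbeats 1600000 in
lemma exists_modeBounds {N : ℕ} (hN : 0 < N) (G : Resonators N) (α : ℝ) {ρ₀ κ₀ vr : ℝ}
    (hρ : 0 < ρ₀) (hκ : 0 < κ₀) (hvr : 0 < vr) :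
    ∃ K : ℝ, 0 ≤ K ∧ ∀ (S : Medium N), S.ρ₀ = ρ₀ → S.κ₀ = κ₀ → S.vr = vr →
      ∀ (ω : ℂ) (v : ℤ → C(ℝ, ℂ)), IsBlochMode G S α ω (fun n => v n) 0 →
      ModeBounds G S α ω v K := by
  have hgl : ∀ i : Fin N, G.right ((i : ℕ) - 1 : ℤ) < G.left (i : ℕ) := fun i => by
    simpa using G.right_lt_left ((i : ℕ) - 1 : ℤ)
  have hgr : ∀ i : Fin N, G.right (i : ℕ) < G.left ((i : ℕ) + 1 : ℤ) := fun i =>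
    G.right_lt_left (i : ℕ)
  choose Kl hKl0 hKl using fun i : Fin N => exists_gap_estimates (hgl i)
  choose Kr hKr0 hKr using fun i : Fin N => exists_gap_estimates (hgr i)
  -- one constant for all gaps
  set K1 : ℝ := ∑ i, (Kl i + Kr i) with hK1
  have hK10 : 0 ≤ K1 := Finset.sum_nonneg fun i _ => add_nonneg (hKl0 i) (hKr0 i)
  have hKlr : ∀ i, Kl i + Kr i ≤ K1 := fun i =>
    Finset.single_le_sum (f := fun i => Kl i + Kr i)
      (fun i _ => add_nonneg (hKl0 i) (hKr0 i)) (Finset.mem_univ i)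
  have hKlK : ∀ i, Kl i ≤ K1 := fun i => by linarith [hKlr i, hKr0 i]
  have hKrK : ∀ i, Kr i ≤ K1 := fun i => by linarith [hKlr i, hKl0 i]
  set w : ℝ := ρ₀ / κ₀ with hw
  have hw0 : 0 < w := div_pos hρ hκ
  set g1 : ℝ := ∑ i : Fin N, (1 / G.gap (i : ℕ) + 1 / G.gap ((i : ℕ) - 1 : ℤ)) with hg1
  have hgpos : ∀ i : Fin N, 0 ≤ 1 / G.gap (i : ℕ) + 1 / G.gap ((i : ℕ) - 1 : ℤ) := fun i =>
    add_nonneg (one_div_nonneg.2 (G.gap_pos _).le) (one_div_nonneg.2 (G.gap_pos _).le)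
  have hg10 : 0 ≤ g1 := Finset.sum_nonneg fun i _ => hgpos i
  have hgi : ∀ i : Fin N, 1 / G.gap (i : ℕ) + 1 / G.gap ((i : ℕ) - 1 : ℤ) ≤ g1 := fun i =>
    Finset.single_le_sum (fun i _ => hgpos i) (Finset.mem_univ i)
  set l1 : ℝ := ∑ i : Fin N, (G.len (i : ℕ) + √(G.len (i : ℕ)) + 1 / √(G.len (i : ℕ))) with hl1
  have hlpos : ∀ i : Fin N, 0 ≤ G.len (i : ℕ) + √(G.len (i : ℕ)) + 1 / √(G.len (i : ℕ)) :=
    fun i => by have := G.len_pos (i : ℕ); positivity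
  have hl10 : 0 ≤ l1 := Finset.sum_nonneg fun i _ => hlpos i
  have hli : ∀ i : Fin N, G.len (i : ℕ) + √(G.len (i : ℕ)) + 1 / √(G.len (i : ℕ)) ≤ l1 := fun i =>
    Finset.single_le_sum (fun i _ => hlpos i) (Finset.mem_univ i)
  set K : ℝ := 2 * K1 * w + 2 * g1 + 2 * l1 * (K1 * (1 + w) + l1 * (1 / vr ^ 2)) +
    (N * (l1 + 1 + 2 * K1 + K1 * w)) + K1 * (1 + w) + l1 with hK
  have hN0 : (0 : ℝ) ≤ N := Nat.cast_nonneg _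
  have t1 : 0 ≤ K1 * w := by positivity
  have t2 : 0 ≤ 2 * l1 * (K1 * (1 + w) + l1 * (1 / vr ^ 2)) := by positivity
  have t3 : 0 ≤ (N * (l1 + 1 + 2 * K1 + K1 * w) : ℝ) := by positivity
  have t4 : 0 ≤ K1 * (1 + w) := by positivity
  refine ⟨K, by positivity, fun S hSρ hSκ hSv ω v hv => ?_⟩
  set s : ℤ → ℂ := fun n => ω + n * S.Ω with hs
  set a : ℤ → ℝ := fun n => cellNorm G.L (v n) with ha
  have ha0 : ∀ n, 0 ≤ a n := fun n => Real.sqrt_nonneg _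
  set θ : ℤ → ℂ := fun n => S.ρ₀ * (ω + n * S.Ω) ^ 2 / S.κ₀ with hθ
  have hθn : ∀ n, ‖θ n‖ = w * ‖s n‖ ^ 2 := fun n => by
    simp only [hθ, norm_div, norm_mul, norm_pow, Complex.norm_real, hSρ, hSκ,
      Real.norm_of_nonneg hρ.le, Real.norm_of_nonneg hκ.le, hw, hs]
    ring
  have hθ1 : ∀ n, 1 + ‖θ n‖ ≤ (1 + w) * (1 + ‖s n‖ ^ 2) := fun n => by
    rw [hθn]; nlinarith [sq_nonneg ‖s n‖]
  have hq : ∀ n x, v n (x + G.L) = Complex.exp (Complex.I * α * G.L) * v n x := hv.quasiperiodic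
  have hmr : ∀ n (i : Fin N), ‖toIntervalL2 (G.right (i : ℕ)) (G.left ((i : ℕ) + 1 : ℤ)) (v n)‖ ≤
      a n := fun n i => norm_toIntervalL2_le_cellNorm (hq n) (hgr i).le
        (G.left_succ_le_right_add hN _)
  have hml : ∀ n (i : Fin N), ‖toIntervalL2 (G.right ((i : ℕ) - 1 : ℤ)) (G.left (i : ℕ)) (v n)‖ ≤
      a n := fun n i => norm_toIntervalL2_le_cellNorm (hq n) (hgl i).le (by
        simpa using G.left_succ_le_right_add hN ((i : ℕ) - 1 : ℤ))
  have hmi : ∀ n (i : Fin N), ‖resonatorL2 G i (v n)‖ ≤ a n := fun n i =>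
    norm_toIntervalL2_le_cellNorm (hq n) (G.left_lt_right _).le (G.right_le_left_add hN _)
  have hT : ∀ n, (1 + ‖s n‖ ^ 2) * a n ≥ 0 := fun n => mul_nonneg (by positivity) (ha0 n)
  have hsa : ∀ n, ‖s n‖ ^ 2 * a n ≥ 0 := fun n => mul_nonneg (by positivity) (ha0 n)
  -- conversion of the gap estimates to the norm over the cell
  have conv1 : ∀ (n : ℤ) (k m : ℝ), 0 ≤ k → k ≤ K1 → 0 ≤ m → m ≤ a n →
      k * ((1 + ‖θ n‖) * m) ≤ K1 * (1 + w) * ((1 + ‖s n‖ ^ 2) * a n) := fun n k m hk0 hk hm0 hm => by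
    calc _ ≤ K1 * (((1 + w) * (1 + ‖s n‖ ^ 2)) * a n) := by
          gcongr
          exact hθ1 n
      _ = _ := by ring
  have conv2 : ∀ (n : ℤ) (k m : ℝ), 0 ≤ k → k ≤ K1 → 0 ≤ m → m ≤ a n →
      k * (‖θ n‖ * m) ≤ K1 * w * (‖s n‖ ^ 2 * a n) := fun n k m hk0 hk hm0 hm => by
    rw [hθn]
    calc _ ≤ K1 * ((w * ‖s n‖ ^ 2) * a n) := by gcongr
      _ = _ := by ring
  -- the quantities on the gaps to the right and to the left of each resonator
  have hR : ∀ n (i : Fin N), ∃ dR : ℂ, Tendsto (deriv (v n)) (𝓝[>] (G.right (i : ℕ))) (𝓝 dR) ∧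
      ‖dR - (nextVal G α (fun j => v n (G.left (j : ℕ))) i - v n (G.right (i : ℕ))) /
        (G.gap (i : ℕ) : ℂ)‖ ≤ K1 * w * (‖s n‖ ^ 2 * a n) ∧
      ‖v n (G.right (i : ℕ))‖ ≤ K1 * (1 + w) * ((1 + ‖s n‖ ^ 2) * a n) ∧
      ‖toIntervalL2 (G.right (i : ℕ)) (G.left ((i : ℕ) + 1 : ℤ)) (v n)‖ ≤
        K1 * (‖v n (G.right (i : ℕ))‖ + ∑ j : Fin N, ‖v n (G.left (j : ℕ))‖) +
          K1 * w * (‖s n‖ ^ 2 * a n) := fun n i => by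
    obtain ⟨da, db, h1, h2, h3, h4, h5, h6, h7, h8, h9⟩ :=
      hKr i (v n) (θ n) (hv.exterior_right n i)
    refine ⟨da, h1, ?_, h5.trans (conv1 n _ _ (hKr0 i) (hKrK i) (norm_nonneg _) (hmr n i)), ?_⟩
    · have h10 := h3.trans (conv2 n _ _ (hKr0 i) (hKrK i) (norm_nonneg _) (hmr n i))
      rwa [quasiperiodic_left_succ (hq n) i] at h10
    · refine h9.trans ?_
      rw [mul_add]
      refine add_le_add ?_ (conv2 n _ _ (hKr0 i) (hKrK i) (norm_nonneg _) (hmr n i))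
      gcongr
      · exact hKrK i
      · rw [quasiperiodic_left_succ (hq n) i]
        exact norm_nextVal_le G α _ i
  have hL : ∀ n (i : Fin N), ∃ dL : ℂ, Tendsto (deriv (v n)) (𝓝[<] (G.left (i : ℕ))) (𝓝 dL) ∧
      ‖dL - (v n (G.left (i : ℕ)) - prevVal G α (fun j => v n (G.right (j : ℕ))) i) /
        (G.gap ((i : ℕ) - 1 : ℤ) : ℂ)‖ ≤ K1 * w * (‖s n‖ ^ 2 * a n) ∧
      ‖v n (G.left (i : ℕ))‖ ≤ K1 * (1 + w) * ((1 + ‖s n‖ ^ 2) * a n) ∧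
      ‖dL‖ ≤ K1 * (1 + w) * ((1 + ‖s n‖ ^ 2) * a n) := fun n i => by
    obtain ⟨da, db, h1, h2, h3, h4, h5, h6, h7, h8, h9⟩ :=
      hKl i (v n) (θ n) (hv.exterior_left n i)
    refine ⟨db, h2, ?_, h6.trans (conv1 n _ _ (hKl0 i) (hKlK i) (norm_nonneg _) (hml n i)),
      h8.trans (conv1 n _ _ (hKl0 i) (hKlK i) (norm_nonneg _) (hml n i))⟩
    have h10 := h4.trans (conv2 n _ _ (hKl0 i) (hKlK i) (norm_nonneg _) (hml n i))
    rw [quasiperiodic_right_pred (hq n) i] at h10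
    have e : G.gap ((i : ℕ) - 1 : ℤ) = G.left (i : ℕ) - G.right ((i : ℕ) - 1 : ℤ) := by
      simp [Resonators.gap]
    rwa [e]
  -- the second derivative in the resonators
  set h : Fin N → ℤ → C(ℝ, ℂ) := fun i n => (-((1 / (S.vr ^ 2 : ℝ) : ℂ) * s n)) •
    trigConv S.M (S.k i) (fun n => s n • v n) n with hh
  have hhx : ∀ i n x, h i n x = -((1 / (S.vr ^ 2 : ℝ) : ℂ) * (s n *
        trigConv S.M (S.k i) (fun n => s n * v n x) n)) := fun i n x => by
    simp only [hh, ContinuousMap.smul_apply, trigConv_apply, smul_eq_mul]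
    ring
  have hres : ∀ n (i : Fin N), ∀ dL dR : ℂ,
      Tendsto (deriv (v n)) (𝓝[<] (G.left (i : ℕ))) (𝓝 dL) →
      Tendsto (deriv (v n)) (𝓝[>] (G.right (i : ℕ))) (𝓝 dR) →
      S.δ * (dR - dL) = ∫ x in G.left (i : ℕ)..G.right (i : ℕ), h i n x ∧
      ∀ x ∈ Set.Icc (G.left (i : ℕ)) (G.right (i : ℕ)),
        ‖S.vStar (fun n => v n) i n x - resonatorAvg G i (S.vStar (fun n => v n) i n)‖ ≤
        2 * G.len (i : ℕ) * (S.δ * ‖dL‖ + ∫ t in G.left (i : ℕ)..G.right (i : ℕ), ‖h i n t‖) := by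
    intro n i dL dR hdL hdR
    obtain ⟨d1, h1, h2⟩ := hv.transmission_left n i
    obtain ⟨d2, h3, h4⟩ := hv.transmission_right n i
    obtain rfl := tendsto_nhds_unique h1 hdL
    obtain rfl := tendsto_nhds_unique h3 hdR
    have hc : Continuous (S.vStar (fun n => v n) i n) := by
      unfold Medium.vStar
      fun_prop
    obtain ⟨h5, h6⟩ := resonator_estimates (G.left_lt_right (i : ℕ)) hc (h i n).continuous
      (fun x hx => (hv.interior_eq n i x hx).congr_value (hhx i n x).symm) h2 h4
    refine ⟨by rw [← h5]; ring, fun x hx => ?_⟩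
    have h7 := h6 x hx
    rw [norm_mul, Complex.norm_real, Real.norm_of_nonneg S.δ_pos.le] at h7
    exact h7
  refine ⟨fun n i => ?_, fun n i x hx => ?_, fun n => ?_, fun n i => ?_, fun n i => ?_,
    fun n i => ?_, hmi⟩
  · obtain ⟨dR, hR1, hR2, -, -⟩ := hR n i
    obtain ⟨dL, hL1, hL2, -, -⟩ := hL n i
    refine ⟨dR - dL, ?_, ?_⟩
    · rw [(hres n i dL dR hL1 hR1).1]
      have hlc : (G.len (i : ℕ) : ℂ) ≠ 0 := by exact_mod_cast (G.len_pos _).ne'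
      have e1 : ∫ x in G.left (i : ℕ)..G.right (i : ℕ), h i n x =
          G.len (i : ℕ) * resonatorAvg G i (h i n) := by
        rw [resonatorAvg]
        field_simp
      have e2 : resonatorAvg G i (h i n) = (-((1 / (S.vr ^ 2 : ℝ) : ℂ) * s n)) *
          trigConv S.M (S.k i) (fun n => s n * resonatorAvg G i (v n)) n := by
        have e3 := trigConv_resonatorAvg G i S.M (S.k i) (fun n => s n • v n) n
        have e4 : (fun n => resonatorAvg G i (s n • v n : C(ℝ, ℂ))) =
            fun n => s n * resonatorAvg G i (v n) := by
          ext n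
          simp only [resonatorAvg, ContinuousMap.coe_smul, Pi.smul_apply, smul_eq_mul,
            intervalIntegral.integral_const_mul]
          ring
        rw [e4] at e3
        rw [← e3]
        simp only [resonatorAvg, hh, smul_eq_mul,
          intervalIntegral.integral_const_mul, trigConv_apply, ContinuousMap.smul_apply]
        ring
      rw [e1, e2]
      push_cast
      ring
    · rw [capacitanceMatrix_mulVec]
      set V : Fin N → ℂ := fun j => resonatorAvg G j (v n) with hV
      set vl : Fin N → ℂ := fun j => v n (G.left (j : ℕ)) with hvl
      set vrr : Fin N → ℂ := fun j => v n (G.right (j : ℕ)) with hvrr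
      change ‖dR - dL + ((V i - prevVal G α V i) / (G.gap ((i : ℕ) - 1 : ℤ) : ℂ) +
        (V i - nextVal G α V i) / (G.gap (i : ℕ) : ℂ))‖ ≤ K * (‖s n‖ ^ 2 * a n +
          ∑ j : Fin N, (‖vl j - V j‖ + ‖vrr j - V j‖))
      have e : dR - dL + ((V i - prevVal G α V i) / (G.gap ((i : ℕ) - 1 : ℤ) : ℂ) +
        (V i - nextVal G α V i) / (G.gap (i : ℕ) : ℂ)) =
        (dR - (nextVal G α vl i - vrr i) / (G.gap (i : ℕ) : ℂ)) -
        (dL - (vl i - prevVal G α vrr i) / (G.gap ((i : ℕ) - 1 : ℤ) : ℂ)) +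
        ((nextVal G α (fun j => vl j - V j) i - (vrr i - V i)) / (G.gap (i : ℕ) : ℂ) +
        (prevVal G α (fun j => vrr j - V j) i - (vl i - V i)) /
          (G.gap ((i : ℕ) - 1 : ℤ) : ℂ)) := by
        rw [nextVal_sub, prevVal_sub]
        ring
      rw [e]
      set Z := ∑ j : Fin N, (‖vl j - V j‖ + ‖vrr j - V j‖) with hZ
      have hZ0 : 0 ≤ Z := Finset.sum_nonneg fun _ _ => by positivity
      have hZl : ∑ j, ‖vl j - V j‖ ≤ Z := Finset.sum_le_sum fun j _ => by
        linarith [norm_nonneg (vrr j - V j)]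
      have hZr : ∑ j, ‖vrr j - V j‖ ≤ Z := Finset.sum_le_sum fun j _ => by
        linarith [norm_nonneg (vl j - V j)]
      have hzl : ‖vl i - V i‖ ≤ Z := le_trans (Finset.single_le_sum
        (f := fun j => ‖vl j - V j‖) (fun _ _ => norm_nonneg _) (Finset.mem_univ i)) hZl
      have hzr : ‖vrr i - V i‖ ≤ Z := le_trans (Finset.single_le_sum
        (f := fun j => ‖vrr j - V j‖) (fun _ _ => norm_nonneg _) (Finset.mem_univ i)) hZr
      have b1 : ‖(nextVal G α (fun j => vl j - V j) i - (vrr i - V i)) / (G.gap (i : ℕ) : ℂ)‖ ≤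
          2 * Z * (1 / G.gap (i : ℕ)) := by
        rw [norm_div, Complex.norm_real, Real.norm_of_nonneg (G.gap_pos _).le, div_eq_mul_one_div]
        have := (G.gap_pos (i : ℕ)).le
        gcongr
        exact (norm_sub_le _ _).trans (by linarith [norm_nextVal_le G α (fun j => vl j - V j) i])
      have b2 : ‖(prevVal G α (fun j => vrr j - V j) i - (vl i - V i)) /
          (G.gap ((i : ℕ) - 1 : ℤ) : ℂ)‖ ≤ 2 * Z * (1 / G.gap ((i : ℕ) - 1 : ℤ)) := by
        rw [norm_div, Complex.norm_real, Real.norm_of_nonneg (G.gap_pos _).le, div_eq_mul_one_div]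
        have := (G.gap_pos ((i : ℕ) - 1 : ℤ)).le
        gcongr
        exact (norm_sub_le _ _).trans (by linarith [norm_prevVal_le G α (fun j => vrr j - V j) i])
      refine (norm_add_le _ _).trans ((add_le_add (norm_sub_le _ _) (norm_add_le _ _)).trans ?_)
      have b3 : 2 * Z * (1 / G.gap (i : ℕ)) + 2 * Z * (1 / G.gap ((i : ℕ) - 1 : ℤ)) ≤
          2 * g1 * Z := by
        rw [← mul_add]
        nlinarith [hgi i]
      have b4 : 2 * g1 * Z ≤ K * Z := by
        gcongr
        rw [hK]
        linarith
      have b5 : 2 * K1 * w * (‖s n‖ ^ 2 * a n) ≤ K * (‖s n‖ ^ 2 * a n) := by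
        refine mul_le_mul_of_nonneg_right ?_ (hsa n)
        rw [hK]
        linarith
      linarith
  · obtain ⟨dR, hR1, hR2, -, -⟩ := hR n i
    obtain ⟨dL, hL1, hL2, -, hL4⟩ := hL n i
    have h1 := (hres n i dL dR hL1 hR1).2 x hx
    have e1 : S.vStar (fun n => v n) i n x - resonatorAvg G i (S.vStar (fun n => v n) i n) =
        trigConv S.M (S.r i) (fun n => v n x - resonatorAvg G i (v n)) n := by
      rw [trigConv_sub, ← trigConv_resonatorAvg]
      rfl
    rw [e1] at h1
    refine h1.trans ?_
    have h2 : ∫ t in G.left (i : ℕ)..G.right (i : ℕ), ‖h i n t‖ ≤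
        √(G.len (i : ℕ)) * ‖resonatorL2 G i (h i n)‖ :=
      integral_norm_le_norm_toIntervalL2 (G.left_lt_right (i : ℕ)) (h i n)
    have e2 : resonatorL2 G i (h i n) =
        (-(1 / (S.vr ^ 2 : ℝ) : ℂ)) • (s n •
          trigConv S.M (S.k i) (fun n => s n • resonatorL2 G i (v n)) n) := by
      have e4 := map_trigConv (resonatorL2 G i) S.M (S.k i) (fun n => s n • v n) n
      have e5 : (fun n => resonatorL2 G i (s n • v n)) = fun n => s n • resonatorL2 G i (v n) :=
        funext fun n => (resonatorL2 G i).map_smul (s n) (v n)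
      rw [e5] at e4
      have e6 : h i n = (-((1 / (S.vr ^ 2 : ℝ) : ℂ) * s n)) •
        trigConv S.M (S.k i) (fun n => s n • v n) n := rfl
      rw [e6, map_smul, e4, smul_smul, neg_mul]
    have e3 : ‖(-(1 / (S.vr ^ 2 : ℝ) : ℂ))‖ = 1 / vr ^ 2 := by
      rw [norm_neg, norm_div, norm_one, Complex.norm_real, hSv, Real.norm_of_nonneg (by positivity)]
    rw [e2, norm_smul, e3] at h2
    set Q := ‖s n • trigConv S.M (S.k i) (fun n => s n • resonatorL2 G i (v n)) n‖
    have hQ0 : 0 ≤ Q := norm_nonneg _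
    have hl := G.len_pos (i : ℕ)
    have hls : √(G.len (i : ℕ)) ≤ l1 := by
      have : 0 ≤ 1 / √(G.len (i : ℕ)) := by positivity
      linarith [hli i]
    have hll : G.len (i : ℕ) ≤ l1 := by
      have : 0 ≤ 1 / √(G.len (i : ℕ)) := by positivity
      linarith [hli i, Real.sqrt_nonneg (G.len (i : ℕ))]
    have hδ := S.δ_pos
    calc _ ≤ 2 * l1 * (S.δ * (K1 * (1 + w) * ((1 + ‖s n‖ ^ 2) * a n)) +
          l1 * (1 / vr ^ 2 * Q)) := by
          gcongr
          · exact add_nonneg (by positivity) (intervalIntegral.integral_nonneg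
              (G.left_lt_right _).le fun _ _ => norm_nonneg _)
          · refine h2.trans ?_
            gcongr
      _ = 2 * l1 * (K1 * (1 + w)) * (S.δ * ((1 + ‖s n‖ ^ 2) * a n)) +
          2 * l1 * (l1 * (1 / vr ^ 2)) * Q := by ring
      _ ≤ K * (S.δ * ((1 + ‖s n‖ ^ 2) * a n)) + K * Q := by
          have u1 : 0 ≤ 2 * l1 * (K1 * (1 + w)) := by positivity
          have u2 : 0 ≤ 2 * l1 * (l1 * (1 / vr ^ 2)) := by positivity
          have u3 : 0 ≤ S.δ * ((1 + ‖s n‖ ^ 2) * a n) := mul_nonneg hδ.le (hT n)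
          refine add_le_add (mul_le_mul_of_nonneg_right ?_ u3) (mul_le_mul_of_nonneg_right ?_ hQ0)
          · rw [hK]; linarith
          · rw [hK]; linarith
      _ = _ := by ring
  · refine (cellNorm_le_sum (hq n)).trans ?_
    change _ ≤ K * (‖s n‖ ^ 2 * a n + _)
    set V : Fin N → ℂ := fun j => resonatorAvg G j (v n) with hV
    set vl : Fin N → ℂ := fun j => v n (G.left (j : ℕ)) with hvl
    set vrr : Fin N → ℂ := fun j => v n (G.right (j : ℕ)) with hvrr
    set z : Fin N → ℝ := fun j => ‖resonatorL2 G j (v n) - V j • resonatorL2 G j 1‖ with hz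
    set Y := ∑ j : Fin N, (‖V j‖ + z j + (‖vl j - V j‖ + ‖vrr j - V j‖)) with hY
    have hY1 : ∀ j, ‖V j‖ + z j + (‖vl j - V j‖ + ‖vrr j - V j‖) ≤ Y := fun j =>
      Finset.single_le_sum (f := fun j => ‖V j‖ + z j + (‖vl j - V j‖ + ‖vrr j - V j‖))
        (fun _ _ => by positivity) (Finset.mem_univ j)
    have hY0 : 0 ≤ Y := Finset.sum_nonneg fun _ _ => by positivity
    have c1 : ∀ i : Fin N, ‖toIntervalL2 (G.left (i : ℕ)) (G.right (i : ℕ)) (v n)‖ ≤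
        l1 * Y + Y := fun i => by
      have h1 : ‖resonatorL2 G i (v n)‖ ≤ ‖V i • resonatorL2 G i 1‖ + z i := by
        have := norm_add_le (V i • resonatorL2 G i 1)
          (resonatorL2 G i (v n) - V i • resonatorL2 G i 1)
        rwa [add_sub_cancel] at this
      have h2 : ‖resonatorL2 G i 1‖ ≤ √(G.len (i : ℕ)) := by
        have := norm_toIntervalL2_le (G.left_lt_right (i : ℕ)).le 1 zero_le_one (by simp)
        rwa [mul_one] at this
      have h3 : ‖V i • resonatorL2 G i 1‖ ≤ Y * l1 := by
        rw [norm_smul]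
        have hl := G.len_pos (i : ℕ)
        have : 0 ≤ 1 / √(G.len (i : ℕ)) := by positivity
        have h4 : ‖V i‖ ≤ Y := by
          have := hY1 i
          have : 0 ≤ z i := norm_nonneg _
          linarith [norm_nonneg (vl i - V i), norm_nonneg (vrr i - V i)]
        gcongr
        exact h2.trans (by linarith [hli i])
      have h5 : z i ≤ Y := by
        have := norm_nonneg (V i)
        linarith [hY1 i, norm_nonneg (vl i - V i), norm_nonneg (vrr i - V i)]
      calc _ ≤ _ := h1
        _ ≤ _ := by linarith
    have c2 : ∀ i : Fin N, ‖toIntervalL2 (G.right (i : ℕ)) (G.left ((i : ℕ) + 1 : ℤ)) (v n)‖ ≤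
        K1 * (2 * Y) + K1 * w * (‖s n‖ ^ 2 * a n) := fun i => by
      obtain ⟨dR, -, -, -, h4⟩ := hR n i
      refine h4.trans ?_
      have h5 : ‖v n (G.right (i : ℕ))‖ ≤ Y := by
        have h6 := norm_add_le (V i) (vrr i - V i)
        rw [add_sub_cancel] at h6
        have : 0 ≤ z i := norm_nonneg _
        linarith [hY1 i, norm_nonneg (vl i - V i)]
      have h7 : ∑ j : Fin N, ‖v n (G.left (j : ℕ))‖ ≤ Y := Finset.sum_le_sum fun j _ => by
        have h6 := norm_add_le (V j) (vl j - V j)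
        rw [add_sub_cancel] at h6
        have : 0 ≤ z j := norm_nonneg _
        linarith [norm_nonneg (vrr j - V j)]
      gcongr
      linarith
    calc _ ≤ ∑ i : Fin N, (l1 * Y + Y + (K1 * (2 * Y) + K1 * w * (‖s n‖ ^ 2 * a n))) :=
          Finset.sum_le_sum fun i _ => add_le_add (c1 i) (c2 i)
      _ = N * (l1 + 1 + 2 * K1) * Y + N * (K1 * w) * (‖s n‖ ^ 2 * a n) := by
          rw [Finset.sum_const, Finset.card_univ, Fintype.card_fin, nsmul_eq_mul]
          ring
      _ ≤ K * Y + K * (‖s n‖ ^ 2 * a n) := by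
          have u1 : 0 ≤ N * (K1 * w) := by positivity
          have u2 : 0 ≤ N * (l1 + 1 + 2 * K1) := by positivity
          have u3 : N * (l1 + 1 + 2 * K1 + K1 * w) ≤ K := by rw [hK]; linarith
          refine add_le_add (mul_le_mul_of_nonneg_right ?_ hY0)
            (mul_le_mul_of_nonneg_right ?_ (hsa n))
          · linarith
          · linarith
      _ = _ := by ring
  · obtain ⟨dL, -, -, h3, -⟩ := hL n i
    refine h3.trans ?_
    refine mul_le_mul_of_nonneg_right ?_ (hT n)
    rw [hK]
    linarith
  · obtain ⟨dR, -, -, h3, -⟩ := hR n i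
    refine h3.trans ?_
    refine mul_le_mul_of_nonneg_right ?_ (hT n)
    rw [hK]
    linarith
  · refine (norm_resonatorAvg_le G i (v n)).trans ?_
    have hl := G.len_pos (i : ℕ)
    gcongr
    · have := hli i
      have := Real.sqrt_nonneg (G.len (i : ℕ))
      rw [hK]
      linarith
    · exact hmi n i


/-! ### Sequences of polynomial growth in the weighted norm -/

/-- Polynomial growth of a sequence of real numbers. -/
def PolyGrowth (f : ℤ → ℝ) : Prop := ∃ (C : ℝ) (k : ℕ), ∀ n, |f n| ≤ C * (1 + |(n : ℝ)|) ^ k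

lemma PolyGrowth.of_le {f : ℤ → ℝ} {g : ℤ → ℝ} (hg : PolyGrowth g) (h : ∀ n, |f n| ≤ g n) :
    PolyGrowth f := by
  obtain ⟨C, k, hC⟩ := hg
  exact ⟨C, k, fun n => (h n).trans ((le_abs_self _).trans (hC n))⟩

lemma PolyGrowth.const (C : ℝ) : PolyGrowth fun _ => C := ⟨|C|, 0, fun n => by simp⟩

lemma PolyGrowth.linear : PolyGrowth fun n => 1 + |(n : ℝ)| := ⟨1, 1, fun n => by
  rw [abs_of_nonneg (by positivity)]; simp⟩

lemma PolyGrowth.mul {f g : ℤ → ℝ} (hf : PolyGrowth f) (hg : PolyGrowth g) :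
    PolyGrowth fun n => f n * g n := by
  obtain ⟨C, k, hC⟩ := hf
  obtain ⟨D, l, hD⟩ := hg
  refine ⟨C * D, k + l, fun n => ?_⟩
  rw [abs_mul, pow_add]
  calc _ ≤ (C * (1 + |(n : ℝ)|) ^ k) * (D * (1 + |(n : ℝ)|) ^ l) :=
        mul_le_mul (hC n) (hD n) (abs_nonneg _) ((abs_nonneg _).trans (hC n))
    _ = _ := by ring

lemma PolyGrowth.add {f g : ℤ → ℝ} (hf : PolyGrowth f) (hg : PolyGrowth g) :
    PolyGrowth fun n => f n + g n := by
  obtain ⟨C, k, hC⟩ := hf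
  obtain ⟨D, l, hD⟩ := hg
  refine ⟨|C| + |D|, k + l, fun n => (abs_add_le _ _).trans ?_⟩
  have h1 : (1 : ℝ) ≤ 1 + |(n : ℝ)| := by linarith [abs_nonneg (n : ℝ)]
  rw [add_mul]
  refine add_le_add ((hC n).trans ?_) ((hD n).trans ?_)
  · exact mul_le_mul (le_abs_self _) (pow_le_pow_right₀ h1 (by omega)) (by positivity)
      (abs_nonneg _)
  · exact mul_le_mul (le_abs_self _) (pow_le_pow_right₀ h1 (by omega)) (by positivity)
      (abs_nonneg _)

lemma PolyGrowth.pow {f : ℤ → ℝ} (hf : PolyGrowth f) (k : ℕ) : PolyGrowth fun n => f n ^ k := by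
  induction k with
  | zero => simpa using PolyGrowth.const 1
  | succ k ih =>
    simp only [pow_succ]
    exact ih.mul hf

lemma PolyGrowth.sum {ι : Type*} (s : Finset ι) {f : ι → ℤ → ℝ} (hf : ∀ i ∈ s, PolyGrowth (f i)) :
    PolyGrowth fun n => ∑ i ∈ s, f i n := by
  classical
  induction s using Finset.induction_on with
  | empty => simpa using PolyGrowth.const 0
  | insert i s hi ih =>
    simp only [Finset.sum_insert hi]
    exact (hf i (by simp)).add (ih fun j hj => hf j (by simp [hj]))

lemma PolyGrowth.comp_sub {f : ℤ → ℝ} (hf : PolyGrowth f) (m : ℤ) :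
    PolyGrowth fun n => f (n - m) := by
  obtain ⟨C, k, hC⟩ := hf
  refine PolyGrowth.of_le (g := fun n => |C| * ((1 + |(m : ℝ)|) * (1 + |(n : ℝ)|)) ^ k)
    ((PolyGrowth.const _).mul ((PolyGrowth.const _).mul PolyGrowth.linear |>.pow k)) fun n => ?_
  refine (hC _).trans ?_
  gcongr
  · exact le_abs_self _
  · push_cast
    have := abs_sub (n : ℝ) m
    nlinarith [abs_nonneg (n : ℝ), abs_nonneg (m : ℝ)]

lemma PolyGrowth.trigConv {H : Type*} [NormedAddCommGroup H] [InnerProductSpace ℂ H] {M : ℕ}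
    {f : ℤ → ℂ} {c : ℤ → H} (hc : PolyGrowth fun n => ‖c n‖) :
    PolyGrowth fun n => ‖trigConv M f c n‖ := by
  refine PolyGrowth.of_le (g := fun n => ∑ m ∈ Finset.Icc (-(M : ℤ)) M, ‖f m‖ * ‖c (n - m)‖)
    (PolyGrowth.sum _ fun m _ => (PolyGrowth.const _).mul (hc.comp_sub m)) fun n => ?_
  rw [abs_norm]
  exact (norm_sum_le _ _).trans_eq (Finset.sum_congr rfl fun m _ => norm_smul _ _)

lemma PolyGrowth.smul {H : Type*} [NormedAddCommGroup H] [InnerProductSpace ℂ H] {s : ℤ → ℂ}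
    {c : ℤ → H} (hs : PolyGrowth fun n => ‖s n‖) (hc : PolyGrowth fun n => ‖c n‖) :
    PolyGrowth fun n => ‖s n • c n‖ := by
  simp only [norm_smul]
  exact hs.mul hc

lemma PolyGrowth.affine (ω Ω : ℂ) : PolyGrowth fun n : ℤ => ‖ω + n * Ω‖ :=
  PolyGrowth.of_le (g := fun n => (‖ω‖ + ‖Ω‖) * (1 + |(n : ℝ)|))
    ((PolyGrowth.const _).mul PolyGrowth.linear) fun n => by
      rw [abs_norm]
      refine (norm_add_le _ _).trans ?_
      rw [norm_mul, Complex.norm_intCast]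
      nlinarith [norm_nonneg ω, norm_nonneg Ω, abs_nonneg (n : ℝ),
        mul_nonneg (norm_nonneg ω) (abs_nonneg (n : ℝ))]

lemma summable_coshWeight_mul {f : ℤ → ℝ} (hf : PolyGrowth f) {θ : ℝ} (hθ : 0 < θ) :
    Summable fun n => coshWeight θ n * f n := by
  obtain ⟨C, k, hC⟩ := hf
  have hnat : Summable fun n : ℕ => 2 * |C| * ((1 + (n : ℝ)) ^ k * Real.exp (-θ * n)) := by
    refine Summable.mul_left _ ?_
    have h1 := Real.summable_pow_mul_exp_neg_nat_mul k hθ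
    have h2 := (summable_nat_add_iff 1).2 h1
    refine (h2.mul_left (Real.exp θ)).congr fun n => ?_
    push_cast
    rw [mul_left_comm, ← Real.exp_add]
    ring_nf
  have key : ∀ n : ℤ, ‖coshWeight θ n * f n‖ ≤
      2 * |C| * ((1 + |(n : ℝ)|) ^ k * Real.exp (-θ * |(n : ℝ)|)) := fun n => by
    rw [norm_mul, Real.norm_of_nonneg (coshWeight_pos θ n).le, Real.norm_eq_abs]
    have h1 := coshWeight_le θ n
    rw [abs_mul, abs_of_pos hθ] at h1
    calc _ ≤ (2 * Real.exp (-(θ * |(n : ℝ)|))) * (|C| * (1 + |(n : ℝ)|) ^ k) := by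
          refine mul_le_mul h1 ((hC n).trans ?_) (abs_nonneg _) (by positivity)
          gcongr
          exact le_abs_self _
      _ = _ := by rw [neg_mul]; ring
  refine Summable.of_norm_bounded ?_ key
  refine Summable.of_nat_of_neg ?_ ?_
  · simpa using hnat
  · simpa using hnat

/-- The weighted `ℓ²` norm of a sequence of real numbers. -/
noncomputable def wnorm (θ : ℝ) (f : ℤ → ℝ) : ℝ := l2norm fun n => coshWeight θ n * f n

section Wnorm

variable {θ : ℝ} {f g : ℤ → ℝ}

lemma wnorm_nonneg (θ : ℝ) (f : ℤ → ℝ) : 0 ≤ wnorm θ f := l2norm_nonneg _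

lemma PolyGrowth.sqSummable (hf : PolyGrowth f) (hθ : 0 < θ) :
    SqSummable fun n => coshWeight θ n * f n :=
  SqSummable.of_summable_norm (summable_coshWeight_mul hf hθ).norm

lemma wnorm_mono (hθ : 0 < θ) (hg : PolyGrowth g) (h : ∀ n, |f n| ≤ g n) :
    wnorm θ f ≤ wnorm θ g := by
  have := l2norm_le_of_norm_le (c := fun n => coshWeight θ n * f n)
    (d := fun n => coshWeight θ n * g n) (hg.sqSummable hθ) zero_le_one fun n => by
      rw [one_mul, norm_mul, norm_mul]
      gcongr
      rw [Real.norm_eq_abs]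
      exact (h n).trans (le_abs_self _)
  simpa [wnorm] using this

lemma wnorm_add_le (hθ : 0 < θ) (hf : PolyGrowth f) (hg : PolyGrowth g) :
    wnorm θ (fun n => f n + g n) ≤ wnorm θ f + wnorm θ g := by
  have := l2norm_add_le (hf.sqSummable hθ) (hg.sqSummable hθ)
  simpa only [wnorm, mul_add] using this

lemma wnorm_const_mul {a : ℝ} (ha : 0 ≤ a) : wnorm θ (fun n => a * f n) = a * wnorm θ f := by
  have := l2norm_const_smul a (fun n => coshWeight θ n * f n)
  rw [Real.norm_of_nonneg ha] at this
  rw [wnorm, wnorm, ← this]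
  congr 1
  ext n
  simp only [smul_eq_mul]
  ring

lemma wnorm_sum_le {ι : Type*} (s : Finset ι) {f : ι → ℤ → ℝ} (hθ : 0 < θ)
    (hf : ∀ i ∈ s, PolyGrowth (f i)) :
    wnorm θ (fun n => ∑ i ∈ s, f i n) ≤ ∑ i ∈ s, wnorm θ (f i) := by
  have := l2norm_sum_le s fun i hi => (hf i hi).sqSummable hθ
  simpa only [wnorm, Finset.mul_sum] using this

variable {H : Type*} [NormedAddCommGroup H] [InnerProductSpace ℂ H] {c : ℤ → H}

lemma l2norm_weighted_eq (θ : ℝ) (c : ℤ → H) : l2norm (weighted θ c) = wnorm θ fun n => ‖c n‖ :=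
  l2norm_congr_norm fun n => by
    rw [norm_weighted, norm_mul, Real.norm_of_nonneg (coshWeight_pos θ n).le, norm_norm]

lemma PolyGrowth.sqSummable_weighted (hc : PolyGrowth fun n => ‖c n‖) (hθ : 0 < θ) :
    SqSummable (weighted θ c) :=
  (hc.sqSummable hθ).of_norm_le (K := 1) fun n => by
    rw [one_mul, norm_weighted, norm_mul, Real.norm_of_nonneg (coshWeight_pos θ n).le, norm_norm]

lemma wnorm_trigConv_le {M : ℕ} {f : ℤ → ℂ} {B : ℝ} (hf : ∀ t : ℝ, ‖trigPoly M f t‖ ≤ B)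
    (hθ : 0 < θ) (hθM : 2 * Real.exp 2 * (M + 1) * θ ≤ 1) (hc : PolyGrowth fun n => ‖c n‖) :
    wnorm θ (fun n => ‖trigConv M f c n‖) ≤ 2 * B * wnorm θ fun n => ‖c n‖ := by
  have hB : 0 ≤ B := (norm_nonneg _).trans (hf 0)
  have h0 : M * θ ≤ 1 := by
    have : 1 ≤ 2 * Real.exp 2 := by linarith [Real.add_one_le_exp 2]
    nlinarith [mul_nonneg (Nat.cast_nonneg (α := ℝ) M) hθ.le]
  have h1 := (l2norm_weighted_trigConv_le hf hθ.le h0 (hc.sqSummable_weighted hθ)).2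
  rw [l2norm_weighted_eq, l2norm_weighted_eq] at h1
  refine h1.trans (mul_le_mul_of_nonneg_right ?_ (wnorm_nonneg _ _))
  gcongr
  linarith

lemma le_wnorm_trigConv {M : ℕ} {f : ℤ → ℂ} {b B : ℝ} (hb : 0 ≤ b)
    (hf : ∀ t : ℝ, ‖trigPoly M f t‖ ≤ B) (hf' : ∀ t : ℝ, b ≤ ‖trigPoly M f t‖)
    (hθ : 0 < θ) (hθM : 2 * Real.exp 2 * (M + 1) * θ ≤ 1)
    (hθB : 2 * Real.exp 2 * (M + 1) * θ * B ≤ b / 2) (hc : PolyGrowth fun n => ‖c n‖) :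
    b / 2 * wnorm θ (fun n => ‖c n‖) ≤ wnorm θ fun n => ‖trigConv M f c n‖ := by
  have h0 : M * θ ≤ 1 := by
    have : 1 ≤ 2 * Real.exp 2 := by linarith [Real.add_one_le_exp 2]
    nlinarith [mul_nonneg (Nat.cast_nonneg (α := ℝ) M) hθ.le]
  have h1 := le_l2norm_weighted_trigConv hb hf hf' hθ.le h0 (hc.sqSummable_weighted hθ)
  rw [l2norm_weighted_eq, l2norm_weighted_eq] at h1
  refine le_trans (mul_le_mul_of_nonneg_right ?_ (wnorm_nonneg _ _)) h1
  linarith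

end Wnorm


/-! ### The weighted averages of a low-frequency mode -/

/-- The hypotheses on a single medium and a single mode from which an approximate Floquet solution
of the capacitance ODE is obtained: the harmonics `v` satisfy `ModeBounds` with constant `K`, the symbols of the modulation lie between
`b` and `B` in modulus, and in the norm with weight `1 / cosh (θ n)` the modes are concentrated on
the frequencies where `ω + n Ω` is small. The number `μ` measures all small quantities. -/
structure LowFrequencyBounds {N : ℕ} (G : Resonators N) (S : Medium N) (α : ℝ) (ω : ℂ)
    (v : ℤ → C(ℝ, ℂ)) (K b B θ μ : ℝ) : Prop where
  modeBounds : ModeBounds G S α ω v K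
  le_r : ∀ i, ∀ t : ℝ, b ≤ ‖trigPoly S.M (S.r i) t‖
  r_le : ∀ i, ∀ t : ℝ, ‖trigPoly S.M (S.r i) t‖ ≤ B
  le_k : ∀ i, ∀ t : ℝ, b ≤ ‖trigPoly S.M (S.k i) t‖
  k_le : ∀ i, ∀ t : ℝ, ‖trigPoly S.M (S.k i) t‖ ≤ B
  θ_pos : 0 < θ
  θ_le : 2 * Real.exp 2 * (S.M + 1) * θ ≤ 1
  θ_le' : 2 * Real.exp 2 * (S.M + 1) * θ * B ≤ b / 2
  θ_le_μ : 2 * Real.exp 2 * (S.M + 1) * θ * B ≤ μ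
  δ_le : S.δ ≤ μ
  μ_le_one : μ ≤ 1
  Ω_mul_le : S.Ω * (S.M + 1) ≤ 1
  polyGrowth : PolyGrowth fun n => cellNorm G.L (v n)
  low : wnorm θ (fun n => ‖ω + n * S.Ω‖ * cellNorm G.L (v n)) ≤
    μ * wnorm θ fun n => cellNorm G.L (v n)
  low_sq : wnorm θ (fun n => ‖ω + n * S.Ω‖ ^ 2 * cellNorm G.L (v n)) ≤
    μ * wnorm θ fun n => cellNorm G.L (v n)

namespace LowFrequencyBounds

variable {N : ℕ} {G : Resonators N} {S : Medium N} {α : ℝ} {ω : ℂ} {v : ℤ → C(ℝ, ℂ)}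
  {K b B θ μ : ℝ}

lemma norm_interior_growth (h : LowFrequencyBounds G S α ω v K b B θ μ) (i : Fin N) :
    PolyGrowth fun n => ‖resonatorL2 G i (v n)‖ :=
  h.polyGrowth.of_le fun n => by rw [abs_norm]; exact h.modeBounds.interiorNorm n i

lemma avg_growth (h : LowFrequencyBounds G S α ω v K b B θ μ) (i : Fin N) :
    PolyGrowth fun n => ‖resonatorAvg G i (v n)‖ :=
  ((PolyGrowth.const K).mul h.polyGrowth).of_le fun n => by
    rw [abs_norm]; exact h.modeBounds.avg n i

lemma inertia_growth (h : LowFrequencyBounds G S α ω v K b B θ μ) (i : Fin N) :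
    PolyGrowth fun n => ‖(ω + n * S.Ω) • trigConv S.M (S.k i)
      (fun n => (ω + n * S.Ω) • resonatorL2 G i (v n)) n‖ :=
  (PolyGrowth.affine ω S.Ω).smul
    (PolyGrowth.trigConv ((PolyGrowth.affine ω S.Ω).smul (h.norm_interior_growth i)))

/-- The inertial term in the resonators is small, by the Leibniz rule for the multiplication with
`ω + n Ω` and Bernstein's inequality. -/
lemma wnorm_inertia_le (h : LowFrequencyBounds G S α ω v K b B θ μ) (i : Fin N) :
    wnorm θ (fun n => ‖(ω + n * S.Ω) • trigConv S.M (S.k i)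
      (fun n => (ω + n * S.Ω) • resonatorL2 G i (v n)) n‖) ≤
      8 * B * μ * wnorm θ fun n => cellNorm G.L (v n) := by
  set A := wnorm θ fun n => cellNorm G.L (v n) with hA
  have hA0 : 0 ≤ A := wnorm_nonneg _ _
  have hB : 0 ≤ B := (norm_nonneg _).trans (h.k_le i 0)
  have hμ : 0 ≤ μ := S.δ_pos.le.trans h.δ_le
  have hs := PolyGrowth.affine ω S.Ω
  have hX := h.norm_interior_growth i
  have g1 := hs.smul hX
  have g2 := hs.smul g1
  have hk' := norm_trigPoly_mul_int_le (h.k_le i)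
  have a1 := wnorm_trigConv_le (h.k_le i) h.θ_pos h.θ_le g2
  have a2 := wnorm_trigConv_le hk' h.θ_pos h.θ_le g1
  have b1 : wnorm θ (fun n => ‖(ω + n * S.Ω) • (ω + n * S.Ω) • resonatorL2 G i (v n)‖) ≤ μ * A := by
    refine (wnorm_mono h.θ_pos ((hs.pow 2).mul h.polyGrowth) fun n => ?_).trans h.low_sq
    rw [abs_norm, norm_smul, norm_smul, sq, mul_assoc]
    gcongr
    exact h.modeBounds.interiorNorm n i
  have b2 : wnorm θ (fun n => ‖(ω + n * S.Ω) • resonatorL2 G i (v n)‖) ≤ μ * A := by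
    refine (wnorm_mono h.θ_pos (hs.mul h.polyGrowth) fun n => ?_).trans h.low
    rw [abs_norm, norm_smul]
    gcongr
    exact h.modeBounds.interiorNorm n i
  have key := wnorm_mono (f := fun n => ‖(ω + n * S.Ω) • trigConv S.M (S.k i)
      (fun n => (ω + n * S.Ω) • resonatorL2 G i (v n)) n‖) h.θ_pos
    (g2.trigConv.add ((PolyGrowth.const S.Ω).mul (PolyGrowth.trigConv g1))) fun n => by
      rw [abs_norm, smul_trigConv]
      refine (norm_add_le _ _).trans (add_le_add_right ?_ _)
      rw [norm_smul, Complex.norm_real, Real.norm_of_nonneg S.Ω_pos.le]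
  refine key.trans ((wnorm_add_le h.θ_pos g2.trigConv ((PolyGrowth.const S.Ω).mul
    (PolyGrowth.trigConv g1))).trans ?_)
  rw [wnorm_const_mul S.Ω_pos.le]
  have e1 : Real.exp 1 ≤ 3 := Real.exp_one_lt_d9.le.trans (by norm_num)
  have c2 : S.Ω * (2 * (Real.exp 1 * (S.M + 1) * B)) ≤ 6 * B := by
    calc _ = (S.Ω * (S.M + 1)) * (2 * Real.exp 1 * B) := by ring
      _ ≤ 1 * (2 * 3 * B) := by
        gcongr
        exact h.Ω_mul_le
      _ = _ := by ring
  have hμA : 0 ≤ μ * A := by positivity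
  have w2 := wnorm_nonneg θ (fun n => ‖(ω + n * S.Ω) • resonatorL2 G i (v n)‖)
  calc _ ≤ 2 * B * (μ * A) + 6 * B * (μ * A) := by
        refine add_le_add (a1.trans (by gcongr)) ?_
        calc _ ≤ S.Ω * (2 * (Real.exp 1 * (S.M + 1) * B) * (μ * A)) := by
              refine mul_le_mul_of_nonneg_left (a2.trans ?_) S.Ω_pos.le
              gcongr
          _ = (S.Ω * (2 * (Real.exp 1 * (S.M + 1) * B))) * (μ * A) := by ring
          _ ≤ _ := by gcongr
    _ = _ := by ring

/-- The bound for the convolved deviations from the averages. -/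
noncomputable def defect (G : Resonators N) (S : Medium N) (ω : ℂ) (v : ℤ → C(ℝ, ℂ)) (K : ℝ)
    (i : Fin N) (n : ℤ) : ℝ :=
  K * (S.δ * ((1 + ‖ω + n * S.Ω‖ ^ 2) * cellNorm G.L (v n)) + ‖(ω + n * S.Ω) •
        trigConv S.M (S.k i) (fun n => (ω + n * S.Ω) • resonatorL2 G i (v n)) n‖)

lemma defect_growth (h : LowFrequencyBounds G S α ω v K b B θ μ) (i : Fin N) :
    PolyGrowth (defect G S ω v K i) :=
  (PolyGrowth.const K).mul (((PolyGrowth.const _).mul (((PolyGrowth.const 1).add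
    ((PolyGrowth.affine ω S.Ω).pow 2)).mul h.polyGrowth)).add (h.inertia_growth i))

lemma wnorm_defect_le (h : LowFrequencyBounds G S α ω v K b B θ μ) (hK : 0 ≤ K) (i : Fin N) :
    wnorm θ (defect G S ω v K i) ≤
      K * (2 + 8 * B) * μ * wnorm θ fun n => cellNorm G.L (v n) := by
  set A := wnorm θ fun n => cellNorm G.L (v n) with hA
  have hA0 : 0 ≤ A := wnorm_nonneg _ _
  have hμ : 0 ≤ μ := S.δ_pos.le.trans h.δ_le
  have g1 : PolyGrowth fun n => ‖ω + n * S.Ω‖ ^ 2 * cellNorm G.L (v n) :=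
    ((PolyGrowth.affine ω S.Ω).pow 2).mul h.polyGrowth
  unfold defect
  have e : ∀ n : ℤ, (1 + ‖ω + n * S.Ω‖ ^ 2) * cellNorm G.L (v n) =
    cellNorm G.L (v n) + ‖ω + n * S.Ω‖ ^ 2 * cellNorm G.L (v n) := fun n => by ring
  simp only [e]
  rw [wnorm_const_mul hK]
  have s1 := wnorm_add_le h.θ_pos (((PolyGrowth.const S.δ).mul (h.polyGrowth.add g1)))
    (h.inertia_growth i)
  rw [wnorm_const_mul S.δ_pos.le] at s1
  have s2 := wnorm_add_le h.θ_pos h.polyGrowth g1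
  have s3 : S.δ * wnorm θ (fun n => cellNorm G.L (v n) +
      ‖ω + n * S.Ω‖ ^ 2 * cellNorm G.L (v n)) ≤ μ * (2 * A) := by
    refine mul_le_mul h.δ_le (s2.trans ?_) (wnorm_nonneg _ _) hμ
    have := h.low_sq
    nlinarith [h.μ_le_one]
  have s4 := h.wnorm_inertia_le i
  rw [mul_assoc, mul_assoc]
  refine mul_le_mul_of_nonneg_left ?_ hK
  rw [← hA] at s4
  linarith

/-- The modes are almost constant at each point of the resonators. -/
lemma wnorm_deviation_le (h : LowFrequencyBounds G S α ω v K b B θ μ) (hb : 0 < b) (hK : 0 ≤ K)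
    (i : Fin N) {x : ℝ} (hx : x ∈ Set.Icc (G.left (i : ℕ)) (G.right (i : ℕ)))
    (hv : PolyGrowth fun n => ‖v n x‖) :
    wnorm θ (fun n => ‖v n x - resonatorAvg G i (v n)‖) ≤
      2 / b * (K * (2 + 8 * B)) * μ * wnorm θ fun n => cellNorm G.L (v n) := by
  have hg : PolyGrowth fun n => ‖v n x - resonatorAvg G i (v n)‖ :=
    (hv.add (h.avg_growth i)).of_le fun n => by
      rw [abs_norm]
      exact norm_sub_le _ _
  have h1 := le_wnorm_trigConv hb.le (h.r_le i) (h.le_r i) h.θ_pos h.θ_le h.θ_le' hg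
  have h2 := wnorm_mono (f := fun n => ‖trigConv S.M (S.r i)
    (fun n => v n x - resonatorAvg G i (v n)) n‖) h.θ_pos (h.defect_growth i) fun n => by
      rw [abs_norm]
      exact h.modeBounds.interior n i x hx
  have h3 := h1.trans (h2.trans (h.wnorm_defect_le hK i))
  calc _ = 2 / b * (b / 2 * wnorm θ (fun n => ‖v n x - resonatorAvg G i (v n)‖)) := by
        field_simp
    _ ≤ 2 / b * (K * (2 + 8 * B) * μ * wnorm θ fun n => cellNorm G.L (v n)) := by gcongr
    _ = _ := by ring

lemma left_growth (h : LowFrequencyBounds G S α ω v K b B θ μ) (i : Fin N) :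
    PolyGrowth fun n => ‖v n (G.left (i : ℕ))‖ :=
  ((PolyGrowth.const K).mul (((PolyGrowth.const 1).add
    ((PolyGrowth.affine ω S.Ω).pow 2)).mul h.polyGrowth)).of_le fun n => by
      rw [abs_norm]; exact h.modeBounds.left n i

lemma right_growth (h : LowFrequencyBounds G S α ω v K b B θ μ) (i : Fin N) :
    PolyGrowth fun n => ‖v n (G.right (i : ℕ))‖ :=
  ((PolyGrowth.const K).mul (((PolyGrowth.const 1).add
    ((PolyGrowth.affine ω S.Ω).pow 2)).mul h.polyGrowth)).of_le fun n => by
      rw [abs_norm]; exact h.modeBounds.right n i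

lemma wnorm_left_le (h : LowFrequencyBounds G S α ω v K b B θ μ) (hb : 0 < b) (hK : 0 ≤ K)
    (i : Fin N) : wnorm θ (fun n => ‖v n (G.left (i : ℕ)) - resonatorAvg G i (v n)‖) ≤
      2 / b * (K * (2 + 8 * B)) * μ * wnorm θ fun n => cellNorm G.L (v n) :=
  h.wnorm_deviation_le hb hK i (Set.left_mem_Icc.2 (G.left_lt_right _).le) (h.left_growth i)

lemma wnorm_right_le (h : LowFrequencyBounds G S α ω v K b B θ μ) (hb : 0 < b) (hK : 0 ≤ K)
    (i : Fin N) : wnorm θ (fun n => ‖v n (G.right (i : ℕ)) - resonatorAvg G i (v n)‖) ≤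
      2 / b * (K * (2 + 8 * B)) * μ * wnorm θ fun n => cellNorm G.L (v n) :=
  h.wnorm_deviation_le hb hK i (Set.right_mem_Icc.2 (G.left_lt_right _).le) (h.right_growth i)

lemma deviationL2_growth (h : LowFrequencyBounds G S α ω v K b B θ μ) (i : Fin N) :
    PolyGrowth fun n => ‖resonatorL2 G i (v n) - resonatorAvg G i (v n) • resonatorL2 G i 1‖ :=
  ((h.norm_interior_growth i).add ((h.avg_growth i).mul
    (PolyGrowth.const ‖resonatorL2 G i 1‖))).of_le fun n => by
      rw [abs_norm, ← norm_smul]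
      exact norm_sub_le _ _

/-- The modes are almost constant in the resonators in the sense of `L²`. -/
lemma wnorm_deviationL2_le (h : LowFrequencyBounds G S α ω v K b B θ μ) (hb : 0 < b) (hK : 0 ≤ K)
    (i : Fin N) : wnorm θ (fun n =>
      ‖resonatorL2 G i (v n) - resonatorAvg G i (v n) • resonatorL2 G i 1‖) ≤
      √(G.len (i : ℕ)) * (2 / b * (K * (2 + 8 * B)) * μ *
        wnorm θ fun n => cellNorm G.L (v n)) := by
  have h1 := le_wnorm_trigConv hb.le (h.r_le i) (h.le_r i) h.θ_pos h.θ_le h.θ_le'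
    (h.deviationL2_growth i)
  have hE : ∀ n, 0 ≤ defect G S ω v K i n := fun n => by
    have := S.δ_pos
    have := Real.sqrt_nonneg (∫ x in (0 : ℝ)..G.L, ‖v n x‖ ^ 2)
    unfold defect cellNorm
    positivity
  have h2 := wnorm_mono (f := fun n => ‖trigConv S.M (S.r i) (fun n =>
      resonatorL2 G i (v n) - resonatorAvg G i (v n) • resonatorL2 G i 1) n‖) h.θ_pos
    ((PolyGrowth.const √(G.len (i : ℕ))).mul (h.defect_growth i)) fun n => by
      rw [abs_norm]
      have e : (fun n => resonatorL2 G i (v n) - resonatorAvg G i (v n) • resonatorL2 G i 1) =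
          fun n => resonatorL2 G i (v n - resonatorAvg G i (v n) • (1 : C(ℝ, ℂ))) := by
        ext n
        rw [map_sub, map_smul]
      rw [e, ← map_trigConv (resonatorL2 G i) _ _
        (fun n => v n - resonatorAvg G i (v n) • (1 : C(ℝ, ℂ)))]
      refine norm_toIntervalL2_le (G.left_lt_right _).le _ (hE n) fun x hx => ?_
      rw [trigConv_apply]
      simpa [defect] using h.modeBounds.interior n i x hx
  rw [wnorm_const_mul (Real.sqrt_nonneg _)] at h2
  have h3 := h1.trans (h2.trans (mul_le_mul_of_nonneg_left (h.wnorm_defect_le hK i)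
    (Real.sqrt_nonneg _)))
  calc _ = 2 / b * (b / 2 * wnorm θ (fun n =>
        ‖resonatorL2 G i (v n) - resonatorAvg G i (v n) • resonatorL2 G i 1‖)) := by
        field_simp
    _ ≤ 2 / b * (√(G.len (i : ℕ)) * (K * (2 + 8 * B) * μ *
        wnorm θ fun n => cellNorm G.L (v n))) := by gcongr
    _ = _ := by ring

lemma ends_growth (h : LowFrequencyBounds G S α ω v K b B θ μ) (i : Fin N) :
    PolyGrowth fun n => ‖v n (G.left (i : ℕ)) - resonatorAvg G i (v n)‖ +
      ‖v n (G.right (i : ℕ)) - resonatorAvg G i (v n)‖ :=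
  (((h.left_growth i).add (h.avg_growth i)).add ((h.right_growth i).add (h.avg_growth i))).of_le
    fun n => by
      rw [abs_of_nonneg (by positivity)]
      exact add_le_add (norm_sub_le _ _) (norm_sub_le _ _)

/-- The error terms of the balance of fluxes are small. -/
lemma wnorm_ends_le (h : LowFrequencyBounds G S α ω v K b B θ μ) (hb : 0 < b) (hK : 0 ≤ K) :
    wnorm θ (fun n => ‖ω + n * S.Ω‖ ^ 2 * cellNorm G.L (v n) + ∑ j : Fin N,
        (‖v n (G.left (j : ℕ)) - resonatorAvg G j (v n)‖ +
          ‖v n (G.right (j : ℕ)) - resonatorAvg G j (v n)‖)) ≤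
      (1 + N * (2 * (2 / b * (K * (2 + 8 * B))))) * μ * wnorm θ fun n => cellNorm G.L (v n) := by
  set A := wnorm θ fun n => cellNorm G.L (v n) with hA
  have g1 : PolyGrowth fun n => ‖ω + n * S.Ω‖ ^ 2 * cellNorm G.L (v n) :=
    ((PolyGrowth.affine ω S.Ω).pow 2).mul h.polyGrowth
  refine (wnorm_add_le h.θ_pos g1 (PolyGrowth.sum _ fun j _ => h.ends_growth j)).trans ?_
  have h2 : wnorm θ (fun n => ∑ j : Fin N,
      (‖v n (G.left (j : ℕ)) - resonatorAvg G j (v n)‖ +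
        ‖v n (G.right (j : ℕ)) - resonatorAvg G j (v n)‖)) ≤
      ∑ j : Fin N, 2 * (2 / b * (K * (2 + 8 * B)) * μ * A) := by
    refine (wnorm_sum_le _ h.θ_pos fun j _ => h.ends_growth j).trans
      (Finset.sum_le_sum fun j _ => ?_)
    refine (wnorm_add_le h.θ_pos (((h.left_growth j).add (h.avg_growth j)).of_le fun n => by
      rw [abs_norm]; exact norm_sub_le _ _) (((h.right_growth j).add (h.avg_growth j)).of_le
      fun n => by rw [abs_norm]; exact norm_sub_le _ _)).trans ?_
    linarith [h.wnorm_left_le hb hK j, h.wnorm_right_le hb hK j]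
  rw [Finset.sum_const, Finset.card_univ, Fintype.card_fin, nsmul_eq_mul] at h2
  calc _ ≤ μ * A + N * (2 * (2 / b * (K * (2 + 8 * B)) * μ * A)) := add_le_add h.low_sq h2
    _ = _ := by ring

/-- The modes are controlled by their averages over the resonators. -/
lemma wnorm_cell_le (h : LowFrequencyBounds G S α ω v K b B θ μ) (hb : 0 < b) (hK : 0 ≤ K) {l : ℝ}
    (hl : ∀ i : Fin N, √(G.len (i : ℕ)) ≤ l)
    (hμ : K * ((1 + N * ((2 + l) * (2 / b * (K * (2 + 8 * B))))) * μ) ≤ 1 / 2) :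
    wnorm θ (fun n => cellNorm G.L (v n)) ≤
      2 * K * ∑ j, wnorm θ fun n => ‖resonatorAvg G j (v n)‖ := by
  set A := wnorm θ fun n => cellNorm G.L (v n) with hA
  have hA0 : 0 ≤ A := wnorm_nonneg _ _
  set P : ℝ := 2 / b * (K * (2 + 8 * B)) with hP
  have hends : wnorm θ (fun n => ‖ω + n * S.Ω‖ ^ 2 * cellNorm G.L (v n) + ∑ j : Fin N,
        (‖v n (G.left (j : ℕ)) - resonatorAvg G j (v n)‖ +
          ‖v n (G.right (j : ℕ)) - resonatorAvg G j (v n)‖)) ≤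
      (1 + N * (2 * P)) * μ * A := h.wnorm_ends_le hb hK
  have g1 : PolyGrowth fun n => ‖ω + n * S.Ω‖ ^ 2 * cellNorm G.L (v n) :=
    ((PolyGrowth.affine ω S.Ω).pow 2).mul h.polyGrowth
  have gE := g1.add (PolyGrowth.sum Finset.univ fun j _ => h.ends_growth j)
  have gV := PolyGrowth.sum Finset.univ fun j _ => h.avg_growth j
  have gD := PolyGrowth.sum Finset.univ fun j _ => h.deviationL2_growth j
  have h1 := wnorm_mono (f := fun n => cellNorm G.L (v n)) h.θ_pos
    ((PolyGrowth.const K).mul (gE.add (gV.add gD))) fun n => by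
      rw [abs_of_nonneg (show 0 ≤ cellNorm _ _ from Real.sqrt_nonneg _)]
      refine (h.modeBounds.cell n).trans_eq ?_
      simp only [Finset.sum_add_distrib]
      ring
  rw [wnorm_const_mul hK] at h1
  have h2 := wnorm_add_le h.θ_pos gE (gV.add gD)
  have h3 := wnorm_add_le h.θ_pos gV gD
  have h4 := wnorm_sum_le Finset.univ h.θ_pos fun j _ => h.avg_growth j
  have h5 : wnorm θ (fun n => ∑ j : Fin N,
      ‖resonatorL2 G j (v n) - resonatorAvg G j (v n) • resonatorL2 G j 1‖) ≤
      N * (l * (P * μ * A)) := by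
    refine (wnorm_sum_le _ h.θ_pos fun j _ => h.deviationL2_growth j).trans ?_
    have : ∀ j : Fin N, wnorm θ (fun n =>
        ‖resonatorL2 G j (v n) - resonatorAvg G j (v n) • resonatorL2 G j 1‖) ≤
        l * (P * μ * A) := fun j => by
      refine (h.wnorm_deviationL2_le hb hK j).trans
        (mul_le_mul_of_nonneg_right (hl j) ?_)
      have hB : 0 ≤ B := (norm_nonneg _).trans (h.k_le j 0)
      have hμ : 0 ≤ μ := S.δ_pos.le.trans h.δ_le
      positivity
    refine (Finset.sum_le_sum fun j _ => this j).trans_eq ?_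
    rw [Finset.sum_const, Finset.card_univ, Fintype.card_fin, nsmul_eq_mul]
  have h6 : A ≤ K * (∑ j, wnorm θ fun n => ‖resonatorAvg G j (v n)‖) +
      K * ((1 + N * ((2 + l) * P)) * μ) * A := by
    refine h1.trans ?_
    calc _ ≤ K * ((1 + N * (2 * P)) * μ * A +
          ((∑ j, wnorm θ fun n => ‖resonatorAvg G j (v n)‖) + N * (l * (P * μ * A)))) := by
          refine mul_le_mul_of_nonneg_left ?_ hK
          linarith
      _ = _ := by ring
  nlinarith [mul_le_mul_of_nonneg_right hμ hA0]

end LowFrequencyBounds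

/-- The coefficient of the inertial term of the capacitance ODE for the resonator `i` in the
rescaled time `τ = Ω t`. -/
noncomputable def odeMass {N : ℕ} (G : Resonators N) (S : Medium N) (i : Fin N) : ℝ :=
  G.len (i : ℕ) * S.Ω ^ 2 / (S.δ * S.vr ^ 2)

lemma odeMass_pos {N : ℕ} (G : Resonators N) (S : Medium N) (i : Fin N) : 0 < odeMass G S i := by
  have h1 := G.len_pos (i : ℕ)
  have h2 := S.Ω_pos
  have h3 := S.δ_pos
  have h4 := S.vr_pos
  unfold odeMass
  positivity

/-- Fourier coefficients `y`, `q` of an approximate Floquet solution, with Floquet exponent `σ` and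
with residuals of relative size `ε`, of the capacitance ODE in the rescaled time, written as a first
order system for `y` and `q`, where `q` is the product of `odeMass / κ` and `-i y'`. -/
structure IsApproxFloquet {N : ℕ} (G : Resonators N) (S : Medium N) (α : ℝ) (σ : ℂ)
    (y q : Fin N → ℤ → ℂ) (ε : ℝ) : Prop where
  summable_y : ∀ i, Summable fun n : ℤ => (1 + |(n : ℝ)|) * ‖y i n‖
  summable_q : ∀ i, Summable fun n : ℤ => (1 + |(n : ℝ)|) * ‖q i n‖
  pos : 0 < ∑ i, (l2norm (y i) + l2norm (q i))
  flux : ∀ i, l2norm (fun n : ℤ => ∑ j, capacitanceMatrix G α i j * y j n - (σ + n) * q i n) ≤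
    ε * ∑ i, (l2norm (y i) + l2norm (q i))
  velocity : ∀ i, l2norm (fun n : ℤ => (odeMass G S i : ℂ)⁻¹ * q i n -
    trigConv S.M (S.k i) (fun n : ℤ => (σ + n) * y i n) n) ≤
    ε * ∑ i, (l2norm (y i) + l2norm (q i))

namespace LowFrequencyBounds

variable {N : ℕ} {G : Resonators N} {S : Medium N} {α : ℝ} {ω : ℂ} {v : ℤ → C(ℝ, ℂ)}
  {K b B θ μ : ℝ}

/-- The weighted averages of the mode over the resonators are an approximate Floquet solution of
the capacitance ODE. -/
lemma exists_isApproxFloquet (h : LowFrequencyBounds G S α ω v K b B θ μ) (hb : 0 < b) (hK : 0 ≤ K)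
    {l lam : ℝ} (hl : ∀ i : Fin N, √(G.len (i : ℕ)) ≤ l) (hlam : 0 < lam)
    (hlam' : ∀ i, lam ≤ odeMass G S i)
    (hμ : K * ((1 + N * ((2 + l) * (2 / b * (K * (2 + 8 * B))))) * μ) ≤ 1 / 2)
    (hA : 0 < wnorm θ fun n => cellNorm G.L (v n)) :
    ∃ y q, IsApproxFloquet G S α (ω / S.Ω) y q
      ((2 * K ^ 2 * (1 + N * (2 * (2 / b * (K * (2 + 8 * B))))) + 2 / b / lam) * μ) := by
  have hμ0 : 0 ≤ μ := S.δ_pos.le.trans h.δ_le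
  have hΩ : (S.Ω : ℂ) ≠ 0 := Complex.ofReal_ne_zero.2 S.Ω_pos.ne'
  set σ : ℂ := ω / S.Ω with hσ
  have hs : ∀ n : ℤ, ω + n * S.Ω = S.Ω * (σ + n) := fun n => by
    rw [hσ]; field_simp
  set V : Fin N → ℤ → ℂ := fun i n => resonatorAvg G i (v n) with hV
  have hgV : ∀ i, PolyGrowth fun n => ‖V i n‖ := h.avg_growth
  have hD : PolyGrowth fun n : ℤ => ‖σ + n‖ := by simpa using PolyGrowth.affine σ 1
  have hgDV : ∀ i, PolyGrowth fun n : ℤ => ‖(σ + n) * V i n‖ := fun i => hD.smul (hgV i)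
  have hgk : ∀ i, PolyGrowth fun n => ‖trigConv S.M (S.k i) (fun n : ℤ => (σ + n) * V i n) n‖ :=
    fun i => (hgDV i).trigConv
  set y : Fin N → ℤ → ℂ := fun i => weighted θ (V i) with hy
  set q : Fin N → ℤ → ℂ := fun i n => (odeMass G S i : ℂ) *
    weighted θ (trigConv S.M (S.k i) (fun n : ℤ => (σ + n) * V i n)) n with hq
  set A := wnorm θ fun n => cellNorm G.L (v n) with hAdef
  set P : ℝ := 2 / b * (K * (2 + 8 * B)) with hP
  have hA2 : A ≤ 2 * K * ∑ j, l2norm (y j) := by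
    have := h.wnorm_cell_le hb hK hl hμ
    refine this.trans_eq ?_
    congr 1
    exact Finset.sum_congr rfl fun j _ => (l2norm_weighted_eq θ (V j)).symm
  have hqn : ∀ i, l2norm (q i) = odeMass G S i *
      wnorm θ (fun n => ‖trigConv S.M (S.k i) (fun n : ℤ => (σ + n) * V i n) n‖) := fun i => by
    rw [← l2norm_weighted_eq]
    have := l2norm_const_smul (odeMass G S i : ℂ)
      (weighted θ (trigConv S.M (S.k i) (fun n : ℤ => (σ + n) * V i n)))
    rwa [Complex.norm_real, Real.norm_of_nonneg (odeMass_pos G S i).le] at this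
  have hyY : ∑ j, l2norm (y j) ≤ ∑ i, (l2norm (y i) + l2norm (q i)) :=
    Finset.sum_le_sum fun i _ => le_add_of_nonneg_right (l2norm_nonneg _)
  have hqY : ∀ i, l2norm (q i) ≤ ∑ i, (l2norm (y i) + l2norm (q i)) := fun i =>
    (le_add_of_nonneg_left (l2norm_nonneg (y i))).trans
      (Finset.single_le_sum (f := fun i => l2norm (y i) + l2norm (q i))
        (fun i _ => add_nonneg (l2norm_nonneg _) (l2norm_nonneg _)) (Finset.mem_univ i))
  set Y := ∑ i, (l2norm (y i) + l2norm (q i)) with hYdef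
  have hAY : A ≤ 2 * K * Y := hA2.trans (mul_le_mul_of_nonneg_left hyY (by positivity))
  have hYpos : 0 < Y := by
    by_contra hcon
    have : 2 * K * Y ≤ 0 := mul_nonpos_of_nonneg_of_nonpos (by positivity) (not_lt.1 hcon)
    linarith
  have hsum : ∀ {f : ℤ → ℂ}, PolyGrowth (fun n => ‖f n‖) →
      Summable fun n : ℤ => (1 + |(n : ℝ)|) * ‖weighted θ f n‖ := fun hf => by
    refine (summable_coshWeight_mul (PolyGrowth.linear.mul hf) h.θ_pos).congr fun n => ?_
    rw [norm_weighted]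
    ring
  by_cases hN : IsEmpty (Fin N)
  · rw [hYdef, Finset.univ_eq_empty, Finset.sum_empty] at hYpos
    exact absurd hYpos (lt_irrefl _)
  rw [not_isEmpty_iff] at hN
  have hB : 0 ≤ B := (norm_nonneg _).trans (h.k_le hN.some 0)
  have hP0 : 0 ≤ P := by positivity
  refine ⟨y, q, fun i => hsum (hgV i), fun i => ?_, hYpos, fun i => ?_, fun i => ?_⟩
  · refine ((hsum (hgk i)).mul_left (odeMass G S i)).congr fun n => ?_
    rw [hq, norm_mul, Complex.norm_real, Real.norm_of_nonneg (odeMass_pos G S i).le]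
    ring
  · -- the balance of fluxes
    choose J hJ1 hJ2 using fun n => h.modeBounds.balance n i
    have e : ∀ n : ℤ, ∑ j, capacitanceMatrix G α i j * y j n - (σ + n) * q i n =
        weighted θ (fun n => J n + ∑ j, capacitanceMatrix G α i j * V j n) n := fun n => by
      have hδ : (S.δ : ℂ) ≠ 0 := Complex.ofReal_ne_zero.2 S.δ_pos.ne'
      have e1 : J n = -((odeMass G S i : ℂ) * ((σ + n) *
          trigConv S.M (S.k i) (fun n : ℤ => (σ + n) * V i n) n)) := by
        have e2 : trigConv S.M (S.k i) (fun n : ℤ => (ω + n * S.Ω) * resonatorAvg G i (v n)) n =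
            S.Ω * trigConv S.M (S.k i) (fun n : ℤ => (σ + n) * V i n) n := by
          rw [← smul_eq_mul (S.Ω : ℂ), ← trigConv_const_smul]
          congr 1
          ext n
          rw [hs, smul_eq_mul]
          ring
        have e3 := hJ1 n
        rw [e2, hs] at e3
        refine mul_left_cancel₀ hδ (e3.trans ?_)
        rw [odeMass]
        push_cast
        have hvr : (S.vr : ℂ) ≠ 0 := Complex.ofReal_ne_zero.2 S.vr_pos.ne'
        field_simp
      have e4 : ∑ j, capacitanceMatrix G α i j * y j n =
          coshWeight θ n * ∑ j, capacitanceMatrix G α i j * V j n := by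
        rw [Finset.mul_sum]
        exact Finset.sum_congr rfl fun j _ => by simp only [hy, weighted, smul_eq_mul]; ring
      simp only [weighted, smul_eq_mul, e1, e4, hq]
      ring
    simp only [e]
    rw [l2norm_weighted_eq]
    have gE := (((PolyGrowth.affine ω S.Ω).pow 2).mul h.polyGrowth).add
      (PolyGrowth.sum Finset.univ fun j _ => h.ends_growth j)
    refine (wnorm_mono h.θ_pos ((PolyGrowth.const K).mul gE) fun n => ?_).trans ?_
    · rw [abs_norm]
      exact hJ2 n
    rw [wnorm_const_mul hK]
    calc _ ≤ K * ((1 + N * (2 * P)) * μ * (2 * K * Y)) := by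
          refine mul_le_mul_of_nonneg_left ((h.wnorm_ends_le hb hK).trans ?_) hK
          gcongr
      _ = (2 * K ^ 2 * (1 + N * (2 * P))) * μ * Y := by ring
      _ ≤ _ := by
          gcongr
          exact le_add_of_nonneg_right (by positivity)
  · -- the weights almost commute with the convolution
    have hlm : (odeMass G S i : ℂ) ≠ 0 := Complex.ofReal_ne_zero.2 (odeMass_pos G S i).ne'
    have e : ∀ n : ℤ, (odeMass G S i : ℂ)⁻¹ * q i n -
        trigConv S.M (S.k i) (fun n : ℤ => (σ + n) * y i n) n =
        weighted θ (trigConv S.M (S.k i) (fun n : ℤ => (σ + n) * V i n)) n -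
        trigConv S.M (S.k i) (weighted θ fun n : ℤ => (σ + n) * V i n) n := fun n => by
      simp only [hq, inv_mul_cancel_left₀ hlm]
      congr 3
      ext m
      simp only [hy, weighted, smul_eq_mul]
      ring
    simp only [e]
    have hMθ : S.M * θ ≤ 1 := by
      have h1 : 1 ≤ 2 * Real.exp 2 := by linarith [Real.add_one_le_exp 2]
      have h2 := h.θ_le
      nlinarith [mul_nonneg (Nat.cast_nonneg (α := ℝ) S.M) h.θ_pos.le, h.θ_pos]
    refine (l2norm_weighted_trigConv_sub_le (h.k_le i) h.θ_pos.le hMθ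
      ((hgDV i).sqSummable_weighted h.θ_pos)).2.trans ?_
    have h1 := le_wnorm_trigConv hb.le (h.k_le i) (h.le_k i) h.θ_pos h.θ_le h.θ_le' (hgDV i)
    rw [l2norm_weighted_eq]
    have h2 : lam * wnorm θ (fun n => ‖trigConv S.M (S.k i)
        (fun n : ℤ => (σ + n) * V i n) n‖) ≤ Y :=
      (mul_le_mul_of_nonneg_right (hlam' i) (wnorm_nonneg _ _)).trans
        ((hqn i).symm.le.trans (hqY i))
    have h3 : wnorm θ (fun n : ℤ => ‖(σ + n) * V i n‖) ≤ 2 / b / lam * Y := by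
      calc _ = 2 / b / lam * (lam * (b / 2 * wnorm θ (fun n : ℤ => ‖(σ + n) * V i n‖))) := by
            field_simp
        _ ≤ 2 / b / lam * Y := by
            refine mul_le_mul_of_nonneg_left (le_trans ?_ h2) (by positivity)
            exact mul_le_mul_of_nonneg_left h1 hlam.le
    calc _ ≤ μ * (2 / b / lam * Y) := mul_le_mul h.θ_le_μ h3 (wnorm_nonneg _ _) hμ0
      _ = (2 / b / lam) * μ * Y := by ring
      _ ≤ _ := by
        gcongr
        exact le_add_of_nonneg_left (by positivity)

end LowFrequencyBounds


/-! ### Absolutely convergent Fourier series -/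

/-- The sum `∑ c_n e^{inτ}` of a Fourier series. -/
noncomputable def fourierSum (c : ℤ → ℂ) (τ : ℝ) : ℂ :=
  ∑' n : ℤ, Complex.exp (Complex.I * n * τ) * c n

lemma norm_exp_int_mul (n : ℤ) (τ : ℝ) : ‖Complex.exp (Complex.I * n * τ)‖ = 1 := by
  have : Complex.I * n * τ = ((n * τ : ℝ) : ℂ) * Complex.I := by push_cast; ring
  rw [this, Complex.norm_exp_ofReal_mul_I]

lemma hasSum_fourierSum {c : ℤ → ℂ} (hc : Summable fun n => ‖c n‖) (τ : ℝ) :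
    HasSum (fun n : ℤ => Complex.exp (Complex.I * n * τ) * c n) (fourierSum c τ) :=
  (Summable.of_norm (hc.congr fun n => by rw [norm_mul, norm_exp_int_mul, one_mul])).hasSum

lemma continuous_fourierSum {c : ℤ → ℂ} (hc : Summable fun n => ‖c n‖) :
    Continuous (fourierSum c) :=
  continuous_tsum (fun n => by fun_prop) hc fun n τ => by
    rw [norm_mul, norm_exp_int_mul, one_mul]

lemma fourierSum_add_two_pi (c : ℤ → ℂ) (τ : ℝ) : fourierSum c (τ + 2 * Real.pi) = fourierSum c τ :=
  tsum_congr fun n => by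
    have : Complex.I * n * ((τ + 2 * Real.pi : ℝ) : ℂ) =
        Complex.I * n * τ + n * (2 * Real.pi * Complex.I) := by push_cast; ring
    rw [this, Complex.exp_add, Complex.exp_int_mul_two_pi_mul_I, mul_one]

lemma hasDerivAt_fourierSum {c : ℤ → ℂ} (hc : Summable fun n : ℤ => (1 + |(n : ℝ)|) * ‖c n‖)
    (τ : ℝ) : HasDerivAt (fourierSum c) (fourierSum (fun n => Complex.I * n * c n) τ) τ := by
  have hc0 : Summable fun n => ‖c n‖ :=
    Summable.of_nonneg_of_le (fun _ => norm_nonneg _) (fun n =>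
      le_mul_of_one_le_left (norm_nonneg _) (le_add_of_nonneg_right (abs_nonneg _))) hc
  have h1 : ∀ (n : ℤ) (y : ℝ), HasDerivAt (fun τ : ℝ => Complex.exp (Complex.I * n * τ) * c n)
      (Complex.exp (Complex.I * n * y) * (Complex.I * n * c n)) y := fun n y => by
    have h1 : HasDerivAt (fun y : ℝ => Complex.I * n * (y : ℂ)) (Complex.I * n) y := by
      simpa using (Complex.ofRealCLM.hasDerivAt (x := y)).const_mul (Complex.I * n)
    have h2 := (h1.cexp).mul_const (c n)
    rwa [mul_assoc] at h2
  have h2 : ∀ (n : ℤ) (y : ℝ), ‖Complex.exp (Complex.I * n * y) * (Complex.I * n * c n)‖ ≤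
      (1 + |(n : ℝ)|) * ‖c n‖ := fun n y => by
    rw [norm_mul, norm_exp_int_mul, one_mul, norm_mul, norm_mul, Complex.norm_I, one_mul,
      Complex.norm_intCast]
    gcongr
    linarith
  exact hasDerivAt_tsum hc h1 h2 (hasSum_fourierSum hc0 0).summable τ

lemma fourierSum_add {c d : ℤ → ℂ} (hc : Summable fun n => ‖c n‖) (hd : Summable fun n => ‖d n‖)
    (τ : ℝ) : fourierSum (fun n => c n + d n) τ = fourierSum c τ + fourierSum d τ := by
  refine HasSum.tsum_eq ?_
  simpa only [mul_add] using (hasSum_fourierSum hc τ).add (hasSum_fourierSum hd τ)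

lemma fourierSum_const_mul (a : ℂ) (c : ℤ → ℂ) (τ : ℝ) :
    fourierSum (fun n => a * c n) τ = a * fourierSum c τ := by
  unfold fourierSum
  rw [← tsum_mul_left]
  exact tsum_congr fun n => by ring

lemma fourierSum_sum {ι : Type*} (s : Finset ι) {c : ι → ℤ → ℂ}
    (hc : ∀ i ∈ s, Summable fun n => ‖c i n‖) (τ : ℝ) :
    fourierSum (fun n => ∑ i ∈ s, c i n) τ = ∑ i ∈ s, fourierSum (c i) τ := by
  refine HasSum.tsum_eq ?_
  simpa only [Finset.mul_sum] using hasSum_sum fun i hi => hasSum_fourierSum (hc i hi) τ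

lemma summable_norm_trigConv {M : ℕ} {f : ℤ → ℂ} {c : ℤ → ℂ} (hc : Summable fun n => ‖c n‖) :
    Summable fun n => ‖trigConv M f c n‖ := by
  have h1 : Summable fun n => ∑ m ∈ Finset.Icc (-(M : ℤ)) M, ‖f m‖ * ‖c (n - m)‖ :=
    summable_sum fun m _ => ((Equiv.subRight m).summable_iff.2 hc).mul_left _
  refine Summable.of_nonneg_of_le (fun _ => norm_nonneg _) (fun n => ?_) h1
  exact (norm_sum_le _ _).trans_eq (Finset.sum_congr rfl fun m _ => norm_smul _ _)

lemma fourierSum_trigConv {M : ℕ} (f : ℤ → ℂ) {c : ℤ → ℂ} (hc : Summable fun n => ‖c n‖) (τ : ℝ) :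
    fourierSum (trigConv M f c) τ = trigPoly M f τ * fourierSum c τ := by
  rw [trigPoly, Finset.sum_mul]
  have h1 : ∀ m ∈ Finset.Icc (-(M : ℤ)) M, Summable fun n => ‖f m * c (n - m)‖ := fun m _ => by
    simp only [norm_mul]
    exact ((Equiv.subRight m).summable_iff.2 hc).mul_left _
  have h2 := fourierSum_sum _ h1 τ
  refine Eq.trans (by rfl) (h2.trans (Finset.sum_congr rfl fun m _ => ?_))
  rw [fourierSum_const_mul, mul_assoc]
  congr 1
  unfold fourierSum
  rw [← tsum_mul_left, ← (Equiv.subRight m).tsum_eq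
    fun n => Complex.exp (Complex.I * m * τ) * (Complex.exp (Complex.I * n * τ) * c n)]
  refine tsum_congr fun n => ?_
  rw [Equiv.subRight_apply, ← mul_assoc, ← Complex.exp_add]
  congr 2
  push_cast
  ring

lemma integral_norm_sq_fourierSum {c : ℤ → ℂ} (hc : Summable fun n => ‖c n‖) :
    ∫ τ in (0 : ℝ)..2 * Real.pi, ‖fourierSum c τ‖ ^ 2 = 2 * Real.pi * l2norm c ^ 2 := by
  have h1 : Tendsto (fun s : Finset ℤ => ∫ τ in (0 : ℝ)..2 * Real.pi,
      ‖∑ n ∈ s, Complex.exp (Complex.I * n * τ) • c n‖ ^ 2) atTop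
      (𝓝 (∫ τ in (0 : ℝ)..2 * Real.pi, ‖fourierSum c τ‖ ^ 2)) := by
    refine intervalIntegral.tendsto_integral_filter_of_dominated_convergence
      (fun _ => (∑' n, ‖c n‖) ^ 2) (Eventually.of_forall fun s => ?_)
      (Eventually.of_forall fun s => Eventually.of_forall fun τ _ => ?_)
      (by simp) (Eventually.of_forall fun τ _ => ?_)
    · exact Continuous.aestronglyMeasurable (by fun_prop)
    · rw [Real.norm_of_nonneg (by positivity)]
      gcongr
      refine (norm_sum_le _ _).trans ?_
      simp only [norm_smul, norm_exp_int_mul, one_mul]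
      exact hc.sum_le_tsum _ fun _ _ => norm_nonneg _
    · exact (hasSum_fourierSum hc τ).norm.pow 2
  simp only [integral_norm_sq_sum_exp] at h1
  refine tendsto_nhds_unique h1 ?_
  rw [sq_l2norm]
  exact ((SqSummable.of_summable_norm hc).hasSum).const_mul _

lemma integral_norm_fourierSum_le {c : ℤ → ℂ} (hc : Summable fun n => ‖c n‖) :
    ∫ τ in (0 : ℝ)..2 * Real.pi, ‖fourierSum c τ‖ ≤ 2 * Real.pi * l2norm c := by
  have h1 := sq_integral_le_mul_integral_sq (continuous_fourierSum hc).norm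
    (a := 0) (b := 2 * Real.pi) (by positivity)
  rw [integral_norm_sq_fourierSum hc] at h1
  have := Real.pi_pos
  have := l2norm_nonneg c
  exact le_of_sq_le_sq (h1.trans_eq (by ring)) (by positivity)

lemma exists_l2norm_le_norm_fourierSum {c : ℤ → ℂ} (hc : Summable fun n => ‖c n‖) :
    ∃ τ ∈ Set.Icc 0 (2 * Real.pi), l2norm c ≤ ‖fourierSum c τ‖ := by
  by_contra! hcon
  have h0 := Real.pi_pos
  have h1 := integral_norm_sq_fourierSum hc
  have h2 : ∫ τ in (0 : ℝ)..2 * Real.pi, ‖fourierSum c τ‖ ^ 2 <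
      ∫ τ in (0 : ℝ)..2 * Real.pi, l2norm c ^ 2 := by
    refine intervalIntegral.integral_lt_integral_of_continuousOn_of_le_of_exists_lt
      (by positivity) ((continuous_fourierSum hc).norm.pow 2).continuousOn continuousOn_const
      (fun τ hτ => ?_) ⟨0, ⟨le_rfl, by positivity⟩, ?_⟩
    · have := hcon τ (Set.Ioc_subset_Icc_self hτ)
      gcongr
    · have := hcon 0 ⟨le_rfl, by positivity⟩
      gcongr
  simp only [intervalIntegral.integral_const, sub_zero, smul_eq_mul] at h2
  linarith


/-! ### The capacitance ODE as a first order system -/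

namespace Medium

variable {N : ℕ} (S : Medium N)

lemma inv_κ_eq (i : Fin N) (t : ℝ) :
    ((S.κ i t : ℂ))⁻¹ = trigPoly S.M (S.k i) ((S.Ω * t : ℝ) : ℂ) := by
  rw [← Complex.ofReal_inv, S.κ_series, trigPoly]
  refine Finset.sum_congr rfl fun m _ => ?_
  push_cast
  ring_nf

lemma inv_ρ_eq (i : Fin N) (t : ℝ) :
    ((S.ρ i t : ℂ))⁻¹ = trigPoly S.M (S.r i) ((S.Ω * t : ℝ) : ℂ) := by
  rw [← Complex.ofReal_inv, S.ρ_series, trigPoly]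
  refine Finset.sum_congr rfl fun m _ => ?_
  push_cast
  ring_nf

lemma inv_κ_div_eq (i : Fin N) (τ : ℝ) :
    ((S.κ i (τ / S.Ω) : ℂ))⁻¹ = trigPoly S.M (S.k i) τ := by
  rw [inv_κ_eq, mul_div_cancel₀ _ S.Ω_pos.ne']

lemma inv_ρ_div_eq (i : Fin N) (τ : ℝ) :
    ((S.ρ i (τ / S.Ω) : ℂ))⁻¹ = trigPoly S.M (S.r i) τ := by
  rw [inv_ρ_eq, mul_div_cancel₀ _ S.Ω_pos.ne']

end Medium

lemma trigPoly_add_two_pi (M : ℕ) (f : ℤ → ℂ) (z : ℂ) :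
    trigPoly M f (z + 2 * Real.pi) = trigPoly M f z := by
  refine Finset.sum_congr rfl fun m _ => ?_
  have : Complex.I * m * (z + 2 * Real.pi) =
      Complex.I * m * z + m * (2 * Real.pi * Complex.I) := by ring
  rw [this, Complex.exp_add, Complex.exp_int_mul_two_pi_mul_I, mul_one]

namespace Medium

variable {N : ℕ} (S : Medium N)

lemma κ_periodic (i : Fin N) (τ : ℝ) :
    S.κ i ((τ + 2 * Real.pi) / S.Ω) = S.κ i (τ / S.Ω) := by
  have h1 := S.inv_κ_div_eq i (τ + 2 * Real.pi)
  have h2 := S.inv_κ_div_eq i τ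
  rw [show ((τ + 2 * Real.pi : ℝ) : ℂ) = τ + 2 * Real.pi by push_cast; ring,
    trigPoly_add_two_pi, ← h2] at h1
  exact Complex.ofReal_injective (inv_injective h1)

lemma ρ_periodic (i : Fin N) (τ : ℝ) :
    S.ρ i ((τ + 2 * Real.pi) / S.Ω) = S.ρ i (τ / S.Ω) := by
  have h1 := S.inv_ρ_div_eq i (τ + 2 * Real.pi)
  have h2 := S.inv_ρ_div_eq i τ
  rw [show ((τ + 2 * Real.pi : ℝ) : ℂ) = τ + 2 * Real.pi by push_cast; ring,
    trigPoly_add_two_pi, ← h2] at h1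
  exact Complex.ofReal_injective (inv_injective h1)

lemma continuous_κ_div (i : Fin N) : Continuous fun τ : ℝ => (S.κ i (τ / S.Ω) : ℂ) := by
  have : (fun τ : ℝ => (S.κ i (τ / S.Ω) : ℂ)) = fun τ : ℝ => (trigPoly S.M (S.k i) τ)⁻¹ := by
    ext τ
    rw [← inv_κ_div_eq, inv_inv]
  rw [this]
  refine ((continuous_trigPoly _ _).comp Complex.continuous_ofReal).inv₀ fun τ => ?_
  rw [Function.comp_apply, ← inv_κ_div_eq]
  exact inv_ne_zero (Complex.ofReal_ne_zero.2 (S.κ_pos _ _).ne')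

end Medium

/-- The right-hand side of the first order system `y' = i (κ / m) q`, `q' = i C y`, where `C` is the
capacitance matrix and `m` the vector of the numbers `odeMass`, in the rescaled time `τ = Ω t`. -/
noncomputable def odeField {N : ℕ} (G : Resonators N) (S : Medium N) (α : ℝ) (τ : ℝ) :
    ((Fin N → ℂ) × (Fin N → ℂ)) →L[ℂ] ((Fin N → ℂ) × (Fin N → ℂ)) :=
  LinearMap.toContinuousLinearMap
    { toFun := fun x => (fun i => Complex.I * (S.κ i (τ / S.Ω) / odeMass G S i) * x.2 i,
        fun i => Complex.I * ∑ j, capacitanceMatrix G α i j * x.1 j)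
      map_add' := fun x y => by
        ext i <;> simp [mul_add, Finset.sum_add_distrib]
      map_smul' := fun a x => by
        ext i
        · simp; ring
        · simp only [Prod.smul_fst, Pi.smul_apply, smul_eq_mul, RingHom.id_apply, Prod.smul_snd,
            Finset.mul_sum]
          exact Finset.sum_congr rfl fun j _ => by ring }

section OdeField

variable {N : ℕ} {G : Resonators N} {S : Medium N} {α : ℝ}

lemma odeField_apply (τ : ℝ) (x : (Fin N → ℂ) × (Fin N → ℂ)) :
    odeField G S α τ x = (fun i => Complex.I * (S.κ i (τ / S.Ω) / odeMass G S i) * x.2 i,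
        fun i => Complex.I * ∑ j, capacitanceMatrix G α i j * x.1 j) := rfl

lemma continuous_odeField : Continuous (odeField G S α) := by
  refine continuous_clm_apply.2 fun x => ?_
  simp only [odeField_apply]
  refine Continuous.prodMk (continuous_pi fun i => ?_) continuous_const
  exact (continuous_const.mul ((S.continuous_κ_div i).div_const _)).mul continuous_const

lemma odeField_periodic : Function.Periodic (odeField G S α) (2 * Real.pi) := fun τ => by
  refine ContinuousLinearMap.ext fun x => ?_
  simp only [odeField_apply, S.κ_periodic]

lemma norm_odeField_le {C lam : ℝ} (hlam : 0 < lam) (hlam' : ∀ i, lam ≤ odeMass G S i)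
    (hC : 0 ≤ C) (hκ : ∀ i t, S.κ i t ≤ C) (τ : ℝ) :
    ‖odeField G S α τ‖ ≤ 1 + C / lam + ∑ i, ∑ j, ‖capacitanceMatrix G α i j‖ := by
  have hsum : 0 ≤ ∑ i, ∑ j, ‖capacitanceMatrix G α i j‖ := by positivity
  refine ContinuousLinearMap.opNorm_le_bound _ (by positivity) fun x => ?_
  rw [odeField_apply]
  refine max_le ((pi_norm_le_iff_of_nonneg (by positivity)).2 fun i => ?_)
    ((pi_norm_le_iff_of_nonneg (by positivity)).2 fun i => ?_)
  · rw [norm_mul, norm_mul, Complex.norm_I, one_mul, norm_div, Complex.norm_real, Complex.norm_real,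
      Real.norm_of_nonneg (S.κ_pos _ _).le, Real.norm_of_nonneg (odeMass_pos G S i).le]
    have h1 : S.κ i (τ / S.Ω) / odeMass G S i ≤ C / lam :=
      div_le_div₀ hC (hκ i _) hlam (hlam' i)
    have h2 : ‖x.2 i‖ ≤ ‖x‖ := (norm_le_pi_norm x.2 i).trans (norm_snd_le x)
    refine mul_le_mul (h1.trans ?_) h2 (norm_nonneg _) (by positivity)
    linarith
  · rw [norm_mul, Complex.norm_I, one_mul]
    refine (norm_sum_le _ _).trans ?_
    calc ∑ j, ‖capacitanceMatrix G α i j * x.1 j‖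
        ≤ ∑ j, ‖capacitanceMatrix G α i j‖ * ‖x‖ := by
          refine Finset.sum_le_sum fun j _ => ?_
          rw [norm_mul]
          gcongr
          exact (norm_le_pi_norm x.1 j).trans (norm_fst_le x)
      _ = (∑ j, ‖capacitanceMatrix G α i j‖) * ‖x‖ := by rw [Finset.sum_mul]
      _ ≤ _ := by
          gcongr
          have h1 := Finset.single_le_sum (f := fun i => ∑ j, ‖capacitanceMatrix G α i j‖)
            (fun i _ => by positivity) (Finset.mem_univ i)
          have h2 : 0 ≤ C / lam := by positivity
          linarith

/-- A Floquet solution of the first order system gives a quasifrequency of the capacitance ODE. -/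
lemma isCapacitanceQuasifrequency_of_floquet {X : ℝ → (Fin N → ℂ) × (Fin N → ℂ)}
    (hX : IsLinearSolution (odeField G S α) X) (hX0 : X 0 ≠ 0) {σ : ℂ}
    (hσ : ∀ t, X (t + 2 * Real.pi) = Complex.exp (2 * Real.pi * Complex.I * σ) • X t) :
    IsCapacitanceQuasifrequency G S α (S.Ω * σ) := by
  have hΩ := S.Ω_pos
  have hΩ' : (S.Ω : ℂ) ≠ 0 := Complex.ofReal_ne_zero.2 hΩ.ne'
  have hρ : ∀ i t, (S.ρ i t : ℂ) ≠ 0 := fun i t => Complex.ofReal_ne_zero.2 (S.ρ_pos i t).ne'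
  have hκ : ∀ i t, (S.κ i t : ℂ) ≠ 0 := fun i t => Complex.ofReal_ne_zero.2 (S.κ_pos i t).ne'
  have hm : ∀ i, (odeMass G S i : ℂ) ≠ 0 := fun i =>
    Complex.ofReal_ne_zero.2 (odeMass_pos G S i).ne'
  have hX1 : ∀ i t, HasDerivAt (fun t => (X t).1 i)
      (Complex.I * (S.κ i (t / S.Ω) / odeMass G S i) * (X t).2 i) t := fun i t => by
    have h1 := (hX t).fst
    exact (hasDerivAt_pi.1 h1) i
  have hX2 : ∀ i t, HasDerivAt (fun t => (X t).2 i)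
      (Complex.I * ∑ j, capacitanceMatrix G α i j * (X t).1 j) t := fun i t => by
    have h1 := (hX t).snd
    exact (hasDerivAt_pi.1 h1) i
  have hlin : ∀ t : ℝ, HasDerivAt (fun t : ℝ => S.Ω * t) S.Ω t := fun t => by
    simpa using (hasDerivAt_id t).const_mul S.Ω
  have hw : ∀ i t, HasDerivAt (fun t => (X (S.Ω * t)).1 i)
      (S.Ω * (Complex.I * (S.κ i t / odeMass G S i) * (X (S.Ω * t)).2 i)) t := fun i t => by
    have h1 := (hX1 i (S.Ω * t)).scomp t (hlin t)
    rwa [mul_div_cancel_left₀ _ hΩ.ne', Complex.real_smul] at h1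
  have hq : ∀ i t, HasDerivAt (fun t => (X (S.Ω * t)).2 i)
      (S.Ω * (Complex.I * ∑ j, capacitanceMatrix G α i j * (X (S.Ω * t)).1 j)) t := fun i t => by
    have h1 := (hX2 i (S.Ω * t)).scomp t (hlin t)
    rwa [Complex.real_smul] at h1
  refine ⟨fun i t => (X (S.Ω * t)).1 i / S.ρ i t, fun hc => ?_, fun i t => ?_, fun i t => ?_⟩
  · -- a solution with vanishing first component vanishes
    have h1 : ∀ i t, (X t).1 i = 0 := fun i t => by
      have := congrFun (congrFun hc i) (t / S.Ω)
      simpa [mul_div_cancel₀ _ hΩ.ne', hρ] using this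
    refine hX0 (Prod.ext (funext fun i => h1 i 0) (funext fun i => ?_))
    have h2 := hX1 i 0
    simp only [h1] at h2
    have h3 := h2.unique (hasDerivAt_const 0 (0 : ℂ))
    simpa [hκ, hm] using h3
  · have hT : S.Ω * (t + S.T) = S.Ω * t + 2 * Real.pi := by
      rw [Medium.T, mul_add, mul_div_cancel₀ _ hΩ.ne']
    have hρt : S.ρ i (t + S.T) = S.ρ i t := by
      have := S.ρ_periodic i (S.Ω * t)
      rwa [← hT, mul_div_cancel_left₀ _ hΩ.ne', mul_div_cancel_left₀ _ hΩ.ne'] at this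
    simp only [hT, hρt, hσ, Prod.smul_fst, Pi.smul_apply, smul_eq_mul]
    have e : Complex.exp (-(Complex.I * (S.Ω * σ) * ((t + S.T : ℝ) : ℂ))) =
        Complex.exp (-(2 * Real.pi * Complex.I * σ)) *
          Complex.exp (-(Complex.I * (S.Ω * σ) * t)) := by
      rw [← Complex.exp_add]
      congr 1
      have : (S.Ω : ℂ) * S.T = 2 * Real.pi := by
        rw [Medium.T]; push_cast; field_simp
      push_cast
      linear_combination (-Complex.I * σ) * this
    rw [e]
    have e2 : Complex.exp (2 * Real.pi * Complex.I * σ) *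
        Complex.exp (-(2 * Real.pi * Complex.I * σ)) = 1 := by
      rw [← Complex.exp_add, add_neg_cancel, Complex.exp_zero]
    linear_combination ((X (S.Ω * t)).1 i / S.ρ i t *
      Complex.exp (-(Complex.I * (S.Ω * σ) * t))) * e2
  · simp only [mul_div_cancel₀ _ (hρ _ _)]
    have e2 : (fun s => 1 / (S.κ i s : ℂ) * deriv (fun t => (X (S.Ω * t)).1 i) s) =
        fun s => S.Ω * Complex.I / odeMass G S i * (X (S.Ω * s)).2 i := funext fun s => by
      rw [(hw i s).deriv]
      have := hκ i s
      have := hm i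
      field_simp
    have h3 := (hq i t).const_mul (S.Ω * Complex.I / odeMass G S i)
    refine ⟨(hw i t).differentiableAt, ?_, ?_⟩
    · rw [e2]
      exact h3.differentiableAt
    · rw [e2, h3.deriv]
      have hl : (G.len (i : ℕ) : ℂ) ≠ 0 := Complex.ofReal_ne_zero.2 (G.len_pos _).ne'
      have hδ : (S.δ : ℂ) ≠ 0 := Complex.ofReal_ne_zero.2 S.δ_pos.ne'
      have hκr : (S.κr : ℂ) ≠ 0 := Complex.ofReal_ne_zero.2 S.κr_pos.ne'
      have hρr : (S.ρr : ℂ) ≠ 0 := Complex.ofReal_ne_zero.2 S.ρr_pos.ne'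
      have h5 : (odeMass G S i : ℂ) = G.len (i : ℕ) * S.Ω ^ 2 / (S.δ * (S.κr / S.ρr)) := by
        rw [odeMass, S.sq_vr]; push_cast; ring
      rw [h5]
      set c := ∑ j, capacitanceMatrix G α i j * (X (S.Ω * t)).1 j
      field_simp
      rw [Complex.I_sq]
      ring

lemma isCapacitanceQuasifrequency_of_hasEigenvalue {B : ℝ} (hB : ∀ t, ‖odeField G S α t‖ ≤ B)
    {P : ((Fin N → ℂ) × (Fin N → ℂ)) →ₗ[ℂ] ((Fin N → ℂ) × (Fin N → ℂ))}
    (hP : ∀ X, IsLinearSolution (odeField G S α) X → P (X 0) = X (2 * Real.pi)) {σ : ℂ}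
    (hν : Module.End.HasEigenvalue P (Complex.exp (2 * Real.pi * Complex.I * σ))) :
    IsCapacitanceQuasifrequency G S α (S.Ω * σ) := by
  obtain ⟨-, X, hX, hX0, hXt⟩ :=
    exists_floquet_solution continuous_odeField hB odeField_periodic hP hν
  exact isCapacitanceQuasifrequency_of_floquet hX hX0 hXt

end OdeField


/-! ### Quasifrequencies near approximate Floquet exponents -/

section ApproxFloquet

variable {N : ℕ} {G : Resonators N} {S : Medium N} {α : ℝ}

/-- The monodromy map has an eigenvalue, and any logarithm of it gives a quasifrequency. -/
lemma exists_isCapacitanceQuasifrequency (hN : 0 < N) {C lam : ℝ} (hlam : 0 < lam)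
    (hlam' : ∀ i, lam ≤ odeMass G S i) (hC : 0 ≤ C) (hκ : ∀ i t, S.κ i t ≤ C) :
    ∃ ω, IsCapacitanceQuasifrequency G S α ω := by
  have : Nonempty (Fin N) := ⟨⟨0, hN⟩⟩
  have hB := norm_odeField_le (G := G) (α := α) hlam hlam' hC hκ
  obtain ⟨P, hP⟩ := exists_monodromy (continuous_odeField (G := G) (S := S) (α := α)) hB
    (2 * Real.pi)
  obtain ⟨ν, hν⟩ := Module.End.exists_eigenvalue P
  have hν0 := (exists_floquet_solution continuous_odeField hB odeField_periodic hP hν).1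
  refine ⟨S.Ω * (Complex.log ν / (2 * Real.pi * Complex.I)),
    isCapacitanceQuasifrequency_of_hasEigenvalue hB hP ?_⟩
  rwa [mul_div_cancel₀ _ Complex.two_pi_I_ne_zero, Complex.exp_log hν0]

/-- The function with Fourier coefficients `y`, `q` and Floquet exponent `σ`. -/
noncomputable def floquetSum (σ : ℂ) (y q : Fin N → ℤ → ℂ) (τ : ℝ) : (Fin N → ℂ) × (Fin N → ℂ) :=
  Complex.exp (Complex.I * σ * τ) • (fun i => fourierSum (y i) τ, fun i => fourierSum (q i) τ)

lemma floquetSum_two_pi (σ : ℂ) (y q : Fin N → ℤ → ℂ) :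
    floquetSum σ y q (2 * Real.pi) =
      Complex.exp (2 * Real.pi * Complex.I * σ) • floquetSum σ y q 0 := by
  have h1 : ∀ c, fourierSum c (2 * Real.pi) = fourierSum c 0 := fun c => by
    simpa using fourierSum_add_two_pi c 0
  simp only [floquetSum, h1, smul_smul]
  congr 1
  rw [← Complex.exp_add]
  congr 1
  push_cast
  ring

lemma norm_exp_I_mul_le {σ : ℂ} {R : ℝ} (hR : ‖σ‖ ≤ R) {τ : ℝ} (hτ : τ ∈ Set.Icc 0 (2 * Real.pi)) :
    ‖Complex.exp (Complex.I * σ * τ)‖ ≤ Real.exp (2 * Real.pi * R) ∧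
    Real.exp (-(2 * Real.pi * R)) ≤ ‖Complex.exp (Complex.I * σ * τ)‖ := by
  have h1 : |(Complex.I * σ * τ).re| ≤ 2 * Real.pi * R := by
    refine (Complex.abs_re_le_norm _).trans ?_
    rw [norm_mul, norm_mul, Complex.norm_I, one_mul, Complex.norm_real, Real.norm_of_nonneg hτ.1,
      mul_comm]
    exact mul_le_mul hτ.2 hR (norm_nonneg _) (by positivity)
  rw [Complex.norm_exp]
  exact ⟨Real.exp_le_exp.2 (abs_le.1 h1).2, Real.exp_le_exp.2 (abs_le.1 h1).1⟩

lemma summable_norm_of_summable_mul {c : ℤ → ℂ}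
    (hc : Summable fun n : ℤ => (1 + |(n : ℝ)|) * ‖c n‖) : Summable fun n => ‖c n‖ :=
  Summable.of_nonneg_of_le (fun _ => norm_nonneg _) (fun _ =>
    le_mul_of_one_le_left (norm_nonneg _) (le_add_of_nonneg_right (abs_nonneg _))) hc

lemma summable_norm_shift_mul {c : ℤ → ℂ} (σ : ℂ)
    (hc : Summable fun n : ℤ => (1 + |(n : ℝ)|) * ‖c n‖) :
    Summable fun n : ℤ => ‖(σ + n) * c n‖ := by
  refine Summable.of_nonneg_of_le (fun _ => norm_nonneg _) (fun n => ?_) (hc.mul_left (‖σ‖ + 1))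
  rw [norm_mul, ← mul_assoc]
  gcongr
  refine (norm_add_le _ _).trans ?_
  rw [Complex.norm_intCast]
  nlinarith [norm_nonneg σ, abs_nonneg (n : ℝ), mul_nonneg (norm_nonneg σ) (abs_nonneg (n : ℝ))]

lemma hasDerivAt_exp_mul_fourierSum {c : ℤ → ℂ} (σ : ℂ)
    (hc : Summable fun n : ℤ => (1 + |(n : ℝ)|) * ‖c n‖) (τ : ℝ) :
    HasDerivAt (fun τ : ℝ => Complex.exp (Complex.I * σ * τ) * fourierSum c τ)
      (Complex.I * (Complex.exp (Complex.I * σ * τ) *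
        fourierSum (fun n : ℤ => (σ + n) * c n) τ)) τ := by
  have hc0 := summable_norm_of_summable_mul hc
  have h1 : HasDerivAt (fun y : ℝ => Complex.I * σ * (y : ℂ)) (Complex.I * σ) τ := by
    simpa using (Complex.ofRealCLM.hasDerivAt (x := τ)).const_mul (Complex.I * σ)
  have h2 : HasDerivAt (fun τ : ℝ => Complex.exp (Complex.I * σ * τ) * fourierSum c τ) _ τ :=
    h1.cexp.mul (hasDerivAt_fourierSum hc τ)
  have h3 : fourierSum (fun n : ℤ => (σ + n) * c n) τ =
      σ * fourierSum c τ + fourierSum (fun n : ℤ => n * c n) τ := by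
    have hn : Summable fun n : ℤ => ‖(n : ℂ) * c n‖ := by
      simpa using summable_norm_shift_mul 0 hc
    rw [← fourierSum_const_mul, ← fourierSum_add (by simpa [norm_mul] using hc0.mul_left ‖σ‖) hn]
    simp only [add_mul]
  have h4 : fourierSum (fun n : ℤ => Complex.I * n * c n) τ =
      Complex.I * fourierSum (fun n : ℤ => n * c n) τ := by
    rw [← fourierSum_const_mul]
    simp only [mul_assoc]
  refine h2.congr_deriv ?_
  rw [h3, h4]
  ring

namespace IsApproxFloquet

variable {σ : ℂ} {y q : Fin N → ℤ → ℂ} {ε : ℝ}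

/-- The residual of the first equation of the system. -/
noncomputable def velocityRes (G : Resonators N) (S : Medium N) (σ : ℂ) (y q : Fin N → ℤ → ℂ)
    (i : Fin N) (n : ℤ) : ℂ :=
  (odeMass G S i : ℂ)⁻¹ * q i n - trigConv S.M (S.k i) (fun n : ℤ => (σ + n) * y i n) n

/-- The residual of the second equation of the system. -/
noncomputable def fluxRes (G : Resonators N) (α : ℝ) (σ : ℂ) (y q : Fin N → ℤ → ℂ)
    (i : Fin N) (n : ℤ) : ℂ :=
  ∑ j, capacitanceMatrix G α i j * y j n - (σ + n) * q i n

lemma summable_norm_velocityRes (h : IsApproxFloquet G S α σ y q ε) (i : Fin N) :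
    Summable fun n => ‖velocityRes G S σ y q i n‖ := by
  refine Summable.of_nonneg_of_le (fun _ => norm_nonneg _) (fun n => norm_sub_le _ _)
    (Summable.add ?_ (summable_norm_trigConv (summable_norm_shift_mul σ (h.summable_y i))))
  simp only [norm_mul]
  exact (summable_norm_of_summable_mul (h.summable_q i)).mul_left _

lemma summable_norm_fluxRes (h : IsApproxFloquet G S α σ y q ε) (i : Fin N) :
    Summable fun n => ‖fluxRes G α σ y q i n‖ := by
  refine Summable.of_nonneg_of_le (fun _ => norm_nonneg _) (fun n => (norm_sub_le _ _).trans
    (add_le_add_left (norm_sum_le _ _) _))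
    (Summable.add (summable_sum fun j _ => ?_) (summable_norm_shift_mul σ (h.summable_q i)))
  simp only [norm_mul]
  exact (summable_norm_of_summable_mul (h.summable_y j)).mul_left _

/-- The error term in the system satisfied by `floquetSum`. -/
noncomputable def force (G : Resonators N) (S : Medium N) (α : ℝ) (σ : ℂ) (y q : Fin N → ℤ → ℂ)
    (τ : ℝ) : (Fin N → ℂ) × (Fin N → ℂ) :=
  (-(Complex.I * Complex.exp (Complex.I * σ * τ))) •
    (fun i => S.κ i (τ / S.Ω) * fourierSum (velocityRes G S σ y q i) τ,
      fun i => fourierSum (fluxRes G α σ y q i) τ)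

lemma continuous_force (h : IsApproxFloquet G S α σ y q ε) : Continuous (force G S α σ y q) := by
  unfold force
  refine Continuous.smul (f := fun τ : ℝ => -(Complex.I * Complex.exp (Complex.I * σ * τ)))
    (by fun_prop) (Continuous.prodMk (continuous_pi fun i => ?_)
    (continuous_pi fun i => continuous_fourierSum (h.summable_norm_fluxRes i)))
  exact (S.continuous_κ_div i).mul (continuous_fourierSum (h.summable_norm_velocityRes i))

lemma hasDerivAt_floquetSum (h : IsApproxFloquet G S α σ y q ε) (τ : ℝ) :
    HasDerivAt (floquetSum σ y q)
      (odeField G S α τ (floquetSum σ y q τ) + force G S α σ y q τ) τ := by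
  have hy := fun i => hasDerivAt_exp_mul_fourierSum σ (h.summable_y i) τ
  have hq := fun i => hasDerivAt_exp_mul_fourierSum σ (h.summable_q i) τ
  have h1 : HasDerivAt (floquetSum σ y q) _ τ := (hasDerivAt_pi.2 hy).prodMk (hasDerivAt_pi.2 hq)
  refine h1.congr_deriv (Eq.symm ?_)
  rw [odeField_apply]
  have hκ : ∀ i, (S.κ i (τ / S.Ω) : ℂ) ≠ 0 := fun i => Complex.ofReal_ne_zero.2 (S.κ_pos i _).ne'
  have hm : ∀ i, (odeMass G S i : ℂ) ≠ 0 := fun i =>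
    Complex.ofReal_ne_zero.2 (odeMass_pos G S i).ne'
  refine Prod.ext (funext fun i => ?_) (funext fun i => ?_)
  · have e : fourierSum (velocityRes G S σ y q i) τ = (odeMass G S i : ℂ)⁻¹ * fourierSum (q i) τ -
        (S.κ i (τ / S.Ω) : ℂ)⁻¹ * fourierSum (fun n : ℤ => (σ + n) * y i n) τ := by
      have e1 := fourierSum_add (h.summable_norm_velocityRes i) (summable_norm_trigConv (M := S.M)
        (f := S.k i) (summable_norm_shift_mul σ (h.summable_y i))) τ
      rw [fourierSum_trigConv _ (summable_norm_shift_mul σ (h.summable_y i)),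
        ← S.inv_κ_div_eq] at e1
      simp only [velocityRes, sub_add_cancel, fourierSum_const_mul] at e1
      rw [e1]
      rw [add_sub_cancel_right]
    have := hκ i
    have := hm i
    simp only [floquetSum, force, e, Prod.fst_add, Prod.smul_fst, Prod.smul_snd, Pi.add_apply,
      Pi.smul_apply, smul_eq_mul]
    field_simp
    ring
  · have e : fourierSum (fluxRes G α σ y q i) τ =
        ∑ j, capacitanceMatrix G α i j * fourierSum (y j) τ -
          fourierSum (fun n : ℤ => (σ + n) * q i n) τ := by
      have e1 := fourierSum_add (h.summable_norm_fluxRes i)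
        (summable_norm_shift_mul σ (h.summable_q i)) τ
      have e2 := fourierSum_sum Finset.univ (c := fun j n => capacitanceMatrix G α i j * y j n)
        (fun j _ => by
          simp only [norm_mul]
          exact (summable_norm_of_summable_mul (h.summable_y j)).mul_left _) τ
      simp only [fluxRes, sub_add_cancel, fourierSum_const_mul] at e1 e2
      rw [e2] at e1
      rw [e1]
      rw [add_sub_cancel_right]
    have e2 : ∑ j, capacitanceMatrix G α i j *
        (Complex.exp (Complex.I * σ * τ) * fourierSum (y j) τ) =
        Complex.exp (Complex.I * σ * τ) * ∑ j, capacitanceMatrix G α i j * fourierSum (y j) τ := by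
      rw [Finset.mul_sum]
      exact Finset.sum_congr rfl fun j _ => by ring
    simp only [floquetSum, force, e, Prod.snd_add, Prod.smul_fst, Prod.smul_snd, Pi.add_apply,
      Pi.smul_apply, smul_eq_mul, e2]
    ring

lemma integral_norm_force_le (h : IsApproxFloquet G S α σ y q ε) {R C : ℝ} (hR : ‖σ‖ ≤ R)
    (hC : 0 ≤ C) (hκ : ∀ i t, S.κ i t ≤ C) :
    ∫ τ in (0 : ℝ)..2 * Real.pi, ‖force G S α σ y q τ‖ ≤
      Real.exp (2 * Real.pi * R) * (N * ((C + 1) * (2 * Real.pi * (ε *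
        ∑ i, (l2norm (y i) + l2norm (q i)))))) := by
  set Y := ∑ i, (l2norm (y i) + l2norm (q i))
  have h2π : (0 : ℝ) ≤ 2 * Real.pi := by positivity
  have hcv := fun i => continuous_fourierSum (h.summable_norm_velocityRes i)
  have hcf := fun i => continuous_fourierSum (h.summable_norm_fluxRes i)
  have h1 : ∀ τ ∈ Set.Icc 0 (2 * Real.pi), ‖force G S α σ y q τ‖ ≤ Real.exp (2 * Real.pi * R) *
      ∑ i, (C * ‖fourierSum (velocityRes G S σ y q i) τ‖ +
        ‖fourierSum (fluxRes G α σ y q i) τ‖) := fun τ hτ => by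
    rw [force, norm_smul, norm_neg, norm_mul, Complex.norm_I, one_mul]
    refine mul_le_mul (norm_exp_I_mul_le hR hτ).1 ?_ (norm_nonneg _) (Real.exp_nonneg _)
    have hs : ∀ i, C * ‖fourierSum (velocityRes G S σ y q i) τ‖ +
        ‖fourierSum (fluxRes G α σ y q i) τ‖ ≤
        ∑ i, (C * ‖fourierSum (velocityRes G S σ y q i) τ‖ +
        ‖fourierSum (fluxRes G α σ y q i) τ‖) := fun i =>
      Finset.single_le_sum (f := fun i => C * ‖fourierSum (velocityRes G S σ y q i) τ‖ +
        ‖fourierSum (fluxRes G α σ y q i) τ‖) (fun i _ => by positivity) (Finset.mem_univ i)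
    refine max_le ((pi_norm_le_iff_of_nonneg (by positivity)).2 fun i => ?_)
      ((pi_norm_le_iff_of_nonneg (by positivity)).2 fun i => ?_)
    · refine le_trans ?_ (hs i)
      rw [norm_mul, Complex.norm_real, Real.norm_of_nonneg (S.κ_pos _ _).le]
      refine le_add_of_le_of_nonneg ?_ (norm_nonneg _)
      gcongr
      exact hκ i _
    · exact le_trans (le_add_of_nonneg_left (by positivity)) (hs i)
  calc _ ≤ ∫ τ in (0 : ℝ)..2 * Real.pi, Real.exp (2 * Real.pi * R) *
      ∑ i, (C * ‖fourierSum (velocityRes G S σ y q i) τ‖ +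
        ‖fourierSum (fluxRes G α σ y q i) τ‖) :=
        intervalIntegral.integral_mono_on h2π (h.continuous_force.norm.intervalIntegrable _ _)
          (Continuous.intervalIntegrable (by fun_prop) _ _) h1
    _ = Real.exp (2 * Real.pi * R) * ∑ i,
        (C * (∫ τ in (0 : ℝ)..2 * Real.pi, ‖fourierSum (velocityRes G S σ y q i) τ‖) +
          ∫ τ in (0 : ℝ)..2 * Real.pi, ‖fourierSum (fluxRes G α σ y q i) τ‖) := by
        rw [intervalIntegral.integral_const_mul, intervalIntegral.integral_finsetSum
          fun i _ => Continuous.intervalIntegrable (by fun_prop) _ _]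
        congr 1
        refine Finset.sum_congr rfl fun i _ => ?_
        rw [intervalIntegral.integral_add (Continuous.intervalIntegrable (by fun_prop) _ _)
          (Continuous.intervalIntegrable (by fun_prop) _ _), intervalIntegral.integral_const_mul]
    _ ≤ Real.exp (2 * Real.pi * R) * ∑ i : Fin N, ((C + 1) * (2 * Real.pi * (ε * Y))) := by
        gcongr with i
        have a1 := (integral_norm_fourierSum_le (h.summable_norm_velocityRes i)).trans
          (mul_le_mul_of_nonneg_left (h.velocity i) h2π)
        have a2 := (integral_norm_fourierSum_le (h.summable_norm_fluxRes i)).trans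
          (mul_le_mul_of_nonneg_left (h.flux i) h2π)
        rw [add_mul, one_mul]
        exact add_le_add (mul_le_mul_of_nonneg_left a1 hC) a2
    _ = _ := by rw [Finset.sum_const, Finset.card_univ, Fintype.card_fin, nsmul_eq_mul]

/-- By Parseval's identity, the function is somewhere as large as its Fourier coefficients. -/
lemma exists_le_norm_floquetSum (h : IsApproxFloquet G S α σ y q ε) {R : ℝ} (hR : ‖σ‖ ≤ R) :
    ∃ t₀ ∈ Set.Icc 0 (2 * Real.pi), ∑ i, (l2norm (y i) + l2norm (q i)) ≤
      2 * N * (Real.exp (2 * Real.pi * R) * ‖floquetSum σ y q t₀‖) := by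
  have hcont : Continuous (floquetSum σ y q) :=
    continuous_iff_continuousAt.2 fun τ => (h.hasDerivAt_floquetSum τ).continuousAt
  obtain ⟨t₀, ht₀, hmax⟩ := (isCompact_Icc (a := (0 : ℝ)) (b := 2 * Real.pi)).exists_isMaxOn
    ⟨0, le_rfl, by positivity⟩ hcont.norm.continuousOn
  refine ⟨t₀, ht₀, ?_⟩
  have key : ∀ c : ℤ → ℂ, (Summable fun n => ‖c n‖) → (∀ τ : ℝ,
      ‖Complex.exp (Complex.I * σ * τ)‖ * ‖fourierSum c τ‖ ≤ ‖floquetSum σ y q τ‖) →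
      l2norm c ≤ Real.exp (2 * Real.pi * R) * ‖floquetSum σ y q t₀‖ := fun c hc hle => by
    obtain ⟨τ, hτ, h1⟩ := exists_l2norm_le_norm_fourierSum hc
    have h2 := (norm_exp_I_mul_le hR hτ).2
    have h3 : ‖floquetSum σ y q τ‖ ≤ ‖floquetSum σ y q t₀‖ := hmax hτ
    calc l2norm c ≤ ‖fourierSum c τ‖ := h1
      _ = Real.exp (2 * Real.pi * R) * (Real.exp (-(2 * Real.pi * R)) * ‖fourierSum c τ‖) := by
          rw [← mul_assoc, ← Real.exp_add, add_neg_cancel, Real.exp_zero, one_mul]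
      _ ≤ _ := by
          gcongr
          exact (mul_le_mul_of_nonneg_right h2 (norm_nonneg _)).trans ((hle τ).trans h3)
  calc ∑ i, (l2norm (y i) + l2norm (q i))
      ≤ ∑ i : Fin N, (2 * (Real.exp (2 * Real.pi * R) * ‖floquetSum σ y q t₀‖)) := by
        refine Finset.sum_le_sum fun i _ => ?_
        have a1 := key (y i) (summable_norm_of_summable_mul (h.summable_y i)) fun τ => by
          rw [floquetSum, norm_smul]
          refine mul_le_mul_of_nonneg_left ?_ (norm_nonneg _)
          exact (norm_le_pi_norm (fun i => fourierSum (y i) τ) i).trans (le_max_left _ _)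
        have a2 := key (q i) (summable_norm_of_summable_mul (h.summable_q i)) fun τ => by
          rw [floquetSum, norm_smul]
          refine mul_le_mul_of_nonneg_left ?_ (norm_nonneg _)
          exact (norm_le_pi_norm (fun i => fourierSum (q i) τ) i).trans (le_max_right _ _)
        linarith
    _ = _ := by
        rw [Finset.sum_const, Finset.card_univ, Fintype.card_fin, nsmul_eq_mul]
        ring

end IsApproxFloquet

/-- Floquet exponents of sufficiently good approximate Floquet solutions are close to
quasifrequencies of the capacitance ODE, uniformly in the modulation. -/
lemma exists_near_isCapacitanceQuasifrequency (hN : 0 < N) (G : Resonators N) (α : ℝ)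
    {R C lam η : ℝ} (hC : 0 ≤ C) (hlam : 0 < lam) (hη : 0 < η) :
    ∃ ε > 0, ∀ (S : Medium N) (σ : ℂ) (y q : Fin N → ℤ → ℂ), (∀ i, lam ≤ odeMass G S i) →
      (∀ i t, S.κ i t ≤ C) → ‖σ‖ ≤ R → IsApproxFloquet G S α σ y q ε →
      ∃ ω, IsCapacitanceQuasifrequency G S α ω ∧ ‖S.Ω * σ - ω‖ ≤ η * S.Ω := by
  set B := 1 + C / lam + ∑ i, ∑ j, ‖capacitanceMatrix G α i j‖ with hB
  have hB1 : 1 ≤ B := by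
    have : 0 ≤ ∑ i, ∑ j, ‖capacitanceMatrix G α i j‖ := by positivity
    have : 0 ≤ C / lam := by positivity
    linarith
  have h2π : (0 : ℝ) ≤ 2 * Real.pi := by positivity
  set T := 2 * Real.pi with hT
  set e := Real.exp (T * R) with he
  have he0 : 0 < e := Real.exp_pos _
  set R' := Real.exp (B * T) + e with hR'
  -- a neighbourhood of `1` on which the logarithm is small
  obtain ⟨r, hr, hlog⟩ : ∃ r > 0, ∀ z : ℂ, ‖z - 1‖ < r → ‖Complex.log z‖ ≤ T * η := by
    have h1 : ContinuousAt Complex.log 1 := continuousAt_clog (by simp)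
    obtain ⟨r, hr, h2⟩ := Metric.continuousAt_iff.1 h1 (T * η) (by positivity)
    refine ⟨r, hr, fun z hz => ?_⟩
    have := h2 (x := z) (by rwa [dist_eq_norm])
    rw [Complex.log_one, dist_zero_right] at this
    exact this.le
  set E := (Fin N → ℂ) × (Fin N → ℂ)
  have : Nonempty (Fin N) := ⟨⟨0, hN⟩⟩
  set d := Module.finrank ℂ E with hd
  have hd0 : d ≠ 0 := (Module.finrank_pos (R := ℂ) (M := E)).ne'
  set a := e * (N * ((C + 1) * (T * (2 * N * e)))) with ha
  have hN' : (0 : ℝ) < N := Nat.cast_pos.2 hN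
  have ha0 : 0 < a := by positivity
  set D := d * (2 * R' + 1) ^ d * (2 * Real.exp (B * T) ^ 2 * a) with hD
  have hD0 : 0 ≤ D := by positivity
  set ε := min ((r / e) ^ d / (D + 1)) (1 / (2 * (Real.exp (B * T) * a))) with hε
  have hε0 : 0 < ε := by positivity
  refine ⟨ε, hε0, fun S σ y q hlam' hκ hσ h => ?_⟩
  have hBS : ∀ t, ‖odeField G S α t‖ ≤ B := norm_odeField_le hlam hlam' hC hκ
  obtain ⟨P, hP⟩ := exists_monodromy (continuous_odeField (G := G) (S := S) (α := α)) hBS T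
  set μ := Complex.exp (2 * Real.pi * Complex.I * σ) with hμ
  have hμ' : μ = Complex.exp (Complex.I * σ * (T : ℝ)) := by
    rw [hμ, hT]; congr 1; push_cast; ring
  have hμ1 := norm_exp_I_mul_le hσ (τ := T) ⟨h2π, le_rfl⟩
  rw [← hμ'] at hμ1
  obtain ⟨t₀, ht₀, hY⟩ := h.exists_le_norm_floquetSum hσ
  have hX0 : floquetSum σ y q t₀ ≠ 0 := fun h0 => by
    rw [h0, norm_zero, mul_zero, mul_zero] at hY
    exact absurd h.pos (not_lt.2 hY)
  have hI : ∫ s in (0 : ℝ)..T, ‖IsApproxFloquet.force G S α σ y q s‖ ≤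
      (a * ε) * ‖floquetSum σ y q t₀‖ := by
    refine (h.integral_norm_force_le hσ hC hκ).trans ?_
    calc _ ≤ e * (N * ((C + 1) * (T * (ε * (2 * N * (e * ‖floquetSum σ y q t₀‖)))))) := by gcongr
      _ = _ := by ring
  have hsmall : Real.exp (B * T) * (a * ε) ≤ 1 / 2 := by
    have : ε ≤ 1 / (2 * (Real.exp (B * T) * a)) := min_le_right _ _
    rw [le_div_iff₀ (by positivity)] at this
    linarith
  obtain ⟨hx0, hx⟩ := norm_monodromy_sub_le continuous_odeField hB1 hBS h2π hP h.continuous_force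
    h.hasDerivAt_floquetSum (floquetSum_two_pi σ y q) hsmall ht₀ hX0 hI
  obtain ⟨ν, hν, hμν⟩ := exists_hasEigenvalue_near (R := R') (by positivity)
    (fun x => (norm_monodromy_le continuous_odeField hBS h2π hP x).trans
      (mul_le_mul_of_nonneg_right (le_add_of_nonneg_right he0.le) (norm_nonneg _)))
    (hμ1.1.trans (le_add_of_nonneg_left (Real.exp_nonneg _))) hx0 (by positivity) hx
  have hν0 := (exists_floquet_solution continuous_odeField hBS odeField_periodic hP hν).1
  have hμ0 : μ ≠ 0 := Complex.exp_ne_zero _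
  have hdist : ‖μ - ν‖ < r / e := by
    refine lt_of_pow_lt_pow_left₀ d (by positivity) (hμν.trans_lt ?_)
    calc _ = D * ε := by ring
      _ ≤ D * ((r / e) ^ d / (D + 1)) := by
          gcongr
          exact min_le_left _ _
      _ = (r / e) ^ d * (D / (D + 1)) := by ring
      _ < (r / e) ^ d * 1 := by
          gcongr
          rw [div_lt_one (by positivity)]
          linarith
      _ = _ := mul_one _
  have hquot : ‖ν / μ - 1‖ < r := by
    have h1 : ν / μ - 1 = (ν - μ) / μ := by field_simp
    rw [h1, norm_div, norm_sub_rev, div_lt_iff₀ (norm_pos_iff.2 hμ0)]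
    have h2 : 1 / e ≤ ‖μ‖ := by
      rw [one_div, he, ← Real.exp_neg]
      exact hμ1.2
    calc ‖μ - ν‖ < r / e := hdist
      _ = r * (1 / e) := by ring
      _ ≤ _ := by gcongr
  set σ' := σ + Complex.log (ν / μ) / (2 * Real.pi * Complex.I) with hσ'
  have hexp : Complex.exp (2 * Real.pi * Complex.I * σ') = ν := by
    rw [hσ', mul_add, Complex.exp_add, mul_div_cancel₀ _ Complex.two_pi_I_ne_zero,
      Complex.exp_log (div_ne_zero hν0 hμ0), mul_div_cancel₀ _ hμ0]
  refine ⟨S.Ω * σ', isCapacitanceQuasifrequency_of_hasEigenvalue hBS hP (by rwa [hexp]), ?_⟩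
  have h1 : S.Ω * σ - S.Ω * σ' = -(S.Ω * (Complex.log (ν / μ) / (2 * Real.pi * Complex.I))) := by
    rw [hσ']; ring
  have h2 : ‖(2 * Real.pi * Complex.I : ℂ)‖ = T := by
    rw [norm_mul, norm_mul, Complex.norm_I, mul_one, Complex.norm_real, Complex.norm_ofNat,
      Real.norm_of_nonneg Real.pi_pos.le]
  rw [h1, norm_neg, norm_mul, norm_div, h2, Complex.norm_real, Real.norm_of_nonneg S.Ω_pos.le,
    mul_comm]
  refine mul_le_mul_of_nonneg_right ?_ S.Ω_pos.le
  rw [div_le_iff₀ (by positivity), mul_comm]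
  exact hlog _ hquot

end ApproxFloquet


/-! ### Concentration on low frequencies in the weighted norm -/

section LowFrequency

variable {a : ℤ → ℝ} {θ : ℝ}

lemma polyGrowth_of_hasSum (ha0 : ∀ n, 0 ≤ a n) (ha : HasSum a 1) : PolyGrowth a :=
  (PolyGrowth.const 1).of_le fun n => by
    rw [abs_of_nonneg (ha0 n)]
    exact le_hasSum ha n fun m _ => ha0 m

/-- Modes which are essentially supported in `|n| ≤ K` have a weighted norm which is not too small. -/
lemma le_wnorm_of_sum (hθ : 0 < θ) (ha0 : ∀ n, 0 ≤ a n) (ha : HasSum a 1) {K : ℕ}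
    (hK : 1 / 2 ≤ ∑ n ∈ Finset.Icc (-(K : ℤ)) K, a n) :
    1 ≤ 2 * √(2 * K + 1) * Real.exp (θ * K) * wnorm θ a := by
  have h1 := sum_sq_le_sq_l2norm ((polyGrowth_of_hasSum ha0 ha).sqSummable hθ)
    (Finset.Icc (-(K : ℤ)) K)
  have h2 := sq_sum_le_card_mul_sum_sq (s := Finset.Icc (-(K : ℤ)) K) (f := a)
  have hcard : (((Finset.Icc (-(K : ℤ)) K).card : ℕ) : ℝ) = 2 * K + 1 := by
    rw [Int.card_Icc]
    have : ((K : ℤ) + 1 - -(K : ℤ)).toNat = 2 * K + 1 := by omega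
    rw [this]
    push_cast
    ring
  rw [hcard] at h2
  have h3 : ∑ n ∈ Finset.Icc (-(K : ℤ)) K, a n ^ 2 ≤
      Real.exp (θ * K) ^ 2 * wnorm θ a ^ 2 := by
    refine le_trans ?_ (mul_le_mul_of_nonneg_left h1 (by positivity))
    rw [Finset.mul_sum]
    refine Finset.sum_le_sum fun n hn => ?_
    have hn' : |(n : ℝ)| ≤ K := by
      rw [Finset.mem_Icc] at hn
      rw [abs_le]
      exact ⟨by exact_mod_cast hn.1, by exact_mod_cast hn.2⟩
    have hw : 1 ≤ Real.exp (θ * K) * coshWeight θ n := by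
      refine le_trans ?_ (mul_le_mul_of_nonneg_left (le_coshWeight θ n) (Real.exp_nonneg _))
      rw [← Real.exp_add, abs_mul, abs_of_pos hθ]
      refine Real.one_le_exp ?_
      nlinarith
    rw [norm_mul, Real.norm_of_nonneg (coshWeight_pos θ n).le, Real.norm_of_nonneg (ha0 n),
      ← mul_pow, ← mul_assoc]
    exact pow_le_pow_left₀ (ha0 n) (le_mul_of_one_le_left (ha0 n) hw) 2
  refine le_of_sq_le_sq (a := 1) ?_ (by have := wnorm_nonneg θ a; positivity)
  rw [mul_pow, mul_pow, mul_pow, Real.sq_sqrt (by positivity)]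
  calc (1 : ℝ) ^ 2 = 2 ^ 2 * (1 / 2) ^ 2 := by norm_num
    _ ≤ 2 ^ 2 * ((2 * K + 1) * (Real.exp (θ * K) ^ 2 * wnorm θ a ^ 2)) := by
        refine mul_le_mul_of_nonneg_left ?_ (by norm_num)
        refine (pow_le_pow_left₀ (by norm_num) hK 2).trans (h2.trans ?_)
        gcongr
    _ = _ := by ring

/-- The part of the modes beyond `K₂` is negligible, since the weight decays exponentially. -/
lemma wnorm_pow_mul_le (hθ : 0 < θ) (ha0 : ∀ n, 0 ≤ a n) (ha : HasSum a 1) {K : ℕ}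
    (hK : 1 / 2 ≤ ∑ n ∈ Finset.Icc (-(K : ℤ)) K, a n) {Ω R K₂ : ℝ} (hΩ : 0 < Ω) (hΩ1 : Ω ≤ 1)
    (hR : 0 ≤ R) (hK₂ : 1 ≤ K₂) (hKK₂ : (K : ℝ) ≤ K₂ / 2) {ω : ℂ} (hω : ‖ω‖ ≤ R * Ω) {j : ℕ}
    (hj : j ≤ 2) :
    wnorm θ (fun n => ‖ω + n * Ω‖ ^ j * a n) ≤
      ((Ω * (R + K₂)) ^ j + 3072 * (R + 1) ^ 2 * ((θ⁻¹) ^ 3 * Real.exp (-(θ * K₂ / 4)))) *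
        wnorm θ a := by
  set A := wnorm θ a with hA
  have hA0 : 0 ≤ A := wnorm_nonneg _ _
  have hg := polyGrowth_of_hasSum ha0 ha
  have hA1 := le_wnorm_of_sum hθ ha0 ha hK
  rw [← hA] at hA1
  have hs : ∀ n : ℤ, ‖ω + n * Ω‖ ≤ Ω * (R + |(n : ℝ)|) := fun n => by
    refine (norm_add_le _ _).trans ?_
    rw [norm_mul, Complex.norm_intCast, Complex.norm_real, Real.norm_of_nonneg hΩ.le]
    linarith
  set t : ℤ → ℝ := fun n => if K₂ < |(n : ℝ)| then ‖ω + n * Ω‖ ^ j * a n else 0 with ht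
  have ht0 : ∀ n, 0 ≤ t n := fun n => by
    rw [ht]
    dsimp only
    split_ifs
    · exact mul_nonneg (by positivity) (ha0 n)
    · exact le_rfl
  have htg : PolyGrowth t := (((PolyGrowth.affine ω Ω).pow j).mul hg).of_le fun n => by
    rw [abs_of_nonneg (ht0 n), ht]
    dsimp only
    split_ifs
    · exact le_rfl
    · exact mul_nonneg (by positivity) (ha0 n)
  set Q := 3072 * (R + 1) ^ 2 * ((θ⁻¹) ^ 3 * Real.exp (-(θ * K₂ / 4))) with hQ
  have hQ0 : 0 ≤ Q := by positivity
  have hle : wnorm θ (fun n => ‖ω + n * Ω‖ ^ j * a n) ≤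
      wnorm θ (fun n => (Ω * (R + K₂)) ^ j * a n + t n) := by
    refine wnorm_mono hθ (((PolyGrowth.const _).mul hg).add htg) fun n => ?_
    rw [abs_of_nonneg (mul_nonneg (by positivity) (ha0 n)), ht]
    dsimp only
    split_ifs with hn
    · exact le_add_of_nonneg_left (mul_nonneg (by positivity) (ha0 n))
    · rw [add_zero]
      refine mul_le_mul_of_nonneg_right (pow_le_pow_left₀ (norm_nonneg _) ((hs n).trans ?_) j)
        (ha0 n)
      gcongr
      exact not_lt.1 hn
  -- the tail
  have htail : ∀ n, ‖coshWeight θ n * t n‖ ≤ Q * A * a n := fun n => by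
    rw [Real.norm_of_nonneg (mul_nonneg (coshWeight_pos θ n).le (ht0 n)), ht]
    dsimp only
    split_ifs with hn
    swap
    · rw [mul_zero]
      exact mul_nonneg (mul_nonneg hQ0 hA0) (ha0 n)
    set x := |(n : ℝ)| with hx
    have hx1 : 1 ≤ x := hK₂.trans hn.le
    have hxK : (K : ℝ) ≤ x / 2 := by linarith
    have b1 : ‖ω + n * Ω‖ ^ j ≤ ((R + 1) * x) ^ 2 := by
      have c1 : ‖ω + n * Ω‖ ≤ (R + 1) * x := by
        refine (hs n).trans ?_
        have : Ω * (R + x) ≤ 1 * (R + x) := by gcongr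
        nlinarith
      have c2 : 1 ≤ (R + 1) * x := by nlinarith
      exact (pow_le_pow_left₀ (norm_nonneg _) c1 j).trans (pow_le_pow_right₀ c2 hj)
    have b2 : coshWeight θ n ≤ 2 * Real.exp (-(θ * x)) := by
      have := coshWeight_le θ n
      rwa [abs_mul, abs_of_pos hθ] at this
    have b3 : 1 ≤ 4 * x * Real.exp (θ * x / 2) * A := by
      refine hA1.trans (mul_le_mul_of_nonneg_right ?_ hA0)
      refine mul_le_mul ?_ (Real.exp_le_exp.2 (by nlinarith)) (Real.exp_nonneg _) (by positivity)
      have : √(2 * K + 1) ≤ 2 * x := by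
        rw [Real.sqrt_le_left (by positivity)]
        nlinarith
      linarith
    have b4 : x ^ 3 * Real.exp (-(θ * x / 4)) ≤ 384 * (θ⁻¹) ^ 3 := by
      have c1 := Real.pow_div_factorial_le_exp (θ * x / 4) (by positivity) 3
      have c2 : x ^ 3 = 384 * (θ⁻¹) ^ 3 * ((θ * x / 4) ^ 3 / (Nat.factorial 3 : ℕ)) := by
        have : ((Nat.factorial 3 : ℕ) : ℝ) = 6 := by norm_num [Nat.factorial]
        rw [this]
        field_simp
        norm_num
      calc _ = 384 * (θ⁻¹) ^ 3 * (((θ * x / 4) ^ 3 / (Nat.factorial 3 : ℕ)) *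
            Real.exp (-(θ * x / 4))) := by rw [← mul_assoc, ← c2]
        _ ≤ 384 * (θ⁻¹) ^ 3 * (Real.exp (θ * x / 4) * Real.exp (-(θ * x / 4))) := by gcongr
        _ = _ := by rw [← Real.exp_add, add_neg_cancel, Real.exp_zero, mul_one]
    have b5 : Real.exp (-(θ * x / 4)) ≤ Real.exp (-(θ * K₂ / 4)) := by
      refine Real.exp_le_exp.2 ?_
      nlinarith
    have b6 : Real.exp (-(θ * x)) * Real.exp (θ * x / 2) =
        Real.exp (-(θ * x / 4)) * Real.exp (-(θ * x / 4)) := by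
      rw [← Real.exp_add, ← Real.exp_add]
      ring_nf
    calc coshWeight θ n * (‖ω + n * Ω‖ ^ j * a n)
        ≤ (2 * Real.exp (-(θ * x))) * (((R + 1) * x) ^ 2 * a n) := by
          have := ha0 n
          gcongr
      _ ≤ (2 * Real.exp (-(θ * x))) * (((R + 1) * x) ^ 2 * a n) *
          (4 * x * Real.exp (θ * x / 2) * A) := by
          refine le_mul_of_one_le_right ?_ b3
          have := ha0 n
          positivity
      _ = 8 * (R + 1) ^ 2 * x ^ 3 * (Real.exp (-(θ * x)) * Real.exp (θ * x / 2)) * A * a n := by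
          ring
      _ = 8 * (R + 1) ^ 2 * ((x ^ 3 * Real.exp (-(θ * x / 4))) * Real.exp (-(θ * x / 4))) *
          A * a n := by
          rw [b6]
          ring
      _ ≤ 8 * (R + 1) ^ 2 * ((384 * (θ⁻¹) ^ 3) * Real.exp (-(θ * K₂ / 4))) * A * a n := by
          have := ha0 n
          gcongr
      _ = _ := by
          rw [hQ]
          ring
  have hsum : HasSum (fun n => Q * A * a n) (Q * A) := by simpa using ha.mul_left (Q * A)
  have hts : Summable fun n => ‖coshWeight θ n * t n‖ :=
    Summable.of_nonneg_of_le (fun _ => norm_nonneg _) htail hsum.summable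
  have htw : wnorm θ t ≤ Q * A :=
    (l2norm_le_tsum_norm hts).trans (hasSum_le htail hts.hasSum hsum)
  refine hle.trans ((wnorm_add_le hθ ((PolyGrowth.const _).mul hg) htg).trans ?_)
  rw [wnorm_const_mul (by positivity), add_mul]
  gcongr

end LowFrequency


/-! ### Subwavelength quasifrequencies are close to those of the capacitance ODE -/

lemma tendsto_rpow_neg_three_mul_exp {b s : ℝ} (hb : 0 < b) (hs : 0 < s) :
    Tendsto (fun x : ℝ => x ^ (-3 : ℝ) * Real.exp (-b * x ^ (-s))) (𝓝[>] 0) (𝓝 0) := by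
  have h1 : Tendsto (fun x : ℝ => x ^ (-s)) (𝓝[>] 0) atTop :=
    tendsto_rpow_neg_nhdsGT_zero (neg_neg_of_pos hs)
  have h2 := (tendsto_rpow_mul_exp_neg_mul_atTop_nhds_zero (3 / s) b hb).comp h1
  refine h2.congr' ?_
  filter_upwards [self_mem_nhdsWithin] with x hx
  have hx' : (0 : ℝ) < x := hx
  simp only [Function.comp_apply]
  rw [← Real.rpow_mul hx'.le]
  congr 2
  field_simp

section Sequence

variable {N : ℕ} {S : ℕ → Medium N}

lemma tendsto_Ω (hδ : Tendsto (fun p => (S p).δ) atTop (𝓝 0))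
    (hΩ : (fun p => (S p).Ω) =Θ[atTop] (fun p => √(S p).δ)) :
    Tendsto (fun p => (S p).Ω) atTop (𝓝[>] 0) := by
  refine tendsto_nhdsWithin_iff.2 ⟨hΩ.1.trans_tendsto ?_,
    Eventually.of_forall fun p => (S p).Ω_pos⟩
  simpa using hδ.sqrt

lemma exists_sqrt_δ_bounds (hΩ : (fun p => (S p).Ω) =Θ[atTop] (fun p => √(S p).δ)) :
    ∃ R > 0, ∀ᶠ p in atTop, √(S p).δ ≤ R * (S p).Ω ∧ (S p).Ω ≤ R * √(S p).δ := by
  obtain ⟨R₁, hR₁, h1⟩ := hΩ.1.exists_pos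
  obtain ⟨R₂, hR₂, h2⟩ := hΩ.2.exists_pos
  refine ⟨max R₁ R₂, lt_max_of_lt_left hR₁, ?_⟩
  filter_upwards [h1.bound, h2.bound] with p h1 h2
  rw [Real.norm_of_nonneg (S p).Ω_pos.le, Real.norm_of_nonneg (Real.sqrt_nonneg _)] at h1 h2
  have := (S p).Ω_pos
  exact ⟨h2.trans (by gcongr; exact le_max_right _ _), h1.trans (by gcongr; exact le_max_left _ _)⟩

/-- The degree of the modulation in terms of its frequency. -/
lemma exists_degree_le (hδ : Tendsto (fun p => (S p).δ) atTop (𝓝 0))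
    (hΩ : (fun p => (S p).Ω) =Θ[atTop] (fun p => √(S p).δ))
    {γ : ℝ} (hγ : γ ∈ Set.Ioo (0 : ℝ) 1)
    (hM : (fun p => ((S p).M : ℝ)) =O[atTop] (fun p => (S p).δ ^ (-γ / 2))) :
    ∃ D > 0, ∀ᶠ p in atTop, ((S p).M : ℝ) + 1 ≤ D * (S p).Ω ^ (-γ) := by
  obtain ⟨R, hR, hRΩ⟩ := exists_sqrt_δ_bounds hΩ
  obtain ⟨D, hD, hDM⟩ := hM.exists_pos
  have hlt : ∀ᶠ p in atTop, (S p).Ω < 1 :=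
    (tendsto_nhdsWithin_iff.1 (tendsto_Ω hδ hΩ)).1.eventually_lt_const one_pos
  refine ⟨D * R ^ γ + 1, by positivity, ?_⟩
  filter_upwards [hRΩ, hDM.bound, hlt] with p h1 h2 h3
  have hΩp := (S p).Ω_pos
  have hδp := (S p).δ_pos
  have h4 : (S p).δ ^ (-γ / 2) = (√(S p).δ) ^ (-γ) := by
    rw [Real.sqrt_eq_rpow, ← Real.rpow_mul hδp.le]
    ring_nf
  have h5 : (S p).Ω / R ≤ √(S p).δ := by
    rw [div_le_iff₀ hR, mul_comm]
    exact h1.2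
  have h6 : (√(S p).δ) ^ (-γ) ≤ R ^ γ * (S p).Ω ^ (-γ) := by
    refine (Real.rpow_le_rpow_of_nonpos (by positivity) h5 (by linarith [hγ.1])).trans_eq ?_
    rw [Real.div_rpow hΩp.le hR.le, Real.rpow_neg hR.le, div_inv_eq_mul, mul_comm]
  have h7 : 1 ≤ (S p).Ω ^ (-γ) :=
    Real.one_le_rpow_of_pos_of_le_one_of_nonpos hΩp h3.le (by linarith [hγ.1])
  rw [Real.norm_of_nonneg (Nat.cast_nonneg _), Real.norm_of_nonneg (by positivity), h4] at h2
  calc ((S p).M : ℝ) + 1 ≤ D * (R ^ γ * (S p).Ω ^ (-γ)) + (S p).Ω ^ (-γ) := by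
        refine add_le_add (h2.trans ?_) h7
        gcongr
    _ = _ := by ring

lemma exists_le_odeMass (G : Resonators N) {vr : ℝ} (hvr : ∀ p, (S p).vr = vr)
    (hΩ : (fun p => (S p).Ω) =Θ[atTop] (fun p => √(S p).δ)) :
    ∃ lam > 0, ∀ᶠ p in atTop, ∀ i, lam ≤ odeMass G (S p) i := by
  obtain ⟨R, hR, hRΩ⟩ := exists_sqrt_δ_bounds hΩ
  have hvr0 : 0 < vr := hvr 0 ▸ (S 0).vr_pos
  have hne : ∃ l > 0, ∀ i : Fin N, l ≤ G.len (i : ℕ) := by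
    obtain hN | hN := isEmpty_or_nonempty (Fin N)
    · exact ⟨1, one_pos, fun i => hN.elim i⟩
    · obtain ⟨i, hi⟩ := Finite.exists_min fun i : Fin N => G.len (i : ℕ)
      exact ⟨_, G.len_pos _, hi⟩
  obtain ⟨l, hl, hli⟩ := hne
  refine ⟨l / (R ^ 2 * vr ^ 2), by positivity, ?_⟩
  filter_upwards [hRΩ] with p h1 i
  have hδp := (S p).δ_pos
  have h2 : (S p).δ ≤ R ^ 2 * (S p).Ω ^ 2 := by
    have := pow_le_pow_left₀ (Real.sqrt_nonneg _) h1.1 2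
    rwa [Real.sq_sqrt hδp.le, mul_pow] at this
  rw [odeMass, hvr, div_le_div_iff₀ (by positivity) (by positivity)]
  calc l * ((S p).δ * vr ^ 2) ≤ G.len (i : ℕ) * ((R ^ 2 * (S p).Ω ^ 2) * vr ^ 2) := by
        gcongr
        · exact (G.len_pos _).le
        · exact hli i
    _ = _ := by ring

end Sequence

lemma Medium.norm_trigPoly_k_mem {N : ℕ} (S : Medium N) {c C : ℝ} (hc : 0 < c)
    (hκ : ∀ i t, S.κ i t ∈ Set.Icc c C) (i : Fin N) (t : ℝ) :
    ‖trigPoly S.M (S.k i) t‖ ∈ Set.Icc C⁻¹ c⁻¹ := by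
  rw [← S.inv_κ_div_eq, norm_inv, Complex.norm_real, Real.norm_of_nonneg (S.κ_pos _ _).le]
  exact ⟨inv_anti₀ (S.κ_pos _ _) (hκ i _).2, inv_anti₀ hc (hκ i _).1⟩

lemma Medium.norm_trigPoly_r_mem {N : ℕ} (S : Medium N) {c C : ℝ} (hc : 0 < c)
    (hρ : ∀ i t, S.ρ i t ∈ Set.Icc c C) (i : Fin N) (t : ℝ) :
    ‖trigPoly S.M (S.r i) t‖ ∈ Set.Icc C⁻¹ c⁻¹ := by
  rw [← S.inv_ρ_div_eq, norm_inv, Complex.norm_real, Real.norm_of_nonneg (S.ρ_pos _ _).le]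
  exact ⟨inv_anti₀ (S.ρ_pos _ _) (hρ i _).2, inv_anti₀ hc (hρ i _).1⟩

lemma IsApproxFloquet.mono {N : ℕ} {G : Resonators N} {S : Medium N} {α : ℝ} {σ : ℂ}
    {y q : Fin N → ℤ → ℂ} {ε ε' : ℝ} (h : IsApproxFloquet G S α σ y q ε) (hε : ε ≤ ε') :
    IsApproxFloquet G S α σ y q ε' where
  summable_y := h.summable_y
  summable_q := h.summable_q
  pos := h.pos
  flux i := (h.flux i).trans (mul_le_mul_of_nonneg_right hε h.pos.le)
  velocity i := (h.velocity i).trans (mul_le_mul_of_nonneg_right hε h.pos.le)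

/-- The analytic form of the choice of the weight: with `θ = Ω ^ β / (M + 1)` for a small power `β`,
low-frequency modes are concentrated, in the weighted norm, on frequencies tending to zero. -/
lemma eventually_wnorm_pow_mul_le {N : ℕ} {S : ℕ → Medium N} {γ β : ℝ} (hγ : γ ∈ Set.Ioo (0 : ℝ) 1)
    (hβ : β = (1 - γ) / 4)
    (hδ : Tendsto (fun p => (S p).δ) atTop (𝓝 0))
    (hΩ : (fun p => (S p).Ω) =Θ[atTop] (fun p => √(S p).δ))
    (hM : (fun p => ((S p).M : ℝ)) =O[atTop] (fun p => (S p).δ ^ (-γ / 2)))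
    {a : ℕ → ℤ → ℝ} (ha0 : ∀ p n, 0 ≤ a p n) (ha : ∀ᶠ p in atTop, HasSum (a p) 1) {K : ℕ → ℕ}
    (hK : Tendsto (fun p => (K p : ℝ) * (S p).Ω) atTop (𝓝 0))
    (hKa : Tendsto (fun p => ∑ n ∈ Finset.Icc (-(K p : ℤ)) (K p), a p n) atTop (𝓝 1))
    {ω : ℕ → ℂ} {R : ℝ} (hR : 0 ≤ R) (hω : ∀ᶠ p in atTop, ‖ω p‖ ≤ R * (S p).Ω)
    {μ : ℝ} (hμ : 0 < μ) :
    ∀ᶠ p in atTop, ∀ j : ℕ, j = 1 ∨ j = 2 →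
      wnorm ((S p).Ω ^ β / ((S p).M + 1)) (fun n => ‖ω p + n * (S p).Ω‖ ^ j * a p n) ≤
        μ * wnorm ((S p).Ω ^ β / ((S p).M + 1)) (a p) := by
  have hβ0 : 0 < β := by rw [hβ]; linarith [hγ.2]
  have hΩ0 := tendsto_Ω hδ hΩ
  have hΩ0' := (tendsto_nhdsWithin_iff.1 hΩ0).1
  obtain ⟨D, hD, hDM⟩ := exists_degree_le hδ hΩ hγ hM
  -- the frequency at which the modes are cut off
  set g : ℕ → ℝ := fun p => max (√((K p : ℝ) * (S p).Ω)) ((S p).Ω ^ β) with hg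
  have hg0 : Tendsto g atTop (𝓝 0) := by
    have h1 : Tendsto (fun p => √((K p : ℝ) * (S p).Ω)) atTop (𝓝 0) := by simpa using hK.sqrt
    have h2 : Tendsto (fun p => (S p).Ω ^ β) atTop (𝓝 0) := by
      simpa [Real.zero_rpow hβ0.ne'] using hΩ0'.rpow_const (p := β) (Or.inr hβ0.le)
    have h3 := h1.max h2
    rwa [max_self] at h3
  have hs : Tendsto (fun p => (S p).Ω * R + g p) atTop (𝓝 0) := by
    simpa using (hΩ0'.mul_const R).add hg0
  have hexp : Tendsto (fun p => 3072 * (R + 1) ^ 2 * D ^ 3 * ((S p).Ω ^ (-3 : ℝ) *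
      Real.exp (-(1 / (4 * D)) * (S p).Ω ^ (-((1 - γ) / 2))))) atTop (𝓝 0) := by
    have := ((tendsto_rpow_neg_three_mul_exp (b := 1 / (4 * D)) (s := (1 - γ) / 2) (by positivity)
      (by linarith [hγ.2])).comp hΩ0).const_mul (3072 * (R + 1) ^ 2 * D ^ 3)
    rwa [mul_zero] at this
  filter_upwards [ha, hKa.eventually_const_lt (by norm_num : (1 / 2 : ℝ) < 1), hω, hDM,
    hs.eventually_lt_const (show (0 : ℝ) < min (μ / 2) 1 by positivity),
    hexp.eventually_lt_const (half_pos hμ), hg0.eventually_lt_const (by norm_num : (0 : ℝ) < 1 / 2),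
    hΩ0'.eventually_lt_const one_pos] with p h1 h2 h3 h4 h5 h6 h7 h8 j hj
  have hx := (S p).Ω_pos
  set x := (S p).Ω with hxdef
  set m : ℝ := (S p).M + 1 with hm
  have hm0 : 0 < m := by positivity
  have hθ : 0 < x ^ β / m := by positivity
  have hgx : x ^ β ≤ g p := le_max_right _ _
  have hβ1 : β ≤ 1 := by rw [hβ]; linarith [hγ.1]
  have hK₂ : 1 ≤ g p / x := by
    rw [le_div_iff₀ hx, one_mul]
    refine le_trans ?_ hgx
    simpa using Real.rpow_le_rpow_of_exponent_ge hx h8.le hβ1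
  have hKK₂ : (K p : ℝ) ≤ g p / x / 2 := by
    rw [div_div, le_div_iff₀ (by positivity)]
    have e1 : √((K p : ℝ) * x) ≤ g p := le_max_left _ _
    have e2 : (K p : ℝ) * x = √((K p : ℝ) * x) ^ 2 := (Real.sq_sqrt (by positivity)).symm
    have e3 := Real.sqrt_nonneg ((K p : ℝ) * x)
    nlinarith
  have key := wnorm_pow_mul_le hθ (ha0 p) h1 h2.le hx h8.le hR hK₂ hKK₂ h3 (j := j) (by omega)
  refine key.trans (mul_le_mul_of_nonneg_right ?_ (wnorm_nonneg _ _))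
  have e1 : x * (R + g p / x) = x * R + g p := by field_simp
  rw [e1]
  have e2 : (x * R + g p) ^ j ≤ μ / 2 := by
    have h50 : 0 ≤ x * R + g p := add_nonneg (by positivity) (le_trans (by positivity) hgx)
    refine (pow_le_of_le_one h50 (h5.le.trans (min_le_right _ _)) (by omega)).trans
      (h5.le.trans (min_le_left _ _))
  have e3 : (x ^ β / m)⁻¹ ≤ D * x ^ (-1 : ℝ) := by
    rw [inv_div, div_le_iff₀ (by positivity)]
    refine h4.trans ?_
    rw [mul_assoc, ← Real.rpow_add hx]
    gcongr D * ?_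
    refine Real.rpow_le_rpow_of_exponent_ge hx h8.le ?_
    rw [hβ]
    linarith [hγ.2]
  have e4 : 1 / (4 * D) * x ^ (-((1 - γ) / 2)) ≤ x ^ β / m * (g p / x) / 4 := by
    have f1 : x ^ (-((1 - γ) / 2)) = x ^ β * x ^ β * x ^ γ * x⁻¹ := by
      rw [← Real.rpow_neg_one, ← Real.rpow_add hx, ← Real.rpow_add hx, ← Real.rpow_add hx, hβ]
      ring_nf
    have f2 : x ^ γ * m ≤ D := by
      calc x ^ γ * m ≤ x ^ γ * (D * x ^ (-γ)) := by gcongr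
        _ = D * (x ^ γ * x ^ (-γ)) := by ring
        _ = D := by rw [← Real.rpow_add hx, add_neg_cancel, Real.rpow_zero, mul_one]
    rw [f1]
    calc 1 / (4 * D) * (x ^ β * x ^ β * x ^ γ * x⁻¹)
        = (x ^ β * x ^ β * x⁻¹ / 4) * (x ^ γ / D) := by field_simp
      _ ≤ (x ^ β * g p * x⁻¹ / 4) * (1 / m) := by
          refine mul_le_mul (by gcongr) ?_ (by positivity) ?_
          · rw [div_le_div_iff₀ hD hm0]
            linarith
          · have : 0 ≤ g p := le_trans (by positivity) hgx
            positivity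
      _ = _ := by field_simp
  have e5 : 3072 * (R + 1) ^ 2 * ((x ^ β / m)⁻¹ ^ 3 *
      Real.exp (-(x ^ β / m * (g p / x) / 4))) ≤ μ / 2 := by
    refine le_trans ?_ h6.le
    have f1 : x ^ (-3 : ℝ) = (x ^ (-1 : ℝ)) ^ 3 := by
      rw [← Real.rpow_mul_natCast hx.le]
      norm_num
    calc _ ≤ 3072 * (R + 1) ^ 2 * ((D * x ^ (-1 : ℝ)) ^ 3 *
          Real.exp (-(1 / (4 * D) * x ^ (-((1 - γ) / 2))))) := by gcongr
      _ = _ := by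
        rw [f1, neg_mul]
        ring
  linarith

/-- Near a subwavelength quasifrequency there is a quasifrequency of the capacitance ODE, up to an
arbitrarily small multiple of the modulation frequency. -/
lemma eventually_exists_near {N : ℕ} (hN : 0 < N) (G : Resonators N) (α : ℝ)
    (S : ℕ → Medium N) {ρ₀ κ₀ vr : ℝ}
    (hρ₀ : ∀ p, (S p).ρ₀ = ρ₀) (hκ₀ : ∀ p, (S p).κ₀ = κ₀) (hvr : ∀ p, (S p).vr = vr)
    (hδ : Tendsto (fun p => (S p).δ) atTop (𝓝 0))
    (hΩ : (fun p => (S p).Ω) =Θ[atTop] (fun p => √(S p).δ))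
    {γ : ℝ} (hγ : γ ∈ Set.Ioo (0 : ℝ) 1)
    (hM : (fun p => ((S p).M : ℝ)) =O[atTop] (fun p => (S p).δ ^ (-γ / 2)))
    {c C : ℝ} (hc : 0 < c)
    (hρ : ∀ p i t, (S p).ρ i t ∈ Set.Icc c C)
    (hκ : ∀ p i t, (S p).κ i t ∈ Set.Icc c C)
    {ω : ℕ → ℂ} (hω : IsSubwavelengthQuasifrequency G S α ω) {η : ℝ} (hη : 0 < η) :
    ∀ᶠ p in atTop, ∃ ω', IsCapacitanceQuasifrequency G (S p) α ω' ∧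
      ‖ω p - ω'‖ ≤ η * (S p).Ω := by
  obtain ⟨-, hωO, v, hmode, hsum, K', hK', hK'sum⟩ := hω
  have hC : 0 < C := hc.trans_le ((hκ 0 ⟨0, hN⟩ 0).1.trans (hκ 0 ⟨0, hN⟩ 0).2)
  obtain ⟨K, hK0, hK⟩ := exists_modeBounds hN G α (hρ₀ 0 ▸ (S 0).ρ₀_pos) (hκ₀ 0 ▸ (S 0).κ₀_pos)
    (hvr 0 ▸ (S 0).vr_pos)
  obtain ⟨lam, hlam, hlam'⟩ := exists_le_odeMass G hvr hΩ
  obtain ⟨R, hR, hRω⟩ : ∃ R > 0, ∀ᶠ p in atTop, ‖ω p‖ ≤ R * (S p).Ω := by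
    obtain ⟨R, hR, h⟩ := (hωO.trans hΩ.2).exists_pos
    refine ⟨R, hR, h.bound.mono fun p hp => ?_⟩
    rwa [Real.norm_of_nonneg (S p).Ω_pos.le] at hp
  set l := ∑ i : Fin N, √(G.len (i : ℕ)) with hl
  have hli : ∀ i : Fin N, √(G.len (i : ℕ)) ≤ l := fun i =>
    Finset.single_le_sum (f := fun i : Fin N => √(G.len (i : ℕ))) (fun i _ => Real.sqrt_nonneg _)
      (Finset.mem_univ i)
  have hl0 : 0 ≤ l := (Real.sqrt_nonneg _).trans (hli ⟨0, hN⟩)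
  obtain ⟨ε, hε, hnear⟩ := exists_near_isCapacitanceQuasifrequency hN G α (R := R) hC.le hlam hη
  set b := C⁻¹ with hb
  set B := c⁻¹ with hB
  have hb0 : 0 < b := inv_pos.2 hC
  have hB0 : 0 < B := inv_pos.2 hc
  set c₁ := K * (1 + N * ((2 + l) * (2 / b * (K * (2 + 8 * B))))) with hc₁
  set c₂ := 2 * K ^ 2 * (1 + N * (2 * (2 / b * (K * (2 + 8 * B))))) + 2 / b / lam with hc₂
  have hc₁0 : 0 ≤ c₁ := by positivity
  have hc₂0 : 0 ≤ c₂ := by positivity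
  set μ := min 1 (min (1 / (2 * (c₁ + 1))) (ε / (c₂ + 1))) with hμ
  have hμ0 : 0 < μ := by positivity
  have hμ1 : μ ≤ 1 := min_le_left _ _
  have hμ2 : K * ((1 + N * ((2 + l) * (2 / b * (K * (2 + 8 * B))))) * μ) ≤ 1 / 2 := by
    have h1 : μ ≤ 1 / (2 * (c₁ + 1)) := (min_le_right _ _).trans (min_le_left _ _)
    rw [le_div_iff₀ (by positivity)] at h1
    rw [← mul_assoc, ← hc₁]
    nlinarith
  have hμ3 : c₂ * μ ≤ ε := by
    have h1 : μ ≤ ε / (c₂ + 1) := (min_le_right _ _).trans (min_le_right _ _)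
    rw [le_div_iff₀ (by positivity)] at h1
    nlinarith
  set β := (1 - γ) / 4 with hβ
  have hβ0 : 0 < β := by rw [hβ]; linarith [hγ.2]
  have hΩ0' := (tendsto_nhdsWithin_iff.1 (tendsto_Ω hδ hΩ)).1
  obtain ⟨D, hD, hDM⟩ := exists_degree_le hδ hΩ hγ hM
  have hx : Tendsto (fun p => 2 * Real.exp 2 * (S p).Ω ^ β) atTop (𝓝 0) := by
    have h2 : Tendsto (fun p => (S p).Ω ^ β) atTop (𝓝 0) := by
      simpa [Real.zero_rpow hβ0.ne'] using hΩ0'.rpow_const (p := β) (Or.inr hβ0.le)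
    simpa using h2.const_mul (2 * Real.exp 2)
  have hΩD : Tendsto (fun p => D * (S p).Ω ^ (1 - γ)) atTop (𝓝 0) := by
    have h1 : 0 < 1 - γ := by linarith [hγ.2]
    have h2 : Tendsto (fun p => (S p).Ω ^ (1 - γ)) atTop (𝓝 0) := by
      simpa [Real.zero_rpow h1.ne'] using hΩ0'.rpow_const (p := 1 - γ) (Or.inr h1.le)
    simpa using h2.const_mul D
  filter_upwards [hmode, hsum, hlam', hRω, hDM, hδ.eventually_lt_const hμ0,
    hx.eventually_lt_const (show 0 < min 1 (min (b / 2 / B) (μ / B)) by positivity),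
    hΩD.eventually_lt_const one_pos,
    eventually_wnorm_pow_mul_le hγ hβ hδ hΩ hM (fun p n => Real.sqrt_nonneg _) hsum hK' hK'sum
      hR.le hRω hμ0]
    with p p1 p2 p3 p4 p5 p6 p7 p8 p9
  have hΩp := (S p).Ω_pos
  set θ := (S p).Ω ^ β / ((S p).M + 1) with hθ
  have hM1 : (0 : ℝ) < (S p).M + 1 := by positivity
  have hθ0 : 0 < θ := by positivity
  have hθM : 2 * Real.exp 2 * ((S p).M + 1) * θ = 2 * Real.exp 2 * (S p).Ω ^ β := by
    rw [hθ]; field_simp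
  set v' : ℤ → C(ℝ, ℂ) := fun n => ⟨v p n, p1.continuous n⟩ with hv'
  have hLF : LowFrequencyBounds G (S p) α (ω p) v' K b B θ μ :=
    { modeBounds := hK (S p) (hρ₀ p) (hκ₀ p) (hvr p) (ω p) v' p1
      le_r := fun i t => ((S p).norm_trigPoly_r_mem hc (hρ p) i t).1
      r_le := fun i t => ((S p).norm_trigPoly_r_mem hc (hρ p) i t).2
      le_k := fun i t => ((S p).norm_trigPoly_k_mem hc (hκ p) i t).1
      k_le := fun i t => ((S p).norm_trigPoly_k_mem hc (hκ p) i t).2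
      θ_pos := hθ0
      θ_le := by rw [hθM]; exact p7.le.trans (min_le_left _ _)
      θ_le' := by
        rw [hθM, ← le_div_iff₀ hB0]
        exact p7.le.trans ((min_le_right _ _).trans (min_le_left _ _))
      θ_le_μ := by
        rw [hθM, ← le_div_iff₀ hB0]
        exact p7.le.trans ((min_le_right _ _).trans (min_le_right _ _))
      δ_le := p6.le
      μ_le_one := hμ1
      Ω_mul_le := by
        refine le_trans ?_ p8.le
        calc (S p).Ω * ((S p).M + 1) ≤ (S p).Ω * (D * (S p).Ω ^ (-γ)) := by gcongr
          _ = D * ((S p).Ω ^ (1 : ℝ) * (S p).Ω ^ (-γ)) := by rw [Real.rpow_one]; ring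
          _ = _ := by rw [← Real.rpow_add hΩp, sub_eq_add_neg]
      polyGrowth := polyGrowth_of_hasSum (fun n => Real.sqrt_nonneg _) p2
      low := by
        have h := p9 1 (Or.inl rfl)
        simp only [pow_one] at h
        exact h
      low_sq := p9 2 (Or.inr rfl) }
  have hA : 0 < wnorm θ fun n => cellNorm G.L (v' n) := by
    -- the cell norms do not vanish identically since their sum is one
    refine lt_of_le_of_ne (wnorm_nonneg _ _) fun h0 => ?_
    have hz : ∀ n, cellNorm G.L (v p n) = 0 := fun n => by
      have h1 := norm_le_l2norm (hLF.polyGrowth.sqSummable hθ0) n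
      have h2 : ‖coshWeight θ n * cellNorm G.L (v' n)‖ ≤ 0 := h1.trans h0.symm.le
      exact (mul_eq_zero.1 (norm_le_zero_iff.1 h2)).resolve_left (coshWeight_pos θ n).ne'
    have h3 := p2.unique (by simpa only [hz] using hasSum_zero)
    exact one_ne_zero h3
  obtain ⟨y, q, hyq⟩ := hLF.exists_isApproxFloquet hb0 hK0 hli hlam p3 hμ2 hA
  have hσ : ‖ω p / (S p).Ω‖ ≤ R := by
    rw [norm_div, Complex.norm_real, Real.norm_of_nonneg hΩp.le, div_le_iff₀ hΩp]
    exact p4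
  obtain ⟨ω', h1, h2⟩ := hnear (S p) _ y q p3 (fun i t => (hκ p i t).2) hσ (hyq.mono hμ3)
  refine ⟨ω', h1, ?_⟩
  rwa [mul_div_cancel₀ _ (Complex.ofReal_ne_zero.2 hΩp.ne')] at h2

/-- Since the error in `eventually_exists_near` is an arbitrary multiple of `Ω`, a choice of nearest
quasifrequencies gives an error which is `o(√δ)`. -/
lemma exists_isCapacitanceQuasifrequency_isLittleO {N : ℕ} (hN : 0 < N) (G : Resonators N) (α : ℝ)
    (S : ℕ → Medium N) {ρ₀ κ₀ vr : ℝ}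
    (hρ₀ : ∀ p, (S p).ρ₀ = ρ₀) (hκ₀ : ∀ p, (S p).κ₀ = κ₀) (hvr : ∀ p, (S p).vr = vr)
    (hδ : Tendsto (fun p => (S p).δ) atTop (𝓝 0))
    (hΩ : (fun p => (S p).Ω) =Θ[atTop] (fun p => √(S p).δ))
    {γ : ℝ} (hγ : γ ∈ Set.Ioo (0 : ℝ) 1)
    (hM : (fun p => ((S p).M : ℝ)) =O[atTop] (fun p => (S p).δ ^ (-γ / 2)))
    {c C : ℝ} (hc : 0 < c)
    (hρ : ∀ p i t, (S p).ρ i t ∈ Set.Icc c C)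
    (hκ : ∀ p i t, (S p).κ i t ∈ Set.Icc c C)
    {ω : ℕ → ℂ} (hω : IsSubwavelengthQuasifrequency G S α ω) :
    ∃ ωcap : ℕ → ℂ, (∀ p, IsCapacitanceQuasifrequency G (S p) α (ωcap p)) ∧
      (fun p => ω p - ωcap p) =o[atTop] (fun p => √(S p).δ) := by
  have hC : 0 < C := hc.trans_le ((hκ 0 ⟨0, hN⟩ 0).1.trans (hκ 0 ⟨0, hN⟩ 0).2)
  have : Nonempty (Fin N) := ⟨⟨0, hN⟩⟩
  have hne : ∀ p, {ω' | IsCapacitanceQuasifrequency G (S p) α ω'}.Nonempty := fun p => by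
    obtain ⟨i, hi⟩ := Finite.exists_min fun i : Fin N => odeMass G (S p) i
    exact exists_isCapacitanceQuasifrequency hN (odeMass_pos G (S p) i) hi hC.le
      fun i t => (hκ p i t).2
  have hex : ∀ p, ∃ ω', IsCapacitanceQuasifrequency G (S p) α ω' ∧ dist (ω p) ω' <
      Metric.infDist (ω p) {ω' | IsCapacitanceQuasifrequency G (S p) α ω'} +
        (S p).Ω * (1 / ((p : ℝ) + 1)) := fun p => by
    have hpos : 0 < (S p).Ω * (1 / ((p : ℝ) + 1)) := mul_pos (S p).Ω_pos (by positivity)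
    obtain ⟨ω', h1, h2⟩ := (Metric.infDist_lt_iff (hne p)).1 (lt_add_of_pos_right _ hpos)
    exact ⟨ω', h1, h2⟩
  choose ωcap h1 h2 using hex
  refine ⟨ωcap, h1, IsLittleO.trans_isBigO (IsLittleO.of_bound fun η hη => ?_) hΩ.1⟩
  filter_upwards [eventually_exists_near hN G α S hρ₀ hκ₀ hvr hδ hΩ hγ hM hc hρ hκ hω (half_pos hη),
    (tendsto_one_div_add_atTop_nhds_zero_nat (𝕜 := ℝ)).eventually_lt_const (half_pos hη)]
    with p ⟨ω', h3, h4⟩ h5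
  rw [Real.norm_of_nonneg (S p).Ω_pos.le, ← dist_eq_norm]
  have h6 : Metric.infDist (ω p) {ω' | IsCapacitanceQuasifrequency G (S p) α ω'} ≤
      η / 2 * (S p).Ω := (Metric.infDist_le_dist_of_mem
        (show ω' ∈ {ω' | IsCapacitanceQuasifrequency G (S p) α ω'} from h3)).trans
        (by rwa [dist_eq_norm])
  have h7 : (S p).Ω * (1 / ((p : ℝ) + 1)) ≤ (S p).Ω * (η / 2) :=
    mul_le_mul_of_nonneg_left h5.le (S p).Ω_pos.le
  linarith [h2 p]


/-! ### Fourier coefficients of Floquet functions -/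

/-- The Fourier coefficients of `e^{-iστ} g(τ)`. -/
noncomputable def floquetCoeff (σ : ℂ) (g : ℝ → ℂ) (n : ℤ) : ℂ :=
  (1 / (2 * Real.pi) : ℂ) * ∫ τ in (0 : ℝ)..2 * Real.pi, Complex.exp (-(Complex.I * (σ + n) * τ)) * g τ

section FloquetCoeff

variable {σ : ℂ} {g g' : ℝ → ℂ}

lemma floquetCoeff_eq_fourierCoeffOn {b : ℝ} (hb : b = 2 * Real.pi) (hab : 0 < b) (σ : ℂ)
    (g : ℝ → ℂ) (n : ℤ) : floquetCoeff σ g n =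
      fourierCoeffOn hab (fun τ : ℝ => Complex.exp (-(Complex.I * σ * τ)) * g τ) n := by
  subst hb
  rw [fourierCoeffOn_eq_integral, floquetCoeff, Complex.real_smul]
  congr 1
  · push_cast
    rw [sub_zero]
  · refine intervalIntegral.integral_congr fun τ _ => ?_
    rw [fourier_coe_apply, smul_eq_mul, ← mul_assoc, ← Complex.exp_add]
    congr 2
    have : (Real.pi : ℂ) ≠ 0 := Complex.ofReal_ne_zero.2 Real.pi_ne_zero
    push_cast
    rw [sub_zero]
    field_simp
    ring

lemma floquetCoeff_add (hg : Continuous g) (hg' : Continuous g') (n : ℤ) :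
    floquetCoeff σ (fun τ => g τ + g' τ) n = floquetCoeff σ g n + floquetCoeff σ g' n := by
  simp only [floquetCoeff, mul_add]
  rw [intervalIntegral.integral_add (Continuous.intervalIntegrable (by fun_prop) _ _)
    (Continuous.intervalIntegrable (by fun_prop) _ _), mul_add]

lemma floquetCoeff_const_mul (a : ℂ) (g : ℝ → ℂ) (n : ℤ) :
    floquetCoeff σ (fun τ => a * g τ) n = a * floquetCoeff σ g n := by
  simp only [floquetCoeff, mul_left_comm _ a, intervalIntegral.integral_const_mul]

lemma floquetCoeff_sub (hg : Continuous g) (hg' : Continuous g') (n : ℤ) :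
    floquetCoeff σ (fun τ => g τ - g' τ) n = floquetCoeff σ g n - floquetCoeff σ g' n := by
  have := floquetCoeff_add (σ := σ) hg (hg'.const_mul (-1)) n
  rw [floquetCoeff_const_mul] at this
  simpa [sub_eq_add_neg] using this

/-- Integration by parts: differentiation is multiplication with `i (σ + n)`. -/
lemma floquetCoeff_deriv (hg : ∀ τ, HasDerivAt g (g' τ) τ) (hg' : Continuous g')
    (hper : g (2 * Real.pi) = Complex.exp (2 * Real.pi * Complex.I * σ) * g 0) (n : ℤ) :
    floquetCoeff σ g' n = Complex.I * (σ + n) * floquetCoeff σ g n := by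
  have hgc : Continuous g := continuous_iff_continuousAt.2 fun τ => (hg τ).continuousAt
  have h1 : ∀ τ : ℝ, HasDerivAt (fun τ : ℝ => Complex.exp (-(Complex.I * (σ + n) * τ)) * g τ)
      (Complex.exp (-(Complex.I * (σ + n) * τ)) * g' τ -
        Complex.I * (σ + n) * (Complex.exp (-(Complex.I * (σ + n) * τ)) * g τ)) τ := fun τ => by
    have h2 : HasDerivAt (fun τ : ℝ => -(Complex.I * (σ + n) * (τ : ℂ))) (-(Complex.I * (σ + n)))
        τ := by
      simpa using ((Complex.ofRealCLM.hasDerivAt (x := τ)).const_mul (Complex.I * (σ + n))).fun_neg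
    refine (h2.cexp.fun_mul (hg τ)).congr_deriv ?_
    ring
  have h2 := intervalIntegral.integral_eq_sub_of_hasDerivAt (a := 0) (b := 2 * Real.pi)
    (fun τ _ => h1 τ) (Continuous.intervalIntegrable (by fun_prop) _ _)
  rw [intervalIntegral.integral_sub (Continuous.intervalIntegrable (by fun_prop) _ _)
    (Continuous.intervalIntegrable (by fun_prop) _ _), intervalIntegral.integral_const_mul] at h2
  have h3 : Complex.exp (-(Complex.I * (σ + n) * ((2 * Real.pi : ℝ) : ℂ))) * g (2 * Real.pi) =
      g 0 := by
    rw [hper, ← mul_assoc, ← Complex.exp_add]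
    have : -(Complex.I * (σ + n) * ((2 * Real.pi : ℝ) : ℂ)) + 2 * Real.pi * Complex.I * σ =
        ((-n : ℤ) : ℂ) * (2 * Real.pi * Complex.I) := by push_cast; ring
    rw [this, Complex.exp_int_mul_two_pi_mul_I, one_mul]
  rw [h3] at h2
  simp only [Complex.ofReal_zero, mul_zero, neg_zero, Complex.exp_zero, one_mul, sub_self] at h2
  rw [sub_eq_zero] at h2
  rw [floquetCoeff, h2, floquetCoeff]
  ring

lemma trigConv_floquetCoeff (M : ℕ) (f : ℤ → ℂ) (hg : Continuous g) (n : ℤ) :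
    trigConv M f (floquetCoeff σ g) n = floquetCoeff σ (fun τ => trigPoly M f τ * g τ) n := by
  unfold trigConv floquetCoeff
  have h1 : ∀ τ : ℝ, Complex.exp (-(Complex.I * (σ + n) * τ)) * (trigPoly M f τ * g τ) =
      ∑ m ∈ Finset.Icc (-(M : ℤ)) M,
        f m * (Complex.exp (-(Complex.I * (σ + (n - m : ℤ)) * τ)) * g τ) := fun τ => by
    rw [trigPoly, Finset.sum_mul, Finset.mul_sum]
    refine Finset.sum_congr rfl fun m _ => ?_
    have : Complex.exp (-(Complex.I * (σ + (n - m : ℤ)) * τ)) =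
        Complex.exp (-(Complex.I * (σ + n) * τ)) * Complex.exp (Complex.I * m * τ) := by
      rw [← Complex.exp_add]
      congr 1
      push_cast
      ring
    rw [this]
    ring
  simp only [h1]
  rw [intervalIntegral.integral_finsetSum
    fun m _ => Continuous.intervalIntegrable (by fun_prop) _ _, Finset.mul_sum]
  refine Finset.sum_congr rfl fun m _ => ?_
  rw [intervalIntegral.integral_const_mul, smul_eq_mul]
  ring

lemma norm_exp_neg_I_mul_le {R : ℝ} (hR : ‖σ‖ ≤ R) {τ : ℝ} (hτ : τ ∈ Set.Icc 0 (2 * Real.pi)) :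
    ‖Complex.exp (-(Complex.I * σ * τ))‖ ≤ Real.exp (2 * Real.pi * R) := by
  have := (norm_exp_I_mul_le (σ := -σ) (R := R) (by rwa [norm_neg]) hτ).1
  rwa [mul_neg, neg_mul] at this

/-- Parseval's identity, in the form of an estimate by the supremum. -/
lemma floquetCoeff_sqSummable_and_le (hg : Continuous g) {R A : ℝ} (hR : ‖σ‖ ≤ R) (hA : 0 ≤ A)
    (hgA : ∀ τ ∈ Set.Icc 0 (2 * Real.pi), ‖g τ‖ ≤ A) :
    SqSummable (floquetCoeff σ g) ∧
      l2norm (floquetCoeff σ g) ≤ Real.exp (2 * Real.pi * R) * A := by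
  have h2π : (0 : ℝ) < 2 * Real.pi := by positivity
  have hFc : Continuous fun τ : ℝ => Complex.exp (-(Complex.I * σ * τ)) * g τ := by fun_prop
  have hF : ∀ τ ∈ Set.Icc 0 (2 * Real.pi), ‖Complex.exp (-(Complex.I * σ * τ)) * g τ‖ ≤
      Real.exp (2 * Real.pi * R) * A := fun τ hτ => by
    rw [norm_mul]
    exact mul_le_mul (norm_exp_neg_I_mul_le hR hτ) (hgA τ hτ) (norm_nonneg _) (Real.exp_nonneg _)
  have hsum := hasSum_sq_fourierCoeffOn h2π (memLp_of_continuous 0 (2 * Real.pi)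
    ⟨fun τ : ℝ => Complex.exp (-(Complex.I * σ * τ)) * g τ, hFc⟩)
  simp only [ContinuousMap.coe_mk, ← floquetCoeff_eq_fourierCoeffOn rfl h2π] at hsum
  refine ⟨hsum.summable, le_of_sq_le_sq ?_ (by positivity)⟩
  rw [sq_l2norm, hsum.tsum_eq, smul_eq_mul, sub_zero]
  have h1 : ∫ τ in (0 : ℝ)..2 * Real.pi, ‖Complex.exp (-(Complex.I * σ * τ)) * g τ‖ ^ 2 ≤
      ∫ τ in (0 : ℝ)..2 * Real.pi, (Real.exp (2 * Real.pi * R) * A) ^ 2 := by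
    refine intervalIntegral.integral_mono_on h2π.le (Continuous.intervalIntegrable (by fun_prop) _ _)
      (by simp) fun τ hτ => ?_
    have := hF τ hτ
    gcongr
  rw [intervalIntegral.integral_const, smul_eq_mul, sub_zero] at h1
  rw [inv_mul_le_iff₀ h2π]
  exact h1

/-- A Floquet function is the sum of its absolutely convergent Fourier series. -/
lemma norm_le_tsum_floquetCoeff (hg : Continuous g)
    (hper : ∀ τ, g (τ + 2 * Real.pi) = Complex.exp (2 * Real.pi * Complex.I * σ) * g τ)
    (hs : Summable fun n => ‖floquetCoeff σ g n‖) {τ : ℝ} (hτ : τ ∈ Set.Icc 0 (2 * Real.pi)) :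
    ‖Complex.exp (-(Complex.I * σ * τ)) * g τ‖ ≤ ∑' n, ‖floquetCoeff σ g n‖ := by
  have h2π : (0 : ℝ) < 2 * Real.pi := by positivity
  have : Fact ((0 : ℝ) < 2 * Real.pi) := ⟨h2π⟩
  set F : ℝ → ℂ := fun τ => Complex.exp (-(Complex.I * σ * τ)) * g τ with hF
  have hFc : Continuous F := by fun_prop
  have hFper : F 0 = F (0 + 2 * Real.pi) := by
    simp only [hF, hper]
    rw [← mul_assoc, ← Complex.exp_add]
    congr 2
    push_cast
    ring
  set f : C(AddCircle (2 * Real.pi), ℂ) :=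
    ⟨AddCircle.liftIco (2 * Real.pi) 0 F, AddCircle.liftIco_continuous hFper hFc.continuousOn⟩
    with hf
  have hfc : ∀ n, fourierCoeff f n = floquetCoeff σ g n := fun n => by
    rw [floquetCoeff_eq_fourierCoeffOn (zero_add _) (lt_add_of_pos_right 0 h2π), hf]
    exact fourierCoeff_liftIco_eq F n
  have hpt : ∀ τ ∈ Set.Ico 0 (2 * Real.pi), ‖F τ‖ ≤ ∑' n, ‖floquetCoeff σ g n‖ := fun τ hτ => by
    have hsf : Summable (fourierCoeff f) := by
      refine Summable.of_norm (hs.congr fun n => ?_)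
      rw [hfc]
    have h1 := has_pointwise_sum_fourier_series_of_summable hsf (τ : AddCircle (2 * Real.pi))
    have h2 : f (τ : AddCircle (2 * Real.pi)) = F τ :=
      show AddCircle.liftIco (2 * Real.pi) 0 F (τ : AddCircle (2 * Real.pi)) = F τ from
        AddCircle.liftIco_coe_apply (by rwa [zero_add])
    rw [h2] at h1
    have h3 : ∀ n, ‖fourierCoeff f n • fourier n (τ : AddCircle (2 * Real.pi))‖ =
        ‖floquetCoeff σ g n‖ := fun n => by
      rw [norm_smul, hfc, fourier_apply, Circle.norm_coe, mul_one]
    rw [← h1.tsum_eq]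
    refine (norm_tsum_le_tsum_norm (hs.congr fun n => (h3 n).symm)).trans_eq ?_
    simp only [h3]
  rcases eq_or_lt_of_le hτ.2 with h | h
  · have h4 : F τ = F 0 := by rw [h, hFper, zero_add]
    change ‖F τ‖ ≤ _
    rw [h4]
    exact hpt 0 ⟨le_rfl, h2π⟩
  · exact hpt τ ⟨hτ.1, h⟩

end FloquetCoeff


/-! ### Bounds for Floquet solutions of the capacitance ODE -/

section Solution

variable {N : ℕ} {G : Resonators N} {S : Medium N} {α : ℝ}

/-- A quasifrequency of the capacitance ODE gives a Floquet solution of the first order system. -/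
lemma IsCapacitanceQuasifrequency.exists_floquet {ω : ℂ}
    (h : IsCapacitanceQuasifrequency G S α ω) :
    ∃ X, IsLinearSolution (odeField G S α) X ∧
      (∀ t, X (t + 2 * Real.pi) = Complex.exp (2 * Real.pi * Complex.I * (ω / S.Ω)) • X t) ∧
      ∃ t, (X t).1 ≠ 0 := by
  obtain ⟨c, hc, hper, hode⟩ := h
  have hΩ := S.Ω_pos
  have hΩ' : (S.Ω : ℂ) ≠ 0 := Complex.ofReal_ne_zero.2 hΩ.ne'
  have hκ : ∀ i t, (S.κ i t : ℂ) ≠ 0 := fun i t => Complex.ofReal_ne_zero.2 (S.κ_pos i t).ne'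
  set w : Fin N → ℝ → ℂ := fun i t => S.ρ i t * c i t with hw
  set e := Complex.exp (2 * Real.pi * Complex.I * (ω / S.Ω)) with he
  have hT : ∀ τ : ℝ, (τ + 2 * Real.pi) / S.Ω = τ / S.Ω + S.T := fun τ => by
    rw [Medium.T, add_div]
  have hwper : ∀ i t, w i (t + S.T) = e * w i t := fun i t => by
    have h1 := hper i t
    have h2 : S.ρ i (t + S.T) = S.ρ i t := by
      have := S.ρ_periodic i (S.Ω * t)
      rwa [hT, mul_div_cancel_left₀ _ hΩ.ne'] at this
    have h3 : Complex.exp (-(Complex.I * ω * ((t + S.T : ℝ) : ℂ))) * e =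
        Complex.exp (-(Complex.I * ω * t)) := by
      rw [he, ← Complex.exp_add]
      congr 1
      rw [Medium.T]
      push_cast
      field_simp
      ring
    have h4 : c i (t + S.T) = e * c i t := by
      refine mul_right_cancel₀ (Complex.exp_ne_zero (-(Complex.I * ω * ((t + S.T : ℝ) : ℂ)))) ?_
      rw [show c i (t + S.T) * Complex.exp (-(Complex.I * ω * ((t + S.T : ℝ) : ℂ))) =
        c i t * Complex.exp (-(Complex.I * ω * t)) from h1, ← h3]
      ring
    simp only [hw, h2, h4]
    ring
  have hdper : ∀ i t, deriv (w i) (t + S.T) = e * deriv (w i) t := fun i t => by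
    rw [← deriv_comp_add_const, ← deriv_const_mul_field]
    congr 1
    exact funext (hwper i)
  have hscale : ∀ τ : ℝ, HasDerivAt (fun τ : ℝ => τ / S.Ω) (1 / S.Ω) τ := fun τ =>
    (hasDerivAt_id τ).div_const _
  have hm : ∀ i, (odeMass G S i : ℂ) ≠ 0 := fun i =>
    Complex.ofReal_ne_zero.2 (odeMass_pos G S i).ne'
  refine ⟨fun τ => (fun i => w i (τ / S.Ω), fun i => (odeMass G S i / (Complex.I * S.Ω)) *
    (1 / (S.κ i (τ / S.Ω) : ℂ) * deriv (w i) (τ / S.Ω))), fun τ => ?_, fun τ => ?_, ?_⟩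
  · rw [odeField_apply]
    refine HasDerivAt.prodMk (hasDerivAt_pi.2 fun i => ?_) (hasDerivAt_pi.2 fun i => ?_)
    · have h1 := (hode i (τ / S.Ω)).1.hasDerivAt.scomp τ (hscale τ)
      refine h1.congr_deriv ?_
      have := hκ i (τ / S.Ω)
      have := hm i
      rw [Complex.real_smul]
      push_cast
      field_simp
    · have h1 := ((hode i (τ / S.Ω)).2.1.hasDerivAt.scomp τ (hscale τ)).const_mul
        (odeMass G S i / (Complex.I * S.Ω))
      refine h1.congr_deriv ?_
      have h2 := (hode i (τ / S.Ω)).2.2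
      dsimp only at h2 ⊢
      rw [h2, Complex.real_smul, odeMass, S.sq_vr]
      have hl : (G.len (i : ℕ) : ℂ) ≠ 0 := Complex.ofReal_ne_zero.2 (G.len_pos _).ne'
      have hδ : (S.δ : ℂ) ≠ 0 := Complex.ofReal_ne_zero.2 S.δ_pos.ne'
      have hκr : (S.κr : ℂ) ≠ 0 := Complex.ofReal_ne_zero.2 S.κr_pos.ne'
      have hρr : (S.ρr : ℂ) ≠ 0 := Complex.ofReal_ne_zero.2 S.ρr_pos.ne'
      push_cast
      set D := deriv (fun s => 1 / (S.κ i s : ℂ) * deriv (w i) s) (τ / S.Ω)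
      field_simp
      rw [Complex.I_sq]
      ring
  · refine Prod.ext (funext fun i => ?_) (funext fun i => ?_)
    · simp only [hT, hwper, Prod.smul_fst, Pi.smul_apply, smul_eq_mul]
    · have h1 : S.κ i (τ / S.Ω + S.T) = S.κ i (τ / S.Ω) := by rw [← hT, S.κ_periodic]
      simp only [hT, hdper, h1, Prod.smul_snd, Pi.smul_apply, smul_eq_mul]
      ring
  · obtain ⟨i, hi⟩ := Function.ne_iff.1 hc
    obtain ⟨t, ht⟩ := Function.ne_iff.1 hi
    refine ⟨S.Ω * t, fun h0 => ?_⟩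
    have h1 := congrFun h0 i
    simp only [mul_div_cancel_left₀ _ hΩ.ne', hw, Pi.zero_apply, mul_eq_zero] at h1
    exact h1.elim (Complex.ofReal_ne_zero.2 (S.ρ_pos i t).ne') ht

/-- A Floquet solution can be normalized to have maximum one over a period. -/
lemma exists_normalized_floquet {X : ℝ → (Fin N → ℂ) × (Fin N → ℂ)} {σ : ℂ}
    (hX : IsLinearSolution (odeField G S α) X)
    (hσ : ∀ t, X (t + 2 * Real.pi) = Complex.exp (2 * Real.pi * Complex.I * σ) • X t)
    (h0 : ∃ t, (X t).1 ≠ 0) :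
    ∃ X, IsLinearSolution (odeField G S α) X ∧
      (∀ t, X (t + 2 * Real.pi) = Complex.exp (2 * Real.pi * Complex.I * σ) • X t) ∧
      (∀ t ∈ Set.Icc 0 (2 * Real.pi), ‖(X t).1‖ ≤ 1) ∧
      ∃ t ∈ Set.Icc 0 (2 * Real.pi), ‖(X t).1‖ = 1 := by
  have h2π : (0 : ℝ) < 2 * Real.pi := by positivity
  have hcont : Continuous X := continuous_iff_continuousAt.2 fun t => (hX t).continuousAt
  obtain ⟨t₀, ht₀, hmax⟩ := (isCompact_Icc (a := (0 : ℝ)) (b := 2 * Real.pi)).exists_isMaxOn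
    ⟨0, le_rfl, h2π.le⟩ hcont.fst.norm.continuousOn
  have hpos : 0 < ‖(X t₀).1‖ := by
    obtain ⟨t, ht⟩ := h0
    have hper : Function.Periodic (fun t : ℝ => Complex.exp (-(Complex.I * σ * t)) • (X t).1)
        (2 * Real.pi) := fun t => by
      simp only [hσ, Prod.smul_fst, smul_smul]
      rw [← Complex.exp_add]
      congr 2
      push_cast
      ring
    obtain ⟨s, hs, hst⟩ := hper.exists_mem_Ico₀ h2π t
    have h1 : (X s).1 ≠ 0 := fun h => by
      rw [h, smul_zero, smul_eq_zero] at hst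
      exact hst.elim (Complex.exp_ne_zero _) ht
    exact (norm_pos_iff.2 h1).trans_le (hmax (Set.Ico_subset_Icc_self hs))
  refine ⟨fun t => ((‖(X t₀).1‖⁻¹ : ℝ) : ℂ) • X t, hX.smul _, fun t => ?_, fun t ht => ?_, t₀, ht₀, ?_⟩
  · simp only [hσ]
    rw [smul_comm]
  · rw [Prod.smul_fst, norm_smul, Complex.norm_real, Real.norm_of_nonneg (inv_nonneg.2 hpos.le),
      inv_mul_le_iff₀ hpos, mul_one]
    exact hmax ht
  · rw [Prod.smul_fst, norm_smul, Complex.norm_real, Real.norm_of_nonneg (inv_nonneg.2 hpos.le),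
      inv_mul_cancel₀ hpos.ne']

/-- If `p' = i (k / m) q` with a positive function `k` and a function `q` which is almost constant,
then `q` is bounded in terms of `p`. -/
lemma norm_le_of_hasDerivAt_I_mul {p q k : ℝ → ℂ} {kr : ℝ → ℝ} (hk : ∀ t, k t = kr t)
    (hkc : Continuous kr) (hqc : Continuous q) {m : ℝ}
    (hp : ∀ t, HasDerivAt p (Complex.I * (k t / m) * q t) t)
    {T c C lam Lam D : ℝ} (hT : 0 < T) (hc : 0 < c) (hkr : ∀ t, kr t ∈ Set.Icc c C)
    (hlam : 0 < lam) (hm : m ∈ Set.Icc lam Lam) (hp0 : ‖p 0‖ ≤ 1) (hpT : ‖p T‖ ≤ 1)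
    (hq : ∀ t ∈ Set.Icc 0 T, ‖q t - q 0‖ ≤ D) :
    ‖q 0‖ ≤ Lam / (T * c) * (2 + C / lam * D * T) := by
  have hm0 : 0 < m := hlam.trans_le hm.1
  have hLam : 0 < Lam := hm0.trans_le hm.2
  have hC : 0 ≤ C := hc.le.trans ((hkr 0).1.trans (hkr 0).2)
  have hkc' : Continuous k := by
    rw [funext hk]
    exact Complex.continuous_ofReal.comp hkc
  have hint := intervalIntegral.integral_eq_sub_of_hasDerivAt (a := 0) (b := T)
    (fun t _ => hp t) (Continuous.intervalIntegrable (by fun_prop) _ _)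
  have hsplit : ∫ t in (0 : ℝ)..T, Complex.I * (k t / m) * q t =
      (Complex.I * q 0 / m) * (∫ t in (0 : ℝ)..T, kr t : ℝ) +
      ∫ t in (0 : ℝ)..T, Complex.I * (k t / m) * (q t - q 0) := by
    rw [← intervalIntegral.integral_ofReal, ← intervalIntegral.integral_const_mul,
      ← intervalIntegral.integral_add (Continuous.intervalIntegrable (by fun_prop) _ _)
        (Continuous.intervalIntegrable (by fun_prop) _ _)]
    refine intervalIntegral.integral_congr fun t _ => ?_
    simp only [hk]
    ring
  have hrem : ‖∫ t in (0 : ℝ)..T, Complex.I * (k t / m) * (q t - q 0)‖ ≤ C / lam * D * T := by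
    have h3 := intervalIntegral.norm_integral_le_of_norm_le_const (a := 0) (b := T)
      (C := C / lam * D) (f := fun t => Complex.I * (k t / m) * (q t - q 0))
      fun t ht => by
        rw [Set.uIoc_of_le hT.le] at ht
        rw [norm_mul, norm_mul, Complex.norm_I, one_mul, norm_div, hk, Complex.norm_real,
          Complex.norm_real, Real.norm_of_nonneg (hc.le.trans (hkr t).1),
          Real.norm_of_nonneg hm0.le]
        exact mul_le_mul (div_le_div₀ hC (hkr t).2 hlam hm.1)
          (hq t (Set.Ioc_subset_Icc_self ht)) (norm_nonneg _) (by positivity)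
    rwa [sub_zero, abs_of_pos hT] at h3
  have hkint : c * T ≤ ∫ t in (0 : ℝ)..T, kr t := by
    have := intervalIntegral.integral_mono_on (a := 0) (b := T) (μ := MeasureTheory.volume)
      (f := fun _ => c) (g := kr) hT.le (by simp) (hkc.intervalIntegrable _ _) fun t _ => (hkr t).1
    simpa [mul_comm] using this
  have hmain : ‖q 0‖ * (T * c / Lam) ≤ 2 + C / lam * D * T := by
    have h4 : (Complex.I * q 0 / m) * (∫ t in (0 : ℝ)..T, kr t : ℝ) =
        p T - p 0 - ∫ t in (0 : ℝ)..T, Complex.I * (k t / m) * (q t - q 0) := by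
      rw [← hint, hsplit, add_sub_cancel_right]
    have h5 := norm_sub_le (p T - p 0) (∫ t in (0 : ℝ)..T, Complex.I * (k t / m) * (q t - q 0))
    have hk0 : 0 ≤ ∫ t in (0 : ℝ)..T, kr t := le_trans (by positivity) hkint
    rw [← h4, norm_mul, norm_div, norm_mul, Complex.norm_I, one_mul, Complex.norm_real,
      Complex.norm_real, Real.norm_of_nonneg hm0.le, Real.norm_of_nonneg hk0] at h5
    have h6 := norm_sub_le (p T) (p 0)
    have h9 : ‖q 0‖ * (T * c / Lam) ≤ ‖q 0‖ / m * ∫ t in (0 : ℝ)..T, kr t := by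
      calc _ = ‖q 0‖ / Lam * (c * T) := by ring
        _ ≤ _ := by
          gcongr
          exact hm.2
    linarith
  calc ‖q 0‖ = Lam / (T * c) * (‖q 0‖ * (T * c / Lam)) := by field_simp
    _ ≤ _ := by gcongr

/-- The second component of a solution is controlled by the first one: if it were much larger, it
would be almost constant, and the first component would grow by a large amount over a period. -/
lemma norm_snd_le_of_norm_fst_le {X : ℝ → (Fin N → ℂ) × (Fin N → ℂ)}
    (hX : IsLinearSolution (odeField G S α) X)
    (h1 : ∀ t ∈ Set.Icc 0 (2 * Real.pi), ‖(X t).1‖ ≤ 1) {c C lam Lam s : ℝ} (hc : 0 < c)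
    (hκ : ∀ i t, S.κ i t ∈ Set.Icc c C) (hlam : 0 < lam)
    (hm : ∀ i, odeMass G S i ∈ Set.Icc lam Lam) (hs : ∀ i, ∑ j, ‖capacitanceMatrix G α i j‖ ≤ s)
    (i : Fin N) {t : ℝ} (ht : t ∈ Set.Icc 0 (2 * Real.pi)) :
    ‖(X t).2 i‖ ≤
      Lam / (2 * Real.pi * c) * (2 + C / lam * (s * (2 * Real.pi)) * (2 * Real.pi)) +
        s * (2 * Real.pi) := by
  have h2π : (0 : ℝ) < 2 * Real.pi := by positivity
  have hX1 : ∀ t, HasDerivAt (fun t => (X t).1 i)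
      (Complex.I * (S.κ i (t / S.Ω) / odeMass G S i) * (X t).2 i) t := fun t =>
    (hasDerivAt_pi.1 (hX t).fst) i
  have hX2 : ∀ t, HasDerivAt (fun t => (X t).2 i)
      (Complex.I * ∑ j, capacitanceMatrix G α i j * (X t).1 j) t := fun t =>
    (hasDerivAt_pi.1 (hX t).snd) i
  have hs0 : 0 ≤ s := le_trans (by positivity) (hs i)
  have hq : ∀ t ∈ Set.Icc 0 (2 * Real.pi), ‖(X t).2 i - (X 0).2 i‖ ≤ s * (2 * Real.pi) :=
      fun t ht => by
    have h2 := (convex_Icc (0 : ℝ) (2 * Real.pi)).norm_image_sub_le_of_norm_hasDerivWithin_le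
      (f := fun t => (X t).2 i) (C := s) (fun t _ => (hX2 t).hasDerivWithinAt) (fun t ht => by
        rw [norm_mul, Complex.norm_I, one_mul]
        refine (norm_sum_le _ _).trans ((Finset.sum_le_sum fun j _ => ?_).trans (hs i))
        rw [norm_mul]
        exact mul_le_of_le_one_right (norm_nonneg _)
          ((norm_le_pi_norm (X t).1 j).trans (h1 t ht)))
      ⟨le_rfl, h2π.le⟩ ht
    refine h2.trans (mul_le_mul_of_nonneg_left ?_ hs0)
    rw [sub_zero, Real.norm_of_nonneg ht.1]
    exact ht.2
  have hqc : Continuous fun t => (X t).2 i :=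
    continuous_iff_continuousAt.2 fun t => (hX2 t).continuousAt
  have hκr : Continuous fun t : ℝ => S.κ i (t / S.Ω) := by
    have := Complex.continuous_re.comp (S.continuous_κ_div i)
    simpa [Function.comp_def] using this
  have h10 := norm_le_of_hasDerivAt_I_mul (fun _ => rfl) hκr hqc hX1 h2π hc (fun t => hκ i _) hlam
    (hm i) ((norm_le_pi_norm (X 0).1 i).trans (h1 _ ⟨le_rfl, h2π.le⟩))
    ((norm_le_pi_norm (X (2 * Real.pi)).1 i).trans (h1 _ ⟨h2π.le, le_rfl⟩)) hq
  calc ‖(X t).2 i‖ = ‖(X 0).2 i + ((X t).2 i - (X 0).2 i)‖ := by rw [add_sub_cancel]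
    _ ≤ _ := (norm_add_le _ _).trans (add_le_add h10 (hq t ht))

end Solution


/-! ### Twice differentiable Floquet functions -/

/-- `g` is a Floquet function with exponent `σ` and derivatives `g'` and `g''`, which are bounded on
a period by `A`, `A m` and `A m ^ 2`. -/
structure IsFloquetC2 (σ : ℂ) (A m : ℝ) (g g' g'' : ℝ → ℂ) : Prop where
  deriv : ∀ τ, HasDerivAt g (g' τ) τ
  deriv₂ : ∀ τ, HasDerivAt g' (g'' τ) τ
  continuous : Continuous g''
  floquet : ∀ τ, g (τ + 2 * Real.pi) = Complex.exp (2 * Real.pi * Complex.I * σ) * g τ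
  nonneg : 0 ≤ A
  bound : ∀ τ ∈ Set.Icc 0 (2 * Real.pi), ‖g τ‖ ≤ A
  bound' : ∀ τ ∈ Set.Icc 0 (2 * Real.pi), ‖g' τ‖ ≤ A * m
  bound'' : ∀ τ ∈ Set.Icc 0 (2 * Real.pi), ‖g'' τ‖ ≤ A * m ^ 2

/-- The bounds for the Fourier coefficients of the functions in `IsFloquetC2`. -/
structure IsFloquetSeq (σ : ℂ) (A m : ℝ) (c : ℤ → ℂ) : Prop where
  sq₀ : SqSummable c
  sq₁ : SqSummable fun n : ℤ => (σ + n) * c n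
  sq₂ : SqSummable fun n : ℤ => (σ + n) ^ 2 * c n
  le₀ : l2norm c ≤ A
  le₁ : l2norm (fun n : ℤ => (σ + n) * c n) ≤ A * m
  le₂ : l2norm (fun n : ℤ => (σ + n) ^ 2 * c n) ≤ A * m ^ 2

namespace IsFloquetC2

variable {σ σ' : ℂ} {A A' m : ℝ} {g g' g'' h h' h'' : ℝ → ℂ}

lemma continuous₁ (hg : IsFloquetC2 σ A m g g' g'') : Continuous g' :=
  continuous_iff_continuousAt.2 fun τ => (hg.deriv₂ τ).continuousAt

lemma continuous₀ (hg : IsFloquetC2 σ A m g g' g'') : Continuous g :=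
  continuous_iff_continuousAt.2 fun τ => (hg.deriv τ).continuousAt

lemma floquet' (hg : IsFloquetC2 σ A m g g' g'') (τ : ℝ) :
    g' (τ + 2 * Real.pi) = Complex.exp (2 * Real.pi * Complex.I * σ) * g' τ := by
  have h1 := (hg.deriv (τ + 2 * Real.pi)).comp_add_const τ (2 * Real.pi)
  simp only [hg.floquet] at h1
  exact h1.unique ((hg.deriv τ).const_mul _)

lemma const_mul (hg : IsFloquetC2 σ A m g g' g'') (a : ℂ) :
    IsFloquetC2 σ (‖a‖ * A) m (fun τ => a * g τ) (fun τ => a * g' τ) (fun τ => a * g'' τ) where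
  deriv τ := (hg.deriv τ).const_mul a
  deriv₂ τ := (hg.deriv₂ τ).const_mul a
  continuous := continuous_const.mul hg.continuous
  floquet τ := by rw [hg.floquet]; ring
  nonneg := mul_nonneg (norm_nonneg _) hg.nonneg
  bound τ hτ := by
    rw [norm_mul]
    exact mul_le_mul_of_nonneg_left (hg.bound τ hτ) (norm_nonneg _)
  bound' τ hτ := by
    rw [norm_mul, mul_assoc]
    exact mul_le_mul_of_nonneg_left (hg.bound' τ hτ) (norm_nonneg _)
  bound'' τ hτ := by
    rw [norm_mul, mul_assoc]
    exact mul_le_mul_of_nonneg_left (hg.bound'' τ hτ) (norm_nonneg _)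

lemma sub (hg : IsFloquetC2 σ A m g g' g'') (hh : IsFloquetC2 σ A' m h h' h'') :
    IsFloquetC2 σ (A + A') m (fun τ => g τ - h τ) (fun τ => g' τ - h' τ)
      (fun τ => g'' τ - h'' τ) where
  deriv τ := (hg.deriv τ).sub (hh.deriv τ)
  deriv₂ τ := (hg.deriv₂ τ).sub (hh.deriv₂ τ)
  continuous := hg.continuous.sub hh.continuous
  floquet τ := by rw [hg.floquet, hh.floquet]; ring
  nonneg := add_nonneg hg.nonneg hh.nonneg
  bound τ hτ := (norm_sub_le _ _).trans (add_le_add (hg.bound τ hτ) (hh.bound τ hτ))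
  bound' τ hτ := by
    rw [add_mul]
    exact (norm_sub_le _ _).trans (add_le_add (hg.bound' τ hτ) (hh.bound' τ hτ))
  bound'' τ hτ := by
    rw [add_mul]
    exact (norm_sub_le _ _).trans (add_le_add (hg.bound'' τ hτ) (hh.bound'' τ hτ))

lemma mul (hg : IsFloquetC2 σ A m g g' g'') (hh : IsFloquetC2 σ' A' m h h' h'') (hm : 0 ≤ m) :
    IsFloquetC2 (σ + σ') (4 * (A * A')) m (fun τ => g τ * h τ) (fun τ => g' τ * h τ + g τ * h' τ)
      (fun τ => (g'' τ * h τ + g' τ * h' τ) + (g' τ * h' τ + g τ * h'' τ)) where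
  deriv τ := (hg.deriv τ).mul (hh.deriv τ)
  deriv₂ τ := ((hg.deriv₂ τ).mul (hh.deriv τ)).add ((hg.deriv τ).mul (hh.deriv₂ τ))
  continuous := by
    have := hg.continuous
    have := hg.continuous₁
    have := hg.continuous₀
    have := hh.continuous
    have := hh.continuous₁
    have := hh.continuous₀
    fun_prop
  floquet τ := by
    rw [hg.floquet, hh.floquet, mul_add (2 * Real.pi * Complex.I), Complex.exp_add]
    ring
  nonneg := mul_nonneg (by norm_num) (mul_nonneg hg.nonneg hh.nonneg)
  bound τ hτ := by
    have := mul_nonneg hg.nonneg hh.nonneg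
    rw [norm_mul]
    calc _ ≤ A * A' := mul_le_mul (hg.bound τ hτ) (hh.bound τ hτ) (norm_nonneg _) hg.nonneg
      _ ≤ _ := by linarith
  bound' τ hτ := by
    have hA := hg.nonneg
    have hA' := hh.nonneg
    have h1 : ‖g' τ * h τ‖ ≤ A * m * A' := by
      rw [norm_mul]
      exact mul_le_mul (hg.bound' τ hτ) (hh.bound τ hτ) (norm_nonneg _) (by positivity)
    have h2 : ‖g τ * h' τ‖ ≤ A * (A' * m) := by
      rw [norm_mul]
      exact mul_le_mul (hg.bound τ hτ) (hh.bound' τ hτ) (norm_nonneg _) (by positivity)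
    have h3 : 0 ≤ A * A' * m := by positivity
    refine (norm_add_le _ _).trans ((add_le_add h1 h2).trans ?_)
    linarith
  bound'' τ hτ := by
    have hA := hg.nonneg
    have hA' := hh.nonneg
    have h1 : ‖g'' τ * h τ‖ ≤ A * m ^ 2 * A' := by
      rw [norm_mul]
      exact mul_le_mul (hg.bound'' τ hτ) (hh.bound τ hτ) (norm_nonneg _) (by positivity)
    have h2 : ‖g τ * h'' τ‖ ≤ A * (A' * m ^ 2) := by
      rw [norm_mul]
      exact mul_le_mul (hg.bound τ hτ) (hh.bound'' τ hτ) (norm_nonneg _) (by positivity)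
    have h3 : ‖g' τ * h' τ‖ ≤ A * m * (A' * m) := by
      rw [norm_mul]
      exact mul_le_mul (hg.bound' τ hτ) (hh.bound' τ hτ) (norm_nonneg _) (by positivity)
    refine (norm_add_le _ _).trans ((add_le_add (norm_add_le _ _) (norm_add_le _ _)).trans ?_)
    linarith

lemma isFloquetSeq (hg : IsFloquetC2 σ A m g g' g'') (hm : 0 ≤ m) {R : ℝ} (hR : ‖σ‖ ≤ R) :
    IsFloquetSeq σ (Real.exp (2 * Real.pi * R) * A) m (floquetCoeff σ g) := by
  have hA := hg.nonneg
  have h0 := floquetCoeff_sqSummable_and_le hg.continuous₀ hR hA hg.bound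
  have h1 := floquetCoeff_sqSummable_and_le hg.continuous₁ hR (by positivity) hg.bound'
  have h2 := floquetCoeff_sqSummable_and_le hg.continuous hR (by positivity) hg.bound''
  have e1 : ∀ n, floquetCoeff σ g' n = Complex.I * (σ + n) * floquetCoeff σ g n :=
    floquetCoeff_deriv hg.deriv hg.continuous₁ (by simpa using hg.floquet 0)
  have e2 : ∀ n, floquetCoeff σ g'' n = Complex.I * (σ + n) * floquetCoeff σ g' n :=
    floquetCoeff_deriv hg.deriv₂ hg.continuous (by simpa using hg.floquet' 0)
  have n1 : ∀ n : ℤ, ‖(σ + n) * floquetCoeff σ g n‖ = ‖floquetCoeff σ g' n‖ := fun n => by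
    rw [e1, mul_assoc, norm_mul Complex.I, Complex.norm_I, one_mul]
  have n2 : ∀ n : ℤ, ‖(σ + n) ^ 2 * floquetCoeff σ g n‖ = ‖floquetCoeff σ g'' n‖ := fun n => by
    rw [e2, mul_assoc, norm_mul Complex.I, Complex.norm_I, one_mul, norm_mul (σ + n), ← n1,
      ← norm_mul]
    congr 1
    ring
  refine ⟨h0.1, h1.1.of_norm_le (K := 1) fun n => by rw [one_mul, n1],
    h2.1.of_norm_le (K := 1) fun n => by rw [one_mul, n2], h0.2, ?_, ?_⟩
  · rw [l2norm_congr_norm n1, mul_assoc]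
    exact h1.2
  · rw [l2norm_congr_norm n2, mul_assoc]
    exact h2.2

end IsFloquetC2

/-- The reciprocal of a trigonometric polynomial which is bounded away from zero. By Bernstein's
inequality each derivative costs a factor `M + 1`. -/
lemma isFloquetC2_inv_trigPoly {M : ℕ} {f : ℤ → ℂ} {b B : ℝ} (hb : 0 < b)
    (hf : ∀ t : ℝ, b ≤ ‖trigPoly M f t‖) (hf' : ∀ t : ℝ, ‖trigPoly M f t‖ ≤ B) :
    ∃ Q' Q'' : ℝ → ℂ, IsFloquetC2 0 (1 / b + 3 * B / b ^ 2 + 9 * B / b ^ 2 + 18 * B ^ 2 / b ^ 3)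
      (M + 1) (fun τ => (trigPoly M f τ)⁻¹) Q' Q'' := by
  have hB : 0 < B := hb.trans_le ((hf 0).trans (hf' 0))
  set m : ℝ := M + 1 with hm
  have hm1 : 1 ≤ m := by rw [hm]; linarith [Nat.cast_nonneg (α := ℝ) M]
  set P : ℝ → ℂ := fun τ => trigPoly M f τ with hP
  set P' : ℝ → ℂ := fun τ => trigPoly M (fun m => Complex.I * m * f m) τ with hP'
  set P'' : ℝ → ℂ := fun τ => trigPoly M (fun m => Complex.I * m * (Complex.I * m * f m)) τ with hP''
  have hP0 : ∀ τ, P τ ≠ 0 := fun τ => norm_pos_iff.1 (hb.trans_le (hf τ))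
  have d1 : ∀ τ, HasDerivAt P (P' τ) τ := fun τ => (hasDerivAt_trigPoly M f τ).comp_ofReal
  have d2 : ∀ τ, HasDerivAt P' (P'' τ) τ := fun τ => (hasDerivAt_trigPoly M _ τ).comp_ofReal
  have c1 : Continuous P := (continuous_trigPoly M f).comp Complex.continuous_ofReal
  have c2 : Continuous P' := (continuous_trigPoly M _).comp Complex.continuous_ofReal
  have c3 : Continuous P'' := (continuous_trigPoly M _).comp Complex.continuous_ofReal
  have hbern : ∀ {f : ℤ → ℂ} {B : ℝ}, 0 ≤ B → (∀ t : ℝ, ‖trigPoly M f t‖ ≤ B) → ∀ t : ℝ,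
      ‖trigPoly M (fun m => Complex.I * m * f m) t‖ ≤ 3 * m * B := fun hB0 hf t => by
    refine (norm_deriv_trigPoly_le hf t).trans ?_
    rw [Complex.ofReal_im, abs_zero, mul_zero, add_zero]
    have e1 : Real.exp 1 ≤ 3 := Real.exp_one_lt_d9.le.trans (by norm_num)
    rw [← hm, mul_comm m]
    gcongr
  have b1 : ∀ τ, ‖P' τ‖ ≤ 3 * m * B := hbern hB.le hf'
  have b2 : ∀ τ, ‖P'' τ‖ ≤ 3 * m * (3 * m * B) := hbern (by positivity) b1
  refine ⟨fun τ => -P' τ / P τ ^ 2, fun τ => -P'' τ / P τ ^ 2 + 2 * P' τ ^ 2 / P τ ^ 3, ?_⟩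
  have t1 : 0 ≤ 1 / b := by positivity
  have t2 : 0 ≤ 3 * B / b ^ 2 := by positivity
  have t3 : 0 ≤ 9 * B / b ^ 2 := by positivity
  have t4 : 0 ≤ 18 * B ^ 2 / b ^ 3 := by positivity
  have hPb : ∀ τ, b ≤ ‖P τ‖ := fun τ => hf τ
  refine ⟨fun τ => (d1 τ).inv (hP0 τ), fun τ => ?_, ?_, fun τ => ?_, by positivity,
    fun τ _ => ?_, fun τ _ => ?_, fun τ _ => ?_⟩
  · refine ((d2 τ).neg.div ((d1 τ).pow 2) (pow_ne_zero 2 (hP0 τ))).congr_deriv ?_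
    have := hP0 τ
    simp only [Pi.neg_apply, Pi.pow_apply]
    field_simp
    ring
  · exact (c3.neg.div (c1.pow 2) fun τ => pow_ne_zero 2 (hP0 τ)).add
      ((continuous_const.mul (c2.pow 2)).div (c1.pow 3) fun τ => pow_ne_zero 3 (hP0 τ))
  · rw [mul_zero, Complex.exp_zero, one_mul]
    have := trigPoly_add_two_pi M f τ
    push_cast
    rw [this]
  · rw [norm_inv, ← one_div]
    have : 1 / ‖trigPoly M f τ‖ ≤ 1 / b := one_div_le_one_div_of_le hb (hPb τ)
    linarith
  · rw [norm_div, norm_neg, norm_pow]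
    calc ‖P' τ‖ / ‖P τ‖ ^ 2 ≤ 3 * m * B / b ^ 2 :=
          div_le_div₀ (by positivity) (b1 τ) (by positivity) (pow_le_pow_left₀ hb.le (hPb τ) 2)
      _ = 3 * B / b ^ 2 * m := by ring
      _ ≤ _ := by
          gcongr
          linarith
  · have f1 : ‖-P'' τ / P τ ^ 2‖ ≤ 9 * B / b ^ 2 * m ^ 2 := by
      rw [norm_div, norm_neg, norm_pow]
      calc _ ≤ 3 * m * (3 * m * B) / b ^ 2 :=
            div_le_div₀ (by positivity) (b2 τ) (by positivity) (pow_le_pow_left₀ hb.le (hPb τ) 2)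
        _ = _ := by ring
    have f2 : ‖2 * P' τ ^ 2 / P τ ^ 3‖ ≤ 18 * B ^ 2 / b ^ 3 * m ^ 2 := by
      rw [norm_div, norm_mul, norm_pow, norm_pow, Complex.norm_ofNat]
      calc _ ≤ 2 * (3 * m * B) ^ 2 / b ^ 3 :=
            div_le_div₀ (by positivity)
              (mul_le_mul_of_nonneg_left (pow_le_pow_left₀ (norm_nonneg _) (b1 τ) 2) (by norm_num))
              (by positivity) (pow_le_pow_left₀ hb.le (hPb τ) 3)
        _ = _ := by ring
    refine (norm_add_le _ _).trans ((add_le_add f1 f2).trans ?_)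
    rw [← add_mul]
    gcongr
    linarith

section Neighbours

variable {N : ℕ} (G : Resonators N) (α : ℝ) {σ : ℂ} {A m : ℝ} {g g' g'' : Fin N → ℝ → ℂ}

lemma isFloquetC2_nextVal (hg : ∀ i, IsFloquetC2 σ A m (g i) (g' i) (g'' i)) (i : Fin N) :
    IsFloquetC2 σ A m (fun τ => nextVal G α (fun j => g j τ) i)
      (fun τ => nextVal G α (fun j => g' j τ) i) (fun τ => nextVal G α (fun j => g'' j τ) i) := by
  unfold nextVal
  split_ifs with h
  · exact hg _
  · simpa only [(norm_phase G α).1, one_mul] using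
      (hg ⟨0, i.pos⟩).const_mul (Complex.exp (Complex.I * α * G.L))

lemma isFloquetC2_prevVal (hg : ∀ i, IsFloquetC2 σ A m (g i) (g' i) (g'' i)) (i : Fin N) :
    IsFloquetC2 σ A m (fun τ => prevVal G α (fun j => g j τ) i)
      (fun τ => prevVal G α (fun j => g' j τ) i) (fun τ => prevVal G α (fun j => g'' j τ) i) := by
  unfold prevVal
  split_ifs with h
  · simpa only [(norm_phase G α).2, one_mul] using
      (hg ⟨N - 1, by have := i.pos; omega⟩).const_mul (Complex.exp (-(Complex.I * α * G.L)))
  · exact hg _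

lemma floquetCoeff_nextVal (i : Fin N) (n : ℤ) :
    floquetCoeff σ (fun τ => nextVal G α (fun j => g j τ) i) n =
      nextVal G α (fun j => floquetCoeff σ (g j) n) i := by
  unfold nextVal
  split_ifs with h
  · rfl
  · rw [floquetCoeff_const_mul]

lemma floquetCoeff_prevVal (i : Fin N) (n : ℤ) :
    floquetCoeff σ (fun τ => prevVal G α (fun j => g j τ) i) n =
      prevVal G α (fun j => floquetCoeff σ (g j) n) i := by
  unfold prevVal
  split_ifs with h
  · rw [floquetCoeff_const_mul]
  · rfl

end Neighbours


/-! ### Fourier coefficients of solutions of the capacitance ODE -/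

/-- The Fourier coefficients `y i` of a Floquet solution `w` of the capacitance ODE, together with
those of `ρ_i` times the slopes of the piecewise linear interpolation of `w` in the gaps to the left
and to the right of the resonator `i`, with bounds in terms of a constant `A`. -/
structure IsFloquetData {N : ℕ} (G : Resonators N) (S : Medium N) (α : ℝ) (σ : ℂ) (A : ℝ)
    (y G₁ G₂ : Fin N → ℤ → ℂ) : Prop where
  ode : ∀ i n, (σ + n) * trigConv S.M (S.k i) (fun n => (σ + n) * y i n) n =
    (odeMass G S i : ℂ)⁻¹ * ∑ j, capacitanceMatrix G α i j * y j n
  flux_left : ∀ (i : Fin N) n, trigConv S.M (S.r i) (G₁ i) n =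
    (y i n - prevVal G α (fun j => y j n) i) / G.gap (i - 1)
  flux_right : ∀ (i : Fin N) n, trigConv S.M (S.r i) (G₂ i) n =
    (nextVal G α (fun j => y j n) i - y i n) / G.gap i
  seq : ∀ i, IsFloquetSeq σ A (S.M + 1) (y i)
  seq₁ : ∀ i, IsFloquetSeq σ A (S.M + 1) (G₁ i)
  seq₂ : ∀ i, IsFloquetSeq σ A (S.M + 1) (G₂ i)
  velocity_le : ∀ i, l2norm (fun n : ℤ => (σ + n) * y i n) ≤ A
  one_le : ∃ i, 1 ≤ A * ∑' n, ‖y i n‖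

lemma IsFloquetSeq.mono {σ : ℂ} {A A' m : ℝ} {c : ℤ → ℂ} (h : IsFloquetSeq σ A m c) (hA : A ≤ A')
    (hm : 0 ≤ m) : IsFloquetSeq σ A' m c :=
  ⟨h.sq₀, h.sq₁, h.sq₂, h.le₀.trans hA, h.le₁.trans (by gcongr), h.le₂.trans (by gcongr)⟩

/-- The norm in `ℓ²` of the reciprocals of the integers outside `[-K, K]`. -/
noncomputable def invTail (K : ℕ) : ℝ :=
  l2norm fun n : ℤ => (n : ℂ)⁻¹ - trunc K (fun n : ℤ => (n : ℂ)⁻¹) n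

lemma sqSummable_inv_int : SqSummable fun n : ℤ => (n : ℂ)⁻¹ := by
  have : Summable fun n : ℤ => 1 / (n : ℝ) ^ 2 := Real.summable_one_div_int_pow.2 one_lt_two
  refine this.congr fun n => ?_
  rw [norm_inv, Complex.norm_intCast, inv_pow, sq_abs, one_div]

lemma tendsto_invTail : Tendsto invTail atTop (𝓝 0) :=
  sqSummable_inv_int.tendsto_l2norm_sub_trunc

/-- By the Cauchy-Schwarz inequality, square summability of `n c n` implies summability of `c`, with
a bound for the tails. -/
lemma summable_norm_and_tsum_le {c : ℤ → ℂ} (h : SqSummable fun n : ℤ => (n : ℂ) * c n) :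
    (Summable fun n => ‖c n‖) ∧ ∀ K : ℕ, ∑' n, ‖c n‖ ≤
      ∑ n ∈ Finset.Icc (-(K : ℤ)) K, ‖c n‖ + invTail K * l2norm fun n : ℤ => (n : ℂ) * c n := by
  have key : ∀ (K : ℕ) (s : Finset ℤ), ∑ n ∈ s, ‖c n‖ ≤
      ∑ n ∈ Finset.Icc (-(K : ℤ)) K, ‖c n‖ + invTail K * l2norm fun n : ℤ => (n : ℂ) * c n :=
      fun K s => by
    set I := Finset.Icc (-(K : ℤ)) K with hI
    set e : ℤ → ℂ := fun n => (n : ℂ)⁻¹ - trunc K (fun n : ℤ => (n : ℂ)⁻¹) n with he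
    have he2 : SqSummable e := sqSummable_inv_int.sub
      (sqSummable_inv_int.of_norm_le (norm_trunc_le K _))
    have h1 : ∑ n ∈ s, ‖c n‖ ≤ ∑ n ∈ I, ‖c n‖ + ∑ n ∈ s \ I, ‖c n‖ := by
      rw [← Finset.sum_inter_add_sum_sdiff s I]
      exact add_le_add_left (Finset.sum_le_sum_of_subset_of_nonneg Finset.inter_subset_right
        fun _ _ _ => norm_nonneg _) _
    have h2 : ∑ n ∈ s \ I, ‖c n‖ = ∑ n ∈ s \ I, ‖e n‖ * ‖(n : ℂ) * c n‖ := by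
      refine Finset.sum_congr rfl fun n hn => ?_
      have hnI := (Finset.mem_sdiff.1 hn).2
      have hn0 : (n : ℂ) ≠ 0 := fun h0 => hnI (by
        rw [Int.cast_eq_zero.1 h0, hI, Finset.mem_Icc]
        omega)
      rw [← norm_mul, he]
      simp only [trunc_support K _ n hnI, sub_zero]
      rw [inv_mul_cancel_left₀ hn0]
    have h3 := Real.sum_mul_le_sqrt_mul_sqrt (s \ I) (fun n => ‖e n‖) fun n : ℤ => ‖(n : ℂ) * c n‖
    have h4 : √(∑ n ∈ s \ I, ‖e n‖ ^ 2) ≤ invTail K :=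
      Real.sqrt_le_iff.2 ⟨l2norm_nonneg _, sum_sq_le_sq_l2norm he2 _⟩
    have h5 : √(∑ n ∈ s \ I, ‖(n : ℂ) * c n‖ ^ 2) ≤ l2norm fun n : ℤ => (n : ℂ) * c n :=
      Real.sqrt_le_iff.2 ⟨l2norm_nonneg _, sum_sq_le_sq_l2norm h _⟩
    rw [h2] at h1
    exact h1.trans (add_le_add_right (h3.trans
      (mul_le_mul h4 h5 (Real.sqrt_nonneg _) (l2norm_nonneg _))) _)
  have hs : Summable fun n => ‖c n‖ := summable_of_sum_le (fun _ => norm_nonneg _) (key 0)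
  exact ⟨hs, fun K => hs.tsum_le_of_sum_le (key K)⟩

lemma IsFloquetSeq.sqSummable_int_mul {σ : ℂ} {A m : ℝ} {c : ℤ → ℂ} (h : IsFloquetSeq σ A m c) :
    SqSummable (fun n : ℤ => (n : ℂ) * c n) ∧ l2norm (fun n : ℤ => (n : ℂ) * c n) ≤
      l2norm (fun n : ℤ => (σ + n) * c n) + ‖σ‖ * l2norm c := by
  have e : (fun n : ℤ => (n : ℂ) * c n) = fun n : ℤ => (σ + n) * c n - σ • c n := by
    funext n
    rw [smul_eq_mul]
    ring
  rw [e, ← l2norm_const_smul]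
  exact ⟨h.sq₁.sub (h.sq₀.const_smul σ), l2norm_sub_le h.sq₁ (h.sq₀.const_smul σ)⟩

lemma IsFloquetSeq.summable_norm {σ : ℂ} {A m : ℝ} {c : ℤ → ℂ} (h : IsFloquetSeq σ A m c) :
    Summable fun n => ‖c n‖ := (summable_norm_and_tsum_le h.sqSummable_int_mul.1).1

section Existence

variable {N : ℕ} {G : Resonators N} {α : ℝ}

/-- The Floquet data of normalized solutions are bounded in terms of the bounds for the media. -/
lemma exists_isFloquetData (hN : 0 < N) (G : Resonators N) (α : ℝ) {c C lam Lam R : ℝ}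
    (hc : 0 < c) (hlam : 0 < lam) : ∃ A : ℝ, 0 < A ∧ ∀ (S : Medium N) (ω : ℂ),
      (∀ i t, S.ρ i t ∈ Set.Icc c C) → (∀ i t, S.κ i t ∈ Set.Icc c C) →
      (∀ i, odeMass G S i ∈ Set.Icc lam Lam) → ‖ω / S.Ω‖ ≤ R →
      IsCapacitanceQuasifrequency G S α ω →
      ∃ y G₁ G₂ : Fin N → ℤ → ℂ, IsFloquetData G S α (ω / S.Ω) A y G₁ G₂ := by
  -- the supremum of `‖C‖`, of the second component `q`, and the bounds for `κ`, `w` and the slopes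
  obtain ⟨s, hs⟩ : ∃ s, ∀ i, ∑ j, ‖capacitanceMatrix G α i j‖ ≤ s :=
    ⟨∑ i, ∑ j, ‖capacitanceMatrix G α i j‖, fun i =>
      Finset.single_le_sum (f := fun i => ∑ j, ‖capacitanceMatrix G α i j‖)
        (fun _ _ => by positivity) (Finset.mem_univ i)⟩
  obtain ⟨g₀, hg₀⟩ : ∃ g₀ : ℝ, ∀ i : Fin N, 1 / G.gap (i - 1) ≤ g₀ ∧ 1 / G.gap i ≤ g₀ := by
    refine ⟨∑ i : Fin N, (1 / G.gap (i - 1) + 1 / G.gap i), fun i => ?_⟩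
    have h0 : ∀ i : ℤ, 0 < 1 / G.gap i := fun i => one_div_pos.2 (G.gap_pos i)
    have h1 := Finset.single_le_sum (f := fun i : Fin N => 1 / G.gap (i - 1) + 1 / G.gap i)
      (fun i _ => (add_pos (h0 _) (h0 _)).le) (Finset.mem_univ i)
    exact ⟨(le_add_of_nonneg_right (h0 _).le).trans h1, (le_add_of_nonneg_left (h0 _).le).trans h1⟩
  have hg₀0 : 0 ≤ g₀ := (one_div_pos.2 (G.gap_pos _)).le.trans (hg₀ ⟨0, hN⟩).2
  have hs0 : 0 ≤ s := le_trans (by positivity) (hs ⟨0, hN⟩)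
  set Q : ℝ := Lam / (2 * Real.pi * c) * (2 + C / lam * (s * (2 * Real.pi)) * (2 * Real.pi)) +
    s * (2 * Real.pi) with hQ
  set A₀ : ℝ := 1 / C⁻¹ + 3 * c⁻¹ / C⁻¹ ^ 2 + 9 * c⁻¹ / C⁻¹ ^ 2 + 18 * c⁻¹ ^ 2 / C⁻¹ ^ 3 with hA₀
  set A₁ : ℝ := 1 + A₀ * (|Q| + s) / lam with hA₁
  set A₂ : ℝ := A₁ + 4 * (A₀ * (g₀ * (A₁ + A₁))) with hA₂
  set E : ℝ := Real.exp (2 * Real.pi * R) with hE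
  have hE0 : 0 < E := Real.exp_pos _
  by_cases hcC : c ≤ C
  swap
  · refine ⟨1, one_pos, fun S ω hρ => ?_⟩
    have := hρ ⟨0, hN⟩ 0
    exact absurd (this.1.trans this.2) hcC
  have hC : 0 < C := hc.trans_le hcC
  have hA₀0 : 0 ≤ A₀ := by positivity
  have hA₁1 : 1 ≤ A₁ := le_add_of_nonneg_right (by positivity)
  have hA₁2 : A₁ ≤ A₂ := le_add_of_nonneg_right (by positivity)
  have hA₂0 : 0 < A₂ := by linarith
  refine ⟨E * A₂, by positivity, fun S ω hρ hκ hm hR hω => ?_⟩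
  obtain ⟨X₀, hX₀, hσ₀, h0⟩ := hω.exists_floquet
  obtain ⟨X, hX, hσ, hle, t₀, ht₀, ht₁⟩ := exists_normalized_floquet hX₀ hσ₀ h0
  set σ : ℂ := ω / S.Ω with hσdef
  set m : ℝ := S.M + 1 with hmdef
  have hm1 : 1 ≤ m := by rw [hmdef]; linarith [Nat.cast_nonneg (α := ℝ) S.M]
  have hm0 : 0 ≤ m := by linarith
  have hq : ∀ i, ∀ t ∈ Set.Icc 0 (2 * Real.pi), ‖(X t).2 i‖ ≤ |Q| := fun i t ht =>
    (norm_snd_le_of_norm_fst_le hX hle hc hκ hlam hm hs i ht).trans (le_abs_self _)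
  have hX1 : ∀ i t, HasDerivAt (fun t => (X t).1 i)
      (Complex.I * (S.κ i (t / S.Ω) / odeMass G S i) * (X t).2 i) t := fun i t =>
    (hasDerivAt_pi.1 (hX t).fst) i
  have hX2 : ∀ i t, HasDerivAt (fun t => (X t).2 i)
      (Complex.I * ∑ j, capacitanceMatrix G α i j * (X t).1 j) t := fun i t =>
    (hasDerivAt_pi.1 (hX t).snd) i
  have hXc : Continuous X := continuous_iff_continuousAt.2 fun t => (hX t).continuousAt
  have hw1 : ∀ i, Continuous fun t => (X t).1 i := fun i =>
    (continuous_apply i).comp hXc.fst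
  have hq1 : ∀ i, Continuous fun t => (X t).2 i := fun i =>
    (continuous_apply i).comp hXc.snd
  have hC0 : (0 : ℝ) < C⁻¹ := inv_pos.2 hC
  have hk := fun i => isFloquetC2_inv_trigPoly hC0
    (fun t => (S.norm_trigPoly_k_mem hc hκ i t).1) (fun t => (S.norm_trigPoly_k_mem hc hκ i t).2)
  have hr := fun i => isFloquetC2_inv_trigPoly hC0
    (fun t => (S.norm_trigPoly_r_mem hc hρ i t).1) (fun t => (S.norm_trigPoly_r_mem hc hρ i t).2)
  simp only [← S.inv_κ_div_eq, ← S.inv_ρ_div_eq, inv_inv] at hk hr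
  choose k' k'' hk using hk
  choose r' r'' hr using hr
  have hsum : ∀ i, ∀ t ∈ Set.Icc 0 (2 * Real.pi),
      ‖∑ j, capacitanceMatrix G α i j * (X t).1 j‖ ≤ s := fun i t ht => by
    refine (norm_sum_le _ _).trans ((Finset.sum_le_sum fun j _ => ?_).trans (hs i))
    rw [norm_mul]
    exact mul_le_of_le_one_right (norm_nonneg _) ((norm_le_pi_norm (X t).1 j).trans (hle t ht))
  have hmi : ∀ i, ‖(odeMass G S i : ℂ)⁻¹‖ ≤ 1 / lam := fun i => by
    rw [norm_inv, Complex.norm_real, Real.norm_of_nonneg (odeMass_pos G S i).le, ← one_div]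
    exact one_div_le_one_div_of_le hlam (hm i).1
  have hb' : ∀ i, ∀ t ∈ Set.Icc 0 (2 * Real.pi),
      ‖Complex.I * (S.κ i (t / S.Ω) / odeMass G S i) * (X t).2 i‖ ≤ A₁ := fun i t ht => by
    rw [norm_mul, norm_mul, Complex.norm_I, one_mul, div_eq_mul_inv, norm_mul]
    calc _ ≤ A₀ * (1 / lam) * |Q| := mul_le_mul
          (mul_le_mul ((hk i).bound t ht) (hmi i) (norm_nonneg _) hA₀0) (hq i t ht)
          (norm_nonneg _) (by positivity)
      _ = A₀ * |Q| / lam := by ring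
      _ ≤ A₀ * (|Q| + s) / lam := by gcongr; linarith
      _ ≤ A₁ := by rw [hA₁]; linarith
  -- the solution is twice differentiable
  have hw : ∀ i, IsFloquetC2 σ A₁ m (fun t => (X t).1 i)
      (fun t => Complex.I * (S.κ i (t / S.Ω) / odeMass G S i) * (X t).2 i)
      (fun t => Complex.I * (odeMass G S i : ℂ)⁻¹ * (k' i t * (X t).2 i + S.κ i (t / S.Ω) *
        (Complex.I * ∑ j, capacitanceMatrix G α i j * (X t).1 j))) := fun i => by
    refine ⟨hX1 i, fun t => ?_, ?_, fun t => ?_, by linarith, fun t ht => ?_, fun t ht => ?_,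
      fun t ht => ?_⟩
    · refine ((((hk i).deriv t).mul (hX2 i t)).const_mul
        (Complex.I * (odeMass G S i : ℂ)⁻¹)).congr_of_eventuallyEq
        (Eventually.of_forall fun τ => ?_)
      simp only [Pi.mul_apply]
      ring
    · have := (hk i).continuous₁
      have := S.continuous_κ_div i
      have := hq1 i
      fun_prop
    · rw [hσ]
      rfl
    · exact ((norm_le_pi_norm (X t).1 i).trans (hle t ht)).trans hA₁1
    · exact (hb' i t ht).trans (le_mul_of_one_le_right (by linarith) hm1)
    · rw [norm_mul, norm_mul, Complex.norm_I, one_mul]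
      have e1 : ‖k' i t * (X t).2 i‖ ≤ A₀ * m * |Q| := by
        rw [norm_mul]
        exact mul_le_mul ((hk i).bound' t ht) (hq i t ht) (norm_nonneg _) (by positivity)
      have e2 : ‖(S.κ i (t / S.Ω) : ℂ) *
          (Complex.I * ∑ j, capacitanceMatrix G α i j * (X t).1 j)‖ ≤ A₀ * s := by
        rw [norm_mul, norm_mul Complex.I, Complex.norm_I, one_mul]
        exact mul_le_mul ((hk i).bound t ht) (hsum i t ht) (norm_nonneg _) hA₀0
      calc _ ≤ 1 / lam * (A₀ * m * |Q| + A₀ * s) := mul_le_mul (hmi i)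
            ((norm_add_le _ _).trans (add_le_add e1 e2)) (norm_nonneg _) (by positivity)
        _ ≤ 1 / lam * (A₀ * m ^ 2 * |Q| + A₀ * m ^ 2 * s) := by
            gcongr
            · nlinarith
            · exact le_mul_of_one_le_right hA₀0 (one_le_pow₀ hm1)
        _ = A₀ * (|Q| + s) / lam * m ^ 2 := by ring
        _ ≤ A₁ * m ^ 2 := by
            gcongr
            rw [hA₁]
            linarith
  -- the slopes multiplied by `ρ`
  have hgn : ∀ a : ℤ, 0 < G.gap a → 1 / G.gap a ≤ g₀ → ‖(1 / G.gap a : ℂ)‖ ≤ g₀ := fun a h1 h2 => by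
    rw [norm_div, norm_one, Complex.norm_real, Real.norm_of_nonneg h1.le]
    exact h2
  have hG : ∀ (i : Fin N) (a : ℤ), ‖(1 / G.gap a : ℂ)‖ ≤ g₀ → ∀ {g g' g'' : ℝ → ℂ},
      IsFloquetC2 σ (A₁ + A₁) m g g' g'' →
      IsFloquetSeq σ (E * A₂) m
        (floquetCoeff σ (fun τ => S.ρ i (τ / S.Ω) * (1 / G.gap a * g τ))) ∧
      ∀ n, trigConv S.M (S.r i)
        (floquetCoeff σ (fun τ => S.ρ i (τ / S.Ω) * (1 / G.gap a * g τ))) n =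
        1 / G.gap a * floquetCoeff σ g n := fun i a ha g g' g'' hg => by
    have h1 := (hr i).mul (hg.const_mul (1 / G.gap a : ℂ)) hm0
    rw [zero_add] at h1
    refine ⟨(h1.isFloquetSeq hm0 hR).mono ?_ hm0, fun n => ?_⟩
    · have : 4 * (A₀ * (‖(1 / G.gap a : ℂ)‖ * (A₁ + A₁))) ≤ A₂ := by
        rw [hA₂]
        have : 4 * (A₀ * (‖(1 / G.gap a : ℂ)‖ * (A₁ + A₁))) ≤ 4 * (A₀ * (g₀ * (A₁ + A₁))) := by
          gcongr
        linarith
      exact mul_le_mul_of_nonneg_left this hE0.le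
    · rw [trigConv_floquetCoeff _ _ h1.continuous₀, ← floquetCoeff_const_mul]
      congr 1
      funext τ
      have h2 : (S.ρ i (τ / S.Ω) : ℂ) ≠ 0 := Complex.ofReal_ne_zero.2 (S.ρ_pos _ _).ne'
      rw [← S.inv_ρ_div_eq, ← mul_assoc, inv_mul_cancel₀ h2, one_mul]
  have hy : ∀ i, IsFloquetSeq σ (E * A₂) m (floquetCoeff σ fun t => (X t).1 i) := fun i =>
    ((hw i).isFloquetSeq hm0 hR).mono (mul_le_mul_of_nonneg_left hA₁2 hE0.le) hm0
  have hd : ∀ i n, floquetCoeff σ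
      (fun t => Complex.I * (S.κ i (t / S.Ω) / odeMass G S i) * (X t).2 i) n =
      Complex.I * (σ + n) * floquetCoeff σ (fun t => (X t).1 i) n := fun i =>
    floquetCoeff_deriv (hw i).deriv (hw i).continuous₁ (by simpa using (hw i).floquet 0)
  have hp := fun i => (isFloquetC2_prevVal G α hw i)
  have hn := fun i => (isFloquetC2_nextVal G α hw i)
  refine ⟨fun i => floquetCoeff σ fun t => (X t).1 i,
    fun i => floquetCoeff σ fun τ => S.ρ i (τ / S.Ω) * (1 / G.gap (i - 1) *
      ((X τ).1 i - prevVal G α (fun j => (X τ).1 j) i)),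
    fun i => floquetCoeff σ fun τ => S.ρ i (τ / S.Ω) * (1 / G.gap i *
      (nextVal G α (fun j => (X τ).1 j) i - (X τ).1 i)), fun i n => ?_, fun i n => ?_,
      fun i n => ?_, hy, fun i => ?_, fun i => ?_, fun i => ?_, ?_⟩
  · have e1 : (fun n : ℤ => (σ + n) * floquetCoeff σ (fun t => (X t).1 i) n) =
        fun n => (-Complex.I) • floquetCoeff σ
          (fun t => Complex.I * (S.κ i (t / S.Ω) / odeMass G S i) * (X t).2 i) n := by
      funext n
      rw [hd, smul_eq_mul]
      linear_combination ((σ + n) * floquetCoeff σ (fun t => (X t).1 i) n) * Complex.I_sq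
    have e2 : trigConv S.M (S.k i) (floquetCoeff σ
          (fun t => Complex.I * (S.κ i (t / S.Ω) / odeMass G S i) * (X t).2 i)) n =
        Complex.I * (odeMass G S i : ℂ)⁻¹ * floquetCoeff σ (fun t => (X t).2 i) n := by
      rw [trigConv_floquetCoeff _ _ (hw i).continuous₁, ← floquetCoeff_const_mul]
      congr 1
      funext τ
      have h2 : (S.κ i (τ / S.Ω) : ℂ) ≠ 0 := Complex.ofReal_ne_zero.2 (S.κ_pos _ _).ne'
      rw [← S.inv_κ_div_eq]
      field_simp
    have e3 : floquetCoeff σ (fun t => Complex.I * ∑ j, capacitanceMatrix G α i j * (X t).1 j) n =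
        Complex.I * (σ + n) * floquetCoeff σ (fun t => (X t).2 i) n :=
      floquetCoeff_deriv (hX2 i) (by have := hw1; fun_prop) (by
        have := hσ 0
        rw [zero_add] at this
        rw [this]
        rfl) n
    have e4 : floquetCoeff σ (fun t => ∑ j, capacitanceMatrix G α i j * (X t).1 j) n =
        ∑ j, capacitanceMatrix G α i j * floquetCoeff σ (fun t => (X t).1 j) n := by
      have : ∀ s : Finset (Fin N), floquetCoeff σ
          (fun t => ∑ j ∈ s, capacitanceMatrix G α i j * (X t).1 j) n =
          ∑ j ∈ s, capacitanceMatrix G α i j * floquetCoeff σ (fun t => (X t).1 j) n := fun s => by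
        classical
        induction s using Finset.induction_on with
        | empty => simp [floquetCoeff]
        | insert a s ha ih =>
          simp only [Finset.sum_insert ha]
          rw [floquetCoeff_add ((hw1 a).const_mul _) (by have := hw1; fun_prop), ih,
            floquetCoeff_const_mul]
      exact this _
    rw [floquetCoeff_const_mul, e4] at e3
    rw [e1, trigConv_const_smul, e2, smul_eq_mul]
    have e5 := mul_left_cancel₀ Complex.I_ne_zero (e3.trans (mul_assoc _ _ _))
    rw [e5]
    linear_combination -((σ + n) * (odeMass G S i : ℂ)⁻¹ *
      floquetCoeff σ (fun t => (X t).2 i) n) * Complex.I_sq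
  · rw [(hG i _ (hgn _ (G.gap_pos _) (hg₀ i).1) ((hw i).sub (hp i))).2 n,
      floquetCoeff_sub (hw1 i) (hp i).continuous₀, floquetCoeff_prevVal]
    ring
  · rw [(hG i _ (hgn _ (G.gap_pos _) (hg₀ i).2) ((hn i).sub (hw i))).2 n,
      floquetCoeff_sub (hn i).continuous₀ (hw1 i), floquetCoeff_nextVal]
    ring
  · exact (hG i _ (hgn _ (G.gap_pos _) (hg₀ i).1) ((hw i).sub (hp i))).1
  · exact (hG i _ (hgn _ (G.gap_pos _) (hg₀ i).2) ((hn i).sub (hw i))).1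
  · have h1 := (floquetCoeff_sqSummable_and_le (hw i).continuous₁ hR (by linarith) (hb' i)).2
    rw [l2norm_congr_norm (d := floquetCoeff σ
      fun t => Complex.I * (S.κ i (t / S.Ω) / odeMass G S i) * (X t).2 i) fun n => by
        rw [hd, mul_assoc Complex.I, norm_mul Complex.I, Complex.norm_I, one_mul]]
    exact h1.trans (mul_le_mul_of_nonneg_left hA₁2 hE0.le)
  · obtain ⟨i, hi⟩ : ∃ i, 1 ≤ ‖(X t₀).1 i‖ := by
      by_contra! hcon
      have := (pi_norm_lt_iff one_pos).2 hcon
      exact this.ne ht₁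
    refine ⟨i, ?_⟩
    have h1 := norm_le_tsum_floquetCoeff (hw i).continuous₀ (hw i).floquet (hy i).summable_norm ht₀
    have h2 := (norm_exp_I_mul_le hR ht₀).1
    have h3 : ‖(X t₀).1 i‖ = ‖Complex.exp (Complex.I * σ * t₀)‖ *
        ‖Complex.exp (-(Complex.I * σ * t₀)) * (X t₀).1 i‖ := by
      rw [← norm_mul, ← mul_assoc, ← Complex.exp_add, add_neg_cancel, Complex.exp_zero, one_mul]
    calc (1 : ℝ) ≤ E * ∑' n, ‖floquetCoeff σ (fun t => (X t).1 i) n‖ := by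
          refine hi.trans (h3.trans_le (mul_le_mul h2 h1 (norm_nonneg _) hE0.le))
      _ ≤ _ := by
          refine mul_le_mul_of_nonneg_right ?_ (tsum_nonneg fun _ => norm_nonneg _)
          exact le_mul_of_one_le_right hE0.le (by linarith)

end Existence


/-! ### Construction of profiles from values at the resonators -/

lemma exists_mem_Ico_of_strictMono {a : ℤ → ℝ} (ha : StrictMono a) (hbot : Tendsto a atBot atBot)
    (htop : Tendsto a atTop atTop) (x : ℝ) : ∃ k, x ∈ Set.Ico (a k) (a (k + 1)) := by
  obtain ⟨p, hp⟩ := (hbot.eventually (eventually_le_atBot x)).exists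
  obtain ⟨q, hq⟩ := (htop.eventually (eventually_gt_atTop x)).exists
  obtain ⟨k, hk, hmax⟩ := Int.exists_greatest_of_bdd (P := fun k => a k ≤ x)
    ⟨q, fun z hz => (ha.lt_iff_lt.1 (lt_of_le_of_lt hz hq)).le⟩ ⟨p, hp⟩
  exact ⟨k, hk, not_le.1 fun h => by have := hmax _ h; omega⟩

/-- Gluing of continuous functions on the intervals between consecutive terms of a sequence. -/
lemma exists_continuous_eqOn_Icc {a : ℤ → ℝ} (ha : StrictMono a) (hbot : Tendsto a atBot atBot)
    (htop : Tendsto a atTop atTop) {P : ℤ → ℝ → ℂ} (hP : ∀ k, Continuous (P k))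
    (hglue : ∀ k, P k (a (k + 1)) = P (k + 1) (a (k + 1))) :
    ∃ v : ℝ → ℂ, Continuous v ∧ ∀ k, ∀ x ∈ Set.Icc (a k) (a (k + 1)), v x = P k x := by
  choose κ hκ using exists_mem_Ico_of_strictMono ha hbot htop
  have hv : ∀ k, ∀ x ∈ Set.Icc (a k) (a (k + 1)), P (κ x) x = P k x := fun k x hx => by
    have h1 : κ x < k + 1 + 1 := ha.lt_iff_lt.1 ((hκ x).1.trans_lt
      (hx.2.trans_lt (ha (lt_add_one _))))
    have h2 : k < κ x + 1 := ha.lt_iff_lt.1 (hx.1.trans_lt (hκ x).2)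
    obtain h | h : κ x = k ∨ κ x = k + 1 := by omega
    · rw [h]
    · have h3 : x = a (k + 1) := le_antisymm hx.2 (h ▸ (hκ x).1)
      rw [h, h3, hglue]
  refine ⟨fun x => P (κ x) x, ?_, hv⟩
  refine LocallyFinite.continuous (f := fun k => Set.Icc (a k) (a (k + 1))) (fun x => ?_)
    (Set.eq_univ_of_forall fun x => Set.mem_iUnion.2 ⟨κ x, Set.Ico_subset_Icc_self (hκ x)⟩)
    (fun k => isClosed_Icc) fun k => (hP k).continuousOn.congr fun x hx => hv k x hx
  obtain ⟨p, hp⟩ := (hbot.eventually (eventually_lt_atBot x)).exists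
  obtain ⟨q, hq⟩ := (htop.eventually (eventually_gt_atTop x)).exists
  refine ⟨Set.Ioo (a p) (a q), Ioo_mem_nhds hp hq, (Set.finite_Icc p q).subset ?_⟩
  rintro k ⟨z, hz1, hz2⟩
  have h1 : k < q := ha.lt_iff_lt.1 (hz1.1.trans_lt hz2.2)
  have h2 : p < k + 1 := ha.lt_iff_lt.1 (hz2.1.trans_le hz1.2)
  exact ⟨by omega, h1.le⟩

section Profile

variable {N : ℕ} (G : Resonators N) (α : ℝ)

lemma Resonators.tendsto_left : Tendsto G.left atBot atBot ∧ Tendsto G.left atTop atTop := by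
  have h : ∀ k : ℤ, G.left (k * N) = G.left 0 + k * G.L := fun k => by
    induction k using Int.induction_on with
    | zero => simp
    | succ i ih =>
      rw [add_mul, one_mul, G.left_periodic, ih]
      push_cast
      ring
    | pred i ih =>
      have := G.left_periodic ((-(i : ℤ) - 1) * N)
      rw [show (-(i : ℤ) - 1) * N + N = -(i : ℤ) * N by ring, ih] at this
      push_cast at this ⊢
      linarith
  have hL := G.L_pos
  refine ⟨tendsto_atBot_atBot_of_monotone G.left_strictMono.monotone fun b => ?_,
    tendsto_atTop_atTop_of_monotone G.left_strictMono.monotone fun b => ?_⟩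
  · refine ⟨⌊(b - G.left 0) / G.L⌋ * N, ?_⟩
    rw [h]
    have := (le_div_iff₀ hL).1 (Int.floor_le ((b - G.left 0) / G.L))
    linarith
  · refine ⟨⌈(b - G.left 0) / G.L⌉ * N, ?_⟩
    rw [h]
    have := (div_le_iff₀ hL).1 (Int.le_ceil ((b - G.left 0) / G.L))
    linarith

/-- The `α`-quasiperiodic extension of values at the resonators of one period. -/
lemma exists_quasiperiodic_extension (y : Fin N → ℂ) : ∃ Y : ℤ → ℂ,
    (∀ k, Y (k + N) = Complex.exp (Complex.I * α * G.L) * Y k) ∧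
    ∀ i : Fin N, Y (i : ℕ) = y i ∧ Y ((i : ℕ) + 1) = nextVal G α y i ∧
      Y ((i : ℕ) - 1) = prevVal G α y i := by
  obtain rfl | hN := Nat.eq_zero_or_pos N
  · exact ⟨0, fun k => by simp, fun i => i.elim0⟩
  have hN' : (N : ℤ) ≠ 0 := by omega
  have hm : ∀ k : ℤ, (k % N).toNat < N := fun k => by
    have h1 := Int.emod_nonneg k hN'
    have h2 := Int.emod_lt_of_pos k (by omega : (0 : ℤ) < N)
    omega
  set Y : ℤ → ℂ := fun k =>
    Complex.exp (Complex.I * α * G.L) ^ (k / (N : ℤ)) * y ⟨(k % N).toNat, hm k⟩ with hY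
  have h1 : ∀ k, Y (k + N) = Complex.exp (Complex.I * α * G.L) * Y k := fun k => by
    simp only [hY, Int.add_emod_right]
    rw [Int.add_ediv_of_dvd_right dvd_rfl, Int.ediv_self hN', zpow_add₀ (Complex.exp_ne_zero _),
      zpow_one]
    ring
  have h2 : ∀ i : Fin N, Y (i : ℕ) = y i := fun i => by
    have e1 : ((i : ℕ) : ℤ) / N = 0 := Int.ediv_eq_zero_of_lt (by omega) (by omega)
    have e2 : ((i : ℕ) : ℤ) % N = (i : ℕ) := Int.emod_eq_of_lt (by omega) (by omega)
    simp only [hY, e1, e2, zpow_zero, one_mul, Int.toNat_natCast]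
  refine ⟨Y, h1, fun i => ⟨h2 i, ?_, ?_⟩⟩
  · unfold nextVal
    split_ifs with h
    · exact_mod_cast h2 ⟨i + 1, h⟩
    · have : ((i : ℕ) + 1 : ℤ) = ((0 : ℕ) : ℤ) + N := by have := i.isLt; omega
      rw [this, h1]
      exact congrArg _ (h2 ⟨0, hN⟩)
  · unfold prevVal
    split_ifs with h
    · have h3 := h1 ((i : ℕ) - 1)
      have h4 := h2 ⟨N - 1, by omega⟩
      have e : ((N - 1 : ℕ) : ℤ) = ((i : ℕ) : ℤ) - 1 + N := by omega
      rw [← h4]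
      simp only [e]
      rw [h3, ← mul_assoc, ← Complex.exp_add, neg_add_cancel, Complex.exp_zero, one_mul]
    · have h4 := h2 ⟨i - 1, by omega⟩
      have e : ((i - 1 : ℕ) : ℤ) = ((i : ℕ) : ℤ) - 1 := by omega
      simp only [e] at h4
      exact h4

/-- The quadratic function on an interval of length `l` which vanishes at `0` and has derivative `A`
at `0` and `B` at `l`. -/
noncomputable def quadProfile (l : ℝ) (A B : ℂ) (x : ℝ) : ℂ :=
  (x - x ^ 2 / (2 * l)) * A + x ^ 2 / (2 * l) * B

/-- The cubic Hermite function with values `1` and `0` at `0` and `1`, where its derivative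
vanishes. -/
noncomputable def hermite (x : ℝ) : ℂ := 1 - 3 * (x : ℂ) ^ 2 + 2 * (x : ℂ) ^ 3

lemma continuous_quadProfile (l : ℝ) (A B : ℂ) : Continuous (quadProfile l A B) := by
  unfold quadProfile; fun_prop

lemma continuous_hermite : Continuous hermite := by
  unfold hermite; fun_prop

/-- There is a continuous quasiperiodic function which is almost equal to `y i` in the resonators,
where it has slopes `δ A i` and `δ B i` at the ends, and almost linear in the gaps, with slopes given
by the differences of `y`. -/
lemma exists_profile (δ : ℝ) (y A B : Fin N → ℂ) : ∃ v : ℝ → ℂ, Continuous v ∧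
    (∀ x, v (x + G.L) = Complex.exp (Complex.I * α * G.L) * v x) ∧
    (∀ i : Fin N, ∀ x ∈ Set.Icc (G.left i) (G.right i),
      v x = y i + δ * quadProfile (G.len i) (A i) (B i) (x - G.left i)) ∧
    (∀ i : Fin N, ∀ x ∈ Set.Icc (G.right i) (G.left (i + 1)),
      v x = y i + (nextVal G α y i - y i) * ((x - G.right i) / G.gap i : ℝ) +
        δ * (G.len i / 2 * (A i + B i)) * hermite ((x - G.right i) / G.gap i)) ∧
    ∀ i : Fin N, ∃ e : ℂ, ∀ x ∈ Set.Icc (G.right (i - 1)) (G.left i),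
      v x = prevVal G α y i + (y i - prevVal G α y i) * ((x - G.right (i - 1)) / G.gap (i - 1) : ℝ) +
        e * hermite ((x - G.right (i - 1)) / G.gap (i - 1)) := by
  obtain ⟨Y, hYp, hY⟩ := exists_quasiperiodic_extension G α y
  obtain ⟨A', hAp, hA⟩ := exists_quasiperiodic_extension G α A
  obtain ⟨B', hBp, hB⟩ := exists_quasiperiodic_extension G α B
  set I : ℤ → ℝ → ℂ := fun k x => Y k + δ * quadProfile (G.len k) (A' k) (B' k) (x - G.left k) with hI
  set E : ℤ → ℝ → ℂ := fun k x => Y k + (Y (k + 1) - Y k) * ((x - G.right k) / G.gap k : ℝ) +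
    δ * (G.len k / 2 * (A' k + B' k)) * hermite ((x - G.right k) / G.gap k) with hE
  have hIc : ∀ k, Continuous (I k) := fun k => by
    have := continuous_quadProfile (G.len k) (A' k) (B' k)
    fun_prop
  have hEc : ∀ k, Continuous (E k) := fun k => by
    have := continuous_hermite
    fun_prop
  have hIE : ∀ k, I k (G.right k) = E k (G.right k) := fun k => by
    have hl : (G.len k : ℂ) ≠ 0 := Complex.ofReal_ne_zero.2 (G.len_pos k).ne'
    simp only [hI, hE, quadProfile, hermite, sub_self, zero_div, Complex.ofReal_zero]
    rw [show G.right k - G.left k = G.len k from rfl]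
    field_simp
    ring
  have hEI : ∀ k, E k (G.left (k + 1)) = I (k + 1) (G.left (k + 1)) := fun k => by
    simp only [hI, hE, quadProfile, hermite]
    rw [show G.left (k + 1) - G.right k = G.gap k from rfl, div_self (G.gap_pos k).ne', sub_self]
    norm_num
  obtain ⟨v, hvc, hv⟩ := exists_continuous_eqOn_Icc G.left_strictMono G.tendsto_left.1
    G.tendsto_left.2 (P := fun k x => if x ≤ G.right k then I k x else E k x)
    (fun k => Continuous.if_le (hIc k) (hEc k) continuous_id continuous_const fun x hx => by
      rw [show x = G.right k from hx, hIE])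
    (fun k => by
      rw [if_neg (not_le.2 (G.right_lt_left k)), if_pos (G.left_lt_right _).le, hEI])
  have hv1 : ∀ k, ∀ x ∈ Set.Icc (G.left k) (G.right k), v x = I k x := fun k x hx => by
    rw [hv k x ⟨hx.1, hx.2.trans (G.right_lt_left k).le⟩, if_pos hx.2]
  have hv2 : ∀ k, ∀ x ∈ Set.Icc (G.right k) (G.left (k + 1)), v x = E k x := fun k x hx => by
    rw [hv k x ⟨(G.left_lt_right k).le.trans hx.1, hx.2⟩]
    split_ifs with h
    · rw [show x = G.right k from le_antisymm h hx.1, hIE]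
    · rfl
  refine ⟨v, hvc, fun x => ?_, fun i x hx => ?_, fun i x hx => ?_, fun i => ?_⟩
  · obtain ⟨k, hk⟩ := exists_mem_Ico_of_strictMono G.left_strictMono G.tendsto_left.1
      G.tendsto_left.2 x
    have hk1 : G.left (k + N + 1) = G.left (k + 1) + G.L := by
      rw [← G.left_periodic]
      congr 1
      ring
    have hY1 : Y (k + N + 1) = Complex.exp (Complex.I * α * G.L) * Y (k + 1) := by
      rw [← hYp]
      congr 1
      ring
    have hlen : G.len (k + N) = G.len k := by
      rw [Resonators.len, G.right_periodic, G.left_periodic, Resonators.len]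
      ring
    rw [hv k x ⟨hk.1, hk.2.le⟩, hv (k + N) (x + G.L)
      ⟨by rw [G.left_periodic]; linarith [hk.1], by rw [hk1]; linarith [hk.2]⟩]
    simp only [hI, hE, G.right_periodic, G.left_periodic, hYp, hAp, hBp, hY1, hlen, G.gap_periodic,
      add_le_add_iff_right, add_sub_add_right_eq_sub, quadProfile]
    split_ifs <;> ring
  · rw [hv1 _ x hx]
    simp only [hI, (hY i).1, (hA i).1, (hB i).1]
  · rw [hv2 _ x hx]
    simp only [hE, (hY i).1, (hY i).2.1, (hA i).1, (hB i).1]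
  · refine ⟨δ * (G.len (i - 1) / 2 * (A' (i - 1) + B' (i - 1))), fun x hx => ?_⟩
    have h1 : ((i : ℕ) : ℤ) - 1 + 1 = (i : ℕ) := by ring
    rw [hv2 (((i : ℕ) : ℤ) - 1) x (by rwa [h1])]
    simp only [hE, h1, (hY i).1, (hY i).2.2]

lemma exists_piecewise {K : ℝ} (hK : 0 ≤ K) (F E : Fin N → ℝ → ℂ)
    (hF : ∀ i : Fin N, ∀ x ∈ Set.Ioo (G.left i) (G.right i), ‖F i x‖ ≤ K)
    (hE : ∀ i : Fin N, ∀ x ∈ Set.Ioo (G.right i) (G.left (i + 1)), ‖E i x‖ ≤ K) :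
    ∃ f : ℝ → ℂ, (∀ x, ‖f x‖ ≤ K) ∧
      (∀ i : Fin N, ∀ x ∈ Set.Ioo (G.left i) (G.right i), f x = F i x) ∧
      ∀ i : Fin N, ∀ x ∈ Set.Ioo (G.right i) (G.left (i + 1)), f x = E i x := by
  classical
  have huniq : ∀ (i j : Fin N) (x : ℝ), x ∈ Set.Ioo (G.left i) (G.left (i + 1)) →
      x ∈ Set.Ioo (G.left j) (G.left (j + 1)) → i = j := fun i j x hi hj => by
    have h1 := G.left_strictMono.lt_iff_lt.1 (hi.1.trans hj.2)
    have h2 := G.left_strictMono.lt_iff_lt.1 (hj.1.trans hi.2)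
    exact Fin.ext (by omega)
  have hsub1 : ∀ (i : Fin N) (x : ℝ), x ∈ Set.Ioo (G.left i) (G.right i) →
      x ∈ Set.Ioo (G.left i) (G.left (i + 1)) := fun i x hx => ⟨hx.1, hx.2.trans (G.right_lt_left _)⟩
  have hsub2 : ∀ (i : Fin N) (x : ℝ), x ∈ Set.Ioo (G.right i) (G.left (i + 1)) →
      x ∈ Set.Ioo (G.left i) (G.left (i + 1)) := fun i x hx => ⟨(G.left_lt_right _).trans hx.1, hx.2⟩
  have h : ∀ x, ∃ z : ℂ, ‖z‖ ≤ K ∧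
      (∀ i : Fin N, x ∈ Set.Ioo (G.left i) (G.right i) → z = F i x) ∧
      ∀ i : Fin N, x ∈ Set.Ioo (G.right i) (G.left (i + 1)) → z = E i x := fun x => by
    by_cases h1 : ∃ i : Fin N, x ∈ Set.Ioo (G.left i) (G.right i)
    · obtain ⟨i, hi⟩ := h1
      refine ⟨F i x, hF i x hi, fun j hj => ?_, fun j hj => ?_⟩
      · rw [huniq i j x (hsub1 i x hi) (hsub1 j x hj)]
      · have := huniq i j x (hsub1 i x hi) (hsub2 j x hj)
        subst this
        exact absurd (hi.2.trans hj.1) (lt_irrefl _)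
    by_cases h2 : ∃ i : Fin N, x ∈ Set.Ioo (G.right i) (G.left (i + 1))
    · obtain ⟨i, hi⟩ := h2
      refine ⟨E i x, hE i x hi, fun j hj => absurd ⟨j, hj⟩ h1, fun j hj => ?_⟩
      rw [huniq i j x (hsub2 i x hi) (hsub2 j x hj)]
    · exact ⟨0, by simpa using hK, fun j hj => absurd ⟨j, hj⟩ h1, fun j hj => absurd ⟨j, hj⟩ h2⟩
  choose f hf using h
  exact ⟨f, fun x => (hf x).1, fun i x hx => (hf x).2.1 i hx, fun i x hx => (hf x).2.2 i hx⟩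

end Profile

/-- A function which agrees on an open interval with a twice differentiable function inherits its
derivatives there and their one-sided limits at the end points. -/
lemma hasSecondDerivAt_of_eqOn {v p p' p'' : ℝ → ℂ} {a b : ℝ} (hab : a < b)
    (hp : ∀ x, HasDerivAt p (p' x) x) (hp' : ∀ x, HasDerivAt p' (p'' x) x)
    (h : ∀ x ∈ Set.Ioo a b, v x = p x) :
    (∀ x ∈ Set.Ioo a b, HasSecondDerivAt v (p'' x) x) ∧
    Tendsto (deriv v) (𝓝[>] a) (𝓝 (p' a)) ∧ Tendsto (deriv v) (𝓝[<] b) (𝓝 (p' b)) := by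
  have hd : deriv p = p' := funext fun x => (hp x).deriv
  have heq : ∀ x ∈ Set.Ioo a b, v =ᶠ[𝓝 x] p := fun x hx =>
    eventually_of_mem (Ioo_mem_nhds hx.1 hx.2) h
  have hdv : ∀ x ∈ Set.Ioo a b, p' x = deriv v x := fun x hx => by
    rw [(heq x hx).deriv_eq, hd]
  refine ⟨fun x hx => ?_, ?_, ?_⟩
  · exact HasSecondDerivAt.congr_of_eventuallyEq ⟨(hp x).differentiableAt, by rw [hd]; exact hp' x⟩
      (heq x hx)
  · exact ((hp' a).continuousAt.tendsto.mono_left nhdsWithin_le_nhds).congr'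
      (eventually_of_mem (Ioo_mem_nhdsGT hab) hdv)
  · exact ((hp' b).continuousAt.tendsto.mono_left nhdsWithin_le_nhds).congr'
      (eventually_of_mem (Ioo_mem_nhdsLT hab) hdv)

lemma hasDerivAt_quadProfile {l : ℝ} (hl : l ≠ 0) (c δ A B : ℂ) (a x : ℝ) :
    HasDerivAt (fun x => c + δ * quadProfile l A B (x - a))
      (δ * (A + (B - A) * ((x - a : ℝ) / l : ℂ))) x ∧
    HasDerivAt (fun x : ℝ => δ * (A + (B - A) * ((x - a : ℝ) / l : ℂ))) (δ * ((B - A) / l)) x := by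
  have h0 : HasDerivAt (fun x : ℝ => ((x - a : ℝ) : ℂ)) 1 x := by
    have := ((hasDerivAt_id x).sub_const a).ofReal_comp
    simpa using this
  have hl' : (l : ℂ) ≠ 0 := Complex.ofReal_ne_zero.2 hl
  refine ⟨?_, ?_⟩
  · unfold quadProfile
    refine ((((h0.sub ((h0.pow 2).div_const (2 * (l : ℂ)))).mul_const A).add
      (((h0.pow 2).div_const (2 * (l : ℂ))).mul_const B)).const_mul δ |>.const_add c).congr_deriv ?_
    field_simp
    simp
    ring
  · refine ((((h0.div_const (l : ℂ)).const_mul (B - A)).const_add A).const_mul δ).congr_deriv ?_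
    ring

lemma hasDerivAt_hermite {g : ℝ} (hg : g ≠ 0) (c d e : ℂ) (a x : ℝ) :
    HasDerivAt (fun x => c + d * ((x - a) / g : ℝ) + e * hermite ((x - a) / g))
      (d / g + e * (-6 * (((x - a) / g : ℝ) : ℂ) + 6 * (((x - a) / g : ℝ) : ℂ) ^ 2) / g) x ∧
    HasDerivAt (fun x : ℝ =>
        d / g + e * (-6 * (((x - a) / g : ℝ) : ℂ) + 6 * (((x - a) / g : ℝ) : ℂ) ^ 2) / g)
      (e * (-6 + 12 * (((x - a) / g : ℝ) : ℂ)) / g ^ 2) x := by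
  have h0 : HasDerivAt (fun x : ℝ => (((x - a) / g : ℝ) : ℂ)) (1 / g) x := by
    have := (((hasDerivAt_id x).sub_const a).div_const g).ofReal_comp
    simpa using this
  have hg' : (g : ℂ) ≠ 0 := Complex.ofReal_ne_zero.2 hg
  refine ⟨?_, ?_⟩
  · unfold hermite
    refine (((h0.const_mul d).const_add c).add ((((((h0.pow 2).const_mul 3).const_sub 1)).add
      ((h0.pow 3).const_mul 2)).const_mul e)).congr_deriv ?_
    field_simp
    ring
  · refine (((((h0.const_mul (-6)).add ((h0.pow 2).const_mul 6)).const_mul e).div_const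
      (g : ℂ)).const_add (d / g)).congr_deriv ?_
    field_simp
    ring


/-! ### Bloch modes with small sources -/

lemma Resonators.exists_bounds {N : ℕ} (G : Resonators N) : ∃ D : ℝ, 1 ≤ D ∧ ∀ i : Fin N,
    G.len i ≤ D ∧ G.gap i ≤ D ∧ 1 / G.len i ≤ D ∧ 1 / G.gap i ≤ D := by
  have h1 : ∀ i, 0 < G.len i := G.len_pos
  have h2 : ∀ i, 0 < G.gap i := G.gap_pos
  have h3 : ∀ i, 0 < 1 / G.len i := fun i => one_div_pos.2 (h1 i)
  have h4 : ∀ i, 0 < 1 / G.gap i := fun i => one_div_pos.2 (h2 i)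
  set F : Fin N → ℝ := fun i => G.len i + G.gap i + 1 / G.len i + 1 / G.gap i with hF
  have hF0 : ∀ i, 0 ≤ F i := fun i => by
    have := h1 i; have := h2 i; have := h3 i; have := h4 i
    simp only [hF]
    positivity
  refine ⟨1 + ∑ i, F i, le_add_of_nonneg_right (Finset.sum_nonneg fun i _ => hF0 i), fun i => ?_⟩
  have h5 := Finset.single_le_sum (fun i _ => hF0 i) (Finset.mem_univ i)
  have := h1 i; have := h2 i; have := h3 i; have := h4 i
  simp only [hF] at h5 ⊢
  refine ⟨?_, ?_, ?_, ?_⟩ <;> linarith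

lemma norm_quadProfile_le {l : ℝ} (hl : 0 < l) (A B : ℂ) {x : ℝ} (hx : x ∈ Set.Icc 0 l) :
    ‖quadProfile l A B x‖ ≤ l * (‖A‖ + ‖B‖) := by
  have h1 : x ^ 2 / (2 * l) ≤ x := by
    rw [div_le_iff₀ (by positivity)]
    nlinarith [hx.1, hx.2]
  have h2 : 0 ≤ x ^ 2 / (2 * l) := by positivity
  have e1 : ‖((x : ℂ) - x ^ 2 / (2 * l))‖ ≤ l := by
    rw [show ((x : ℂ) - x ^ 2 / (2 * l)) = ((x - x ^ 2 / (2 * l) : ℝ) : ℂ) by push_cast; rfl,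
      Complex.norm_real, Real.norm_of_nonneg (by linarith)]
    linarith [hx.2]
  have e2 : ‖((x : ℂ) ^ 2 / (2 * l))‖ ≤ l := by
    rw [show ((x : ℂ) ^ 2 / (2 * l)) = ((x ^ 2 / (2 * l) : ℝ) : ℂ) by push_cast; rfl,
      Complex.norm_real, Real.norm_of_nonneg h2]
    linarith [hx.2]
  rw [quadProfile, mul_add]
  refine (norm_add_le _ _).trans (add_le_add ?_ ?_) <;> rw [norm_mul] <;> gcongr

lemma norm_hermite_le {x : ℝ} (hx : x ∈ Set.Icc (0 : ℝ) 1) : ‖hermite x‖ ≤ 1 := by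
  have e : hermite x = ((1 - 3 * x ^ 2 + 2 * x ^ 3 : ℝ) : ℂ) := by
    rw [hermite]
    push_cast
    rfl
  rw [e, Complex.norm_real, Real.norm_eq_abs, abs_le]
  obtain ⟨h0, h1⟩ := hx
  constructor
  · nlinarith [mul_nonneg (sq_nonneg x) h0, mul_nonneg (sq_nonneg (1 - x)) h0, sq_nonneg (1 - x)]
  · nlinarith [mul_nonneg (sq_nonneg x) (sub_nonneg.2 h1), sq_nonneg x]

lemma le_norm_toIntervalL2 {a b : ℝ} (hab : a ≤ b) (f : C(ℝ, ℂ)) {K : ℝ}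
    (hf : ∀ x ∈ Set.Icc a b, K ≤ ‖f x‖) : √(b - a) * K ≤ ‖toIntervalL2 a b f‖ := by
  obtain hK | hK := le_total K 0
  · exact (mul_nonpos_of_nonneg_of_nonpos (Real.sqrt_nonneg _) hK).trans (norm_nonneg _)
  refine le_of_sq_le_sq ?_ (norm_nonneg _)
  rw [mul_pow, norm_toIntervalL2_sq hab, Real.sq_sqrt (by linarith)]
  have : ∫ x in a..b, K ^ 2 ≤ ∫ x in a..b, ‖f x‖ ^ 2 :=
    intervalIntegral.integral_mono_on hab (Continuous.intervalIntegrable (by fun_prop) _ _)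
      (Continuous.intervalIntegrable (by fun_prop) _ _)
      fun x hx => pow_le_pow_left₀ hK (hf x hx) 2
  simpa using this

lemma trigConv_add_quadProfile (M : ℕ) (f a A B : ℤ → ℂ) (δ : ℂ) (l x : ℝ) (n : ℤ) :
    trigConv M f (fun m => a m + δ * quadProfile l (A m) (B m) x) n =
      trigConv M f a n + δ * quadProfile l (trigConv M f A n) (trigConv M f B n) x := by
  have h : (fun m => a m + δ * quadProfile l (A m) (B m) x) = fun m => a m +
      ((δ * (x - x ^ 2 / (2 * l))) • A m + (δ * (x ^ 2 / (2 * l))) • B m) := by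
    funext m
    simp only [quadProfile, smul_eq_mul]
    ring
  rw [h, trigConv_add, trigConv_add, trigConv_const_smul, trigConv_const_smul]
  simp only [quadProfile, smul_eq_mul]
  ring

/-- The inertia term of the harmonics `c` in the resonator `i`. -/
noncomputable def inertiaConv {N : ℕ} (S : Medium N) (ω : ℂ) (i : Fin N) (c : ℤ → ℂ) (n : ℤ) : ℂ :=
  (ω + n * S.Ω) * trigConv S.M (S.k i) (fun n => (ω + n * S.Ω) * c n) n

lemma inertiaConv_add_quadProfile {N : ℕ} (S : Medium N) (ω : ℂ) (i : Fin N) (a A B : ℤ → ℂ)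
    (δ : ℂ) (l x : ℝ) (n : ℤ) :
    inertiaConv S ω i (fun m => a m + δ * quadProfile l (A m) (B m) x) n =
      inertiaConv S ω i a n + δ * quadProfile l (inertiaConv S ω i A n) (inertiaConv S ω i B n) x := by
  have h : (fun m : ℤ => (ω + m * S.Ω) * (a m + δ * quadProfile l (A m) (B m) x)) =
      fun m : ℤ => (ω + m * S.Ω) * a m +
        δ * quadProfile l ((ω + m * S.Ω) * A m) ((ω + m * S.Ω) * B m) x := by
    funext m
    simp only [quadProfile]
    ring
  rw [inertiaConv, h, trigConv_add_quadProfile]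
  simp only [inertiaConv, quadProfile]
  ring

/-- The terms which bound the sources of the mode given by `y`, `G₁` and `G₂`. -/
noncomputable def sourceBound {N : ℕ} (S : Medium N) (ω : ℂ) (y G₁ G₂ : Fin N → ℤ → ℂ) (n : ℤ) : ℝ :=
  ∑ i, (‖inertiaConv S ω i (G₁ i) n‖ + ‖inertiaConv S ω i (G₂ i) n‖ +
    S.δ * (‖G₁ i n‖ + ‖G₂ i n‖) + ‖(ω + n * S.Ω) ^ 2 * y i n‖ +
    S.δ * (‖(ω + n * S.Ω) ^ 2 * G₁ i n‖ + ‖(ω + n * S.Ω) ^ 2 * G₂ i n‖))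

/-- The Floquet data of a solution of the capacitance ODE give a Bloch mode with sources.  The main
terms in the resonators cancel because of the ODE. -/
lemma exists_isBlochMode_source {N : ℕ} (G : Resonators N) (α : ℝ) {D : ℝ} (hD1 : 1 ≤ D)
    (hD : ∀ i : Fin N, G.len i ≤ D ∧ G.gap i ≤ D ∧ 1 / G.len i ≤ D ∧ 1 / G.gap i ≤ D)
    (S : Medium N) (ω : ℂ) {A : ℝ} {y G₁ G₂ : Fin N → ℤ → ℂ}
    (h : IsFloquetData G S α (ω / S.Ω) A y G₁ G₂) : ∃ v f : ℤ → ℝ → ℂ,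
      IsBlochMode G S α ω v f ∧
      (∀ n x, ‖f n x‖ ≤
        (D / S.vr ^ 2 + 3 * D ^ 3 + S.ρ₀ / S.κ₀ * (3 + D)) * sourceBound S ω y G₁ G₂ n) ∧
      (∀ n, cellNorm G.L (v n) ≤
        (2 * N * D) * ∑ j, (3 * ‖y j n‖ + D * (S.δ * (‖G₁ j n‖ + ‖G₂ j n‖)))) ∧
      ∀ n i, ‖y i n‖ ≤ D * (cellNorm G.L (v n) + D * (S.δ * (‖G₁ i n‖ + ‖G₂ i n‖))) := by
  have hδ := S.δ_pos
  have hΩ := S.Ω_pos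
  have hΩ' : (S.Ω : ℂ) ≠ 0 := Complex.ofReal_ne_zero.2 hΩ.ne'
  have hδ' : (S.δ : ℂ) ≠ 0 := Complex.ofReal_ne_zero.2 hδ.ne'
  have hvr' : (S.vr : ℂ) ≠ 0 := Complex.ofReal_ne_zero.2 S.vr_pos.ne'
  have hD0 : 0 < D := by linarith
  choose v hvc hvq hvI hvE hvP using fun n => exists_profile G α S.δ (fun j => y j n)
    (fun j => G₁ j n) (fun j => G₂ j n)
  -- bounds for the profile
  set K : ℤ → ℝ := fun n => ∑ j, (3 * ‖y j n‖ + D * (S.δ * (‖G₁ j n‖ + ‖G₂ j n‖))) with hK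
  have hK0 : ∀ n, 0 ≤ K n := fun n => Finset.sum_nonneg fun j _ => by positivity
  have hpart : ∀ n, K n = 3 * (∑ j, ‖y j n‖) + ∑ j, D * (S.δ * (‖G₁ j n‖ + ‖G₂ j n‖)) := fun n => by
    rw [hK, Finset.mul_sum, ← Finset.sum_add_distrib]
  have hy : ∀ n i, ‖y i n‖ ≤ ∑ j, ‖y j n‖ := fun n i =>
    Finset.single_le_sum (f := fun j => ‖y j n‖) (fun _ _ => norm_nonneg _) (Finset.mem_univ i)
  have hg : ∀ n i, D * (S.δ * (‖G₁ i n‖ + ‖G₂ i n‖)) ≤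
      ∑ j, D * (S.δ * (‖G₁ j n‖ + ‖G₂ j n‖)) := fun n i =>
    Finset.single_le_sum (f := fun j => D * (S.δ * (‖G₁ j n‖ + ‖G₂ j n‖)))
      (fun _ _ => by positivity) (Finset.mem_univ i)
  have hδn : ‖(S.δ : ℂ)‖ = S.δ := by rw [Complex.norm_real, Real.norm_of_nonneg hδ.le]
  have hln : ∀ i : ℤ, ‖(G.len i : ℂ)‖ = G.len i := fun i => by
    rw [Complex.norm_real, Real.norm_of_nonneg (G.len_pos i).le]
  have hquad : ∀ n (i : Fin N), ∀ x ∈ Set.Icc (G.left i) (G.right i),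
      ‖S.δ * quadProfile (G.len i) (G₁ i n) (G₂ i n) (x - G.left i)‖ ≤
        D * (S.δ * (‖G₁ i n‖ + ‖G₂ i n‖)) := fun n i x hx => by
    rw [norm_mul, hδn]
    have h1 := norm_quadProfile_le (G.len_pos i) (G₁ i n) (G₂ i n) (x := x - G.left i)
      ⟨by linarith [hx.1], sub_le_sub_right hx.2 _⟩
    calc _ ≤ S.δ * (D * (‖G₁ i n‖ + ‖G₂ i n‖)) := by
          gcongr
          exact h1.trans (by gcongr; exact (hD i).1)
      _ = _ := by ring
  have hs : ∀ (i : Fin N), ∀ x ∈ Set.Icc (G.right i) (G.left (i + 1)),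
      (x - G.right i) / G.gap i ∈ Set.Icc (0 : ℝ) 1 := fun i x hx =>
    ⟨div_nonneg (by linarith [hx.1]) (G.gap_pos _).le,
      (div_le_one (G.gap_pos _)).2 (sub_le_sub_right hx.2 _)⟩
  have hhalf : ∀ n (i : Fin N), ‖(S.δ * (G.len i / 2 * (G₁ i n + G₂ i n)) : ℂ)‖ ≤
      D / 2 * (S.δ * (‖G₁ i n‖ + ‖G₂ i n‖)) := fun n i => by
    rw [norm_mul, hδn, norm_mul, norm_div, hln, Complex.norm_ofNat]
    calc _ ≤ S.δ * (D / 2 * (‖G₁ i n‖ + ‖G₂ i n‖)) := by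
          gcongr
          · exact (hD i).1
          · exact norm_add_le _ _
      _ = _ := by ring
  have hvK1 : ∀ n (i : Fin N), ∀ x ∈ Set.Icc (G.left i) (G.right i), ‖v n x‖ ≤ K n :=
      fun n i x hx => by
    rw [hvI n i x hx, hpart]
    have h1 := hquad n i x hx
    have h2 := hg n i
    have h3 := hy n i
    have h4 := norm_nonneg (y i n)
    refine (norm_add_le _ _).trans ?_
    linarith
  have hvK2 : ∀ n (i : Fin N), ∀ x ∈ Set.Icc (G.right i) (G.left (i + 1)), ‖v n x‖ ≤ K n :=
      fun n i x hx => by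
    rw [hvE n i x hx, hpart]
    have hsx := hs i x hx
    have h2 := hg n i
    have h3 := hy n i
    have h5 := norm_nextVal_le G α (fun j => y j n) i
    have h6 : ‖(nextVal G α (fun j => y j n) i - y i n) * ((x - G.right i) / G.gap i : ℝ)‖ ≤
        (∑ j, ‖y j n‖) + ∑ j, ‖y j n‖ := by
      rw [norm_mul, Complex.norm_real, Real.norm_of_nonneg hsx.1]
      exact (mul_le_of_le_one_right (norm_nonneg _) hsx.2).trans
        ((norm_sub_le _ _).trans (add_le_add h5 h3))
    have h7 : ‖S.δ * (G.len i / 2 * (G₁ i n + G₂ i n)) * hermite ((x - G.right i) / G.gap i)‖ ≤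
        D * (S.δ * (‖G₁ i n‖ + ‖G₂ i n‖)) := by
      rw [norm_mul]
      refine (mul_le_of_le_one_right (norm_nonneg _) (norm_hermite_le hsx)).trans
        ((hhalf n i).trans ?_)
      gcongr
      linarith
    refine (norm_add_le _ _).trans ((add_le_add (norm_add_le _ _) le_rfl).trans ?_)
    linarith
  -- the sources
  set src := sourceBound S ω y G₁ G₂ with hsrc
  set K₀ : ℝ := D / S.vr ^ 2 + 3 * D ^ 3 + S.ρ₀ / S.κ₀ * (3 + D) with hK₀
  have hρκ : 0 < S.ρ₀ / S.κ₀ := div_pos S.ρ₀_pos S.κ₀_pos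
  have t1 : 0 ≤ D / S.vr ^ 2 := by positivity
  have t2 : 0 ≤ 3 * D ^ 3 := by positivity
  have t3 : 0 ≤ S.ρ₀ / S.κ₀ * (3 + D) := by positivity
  have hsrci : ∀ n i, ‖inertiaConv S ω i (G₁ i) n‖ + ‖inertiaConv S ω i (G₂ i) n‖ +
      S.δ * (‖G₁ i n‖ + ‖G₂ i n‖) ≤ src n := fun n i => by
    refine le_trans ?_ (Finset.single_le_sum (f := fun i => ‖inertiaConv S ω i (G₁ i) n‖ +
      ‖inertiaConv S ω i (G₂ i) n‖ + S.δ * (‖G₁ i n‖ + ‖G₂ i n‖) + ‖(ω + n * S.Ω) ^ 2 * y i n‖ +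
      S.δ * (‖(ω + n * S.Ω) ^ 2 * G₁ i n‖ + ‖(ω + n * S.Ω) ^ 2 * G₂ i n‖))
      (fun _ _ => by positivity) (Finset.mem_univ i))
    have e1 : 0 ≤ ‖(ω + n * S.Ω) ^ 2 * y i n‖ := norm_nonneg _
    have e2 : 0 ≤ S.δ * (‖(ω + n * S.Ω) ^ 2 * G₁ i n‖ + ‖(ω + n * S.Ω) ^ 2 * G₂ i n‖) := by
      positivity
    linarith
  have hsrc0 : ∀ n, 0 ≤ src n := fun n => Finset.sum_nonneg fun i _ => by positivity
  have hsrcK : ∀ n : ℤ, ‖(ω + n * S.Ω) ^ 2‖ * K n ≤ (3 + D) * src n := fun n => by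
    rw [hK, hsrc, sourceBound, Finset.mul_sum, Finset.mul_sum]
    refine Finset.sum_le_sum fun j _ => ?_
    simp only [norm_mul]
    set s := ‖(ω + n * S.Ω) ^ 2‖
    have e1 : 0 ≤ ‖inertiaConv S ω j (G₁ j) n‖ + ‖inertiaConv S ω j (G₂ j) n‖ +
      S.δ * (‖G₁ j n‖ + ‖G₂ j n‖) := by positivity
    have e2 : 0 ≤ s * ‖y j n‖ := by positivity
    have e3 : 0 ≤ S.δ * (s * ‖G₁ j n‖ + s * ‖G₂ j n‖) := by positivity
    have e4 := mul_nonneg hD0.le e1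
    have e5 := mul_nonneg hD0.le e2
    calc s * (3 * ‖y j n‖ + D * (S.δ * (‖G₁ j n‖ + ‖G₂ j n‖))) =
        3 * (s * ‖y j n‖) + D * (S.δ * (s * ‖G₁ j n‖ + s * ‖G₂ j n‖)) := by ring
      _ ≤ _ := by
        rw [add_mul, mul_add D, mul_add D]
        linarith
  choose f hf hfI hfE using fun n => exists_piecewise G (K := K₀ * src n)
    (mul_nonneg (by positivity) (hsrc0 n))
    (fun i x => (1 / (S.vr ^ 2 : ℝ) : ℂ) * quadProfile (G.len i) (inertiaConv S ω i (G₁ i) n)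
      (inertiaConv S ω i (G₂ i) n) (x - G.left i))
    (fun i x => S.δ * (G.len i / 2 * (G₁ i n + G₂ i n)) *
      (-6 + 12 * (((x - G.right i) / G.gap i : ℝ) : ℂ)) / G.gap i ^ 2 +
      S.ρ₀ * (ω + n * S.Ω) ^ 2 / S.κ₀ * v n x)
    (fun i x hx => by
      have hx' := Set.Ioo_subset_Icc_self hx
      have h1 := norm_quadProfile_le (G.len_pos i) (inertiaConv S ω i (G₁ i) n)
        (inertiaConv S ω i (G₂ i) n) (x := x - G.left i)
        ⟨by linarith [hx'.1], sub_le_sub_right hx'.2 _⟩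
      rw [norm_mul, norm_div, norm_one, Complex.norm_real, Real.norm_of_nonneg (sq_nonneg S.vr)]
      have h2 : 0 ≤ S.δ * (‖G₁ i n‖ + ‖G₂ i n‖) := by positivity
      calc _ ≤ 1 / S.vr ^ 2 * (D * src n) := by
            refine mul_le_mul_of_nonneg_left (h1.trans ?_) (by positivity)
            exact mul_le_mul (hD i).1 (by linarith [hsrci n i]) (by positivity) hD0.le
        _ = D / S.vr ^ 2 * src n := by ring
        _ ≤ _ := by
            refine mul_le_mul_of_nonneg_right ?_ (hsrc0 n)
            rw [hK₀]
            linarith)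
    (fun i x hx => by
      have hx' := Set.Ioo_subset_Icc_self hx
      have hsx := hs i x hx'
      have h1 : ‖(-6 + 12 * (((x - G.right i) / G.gap i : ℝ) : ℂ))‖ ≤ 6 := by
        rw [show (-6 + 12 * (((x - G.right i) / G.gap i : ℝ) : ℂ)) =
          ((-6 + 12 * ((x - G.right i) / G.gap i) : ℝ) : ℂ) by push_cast; rfl, Complex.norm_real,
          Real.norm_eq_abs, abs_le]
        constructor <;> linarith [hsx.1, hsx.2]
      have h2 : ‖(G.gap i : ℂ) ^ 2‖ = G.gap i ^ 2 := by
        rw [norm_pow, Complex.norm_real, Real.norm_of_nonneg (G.gap_pos _).le]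
      have h3 : 1 / G.gap i ^ 2 ≤ D ^ 2 := by
        rw [← one_div_pow]
        exact pow_le_pow_left₀ (one_div_pos.2 (G.gap_pos _)).le (hD i).2.2.2 2
      have h4 : ‖S.δ * (G.len i / 2 * (G₁ i n + G₂ i n)) *
          (-6 + 12 * (((x - G.right i) / G.gap i : ℝ) : ℂ)) / G.gap i ^ 2‖ ≤ 3 * D ^ 3 * src n := by
        rw [norm_div, norm_mul, h2, div_eq_mul_one_div]
        have h5 : 0 ≤ ‖inertiaConv S ω i (G₁ i) n‖ + ‖inertiaConv S ω i (G₂ i) n‖ := by positivity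
        calc _ ≤ D / 2 * (S.δ * (‖G₁ i n‖ + ‖G₂ i n‖)) * 6 * D ^ 2 := by
              have := G.gap_pos i
              refine mul_le_mul (mul_le_mul (hhalf n i) h1 (norm_nonneg _) (by positivity)) h3
                (by positivity) (by positivity)
          _ = 3 * D ^ 3 * (S.δ * (‖G₁ i n‖ + ‖G₂ i n‖)) := by ring
          _ ≤ _ := by
              gcongr
              linarith [hsrci n i]
      have h6 : ‖S.ρ₀ * (ω + n * S.Ω) ^ 2 / S.κ₀ * v n x‖ ≤ S.ρ₀ / S.κ₀ * (3 + D) * src n := by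
        rw [norm_mul, norm_div, norm_mul, Complex.norm_real, Complex.norm_real,
          Real.norm_of_nonneg S.ρ₀_pos.le, Real.norm_of_nonneg S.κ₀_pos.le]
        calc _ ≤ S.ρ₀ * ‖(ω + n * S.Ω) ^ 2‖ / S.κ₀ * K n := by
              refine mul_le_mul_of_nonneg_left (hvK2 n i x hx') ?_
              have := S.ρ₀_pos
              have := S.κ₀_pos
              positivity
          _ = S.ρ₀ / S.κ₀ * (‖(ω + n * S.Ω) ^ 2‖ * K n) := by ring
          _ ≤ S.ρ₀ / S.κ₀ * ((3 + D) * src n) := mul_le_mul_of_nonneg_left (hsrcK n) hρκ.le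
          _ = _ := by ring
      refine (norm_add_le _ _).trans ((add_le_add h4 h6).trans ?_)
      rw [← add_mul]
      refine mul_le_mul_of_nonneg_right ?_ (hsrc0 n)
      rw [hK₀]
      linarith)
  -- the equations
  have hstar : ∀ n (i : Fin N), ∀ x ∈ Set.Icc (G.left i) (G.right i), S.vStar v i n x =
      trigConv S.M (S.r i) (y i) n + S.δ * quadProfile (G.len i) (trigConv S.M (S.r i) (G₁ i) n)
        (trigConv S.M (S.r i) (G₂ i) n) (x - G.left i) := fun n i x hx => by
    rw [S.vStar_eq, ← trigConv_add_quadProfile]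
    congr 1
    funext m
    exact hvI m i x hx
  have hlne : ∀ i : ℤ, G.len i ≠ 0 := fun i => (G.len_pos i).ne'
  have hgne : ∀ i : ℤ, G.gap i ≠ 0 := fun i => (G.gap_pos i).ne'
  have hI := fun n (i : Fin N) => hasSecondDerivAt_of_eqOn (G.left_lt_right i)
    (fun x => (hasDerivAt_quadProfile (hlne i) (trigConv S.M (S.r i) (y i) n) S.δ
      (trigConv S.M (S.r i) (G₁ i) n) (trigConv S.M (S.r i) (G₂ i) n) (G.left i) x).1)
    (fun x => (hasDerivAt_quadProfile (hlne i) (trigConv S.M (S.r i) (y i) n) S.δ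
      (trigConv S.M (S.r i) (G₁ i) n) (trigConv S.M (S.r i) (G₂ i) n) (G.left i) x).2)
    (fun x hx => hstar n i x (Set.Ioo_subset_Icc_self hx))
  have hE := fun n (i : Fin N) => hasSecondDerivAt_of_eqOn (G.right_lt_left i)
    (fun x => (hasDerivAt_hermite (hgne i) _ _ _ (G.right i) x).1)
    (fun x => (hasDerivAt_hermite (hgne i) 0 _ _ (G.right i) x).2)
    (fun x hx => hvE n i x (Set.Ioo_subset_Icc_self hx))
  have hprev : ∀ i : ℤ, G.right (i - 1) < G.left i := fun i => by
    simpa using G.right_lt_left (i - 1)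
  refine ⟨v, f, ⟨hvc, hvq, fun n i x hx => ?_, fun n i x hx => ?_, fun n i => ?_, fun n i => ?_⟩,
    hf, fun n => ?_, fun n i => ?_⟩
  · refine ((hE n i).1 x hx).congr_value ?_
    rw [hfE n i x hx, add_sub_cancel_right]
  · refine ((hI n i).1 x hx).congr_value ?_
    have e1 : inertiaConv S ω i (fun m => v m x) n = inertiaConv S ω i (y i) n +
        S.δ * quadProfile (G.len i) (inertiaConv S ω i (G₁ i) n) (inertiaConv S ω i (G₂ i) n)
          (x - G.left i) := by
      rw [← inertiaConv_add_quadProfile]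
      congr 1
      funext m
      exact hvI m i x (Set.Ioo_subset_Icc_self hx)
    have e2 : inertiaConv S ω i (y i) n = S.Ω ^ 2 * ((odeMass G S i : ℂ)⁻¹ *
        ∑ j, capacitanceMatrix G α i j * y j n) := by
      have e3 : ∀ n : ℤ, ω + n * S.Ω = S.Ω * (ω / S.Ω + n) := fun n => by
        field_simp
      have e4 : (fun n : ℤ => (ω + n * S.Ω) * y i n) =
          fun n => (S.Ω : ℂ) • ((ω / S.Ω + n) * y i n) := by
        funext n
        rw [e3, smul_eq_mul, mul_assoc]
      rw [← h.ode, inertiaConv, e4, trigConv_const_smul, smul_eq_mul, e3]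
      ring
    rw [S.mul_vStarStar_eq, hfI n i x hx]
    change _ = _ - (1 / (S.vr ^ 2 : ℝ) : ℂ) * inertiaConv S ω i (fun m => v m x) n
    rw [e1, e2, capacitanceMatrix_mulVec, h.flux_left, h.flux_right, odeMass]
    have hl : (G.len i : ℂ) ≠ 0 := Complex.ofReal_ne_zero.2 (hlne i)
    have hg1 : (G.gap i : ℂ) ≠ 0 := Complex.ofReal_ne_zero.2 (hgne i)
    have hg2 : (G.gap (i - 1) : ℂ) ≠ 0 := Complex.ofReal_ne_zero.2 (hgne (i - 1))
    push_cast
    field_simp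
    ring
  · obtain ⟨e, he⟩ := hvP n i
    have h1 := hasSecondDerivAt_of_eqOn (hprev i)
      (fun x => (hasDerivAt_hermite (hgne (i - 1)) _ _ _ (G.right (i - 1)) x).1)
      (fun x => (hasDerivAt_hermite (hgne (i - 1)) 0 _ _ (G.right (i - 1)) x).2)
      (fun x hx => he x (Set.Ioo_subset_Icc_self hx))
    refine ⟨(y i n - prevVal G α (fun j => y j n) i) / G.gap (i - 1), ?_, ?_⟩
    · convert h1.2.2 using 2
      have : G.left i - G.right (i - 1) = G.gap (i - 1) := by
        rw [Resonators.gap, sub_add_cancel]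
      rw [this, div_self (hgne _)]
      norm_num
    · convert (hI n i).2.1 using 2
      rw [h.flux_left, sub_self]
      simp
  · refine ⟨(nextVal G α (fun j => y j n) i - y i n) / G.gap i, ?_, ?_⟩
    · convert (hE n i).2.1 using 2
      rw [sub_self]
      simp
    · convert (hI n i).2.2 using 2
      have : G.right i - G.left i = G.len i := rfl
      rw [h.flux_right, this, div_self (Complex.ofReal_ne_zero.2 (hlne i))]
      ring
  · have hsq : ∀ {a : ℝ}, a ≤ D → √a ≤ D := fun ha =>
      Real.sqrt_le_iff.2 ⟨hD0.le, ha.trans (by nlinarith)⟩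
    refine (cellNorm_le_sum (G := G) (α := α) (g := ⟨v n, hvc n⟩) (hvq n)).trans ?_
    calc _ ≤ ∑ _i : Fin N, (D * K n + D * K n) := by
          refine Finset.sum_le_sum fun i _ => add_le_add ?_ ?_
          · refine (norm_toIntervalL2_le (G.left_lt_right i).le _ (hK0 n) (hvK1 n i)).trans ?_
            exact mul_le_mul_of_nonneg_right (hsq (hD i).1) (hK0 n)
          · refine (norm_toIntervalL2_le (G.right_lt_left i).le _ (hK0 n) (hvK2 n i)).trans ?_
            exact mul_le_mul_of_nonneg_right (hsq (hD i).2.1) (hK0 n)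
      _ = _ := by
          rw [Finset.sum_const, Finset.card_univ, Fintype.card_fin, nsmul_eq_mul]
          ring
  · have h1 := le_norm_toIntervalL2 (G.left_lt_right i).le ⟨v n, hvc n⟩
      (K := ‖y i n‖ - D * (S.δ * (‖G₁ i n‖ + ‖G₂ i n‖))) fun x hx => by
        have e1 := hquad n i x hx
        have e2 := norm_sub_le_norm_add (y i n)
          (S.δ * quadProfile (G.len i) (G₁ i n) (G₂ i n) (x - G.left i))
        rw [← hvI n i x hx] at e2
        exact le_trans (by linarith) e2
    have h2 := norm_toIntervalL2_le_cellNorm (G := G) (α := α) (g := ⟨v n, hvc n⟩) (hvq n)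
      (G.left_lt_right i).le (G.right_le_left_add i.pos i)
    have h3 := h1.trans h2
    change √(G.len i) * _ ≤ cellNorm G.L (v n) at h3
    have hl := G.len_pos i
    have h4 : 1 / D ≤ √(G.len i) := by
      refine Real.le_sqrt_of_sq_le ?_
      have h5 : 1 / D ≤ G.len i := (one_div_le hD0 hl).2 (hD i).2.2.1
      have h6 : 1 / D ≤ 1 := (div_le_one hD0).2 hD1
      have h7 : 0 < 1 / D := by positivity
      nlinarith
    set t := D * (S.δ * (‖G₁ i n‖ + ‖G₂ i n‖)) with ht
    have ht0 : 0 ≤ t := by positivity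
    have hc0 : 0 ≤ cellNorm G.L (v n) := Real.sqrt_nonneg _
    obtain h8 | h8 := le_total (‖y i n‖ - t) 0
    · nlinarith
    · have h9 : 1 / D * (‖y i n‖ - t) ≤ cellNorm G.L (v n) :=
        (mul_le_mul_of_nonneg_right h4 h8).trans h3
      rw [one_div, inv_mul_le_iff₀ hD0] at h9
      nlinarith


/-! ### Norm estimates for the modes with sources -/

lemma HasSecondDerivAt.const_mul {g : ℝ → ℂ} {y : ℂ} {x : ℝ} (h : HasSecondDerivAt g y x) (c : ℂ) :
    HasSecondDerivAt (fun x => c * g x) (c * y) x := by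
  simpa using hasSecondDerivAt_const_mul_comp_add (L := 0) c (by simpa using h)

lemma vStar_const_mul {N : ℕ} (S : Medium N) (z : ℂ) (v : ℤ → ℝ → ℂ) (i : Fin N) (n : ℤ) :
    S.vStar (fun n x => z * v n x) i n = fun x => z * S.vStar v i n x := by
  funext x
  exact trigConv_const_smul z (fun n => v n x) n

lemma vStarStar_const_mul {N : ℕ} (S : Medium N) (ω z : ℂ) (v : ℤ → ℝ → ℂ) (i : Fin N) (n : ℤ)
    (x : ℝ) : S.vStarStar ω (fun n x => z * v n x) i n x = z * S.vStarStar ω v i n x := by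
  simp only [Medium.vStarStar, Finset.mul_sum]
  refine Finset.sum_congr rfl fun m _ => ?_
  ring

lemma deriv_const_mul_fun (z : ℂ) (g : ℝ → ℂ) : deriv (fun x => z * g x) = fun x => z * deriv g x := by
  funext x
  rw [deriv_const_mul_field]

/-- The spectral problem with sources is linear. -/
lemma IsBlochMode.const_mul {N : ℕ} {G : Resonators N} {S : Medium N} {α : ℝ} {ω : ℂ}
    {v f : ℤ → ℝ → ℂ} (h : IsBlochMode G S α ω v f) (z : ℂ) :
    IsBlochMode G S α ω (fun n x => z * v n x) (fun n x => z * f n x) where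
  continuous n := (h.continuous n).const_mul z
  quasiperiodic n x := by rw [h.quasiperiodic]; ring
  exterior n i x hx := ((h.exterior n i x hx).const_mul z).congr_value (by ring)
  interior n i x hx := by
    rw [vStar_const_mul, vStarStar_const_mul]
    exact ((h.interior n i x hx).const_mul z).congr_value (by ring)
  transmission_left n i := by
    obtain ⟨d, h1, h2⟩ := h.transmission_left n i
    refine ⟨z * d, ?_, ?_⟩
    · rw [deriv_const_mul_fun]
      exact h1.const_mul z
    · rw [vStar_const_mul, deriv_const_mul_fun, mul_left_comm]
      exact h2.const_mul z
  transmission_right n i := by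
    obtain ⟨d, h1, h2⟩ := h.transmission_right n i
    refine ⟨z * d, ?_, ?_⟩
    · rw [deriv_const_mul_fun]
      exact h1.const_mul z
    · rw [vStar_const_mul, deriv_const_mul_fun, mul_left_comm]
      exact h2.const_mul z

lemma cellNorm_const_mul (L : ℝ) (z : ℂ) (g : ℝ → ℂ) :
    cellNorm L (fun x => z * g x) = ‖z‖ * cellNorm L g := by
  simp only [cellNorm, norm_mul, mul_pow]
  rw [intervalIntegral.integral_const_mul, Real.sqrt_mul (by positivity),
    Real.sqrt_sq (norm_nonneg _)]

section Bounds

variable {N : ℕ} {G : Resonators N} {S : Medium N} {α : ℝ} {ω : ℂ} {A R : ℝ}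
  {y G₁ G₂ : Fin N → ℤ → ℂ}

/-- Commuting the multiplication with `σ + n` and the convolution costs a factor `M + 1`, by
Bernstein's inequality. -/
lemma inertiaConv_sqSummable_and_le {c C : ℝ} (hc : 0 < c) (hκ : ∀ i t, S.κ i t ∈ Set.Icc c C)
    (i : Fin N) {a : ℤ → ℂ} (ha : IsFloquetSeq (ω / S.Ω) A (S.M + 1) a) :
    SqSummable (inertiaConv S ω i a) ∧
      l2norm (inertiaConv S ω i a) ≤ 4 / c * A * (S.Ω * (S.M + 1)) ^ 2 := by
  have hΩ' : (S.Ω : ℂ) ≠ 0 := Complex.ofReal_ne_zero.2 S.Ω_pos.ne'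
  set σ := ω / S.Ω with hσ
  have hk := fun t => (S.norm_trigPoly_k_mem hc hκ i t).2
  have hk' := norm_trigPoly_mul_int_le hk
  have e : inertiaConv S ω i a = fun n => ((S.Ω ^ 2 : ℝ) : ℂ) • (trigConv S.M (S.k i)
      (fun n : ℤ => (σ + n) ^ 2 * a n) n + trigConv S.M (fun m => m * S.k i m)
      (fun n : ℤ => (σ + n) * a n) n) := by
    funext n
    have e1 : ∀ n : ℤ, ω + n * S.Ω = S.Ω * (σ + n) := fun n => by
      rw [hσ]
      field_simp
    have e2 : (fun n : ℤ => (ω + n * S.Ω) * a n) = fun n => (S.Ω : ℂ) • ((σ + n) * a n) := by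
      funext n
      rw [e1, smul_eq_mul, mul_assoc]
    have e3 := smul_trigConv S.M (S.k i) σ 1 (fun n : ℤ => (σ + n) * a n) n
    simp only [mul_one, one_mul, smul_eq_mul] at e3
    have e4 : (fun n : ℤ => (σ + n) * ((σ + n) * a n)) = fun n : ℤ => (σ + n) ^ 2 * a n := by
      funext n
      ring
    rw [e4] at e3
    rw [inertiaConv, e2, trigConv_const_smul, e1]
    simp only [smul_eq_mul]
    push_cast
    linear_combination (S.Ω : ℂ) ^ 2 * e3
  have h1 := trigConv_sqSummable_and_le hk ha.sq₂
  have h2 := trigConv_sqSummable_and_le hk' ha.sq₁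
  rw [e]
  refine ⟨(h1.1.add h2.1).const_smul _, ?_⟩
  rw [l2norm_const_smul, Complex.norm_real, Real.norm_of_nonneg (sq_nonneg S.Ω)]
  have hm : (0 : ℝ) ≤ S.M + 1 := by positivity
  have e1 : Real.exp 1 ≤ 3 := Real.exp_one_lt_d9.le.trans (by norm_num)
  have hA0 : 0 ≤ A := (l2norm_nonneg _).trans ha.le₀
  have h3 : l2norm (trigConv S.M (S.k i) fun n : ℤ => (σ + n) ^ 2 * a n) ≤
      c⁻¹ * (A * (S.M + 1) ^ 2) :=
    h1.2.trans (mul_le_mul_of_nonneg_left ha.le₂ (inv_nonneg.2 hc.le))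
  have h4 : l2norm (trigConv S.M (fun m => m * S.k i m) fun n : ℤ => (σ + n) * a n) ≤
      3 * (S.M + 1) * c⁻¹ * (A * (S.M + 1)) := by
    refine h2.2.trans (mul_le_mul ?_ ha.le₁ (l2norm_nonneg _) (by positivity))
    gcongr
  calc _ ≤ S.Ω ^ 2 * (c⁻¹ * (A * (S.M + 1) ^ 2) + 3 * (S.M + 1) * c⁻¹ * (A * (S.M + 1))) :=
        mul_le_mul_of_nonneg_left ((l2norm_add_le h1.1 h2.1).trans (add_le_add h3 h4))
          (sq_nonneg _)
    _ = _ := by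
        field_simp
        ring

lemma sq_freq_sqSummable_and_le {a : ℤ → ℂ} (ha : IsFloquetSeq (ω / S.Ω) A (S.M + 1) a) :
    SqSummable (fun n : ℤ => (ω + n * S.Ω) ^ 2 * a n) ∧
      l2norm (fun n : ℤ => (ω + n * S.Ω) ^ 2 * a n) ≤ A * (S.Ω * (S.M + 1)) ^ 2 := by
  have hΩ' : (S.Ω : ℂ) ≠ 0 := Complex.ofReal_ne_zero.2 S.Ω_pos.ne'
  have e : (fun n : ℤ => (ω + n * S.Ω) ^ 2 * a n) =
      fun n : ℤ => ((S.Ω ^ 2 : ℝ) : ℂ) • ((ω / S.Ω + n) ^ 2 * a n) := by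
    funext n
    rw [smul_eq_mul]
    push_cast
    field_simp
  rw [e]
  refine ⟨ha.sq₂.const_smul _, ?_⟩
  rw [l2norm_const_smul, Complex.norm_real, Real.norm_of_nonneg (sq_nonneg S.Ω)]
  calc _ ≤ S.Ω ^ 2 * (A * (S.M + 1) ^ 2) := mul_le_mul_of_nonneg_left ha.le₂ (sq_nonneg _)
    _ = _ := by ring

lemma SqSummable.norm {E : Type*} [NormedAddCommGroup E] {c : ℤ → E} (hc : SqSummable c) :
    SqSummable fun n => ‖c n‖ := by
  simpa [SqSummable] using hc

lemma l2norm_norm {E : Type*} [NormedAddCommGroup E] (c : ℤ → E) :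
    l2norm (fun n => ‖c n‖) = l2norm c := l2norm_congr_norm fun _ => norm_norm _

/-- The `ℓ²` norm of the sources is of the order `(Ω (M + 1)) ^ 2 + δ`. -/
lemma sourceBound_sqSummable_and_le (h : IsFloquetData G S α (ω / S.Ω) A y G₁ G₂) {c C : ℝ}
    (hc : 0 < c) (hκ : ∀ i t, S.κ i t ∈ Set.Icc c C) :
    SqSummable (sourceBound S ω y G₁ G₂) ∧ l2norm (sourceBound S ω y G₁ G₂) ≤
      N * ((8 / c + 1) * A * (S.Ω * (S.M + 1)) ^ 2 +
        S.δ * (2 * A + 2 * A * (S.Ω * (S.M + 1)) ^ 2)) := by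
  have hδ := S.δ_pos
  have key : ∀ i : Fin N, SqSummable (fun n : ℤ => ‖inertiaConv S ω i (G₁ i) n‖ +
      ‖inertiaConv S ω i (G₂ i) n‖ + S.δ * (‖G₁ i n‖ + ‖G₂ i n‖) + ‖(ω + n * S.Ω) ^ 2 * y i n‖ +
      S.δ * (‖(ω + n * S.Ω) ^ 2 * G₁ i n‖ + ‖(ω + n * S.Ω) ^ 2 * G₂ i n‖)) ∧
      l2norm (fun n : ℤ => ‖inertiaConv S ω i (G₁ i) n‖ +
      ‖inertiaConv S ω i (G₂ i) n‖ + S.δ * (‖G₁ i n‖ + ‖G₂ i n‖) + ‖(ω + n * S.Ω) ^ 2 * y i n‖ +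
      S.δ * (‖(ω + n * S.Ω) ^ 2 * G₁ i n‖ + ‖(ω + n * S.Ω) ^ 2 * G₂ i n‖)) ≤
      (8 / c + 1) * A * (S.Ω * (S.M + 1)) ^ 2 +
        S.δ * (2 * A + 2 * A * (S.Ω * (S.M + 1)) ^ 2) := fun i => by
    have a1 := inertiaConv_sqSummable_and_le hc hκ i (h.seq₁ i)
    have a2 := inertiaConv_sqSummable_and_le hc hκ i (h.seq₂ i)
    have a3 := (h.seq₁ i).sq₀
    have a4 := (h.seq₂ i).sq₀
    have a5 := sq_freq_sqSummable_and_le (h.seq i)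
    have a6 := sq_freq_sqSummable_and_le (h.seq₁ i)
    have a7 := sq_freq_sqSummable_and_le (h.seq₂ i)
    have b1 := a1.1.norm.add a2.1.norm
    have b2 := (a3.norm.add a4.norm).const_smul S.δ
    have b3 := (a6.1.norm.add a7.1.norm).const_smul S.δ
    have b4 := b1.add b2
    have b5 := b4.add a5.1.norm
    refine ⟨b5.add b3, (l2norm_add_le b5 b3).trans ?_⟩
    have c1 := l2norm_add_le b4 a5.1.norm
    have c2 := l2norm_add_le b1 b2
    have c3 := l2norm_add_le a1.1.norm a2.1.norm
    have c4 : l2norm (fun n => S.δ • (‖G₁ i n‖ + ‖G₂ i n‖)) ≤ S.δ * (A + A) := by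
      rw [l2norm_const_smul, Real.norm_of_nonneg hδ.le]
      have := l2norm_add_le a3.norm a4.norm
      rw [l2norm_norm, l2norm_norm] at this
      exact mul_le_mul_of_nonneg_left (this.trans (add_le_add (h.seq₁ i).le₀ (h.seq₂ i).le₀)) hδ.le
    have c5 : l2norm (fun n : ℤ => S.δ • (‖(ω + n * S.Ω) ^ 2 * G₁ i n‖ +
        ‖(ω + n * S.Ω) ^ 2 * G₂ i n‖)) ≤
        S.δ * (A * (S.Ω * (S.M + 1)) ^ 2 + A * (S.Ω * (S.M + 1)) ^ 2) := by
      rw [l2norm_const_smul, Real.norm_of_nonneg hδ.le]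
      have := l2norm_add_le a6.1.norm a7.1.norm
      rw [l2norm_norm, l2norm_norm] at this
      exact mul_le_mul_of_nonneg_left (this.trans (add_le_add a6.2 a7.2)) hδ.le
    rw [l2norm_norm, l2norm_norm] at c3
    rw [l2norm_norm] at c1
    have c6 := a5.2
    have c7 := a1.2
    have c8 := a2.2
    have e : 8 / c * A * (S.Ω * (S.M + 1)) ^ 2 = 4 / c * A * (S.Ω * (S.M + 1)) ^ 2 +
      4 / c * A * (S.Ω * (S.M + 1)) ^ 2 := by ring
    simp only [smul_eq_mul] at *
    linarith
  refine ⟨SqSummable.sum _ fun i _ => (key i).1, ?_⟩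
  refine (l2norm_sum_le _ fun i _ => (key i).1).trans
    ((Finset.sum_le_sum fun i _ => (key i).2).trans_eq ?_)
  rw [Finset.sum_const, Finset.card_univ, Fintype.card_fin, nsmul_eq_mul]

/-- The harmonics of the solution are summable with a uniform bound for the tails. -/
lemma IsFloquetData.tsum_le (h : IsFloquetData G S α (ω / S.Ω) A y G₁ G₂) (hR : ‖ω / S.Ω‖ ≤ R)
    (i : Fin N) (K : ℕ) : ∑' n, ‖y i n‖ ≤
      ∑ n ∈ Finset.Icc (-(K : ℤ)) K, ‖y i n‖ + invTail K * ((1 + R) * A) := by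
  have h1 := (h.seq i).sqSummable_int_mul
  refine ((summable_norm_and_tsum_le h1.1).2 K).trans (add_le_add_right ?_ _)
  refine mul_le_mul_of_nonneg_left (h1.2.trans ?_) (l2norm_nonneg _)
  rw [add_mul, one_mul]
  exact add_le_add (h.velocity_le i)
    (mul_le_mul hR (h.seq i).le₀ (l2norm_nonneg _) ((norm_nonneg _).trans hR))

lemma IsFloquetSeq.tsum_le {σ : ℂ} {m : ℝ} {a : ℤ → ℂ} (h : IsFloquetSeq σ A m a) (hm : 1 ≤ m)
    (hR : ‖σ‖ ≤ R) : ∑' n, ‖a n‖ ≤ (1 + invTail 0 * (1 + R)) * A * m := by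
  have h1 := h.sqSummable_int_mul
  have hA0 : 0 ≤ A := (l2norm_nonneg _).trans h.le₀
  have hR0 : 0 ≤ R := (norm_nonneg _).trans hR
  have ht : 0 ≤ invTail 0 := l2norm_nonneg _
  have h2 : ‖a 0‖ ≤ A * m :=
    ((norm_le_l2norm h.sq₀ 0).trans h.le₀).trans (le_mul_of_one_le_right hA0 hm)
  have h3 : l2norm (fun n : ℤ => (n : ℂ) * a n) ≤ (1 + R) * A * m := by
    have : ‖σ‖ * l2norm a ≤ R * (A * m) := mul_le_mul hR
      (h.le₀.trans (le_mul_of_one_le_right hA0 hm)) (l2norm_nonneg _) hR0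
    have h5 := h.le₁
    have h6 := h1.2
    linarith
  have h4 := (summable_norm_and_tsum_le h1.1).2 0
  simp only [Nat.cast_zero, neg_zero, Finset.Icc_self, Finset.sum_singleton] at h4
  have h5 := mul_le_mul_of_nonneg_left h3 ht
  linarith

end Bounds


/-! ### Low-frequency modes from the capacitance ODE -/

section Normalized

variable {N : ℕ}

/-- The mode given by the Floquet data of a solution of the capacitance ODE, after normalization:
the sources and the high frequencies are bounded in terms of `(Ω (M + 1)) ^ 2`. -/
lemma exists_normalized_mode (hN : 0 < N) (G : Resonators N) (α : ℝ) {A R c C ρ₀ κ₀ vr X : ℝ}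
    (hA : 0 < A) (hR : 0 ≤ R) (hc : 0 < c) (hρ₀ : 0 < ρ₀) (hκ₀ : 0 < κ₀) (hvr : 0 < vr)
    (hX : 0 ≤ X) : ∃ B : ℝ, 0 < B ∧
      ∀ (S : Medium N) (ω : ℂ) (y G₁ G₂ : Fin N → ℤ → ℂ), S.ρ₀ = ρ₀ → S.κ₀ = κ₀ → S.vr = vr →
      (∀ i t, S.κ i t ∈ Set.Icc c C) → ‖ω / S.Ω‖ ≤ R → S.δ ≤ X * S.Ω ^ 2 →
      IsFloquetData G S α (ω / S.Ω) A y G₁ G₂ → B * (S.Ω * (S.M + 1)) ^ 2 ≤ 1 →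
      ∃ (v f : ℤ → ℝ → ℂ) (a : ℤ → ℝ), IsBlochMode G S α ω v f ∧
        HasSum (fun n => cellNorm G.L (v n)) 1 ∧ (∀ n x, ‖f n x‖ ≤ a n) ∧ SqSummable a ∧
        l2norm a ≤ B * (S.Ω * (S.M + 1)) ^ 2 ∧ ∀ K : ℕ,
        1 - ∑ n ∈ Finset.Icc (-(K : ℤ)) K, cellNorm G.L (v n) ≤
          B * (invTail K + (S.Ω * (S.M + 1)) ^ 2) := by
  obtain ⟨D, hD1, hD⟩ := G.exists_bounds
  have hD0 : 0 < D := by linarith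
  have hN0 : (0 : ℝ) < N := Nat.cast_pos.2 hN
  have ht0 : 0 ≤ invTail 0 := l2norm_nonneg _
  set A' : ℝ := (1 + invTail 0 * (1 + R)) * A with hA'
  have hA'0 : 0 < A' := by positivity
  set K₀ : ℝ := D / vr ^ 2 + 3 * D ^ 3 + ρ₀ / κ₀ * (3 + D) with hK₀
  have hK₀0 : 0 < K₀ := by positivity
  set B₁ : ℝ := N * ((8 / c + 1) * A + X * (4 * A)) with hB₁
  have hB₁0 : 0 < B₁ := by positivity
  set B₂ : ℝ := D * (X * (2 * A')) with hB₂
  have hB₂0 : 0 ≤ B₂ := by positivity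
  set B₃ : ℝ := 2 * N * D * (N * (3 * ((1 + R) * A) + B₂)) with hB₃
  have hB₃0 : 0 < B₃ := by positivity
  set B : ℝ := 1 + 2 * (D * A) * (K₀ * B₁ + B₂ + B₃) with hB
  have hB0 : 0 < B := by positivity
  clear_value B B₃ B₂ B₁ K₀ A'
  refine ⟨B, hB0, fun S ω y G₁ G₂ hSρ hSκ hSv hκ hσ hδX h hBε => ?_⟩
  have hδ := S.δ_pos
  set m : ℝ := S.M + 1 with hm
  have hm1 : 1 ≤ m := by rw [hm]; linarith [Nat.cast_nonneg (α := ℝ) S.M]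
  set ε : ℝ := (S.Ω * m) ^ 2 with hε
  have hε0 : 0 ≤ ε := sq_nonneg _
  have hε1 : ε ≤ 1 := by
    refine le_trans ?_ hBε
    refine le_mul_of_one_le_left hε0 (hB ▸ le_add_of_nonneg_right ?_)
    positivity
  have hδε : S.δ ≤ X * ε := hδX.trans (mul_le_mul_of_nonneg_left (by
    rw [hε, mul_pow]
    exact le_mul_of_one_le_right (sq_nonneg _) (one_le_pow₀ hm1)) hX)
  have hδm : S.δ * m ≤ X * ε := by
    calc S.δ * m ≤ X * S.Ω ^ 2 * m ^ 2 := mul_le_mul hδX (le_self_pow₀ hm1 two_ne_zero) (by linarith)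
          (by positivity)
      _ = _ := by rw [hε]; ring
  obtain ⟨v, f, hv, hf, hup, hlo⟩ := exists_isBlochMode_source G α hD1 hD S ω h
  rw [hSρ, hSκ, hSv, ← hK₀] at hf
  -- summability of all sequences
  have sy : ∀ i, Summable fun n => ‖y i n‖ := fun i => (h.seq i).summable_norm
  have s1 : ∀ i, Summable fun n => ‖G₁ i n‖ := fun i => (h.seq₁ i).summable_norm
  have s2 : ∀ i, Summable fun n => ‖G₂ i n‖ := fun i => (h.seq₂ i).summable_norm
  have sδ : ∀ i, Summable fun n => D * (S.δ * (‖G₁ i n‖ + ‖G₂ i n‖)) := fun i =>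
    (((s1 i).add (s2 i)).mul_left _).mul_left _
  have tδ : ∀ i, ∑' n, D * (S.δ * (‖G₁ i n‖ + ‖G₂ i n‖)) ≤ B₂ * ε := fun i => by
    rw [tsum_mul_left, tsum_mul_left, (s1 i).tsum_add (s2 i)]
    have e1 := (h.seq₁ i).tsum_le hm1 hσ
    have e2 := (h.seq₂ i).tsum_le hm1 hσ
    rw [← hA'] at e1 e2
    calc D * (S.δ * (∑' n, ‖G₁ i n‖ + ∑' n, ‖G₂ i n‖)) ≤ D * (S.δ * (A' * m + A' * m)) := by gcongr
      _ = D * (S.δ * m * (2 * A')) := by ring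
      _ ≤ D * (X * ε * (2 * A')) := by gcongr
      _ = _ := by rw [hB₂]; ring
  set b : ℤ → ℝ := fun n =>
    (2 * N * D) * ∑ j, (3 * ‖y j n‖ + D * (S.δ * (‖G₁ j n‖ + ‖G₂ j n‖))) with hb
  have sj : ∀ j, Summable fun n => 3 * ‖y j n‖ + D * (S.δ * (‖G₁ j n‖ + ‖G₂ j n‖)) := fun j =>
    ((sy j).mul_left 3).add (sδ j)
  have sb : Summable b := (summable_sum fun j _ => sj j).mul_left _
  have hcell : ∀ n, 0 ≤ cellNorm G.L (v n) := fun n => Real.sqrt_nonneg _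
  have sv : Summable fun n => cellNorm G.L (v n) := Summable.of_nonneg_of_le hcell hup sb
  set Z := ∑' n, cellNorm G.L (v n) with hZ
  -- the normalization constant
  have hZ0 : 1 / (2 * (D * A)) ≤ Z := by
    obtain ⟨i, hi⟩ := h.one_le
    have e1 : ∑' n, ‖y i n‖ ≤ D * (Z + B₂ * ε) := by
      calc ∑' n, ‖y i n‖ ≤ ∑' n, D * (cellNorm G.L (v n) + D * (S.δ * (‖G₁ i n‖ + ‖G₂ i n‖))) :=
            (sy i).tsum_le_tsum (fun n => hlo n i) ((sv.add (sδ i)).mul_left _)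
        _ = D * (Z + ∑' n, D * (S.δ * (‖G₁ i n‖ + ‖G₂ i n‖))) := by
            rw [tsum_mul_left, sv.tsum_add (sδ i)]
        _ ≤ _ := by
            have := tδ i
            gcongr
    have e2 : 1 ≤ D * A * (Z + B₂ * ε) := by
      calc 1 ≤ A * ∑' n, ‖y i n‖ := hi
        _ ≤ A * (D * (Z + B₂ * ε)) := by gcongr
        _ = _ := by ring
    have e3 : 2 * (D * A) * (B₂ * ε) ≤ 1 := by
      refine le_trans ?_ hBε
      rw [← mul_assoc]
      refine mul_le_mul_of_nonneg_right ?_ hε0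
      have e4 : 0 ≤ 2 * (D * A) * (K₀ * B₁ + B₃) := by positivity
      rw [hB]
      linarith
    rw [div_le_iff₀ (by positivity)]
    linarith
  have hZpos : 0 < Z := lt_of_lt_of_le (by positivity) hZ0
  have hZinv : Z⁻¹ ≤ 2 * (D * A) := by
    rw [inv_le_comm₀ hZpos (by positivity), ← one_div]
    exact hZ0
  have hzn : ‖((Z⁻¹ : ℝ) : ℂ)‖ = Z⁻¹ := by
    rw [Complex.norm_real, Real.norm_of_nonneg (inv_nonneg.2 hZpos.le)]
  have hsrc := sourceBound_sqSummable_and_le h hc hκ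
  rw [← hm, ← hε] at hsrc
  have hmain : ∀ x : ℝ, 0 ≤ x → x ≤ K₀ * B₁ + B₂ + B₃ → ∀ t : ℝ, 0 ≤ t →
      Z⁻¹ * (x * t) ≤ B * t := fun x hx0 hx t ht => by
    rw [← mul_assoc]
    refine mul_le_mul_of_nonneg_right ?_ ht
    calc Z⁻¹ * x ≤ 2 * (D * A) * (K₀ * B₁ + B₂ + B₃) := by gcongr
      _ ≤ B := by rw [hB]; linarith
  refine ⟨fun n x => ((Z⁻¹ : ℝ) : ℂ) * v n x, fun n x => ((Z⁻¹ : ℝ) : ℂ) * f n x,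
    fun n => (Z⁻¹ * K₀) • sourceBound S ω y G₁ G₂ n, hv.const_mul _, ?_, fun n x => ?_,
    hsrc.1.const_smul _, ?_, fun K => ?_⟩
  · simp only [cellNorm_const_mul, hzn]
    have := sv.hasSum.mul_left Z⁻¹
    rwa [← hZ, inv_mul_cancel₀ hZpos.ne'] at this
  · change _ ≤ Z⁻¹ * K₀ * sourceBound S ω y G₁ G₂ n
    rw [norm_mul, hzn, mul_assoc]
    exact mul_le_mul_of_nonneg_left (hf n x) (inv_nonneg.2 hZpos.le)
  · rw [l2norm_const_smul, Real.norm_of_nonneg (mul_nonneg (inv_nonneg.2 hZpos.le) hK₀0.le)]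
    have e1 : l2norm (sourceBound S ω y G₁ G₂) ≤ B₁ * ε := by
      refine hsrc.2.trans ?_
      rw [hB₁, mul_assoc (N : ℝ)]
      refine mul_le_mul_of_nonneg_left ?_ hN0.le
      have e2 : S.δ * (2 * A + 2 * A * ε) ≤ X * ε * (4 * A) :=
        by
        have := mul_le_mul_of_nonneg_left hε1 (by positivity : 0 ≤ 2 * A)
        exact mul_le_mul hδε (by linarith) (by positivity) (by positivity)
      linarith
    calc Z⁻¹ * K₀ * l2norm (sourceBound S ω y G₁ G₂) ≤ Z⁻¹ * K₀ * (B₁ * ε) := by gcongr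
      _ = Z⁻¹ * (K₀ * B₁ * ε) := by ring
      _ ≤ _ := hmain _ (by positivity) (by linarith) ε hε0
  · simp only [cellNorm_const_mul, hzn]
    rw [← Finset.mul_sum]
    set I := Finset.Icc (-(K : ℤ)) K with hI
    have htK : 0 ≤ invTail K := l2norm_nonneg _
    have e1 : Z - ∑ n ∈ I, cellNorm G.L (v n) ≤ ∑' n, b n - ∑ n ∈ I, b n := by
      have e2 := (sb.sub sv).sum_le_tsum I fun n _ => sub_nonneg.2 (hup n)
      rw [Finset.sum_sub_distrib, sb.tsum_sub sv] at e2
      linarith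
    have e3 : ∑' n, b n - ∑ n ∈ I, b n ≤ B₃ * (invTail K + ε) := by
      have e4 : ∀ j, ∑' n, (3 * ‖y j n‖ + D * (S.δ * (‖G₁ j n‖ + ‖G₂ j n‖))) -
          ∑ n ∈ I, (3 * ‖y j n‖ + D * (S.δ * (‖G₁ j n‖ + ‖G₂ j n‖))) ≤
          (3 * ((1 + R) * A) + B₂) * (invTail K + ε) := fun j => by
        rw [((sy j).mul_left 3).tsum_add (sδ j), tsum_mul_left, Finset.sum_add_distrib,
          ← Finset.mul_sum]
        have e5 := h.tsum_le hσ j K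
        have e6 := tδ j
        have e7 : 0 ≤ ∑ n ∈ I, D * (S.δ * (‖G₁ j n‖ + ‖G₂ j n‖)) :=
          Finset.sum_nonneg fun n _ => by positivity
        have e8 : 0 ≤ 3 * ((1 + R) * A) * ε := by positivity
        have e9 : 0 ≤ B₂ * invTail K := by positivity
        rw [← hI] at e5
        linarith
      have e5 : ∑' n, b n - ∑ n ∈ I, b n = 2 * N * D * ∑ j,
          (∑' n, (3 * ‖y j n‖ + D * (S.δ * (‖G₁ j n‖ + ‖G₂ j n‖))) -
          ∑ n ∈ I, (3 * ‖y j n‖ + D * (S.δ * (‖G₁ j n‖ + ‖G₂ j n‖)))) := by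
        rw [hb, tsum_mul_left, Summable.tsum_finsetSum fun j _ => sj j, ← Finset.mul_sum,
          Finset.sum_comm, ← mul_sub, Finset.sum_sub_distrib]
      rw [e5]
      refine (mul_le_mul_of_nonneg_left (Finset.sum_le_sum fun j _ => e4 j)
        (by positivity)).trans_eq ?_
      rw [Finset.sum_const, Finset.card_univ, Fintype.card_fin, nsmul_eq_mul, hB₃]
      ring
    calc 1 - Z⁻¹ * ∑ n ∈ I, cellNorm G.L (v n) = Z⁻¹ * (Z - ∑ n ∈ I, cellNorm G.L (v n)) := by
          rw [mul_sub, inv_mul_cancel₀ hZpos.ne']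
      _ ≤ Z⁻¹ * (B₃ * (invTail K + ε)) :=
          mul_le_mul_of_nonneg_left (e1.trans e3) (inv_nonneg.2 hZpos.le)
      _ ≤ _ := hmain _ hB₃0.le (by linarith [mul_pos hK₀0 hB₁0]) _ (by positivity)

end Normalized

section Sequence

variable {N : ℕ} {S : ℕ → Medium N}

lemma exists_odeMass_mem (G : Resonators N) {vr : ℝ} (hvr : ∀ p, (S p).vr = vr)
    (hΩ : (fun p => (S p).Ω) =Θ[atTop] (fun p => √(S p).δ)) :
    ∃ lam > 0, ∃ Lam, ∀ᶠ p in atTop, ∀ i, odeMass G (S p) i ∈ Set.Icc lam Lam := by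
  obtain ⟨lam, hlam, h⟩ := exists_le_odeMass G hvr hΩ
  obtain ⟨R, hR, hRΩ⟩ := exists_sqrt_δ_bounds hΩ
  obtain ⟨D, hD1, hD⟩ := G.exists_bounds
  refine ⟨lam, hlam, D * R ^ 2 / vr ^ 2, ?_⟩
  have hvr0 : 0 < vr := hvr 0 ▸ (S 0).vr_pos
  filter_upwards [h, hRΩ] with p h1 h2 i
  have hδp := (S p).δ_pos
  have hΩp := (S p).Ω_pos
  have h3 : (S p).Ω ^ 2 ≤ R ^ 2 * (S p).δ := by
    have := pow_le_pow_left₀ hΩp.le h2.2 2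
    rwa [mul_pow, Real.sq_sqrt hδp.le] at this
  refine ⟨h1 i, ?_⟩
  rw [odeMass, hvr, div_le_div_iff₀ (by positivity) (by positivity)]
  calc G.len i * (S p).Ω ^ 2 * vr ^ 2 ≤ D * (R ^ 2 * (S p).δ) * vr ^ 2 := by
        gcongr
        exact (hD i).1
    _ = _ := by ring

lemma tendsto_Ω_mul_degree (hδ : Tendsto (fun p => (S p).δ) atTop (𝓝 0))
    (hΩ : (fun p => (S p).Ω) =Θ[atTop] (fun p => √(S p).δ)) {γ : ℝ} (hγ : γ ∈ Set.Ioo (0 : ℝ) 1)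
    (hM : (fun p => ((S p).M : ℝ)) =O[atTop] (fun p => (S p).δ ^ (-γ / 2))) :
    Tendsto (fun p => ((S p).Ω * ((S p).M + 1)) ^ 2) atTop (𝓝 0) := by
  obtain ⟨D, hD, h⟩ := exists_degree_le hδ hΩ hγ hM
  have hT : Tendsto (fun p => (S p).Ω) atTop (𝓝 0) :=
    (tendsto_Ω hδ hΩ).mono_right nhdsWithin_le_nhds
  have h1 : Tendsto (fun p => D * (S p).Ω ^ (1 - γ)) atTop (𝓝 0) := by
    have := (hT.rpow_const (p := 1 - γ) (Or.inr (by linarith [hγ.2]))).const_mul D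
    rwa [Real.zero_rpow (by linarith [hγ.2]), mul_zero] at this
  have h2 : Tendsto (fun p => (S p).Ω * ((S p).M + 1)) atTop (𝓝 0) := by
    refine squeeze_zero' (Eventually.of_forall fun p => ?_) ?_ h1
    · have := (S p).Ω_pos
      positivity
    · filter_upwards [h] with p hp
      have hΩp := (S p).Ω_pos
      calc (S p).Ω * ((S p).M + 1) ≤ (S p).Ω * (D * (S p).Ω ^ (-γ)) := by gcongr
        _ = D * (S p).Ω ^ (1 - γ) := by
            rw [sub_eq_add_neg, Real.rpow_add hΩp, Real.rpow_one]
            ring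
  simpa using h2.pow 2

/-- The sources of the modes in `exists_normalized_mode` tend to zero because `Ω (M + 1)` does. -/
lemma isLeadingOrderQuasifrequency (hN : 0 < N) (G : Resonators N) (α : ℝ) (S : ℕ → Medium N)
    {ρ₀ κ₀ vr : ℝ} (hρ₀ : ∀ p, (S p).ρ₀ = ρ₀) (hκ₀ : ∀ p, (S p).κ₀ = κ₀)
    (hvr : ∀ p, (S p).vr = vr) (hδ : Tendsto (fun p => (S p).δ) atTop (𝓝 0))
    (hΩ : (fun p => (S p).Ω) =Θ[atTop] (fun p => √(S p).δ)) {γ : ℝ} (hγ : γ ∈ Set.Ioo (0 : ℝ) 1)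
    (hM : (fun p => ((S p).M : ℝ)) =O[atTop] (fun p => (S p).δ ^ (-γ / 2))) {c C : ℝ} (hc : 0 < c)
    (hρ : ∀ p i t, (S p).ρ i t ∈ Set.Icc c C) (hκ : ∀ p i t, (S p).κ i t ∈ Set.Icc c C)
    {ω : ℕ → ℂ} (hω : ∀ p, IsCapacitanceQuasifrequency G (S p) α (ω p))
    (hωO : ω =O[atTop] fun p => √(S p).δ) : IsLeadingOrderQuasifrequency G S α ω := by
  have hΩ0 := tendsto_Ω hδ hΩ
  have hε := tendsto_Ω_mul_degree hδ hΩ hγ hM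
  obtain ⟨X, hX, hXΩ⟩ := exists_sqrt_δ_bounds hΩ
  obtain ⟨lam, hlam, Lam, hm⟩ := exists_odeMass_mem G hvr hΩ
  obtain ⟨R, hR, hRω⟩ : ∃ R ≥ 0, ∀ᶠ p in atTop, ‖ω p / (S p).Ω‖ ≤ R := by
    obtain ⟨E, hE, h⟩ := hωO.exists_nonneg
    refine ⟨E * X, mul_nonneg hE hX.le, ?_⟩
    filter_upwards [h.bound, hXΩ] with p h1 h2
    have hΩp := (S p).Ω_pos
    rw [norm_div, Complex.norm_real, Real.norm_of_nonneg hΩp.le, div_le_iff₀ hΩp]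
    rw [Real.norm_of_nonneg (Real.sqrt_nonneg _)] at h1
    calc ‖ω p‖ ≤ E * √(S p).δ := h1
      _ ≤ E * (X * (S p).Ω) := by gcongr; exact h2.1
      _ = _ := by ring
  obtain ⟨A, hA, hdata⟩ := exists_isFloquetData hN G α (C := C) (Lam := Lam) (R := R) hc hlam
  obtain ⟨B, hB, hmode⟩ := exists_normalized_mode hN G α (C := C) (X := X ^ 2) hA hR hc
    (hρ₀ 0 ▸ (S 0).ρ₀_pos) (hκ₀ 0 ▸ (S 0).κ₀_pos) (hvr 0 ▸ (S 0).vr_pos) (sq_nonneg X)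
  have hBε : ∀ᶠ p in atTop, B * ((S p).Ω * ((S p).M + 1)) ^ 2 ≤ 1 := by
    have := hε.const_mul B
    rw [mul_zero] at this
    exact this.eventually (eventually_le_nhds one_pos)
  have hgood : ∀ᶠ p in atTop, ∃ (v f : ℤ → ℝ → ℂ) (a : ℤ → ℝ), IsBlochMode G (S p) α (ω p) v f ∧
      HasSum (fun n => cellNorm G.L (v n)) 1 ∧ (∀ n x, ‖f n x‖ ≤ a n) ∧ SqSummable a ∧
      l2norm a ≤ B * ((S p).Ω * ((S p).M + 1)) ^ 2 ∧ ∀ K : ℕ,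
      1 - ∑ n ∈ Finset.Icc (-(K : ℤ)) K, cellNorm G.L (v n) ≤
        B * (invTail K + ((S p).Ω * ((S p).M + 1)) ^ 2) := by
    filter_upwards [hXΩ, hm, hRω, hBε] with p h1 h2 h3 h4
    obtain ⟨y, G₁, G₂, h5⟩ := hdata (S p) (ω p) (hρ p) (hκ p) h2 h3 (hω p)
    refine hmode (S p) (ω p) y G₁ G₂ (hρ₀ p) (hκ₀ p) (hvr p) (hκ p) h3 ?_ h5 h4
    have := pow_le_pow_left₀ (Real.sqrt_nonneg _) h1.1 2
    rwa [Real.sq_sqrt (S p).δ_pos.le, mul_pow] at this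
  obtain ⟨v, hv⟩ := hgood.choice
  obtain ⟨f, hv⟩ := hv.choice
  obtain ⟨a, hv⟩ := hv.choice
  have hT : Tendsto (fun p => (S p).Ω) atTop (𝓝 0) := hΩ0.mono_right nhdsWithin_le_nhds
  have hsqrt : Tendsto (fun p => √(S p).Ω) atTop (𝓝 0) := by simpa using hT.sqrt
  have hsqrt' : Tendsto (fun p => √(S p).Ω) atTop (𝓝[>] 0) := tendsto_nhdsWithin_iff.2
    ⟨hsqrt, Eventually.of_forall fun p => Real.sqrt_pos.2 (S p).Ω_pos⟩
  -- any cut-off between `1` and `Ω⁻¹` separates the scales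
  set K : ℕ → ℕ := fun p => ⌊(√(S p).Ω)⁻¹⌋₊ with hK
  have hKtop : Tendsto K atTop atTop :=
    tendsto_nat_floor_atTop.comp (tendsto_inv_nhdsGT_zero.comp hsqrt')
  refine ⟨v, f, hv.mono fun p h => h.1, ⟨hv.mono fun p h => h.2.1, K, ?_, ?_⟩, a, ?_, ?_⟩
  · refine squeeze_zero (fun p => ?_) (fun p => ?_) hsqrt
    · have := (S p).Ω_pos
      positivity
    · have hΩp := (S p).Ω_pos
      have h1 : 0 < √(S p).Ω := Real.sqrt_pos.2 hΩp
      calc (K p : ℝ) * (S p).Ω ≤ (√(S p).Ω)⁻¹ * (S p).Ω := by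
            gcongr
            exact Nat.floor_le (inv_nonneg.2 h1.le)
        _ = √(S p).Ω := by
            nth_rewrite 2 [← Real.mul_self_sqrt hΩp.le]
            rw [inv_mul_cancel_left₀ h1.ne']
  · have h1 : Tendsto (fun p => 1 - B * (invTail (K p) + ((S p).Ω * ((S p).M + 1)) ^ 2)) atTop
        (𝓝 1) := by
      simpa using (((tendsto_invTail.comp hKtop).add hε).const_mul B).const_sub 1
    refine tendsto_of_tendsto_of_tendsto_of_le_of_le' h1 tendsto_const_nhds ?_ ?_
    · filter_upwards [hv] with p hp
      have := hp.2.2.2.2.2 (K p)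
      linarith
    · filter_upwards [hv] with p hp
      exact sum_le_hasSum _ (fun n _ => Real.sqrt_nonneg _) hp.2.1
  · filter_upwards [hv] with p hp
    refine ⟨hp.2.2.1, ?_⟩
    simpa [SqSummable] using hp.2.2.2.1
  · have h1 : Tendsto (fun p => (B * ((S p).Ω * ((S p).M + 1)) ^ 2) ^ 2) atTop (𝓝 0) := by
      simpa using (hε.const_mul B).pow 2
    refine squeeze_zero' (Eventually.of_forall fun p => tsum_nonneg fun n => sq_nonneg _) ?_ h1
    filter_upwards [hv] with p hp
    have h2 := pow_le_pow_left₀ (l2norm_nonneg _) hp.2.2.2.2.1 2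
    rw [sq_l2norm] at h2
    simpa using h2

end Sequence

theorem mainTheorem1 {N : ℕ} (hN : 0 < N) (G : Resonators N) (α : ℝ)
    (S : ℕ → Medium N)
    (ρ₀ κ₀ vr : ℝ)
    (hρ₀ : ∀ p, (S p).ρ₀ = ρ₀) (hκ₀ : ∀ p, (S p).κ₀ = κ₀) (hvr : ∀ p, (S p).vr = vr)
    (hδ : Tendsto (fun p => (S p).δ) atTop (𝓝 0))
    (hΩ : (fun p => (S p).Ω) =Θ[atTop] (fun p => √(S p).δ))
    (γ : ℝ) (hγ : γ ∈ Set.Ioo (0 : ℝ) 1)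
    (hM : (fun p => ((S p).M : ℝ)) =O[atTop] (fun p => (S p).δ ^ (-γ / 2)))
    (c C : ℝ) (hc : 0 < c)
    (hρ : ∀ p i t, (S p).ρ i t ∈ Set.Icc c C)
    (hκ : ∀ p i t, (S p).κ i t ∈ Set.Icc c C) :
    (∀ ω : ℕ → ℂ, IsSubwavelengthQuasifrequency G S α ω →
      ∃ ωcap : ℕ → ℂ, (∀ p, IsCapacitanceQuasifrequency G (S p) α (ωcap p)) ∧
        (fun p => ω p - ωcap p) =o[atTop] (fun p => √(S p).δ)) ∧
    (∀ ωcap : ℕ → ℂ, (∀ p, IsCapacitanceQuasifrequency G (S p) α (ωcap p)) →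
      ωcap =O[atTop] (fun p => √(S p).δ) →
      IsLeadingOrderQuasifrequency G S α ωcap) :=
  ⟨fun _ hω => exists_isCapacitanceQuasifrequency_isLittleO hN G α S hρ₀ hκ₀ hvr hδ hΩ hγ hM hc hρ hκ hω,
    fun _ hω hωO => isLeadingOrderQuasifrequency hN G α S hρ₀ hκ₀ hvr hδ hΩ hγ hM hc hρ hκ hω hωO⟩
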